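/- Let $N\in\mathbb N$, $\mathcal N=\{1,\dots,N\}$, $T>0$ and $Q_T=(0,T)\times\mathbb R$. For $k\in\mathcal N$ consider the system $$\partial_t u^k+\partial_x\big(f^k(u^k)\,\nu^k(x,u^k*\omega_\eta)\big)=R^k(x,\boldsymbol u,\boldsymbol u\circledast\omega_\eta)\ \text{ in } Q_T,\qquad u^k(0,\cdot)=u^k_0,\qquad(\ast)$$ where $(u^k*\omega_\eta)(t,x)=\int_x^{x+\eta}\omega_\eta(y-x)u^k(t,y)\,dy$, $\boldsymbol u\circledast\omega_\eta=(u^k*\omega_\eta)_{k\in\mathcal N}$, $$R^k(x,\boldsymbol a,\boldsymbol A)=S^{k-1}(x,a^{k-1},a^k,A^{k-1},A^k)-S^k(x,a^k,a^{k+1},A^k,A^{k+1}),\qquad S^0=S^N=0,$$ and, for $1\le k<N$, $S^k(x,a,b,A,B)=\big(g^{k+1}(b)\nu^{k+1}(x,B)-g^k(a)\nu^k(x,A)\big)^+a-\big(g^{k+1}(b)\nu^{k+1}(x,B)-g^k(a)\nu^k(x,A)\big)^-b$, with $s^+=\max(s,0)$ and $s^-=-\min(s,0)$. Assume, for every $k\in\mathcal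 N$: * $f^k(u)=u\,g^k(u)$, where $g^k:\mathbb R\to\mathbb R$ is Lipschitz and non-increasing and $g^k(1)=0$; * $\nu^k:\mathbb R\times\mathbb R\to\mathbb R$ is bounded and non-negative on $\mathbb R\times[0,1]$, $\nu^k(\cdot,u)\in C^2(\mathbb R)$ for every $u$, $\nu^k(x,\cdot)\in C^2(\mathbb R)$ for every $x$, the mixed partial derivatives $D_{12}\nu^k,D_{21}\nu^k$ exist, and all partial derivatives of $\nu^k$ of order one and two are bounded on $\mathbb R\times[0,1]$; * there are $\mathcal C_0\in\mathbb R$ and a function $a_0:\mathbb R\to\mathbb R$ of bounded variation with $|\nu^k(x,u)-\nu^k(y,u)|\le\mathcal C_0|a_0(x)-a_0(y)|$ for all $x,y,u\in\mathbb R$; * $\eta\in(0,\infty]$, and $\omega_\eta\in(C^2\cap \mathrm{BV}\cap W^{2,\infty})([0,\eta])$ (on $[0,\infty)$ if $\eta=\infty$) is non-negative and non-increasing, with $\int_0^\eta\omega_\eta=1$. Let $\boldsymbol u_0\in((L^1\cap \mathrm{BV})(\mathbb R;[0,1]))^N$. An entropy solution of $(\ast)$ on $[0,T]$ is a function $\boldsymbol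 u\in(\mathrm{Lip}([0,T];L^1(\mathbb R;[0,1]))\cap L^\infty([0,T];\mathrm{BV}(\mathbb R)))^N$ with $\boldsymbol u(0,\cdot)=\boldsymbol u_0$ a.e. such that, for all $k\in\mathcal N$, $\alpha\in\mathbb R$ and $0\le\phi\in C_c^\infty([0,T)\times\mathbb R)$, $$\int_{Q_T}|u^k-\alpha|\phi_t+\int_{Q_T}\operatorname{sgn}(u^k-\alpha)(f^k(u^k)-f^k(\alpha))\,\mathcal U^k\phi_x-\int_{Q_T}\operatorname{sgn}(u^k-\alpha)f^k(\alpha)\,\mathcal U^k_x\phi+\int_{\mathbb R}|u^k(0,x)-\alpha|\phi(0,x)\,dx\ \ge\ -\int_{Q_T}\operatorname{sgn}(u^k-\alpha)\,\mathcal R^k_{\boldsymbol u}\,\phi ,$$ where $\operatorname{sgn}(0)=0$, $\mathcal U^k(t,x)=\nu^k(x,(u^k*\omega_\eta)(t,x))$ and $\mathcal R^k_{\boldsymbol u}(t,x)=R^k(x,\boldsymbol u(t,x),(\boldsymbol u\circledast\omega_\eta)(t,x))$. Write $\|\boldsymbol v\|_{(L^1(\mathbb R))^N}=\sum_k\|v^k\|_{L^1(\mathbb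 R)}$, and $\mathrm{TV}$ for the (essential) total variation, i.e. the total mass of the distributional derivative. Then there is an entropy solution $\boldsymbol u$ of $(\ast)$ on $[0,T]$; it is unique, i.e. any entropy solution $\boldsymbol v$ satisfies $\boldsymbol v(t,\cdot)=\boldsymbol u(t,\cdot)$ a.e. for every $t\in[0,T]$; and for all $t,t_1,t_2\in[0,T]$ $$\boldsymbol u(t,\cdot)\in[0,1]^N\ \text{ a.e.},\qquad \|\boldsymbol u(t,\cdot)\|_{(L^1(\mathbb R))^N}=\|\boldsymbol u_0\|_{(L^1(\mathbb R))^N},$$ $$\sum_{k=1}^N\mathrm{TV}(u^k(t,\cdot))\le e^{\mathcal C_{TV}t}\sum_{k=1}^N\mathrm{TV}(u^k_0)+e^{\mathcal C_{TV}t}-1,\qquad \|\boldsymbol u(t_2,\cdot)-\boldsymbol u(t_1,\cdot)\|_{(L^1(\mathbb R))^N}\le N\,\mathcal C_L\,|t_2-t_1|.$$ Here $\mathcal C_{TV}\ge0$ depends only on $N$ and on upper bounds for $\|\boldsymbol u_0\|_{(L^1(\mathbb R))^N}$, $\|\omega_\eta\|_{L^\infty}$, the Lipschitz constants of $f^k$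 on $[0,1]$, the Lipschitz constants of $S^k(x,\cdot)$ on $[0,1]^4$ (uniformly in $x$; with respect to the $\ell^1$ norm) and the sup norms on $\mathbb R\times[0,1]$ of the first and second partial derivatives of $\nu^k$; and $\mathcal C_L\ge0$ depends only on these, on upper bounds for $\|\nu^k\|_{L^\infty(\mathbb R\times[0,1])}$ and $\sum_k\mathrm{TV}(u_0^k)$, and on $T$. -/

import Mathlib

open MeasureTheory Set
open scoped ENNReal

noncomputable section

/-- The data of a nonlocal `N`-lane traffic model: the factors `g k` of the fluxes
`f k u = u * g k u`, the velocity factors `ν k x u` (`x` is the position and `u` the average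
density), the length `η` of the look-ahead interval (possibly `⊤`) and the kernel `kern` (`ω_η` in the usual notation).
Lanes are indexed by `Fin N`, so that lane `k + 1` of the usual numbering is `k` here. -/
structure LaneModel (N : ℕ) where
  g : Fin N → ℝ → ℝ
  ν : Fin N → ℝ → ℝ → ℝ
  η : EReal
  kern : ℝ → ℝ

/-- Partial derivative in the first (space) variable. -/
def partialX (h : ℝ → ℝ → ℝ) (x u : ℝ) : ℝ := deriv (fun y => h y u) x

/-- Partial derivative in the second (state) variable. -/
def partialU (h : ℝ → ℝ → ℝ) (x u : ℝ) : ℝ := deriv (fun v => h x v) u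

/-- The (essential) total variation of a locally integrable function on the line, i.e. the total
mass of its distributional derivative; it depends only on the a.e. class of `v`. -/
def totalVar (v : ℝ → ℝ) : ℝ≥0∞ :=
  ⨆ (ψ : ℝ → ℝ) (_ : ContDiff ℝ 1 ψ ∧ HasCompactSupport ψ ∧ ∀ x, |ψ x| ≤ 1),
    ENNReal.ofReal (∫ x, v x * deriv ψ x)

namespace LaneModel

variable {N : ℕ}

/-- The interval `[0, η]`, which is `[0, ∞)` if `η = ⊤`. -/
def dom (P : LaneModel N) : Set ℝ := {z : ℝ | 0 ≤ z ∧ (z : EReal) ≤ P.η}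

/-- The flux function `f k u = u * g k u`. -/
def f (P : LaneModel N) (k : Fin N) (u : ℝ) : ℝ := u * P.g k u

/-- The downstream average `(v * kern)(x) = ∫_x^{x+η} kern (y - x) v y dy`. -/
def avg (P : LaneModel N) (v : ℝ → ℝ) (x : ℝ) : ℝ :=
  ∫ y in {y : ℝ | y - x ∈ P.dom}, P.kern (y - x) * v y

/-- The flow from lane `i` into the neighbouring lane `j = i + 1`, at the position `x`, for the
densities `a`, `b` and the average densities `A`, `B` in the lanes `i`, `j`. -/
def S (P : LaneModel N) (i j : Fin N) (x a b A B : ℝ) : ℝ :=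
  max (P.g j b * P.ν j x B - P.g i a * P.ν i x A) 0 * a
    - (-min (P.g j b * P.ν j x B - P.g i a * P.ν i x A) 0) * b

/-- The source term of lane `k` for the vectors `a` of densities and `A` of average densities:
the inflow from lane `k - 1` minus the outflow to lane `k + 1`; there is no exchange across the
two outer boundaries of the road. -/
def R (P : LaneModel N) (k : Fin N) (x : ℝ) (a A : Fin N → ℝ) : ℝ :=
  (if _h : 0 < k.val then
      P.S ⟨k.val - 1, by omega⟩ k x (a ⟨k.val - 1, by omega⟩) (a k)
        (A ⟨k.val - 1, by omega⟩) (A k)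
    else 0)
  - (if h : k.val + 1 < N then
      P.S k ⟨k.val + 1, h⟩ x (a k) (a ⟨k.val + 1, h⟩) (A k) (A ⟨k.val + 1, h⟩)
    else 0)

/-- The standing assumptions on the model. -/
structure Admissible (P : LaneModel N) : Prop where
  g_lip : ∀ k, ∃ L, LipschitzWith L (P.g k)
  g_one : ∀ k, P.g k 1 = 0
  g_anti : ∀ k, Antitone (P.g k)
  ν_nonneg : ∀ k x, ∀ u ∈ Icc (0 : ℝ) 1, 0 ≤ P.ν k x u
  ν_bdd : ∀ k, ∃ C, ∀ x, ∀ u ∈ Icc (0 : ℝ) 1, |P.ν k x u| ≤ C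
  ν_smooth_x : ∀ k u, ContDiff ℝ 2 (fun x => P.ν k x u)
  ν_smooth_u : ∀ k x, ContDiff ℝ 2 (fun u => P.ν k x u)
  ν_mixed_xu : ∀ k x, Differentiable ℝ (fun u => partialX (P.ν k) x u)
  ν_mixed_ux : ∀ k u, Differentiable ℝ (fun x => partialU (P.ν k) x u)
  ν_bv : ∀ k, ∃ (C₀ : ℝ) (a₀ : ℝ → ℝ), BoundedVariationOn a₀ univ ∧
    ∀ x y u, |P.ν k x u - P.ν k y u| ≤ C₀ * |a₀ x - a₀ y|
  η_pos : 0 < P.η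
  kern_smooth : ContDiffOn ℝ 2 P.kern P.dom
  kern_bv : BoundedVariationOn P.kern P.dom
  kern_bdd : ∀ i ≤ 2, ∃ C, ∀ z ∈ P.dom, |iteratedDerivWithin i P.kern P.dom z| ≤ C
  kern_nonneg : ∀ z ∈ P.dom, 0 ≤ P.kern z
  kern_anti : AntitoneOn P.kern P.dom
  kern_int : IntegrableOn P.kern P.dom
  kern_one : ∫ z in P.dom, P.kern z = 1

/-- The norms of the model on which the constant in the total variation bound may depend are
at most `K`: the Lipschitz constants of `f k` on `[0,1]` and of the exchange terms
`S(x, ·)` on `[0,1]⁴` (uniformly in `x`), the sup norms on `ℝ × [0,1]` of the first and second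
partial derivatives of `ν k`, and the sup norm of the kernel. -/
structure BoundedBy (P : LaneModel N) (K : ℝ) : Prop where
  f_lip : ∀ k, ∀ u ∈ Icc (0 : ℝ) 1, ∀ v ∈ Icc (0 : ℝ) 1, |P.f k u - P.f k v| ≤ K * |u - v|
  S_lip : ∀ i j : Fin N, i.val + 1 = j.val → ∀ x,
    ∀ a ∈ Icc (0 : ℝ) 1, ∀ b ∈ Icc (0 : ℝ) 1, ∀ A ∈ Icc (0 : ℝ) 1, ∀ B ∈ Icc (0 : ℝ) 1,
    ∀ a' ∈ Icc (0 : ℝ) 1, ∀ b' ∈ Icc (0 : ℝ) 1, ∀ A' ∈ Icc (0 : ℝ) 1, ∀ B' ∈ Icc (0 : ℝ) 1,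
      |P.S i j x a b A B - P.S i j x a' b' A' B'|
        ≤ K * (|a - a'| + |b - b'| + |A - A'| + |B - B'|)
  ν_x : ∀ k x, ∀ u ∈ Icc (0 : ℝ) 1, |partialX (P.ν k) x u| ≤ K
  ν_u : ∀ k x, ∀ u ∈ Icc (0 : ℝ) 1, |partialU (P.ν k) x u| ≤ K
  ν_xx : ∀ k x, ∀ u ∈ Icc (0 : ℝ) 1, |partialX (partialX (P.ν k)) x u| ≤ K
  ν_xu : ∀ k x, ∀ u ∈ Icc (0 : ℝ) 1, |partialU (partialX (P.ν k)) x u| ≤ K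
  ν_ux : ∀ k x, ∀ u ∈ Icc (0 : ℝ) 1, |partialX (partialU (P.ν k)) x u| ≤ K
  ν_uu : ∀ k x, ∀ u ∈ Icc (0 : ℝ) 1, |partialU (partialU (P.ν k)) x u| ≤ K
  kern_le : ∀ z ∈ P.dom, |P.kern z| ≤ K

/-- Initial data in `((L¹ ∩ BV)(ℝ; [0,1]))^N`. -/
structure IsInitialDatum (u₀ : Fin N → ℝ → ℝ) : Prop where
  integrable : ∀ k, Integrable (u₀ k)
  range : ∀ k, ∀ᵐ x, u₀ k x ∈ Icc (0 : ℝ) 1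
  bv : ∀ k, totalVar (u₀ k) < ⊤

/-- The nonlocal velocity `𝒰 k (t, x) = ν k (x, (u k * kern)(t, x))`; a density profile is written
`u k t x`. -/
def vel (P : LaneModel N) (u : Fin N → ℝ → ℝ → ℝ) (k : Fin N) (t x : ℝ) : ℝ :=
  P.ν k x (P.avg (u k t) x)

/-- The source term of lane `k` along `u`. -/
def src (P : LaneModel N) (u : Fin N → ℝ → ℝ → ℝ) (k : Fin N) (t x : ℝ) : ℝ :=
  P.R k x (fun j => u j t x) (fun j => P.avg (u j t) x)

/-- The Kruzkov entropy flux `𝒢 k (a, b) = sgn (a - b) (f k a - f k b)`. -/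
def G (P : LaneModel N) (k : Fin N) (a b : ℝ) : ℝ := Real.sign (a - b) * (P.f k a - P.f k b)

/-- `u` is an entropy solution on `[0, T]` with initial data `u₀`: a function in
`(Lip([0,T]; L¹(ℝ; [0,1])) ∩ L^∞([0,T]; BV(ℝ)))^N` that takes the initial data and satisfies the
Kruzkov entropy inequalities. Only the values `u k t` for `t ∈ [0, T]` matter. A test function
in `C_c^∞([0,T) × ℝ)` is the restriction of a smooth function on the plane with compact support
contained in `(-∞, T) × ℝ`. -/
structure IsEntropySolution (P : LaneModel N) (T : ℝ) (u₀ : Fin N → ℝ → ℝ)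
    (u : Fin N → ℝ → ℝ → ℝ) : Prop where
  measurable : ∀ k, AEStronglyMeasurable (fun p : ℝ × ℝ => u k p.1 p.2)
    (volume.restrict (Ioo 0 T ×ˢ univ))
  integrable : ∀ k, ∀ t ∈ Icc 0 T, Integrable (u k t)
  range : ∀ k, ∀ t ∈ Icc 0 T, ∀ᵐ x, u k t x ∈ Icc (0 : ℝ) 1
  lip : ∃ L : ℝ, ∀ k, ∀ s ∈ Icc 0 T, ∀ t ∈ Icc 0 T, ∫ x, |u k s x - u k t x| ≤ L * |s - t|
  bv : ∃ M : ℝ, ∀ k, ∀ t ∈ Icc 0 T, totalVar (u k t) ≤ ENNReal.ofReal M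
  initial : ∀ k, u k 0 =ᵐ[volume] u₀ k
  entropy : ∀ (k : Fin N) (α : ℝ) (φ : ℝ → ℝ → ℝ),
    ContDiff ℝ (⊤ : ℕ∞) (fun p : ℝ × ℝ => φ p.1 p.2) →
    HasCompactSupport (fun p : ℝ × ℝ => φ p.1 p.2) →
    tsupport (fun p : ℝ × ℝ => φ p.1 p.2) ⊆ Iio T ×ˢ univ →
    (∀ t ∈ Ico 0 T, ∀ x, 0 ≤ φ t x) →
    (∫ p in Ioo 0 T ×ˢ univ, |u k p.1 p.2 - α| * deriv (fun t => φ t p.2) p.1)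
      + (∫ p in Ioo 0 T ×ˢ univ,
          P.G k (u k p.1 p.2) α * P.vel u k p.1 p.2 * deriv (fun x => φ p.1 x) p.2)
      - (∫ p in Ioo 0 T ×ˢ univ,
          Real.sign (u k p.1 p.2 - α) * P.f k α * deriv (fun x => P.vel u k p.1 x) p.2
            * φ p.1 p.2)
      + (∫ x, |u k 0 x - α| * φ 0 x)
    ≥ -(∫ p in Ioo 0 T ×ˢ univ,
          Real.sign (u k p.1 p.2 - α) * P.src u k p.1 p.2 * φ p.1 p.2)

end LaneModel

end

section

open MeasureTheory Set Filter Topology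
open scoped ENNReal

noncomputable section

/-! ### Kruzkov's entropy flux for a scalar flux function -/

/-! Solutions are obtained as limits of a Lax–Friedrichs scheme, and a single `L¹` stability
estimate for approximate entropy solutions (`exists_stability`) yields both the convergence of the
scheme and uniqueness. No compactness theorem is needed: the approximations form a Cauchy sequence.

A priori bounds. The scheme `LaneModel.step` acts on functions of a real variable instead of grid
values, so variation can be measured by the `L¹` distance of arbitrary translates;
`integral_abs_shift_sub_le_of_totalVar_le` and `sum_totalVar_le_of_shift` translate to and from the
distributional total variation. The range `[0, 1]` is preserved because `f` vanishes at `0` and `1`,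
a lane loses at most in proportion to its density and gains at most in proportion to its free space
(`R_bounds`, `isDensity_step`). The exchange terms telescope over the lanes, so the total mass is
conserved. For the variation, the scheme with a prescribed velocity contracts `L¹`; a translate
therefore drifts away from the original only through the variation of the velocity and of the
source. The velocity sees the density only through its average against a bounded non-increasing
kernel, and such a kernel has a linear `L¹` modulus of continuity. Hence the derivative of the
average is controlled in `L¹` by the density, with no use of its derivative, and second differences
of the velocity are controlled by the variation of the density
(`integral_mul_abs_second_difference_le`). One step turns a variation bound `B` into `B + c τ (B +
1)`, which integrates to the exponential bound.

Entropy. Each half of a step preserves the order, which gives the discrete Kruzkov inequality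
`abs_step_sub_le`; its consistency error is `exists_entropy_error`, and summation over the steps
gives `exists_isApprox`. The error has a form that stays integrable when the Kruzkov constant is
replaced by a second density `w y` and `y` is integrated out.

Stability. Only the space variable is doubled. The two entropy rates of a pair of profiles, added,
are bounded by their distance plus the mollification length (`integral_entropyFlow_add_le`); the
available bounds for the individual rates degenerate with that length. The two solutions are taken
at two independent times, and `diagonal_growth` turns growth bounds in each time, whose rates are
controlled only in sum, into a Gronwall bound on the diagonal by averaging over small squares of
times.

Limit. `exists_limit` passes to the limit in the entropy inequalities. The sign is discontinuous,
but for all but countably many constants `α` the limit takes the value `α` on a null set only; any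
other constant is approached from both sides, where the two signs average to `sgn 0 = 0`.

Formulations. The analysis is carried out with entropy inequalities between two times.
`IsEntropySolution.exists_isApprox` and `IsApprox.isEntropySolution` connect these with the
space-time weak formulation: the former localises in time by smooth cutoffs, the latter sums over
short time intervals with a quadratically small remainder. -/

/-- The Kruzkov entropy flux `sgn (a - b) (f a - f b)`. -/
def kruzkov (f : ℝ → ℝ) (a b : ℝ) : ℝ := Real.sign (a - b) * (f a - f b)

lemma abs_sign_le_one (x : ℝ) : |Real.sign x| ≤ 1 := by
  rcases Real.sign_apply_eq x with h | h | h <;> simp [h]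

lemma sign_mul_self_eq_abs (x : ℝ) : Real.sign x * x = |x| := by
  rcases lt_trichotomy x 0 with h | h | h
  · rw [Real.sign_of_neg h, abs_of_neg h]; ring
  · simp [h]
  · rw [Real.sign_of_pos h, abs_of_pos h]; ring

lemma sign_mul_le_abs (x y : ℝ) : Real.sign x * y ≤ |y| := by
  calc Real.sign x * y ≤ |Real.sign x * y| := le_abs_self _
    _ ≤ 1 * |y| := by rw [abs_mul]; gcongr; exact abs_sign_le_one x
    _ = |y| := one_mul _

lemma abs_sign_mul_le (x y : ℝ) : |Real.sign x * y| ≤ |y| := by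
  rw [abs_mul]
  exact mul_le_of_le_one_left (abs_nonneg _) (abs_sign_le_one x)

lemma sign_sub_comm (a b : ℝ) : Real.sign (a - b) = -Real.sign (b - a) := by
  rw [← Real.sign_neg, neg_sub]

lemma measurable_real_sign : Measurable Real.sign := by
  unfold Real.sign
  refine Measurable.ite measurableSet_Iio measurable_const ?_
  exact Measurable.ite measurableSet_Ioi measurable_const measurable_const

lemma kruzkov_comm (f : ℝ → ℝ) (a b : ℝ) : kruzkov f a b = kruzkov f b a := by
  unfold kruzkov; rw [sign_sub_comm]; ring

/-- This form has no sign in it, so continuity in both variables and the Lipschitz bound become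
visible. -/
lemma kruzkov_eq_max_sub_min (f : ℝ → ℝ) (a b : ℝ) :
    kruzkov f a b = f (max a b) - f (min a b) := by
  unfold kruzkov
  rcases lt_trichotomy a b with h | h | h
  · rw [Real.sign_of_neg (by linarith), max_eq_right h.le, min_eq_left h.le]; ring
  · simp [h]
  · rw [Real.sign_of_pos (by linarith), max_eq_left h.le, min_eq_right h.le]; ring

lemma continuous_kruzkov {f : ℝ → ℝ} (hf : Continuous f) :
    Continuous (fun p : ℝ × ℝ => kruzkov f p.1 p.2) := by
  simp only [kruzkov_eq_max_sub_min]; fun_prop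

lemma abs_kruzkov_le (f : ℝ → ℝ) (a b : ℝ) : |kruzkov f a b| ≤ |f a - f b| :=
  abs_sign_mul_le _ _

/-- Lipschitz continuity of the entropy flux in its first variable; the constant `b` need not
lie in the interval on which `f` is Lipschitz. -/
lemma abs_kruzkov_sub_le {f : ℝ → ℝ} {K : ℝ}
    (hf : ∀ u ∈ Icc (0 : ℝ) 1, ∀ v ∈ Icc (0 : ℝ) 1, |f u - f v| ≤ K * |u - v|) {p q : ℝ}
    (hp : p ∈ Icc (0 : ℝ) 1) (hq : q ∈ Icc (0 : ℝ) 1) (b : ℝ) :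
    |kruzkov f p b - kruzkov f q b| ≤ K * |p - q| := by
  have key : ∀ p q : ℝ, p ∈ Icc (0 : ℝ) 1 → q ∈ Icc (0 : ℝ) 1 → p ≤ q →
      |kruzkov f p b - kruzkov f q b| ≤ K * |p - q| := by
    intro p q hp hq hpq
    rcases le_total b p with h1 | h1
    · rw [kruzkov_eq_max_sub_min, kruzkov_eq_max_sub_min, max_eq_left h1,
        max_eq_left (h1.trans hpq), min_eq_right h1, min_eq_right (h1.trans hpq)]
      simpa using hf p hp q hq
    · rcases le_total b q with h2 | h2
      -- Here `b` lies between `p` and `q`, hence in `[0, 1]`; the increments of `f` over the two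
      -- pieces add up to at most `K * (q - p)`.
      · have hb : b ∈ Icc (0 : ℝ) 1 := ⟨hp.1.trans h1, h2.trans hq.2⟩
        rw [kruzkov_eq_max_sub_min, kruzkov_eq_max_sub_min, max_eq_right h1, min_eq_left h1,
          max_eq_left h2, min_eq_right h2]
        have e1 := hf b hb p hp
        have e2 := hf b hb q hq
        rw [abs_of_nonneg (by linarith : 0 ≤ b - p)] at e1
        rw [abs_of_nonpos (by linarith : b - q ≤ 0)] at e2
        rw [abs_of_nonpos (by linarith : p - q ≤ 0), abs_le]
        constructor <;> linarith [abs_le.1 e1, abs_le.1 e2]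
      · rw [kruzkov_eq_max_sub_min, kruzkov_eq_max_sub_min, max_eq_right h1, min_eq_left h1,
          max_eq_right h2, min_eq_left h2]
        have := hf p hp q hq
        rwa [← abs_neg, show -(f b - f p - (f b - f q)) = f p - f q by ring]
  rcases le_total p q with h | h
  · exact key p q hp hq h
  · rw [abs_sub_comm, abs_sub_comm p]; exact key q p hq hp h

/-- A perturbation of the identity that does not reverse the order acts on the absolute value of
a difference through the entropy flux. -/
lemma abs_sub_sub_flux_eq {f : ℝ → ℝ} {p q c : ℝ} (h : |c * (f p - f q)| ≤ |p - q|) :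
    |p - q - c * (f p - f q)| = |p - q| - c * kruzkov f p q := by
  unfold kruzkov
  rcases lt_trichotomy p q with h1 | h1 | h1
  · rw [abs_of_neg (by linarith : p - q < 0)] at h ⊢
    rw [Real.sign_of_neg (by linarith), abs_of_nonpos (by linarith [neg_le_of_abs_le h])]
    ring
  · simp [h1]
  · rw [abs_of_pos (by linarith : 0 < p - q)] at h ⊢
    rw [Real.sign_of_pos (by linarith), abs_of_nonneg (by linarith [le_of_abs_le h])]
    ring

/-! ### Translations, convolutions and derivatives in `L¹(ℝ)` -/

lemma integral_comp_add (w : ℝ → ℝ) (s : ℝ) : ∫ x, w (x + s) = ∫ x, w x :=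
  integral_add_right_eq_self w s

lemma integrable_prod_mul_comp_add {κ w : ℝ → ℝ} (hκ : Integrable κ) (hw : Integrable w) :
    Integrable (fun p : ℝ × ℝ => κ p.2 * w (p.1 + p.2)) (volume.prod volume) := by
  have h := (measurePreserving_add_prod (volume : Measure ℝ)
    (volume : Measure ℝ)).integrable_comp_of_integrable (hw.mul_prod hκ)
  exact h.congr (.of_forall fun p => by simp [mul_comm])

lemma integrable_prod_mul_comp_sub {κ w : ℝ → ℝ} (hκ : Integrable κ) (hw : Integrable w) :
    Integrable (fun p : ℝ × ℝ => w p.2 * κ (p.1 - p.2)) (volume.prod volume) := by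
  have h := (measurePreserving_sub_prod (volume : Measure ℝ)
    (volume : Measure ℝ)).integrable_comp_of_integrable (hκ.mul_prod hw)
  exact h.congr (.of_forall fun p => by simp [mul_comm])

lemma integrable_prod_mul_comp_sub_left {κ w : ℝ → ℝ} (hκ : Integrable κ) (hw : Integrable w) :
    Integrable (fun p : ℝ × ℝ => w p.1 * κ (p.1 - p.2)) (volume.prod volume) := by
  have h := (integrable_prod_mul_comp_sub (κ := fun z => κ (-z)) hκ.comp_neg hw).swap
  exact h.congr (.of_forall fun p => by simp)

/-- Young's inequality for correlations in `L¹`. -/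
lemma integrable_correlation {κ w : ℝ → ℝ} (hκ : Integrable κ) (hw : Integrable w) :
    Integrable (fun x => ∫ z, κ z * w (x + z)) :=
  (integrable_prod_mul_comp_add hκ hw).integral_prod_left

lemma integral_abs_correlation_le {κ w : ℝ → ℝ} (hκ : Integrable κ) (hw : Integrable w) :
    ∫ x, |∫ z, κ z * w (x + z)| ≤ (∫ z, |κ z|) * ∫ x, |w x| := by
  have h1 := integrable_prod_mul_comp_add hκ.abs hw.abs
  calc ∫ x, |∫ z, κ z * w (x + z)| ≤ ∫ x, ∫ z, |κ z| * |w (x + z)| := by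
        refine integral_mono (integrable_correlation hκ hw).abs h1.integral_prod_left fun x => ?_
        refine (abs_integral_le_integral_abs).trans_eq ?_
        simp [abs_mul]
    _ = ∫ z, ∫ x, |κ z| * |w (x + z)| := integral_integral_swap h1
    _ = (∫ z, |κ z|) * ∫ x, |w x| := by
        simp_rw [integral_const_mul, integral_comp_add (fun x => |w x|), integral_mul_const]

/-- A Lipschitz function whose increments are `O(δ)` in `L¹` has an integrable derivative. -/
lemma integrable_deriv_of_increments {F : ℝ → ℝ} {L : NNReal} (hF : LipschitzWith L F) {C : ℝ}
    (hC : 0 ≤ C) (hint : ∀ δ, Integrable (fun x => F (x + δ) - F x))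
    (hb : ∀ δ, 0 < δ → ∫ x, |F (x + δ) - F x| ≤ C * δ) :
    Integrable (deriv F) ∧ ∫ x, |deriv F x| ≤ C := by
  have hd := hF.ae_differentiableAt_real
  set d : ℕ → ℝ := fun n => 1 / ((n : ℝ) + 1) with hdd
  have hdpos : ∀ n, 0 < d n := fun n => by simp only [hdd]; positivity
  have hd0 : Tendsto d atTop (𝓝 0) := tendsto_one_div_add_atTop_nhds_zero_nat
  set q : ℕ → ℝ → ℝ := fun n x => (d n)⁻¹ * (F (x + d n) - F x) with hq
  have hlim : ∀ᵐ x, Tendsto (fun n => ENNReal.ofReal |q n x|) atTop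
      (𝓝 (ENNReal.ofReal |deriv F x|)) := by
    filter_upwards [hd] with x hx
    have h1 := hx.hasDerivAt.tendsto_slope_zero
    have h2 : Tendsto d atTop (𝓝[≠] 0) :=
      tendsto_nhdsWithin_iff.2 ⟨hd0, Eventually.of_forall fun n => (hdpos n).ne'⟩
    have h3 := h1.comp h2
    exact (ENNReal.continuous_ofReal.tendsto _).comp (h3.abs)
  have hFm : Measurable F := hF.continuous.measurable
  have hqm : ∀ n, Measurable (fun x => ENNReal.ofReal |q n x|) := fun n => by
    have : Measurable (q n) := by
      simp only [hq]
      exact ((hFm.comp (measurable_id.add_const _)).sub hFm).const_mul _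
    exact ENNReal.measurable_ofReal.comp (continuous_abs.measurable.comp this)
  have hbound : ∀ n, ∫⁻ x, ENNReal.ofReal |q n x| ≤ ENNReal.ofReal C := by
    intro n
    rw [← ofReal_integral_eq_lintegral_ofReal ((hint (d n)).const_mul _).abs
      (.of_forall fun x => abs_nonneg _)]
    apply ENNReal.ofReal_le_ofReal
    simp only [abs_mul, integral_const_mul, abs_of_pos (inv_pos.2 (hdpos n))]
    rw [inv_mul_le_iff₀ (hdpos n), mul_comm (d n)]
    exact hb _ (hdpos n)
  -- Fatou's lemma for the difference quotients with steps `1 / (n + 1)`, which converge almost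
  -- everywhere because a Lipschitz function is differentiable almost everywhere.
  have hfin : ∫⁻ x, ENNReal.ofReal |deriv F x| ≤ ENNReal.ofReal C := by
    calc ∫⁻ x, ENNReal.ofReal |deriv F x|
        = ∫⁻ x, liminf (fun n => ENNReal.ofReal |q n x|) atTop := by
          refine lintegral_congr_ae ?_
          filter_upwards [hlim] with x hx using hx.liminf_eq.symm
      _ ≤ liminf (fun n => ∫⁻ x, ENNReal.ofReal |q n x|) atTop := lintegral_liminf_le hqm
      _ ≤ ENNReal.ofReal C := by
          refine liminf_le_of_frequently_le' (Frequently.of_forall hbound)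
  have hm : Measurable (deriv F) := measurable_deriv F
  have hi : Integrable (deriv F) := by
    refine ⟨hm.aestronglyMeasurable, ?_⟩
    rw [hasFiniteIntegral_iff_norm]
    exact hfin.trans_lt ENNReal.ofReal_lt_top
  refine ⟨hi, ?_⟩
  rw [integral_eq_lintegral_of_nonneg_ae (.of_forall fun x => abs_nonneg _)
    hi.abs.aestronglyMeasurable]
  exact ENNReal.toReal_le_of_le_ofReal hC hfin

lemma LipschitzWith.sub_eq_integral_deriv {F : ℝ → ℝ} {L : NNReal} (hF : LipschitzWith L F)
    (x p : ℝ) : F (x + p) - F x = ∫ s in (0 : ℝ)..p, deriv F (x + s) := by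
  have h := (hF.lipschitzOnWith (s := uIcc x (x + p))).absolutelyContinuousOnInterval
  rw [← h.integral_deriv_eq_sub, intervalIntegral.integral_comp_add_left (fun s => deriv F s)]
  simp

lemma LipschitzWith.abs_deriv_le {F : ℝ → ℝ} {L : NNReal} (hF : LipschitzWith L F) (x : ℝ) :
    |deriv F x| ≤ L := norm_deriv_le_of_lipschitz hF

namespace LaneModel

variable {N : ℕ} {P : LaneModel N} {K M : ℝ}

/-! ### Bounds on the data of the model -/

lemma exists_lipschitz_g (hA : P.Admissible) : ∃ L : ℝ, 0 ≤ L ∧ ∀ k u v,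
    |P.g k u - P.g k v| ≤ L * |u - v| := by
  choose L hL using hA.g_lip
  refine ⟨∑ k, (L k : ℝ), Finset.sum_nonneg fun k _ => (L k).2, fun k u v => ?_⟩
  have h := (hL k).dist_le_mul u v
  rw [Real.dist_eq, Real.dist_eq] at h
  refine h.trans ?_
  gcongr
  exact Finset.single_le_sum (f := fun k => (L k : ℝ)) (fun k _ => (L k).2) (Finset.mem_univ k)

lemma continuous_g (hA : P.Admissible) (k : Fin N) : Continuous (P.g k) := by
  obtain ⟨L, hL⟩ := hA.g_lip k
  exact hL.continuous

lemma continuous_f (hA : P.Admissible) (k : Fin N) : Continuous (P.f k) :=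
  continuous_id.mul (continuous_g hA k)

lemma zero_mem_dom (hA : P.Admissible) : (0 : ℝ) ∈ P.dom :=
  ⟨le_rfl, by simpa using hA.η_pos.le⟩

/-- The model satisfies the standing assumptions, and `K` bounds its data. -/
structure Regular (P : LaneModel N) (K : ℝ) : Prop where
  adm : P.Admissible
  bdd : P.BoundedBy K

lemma Regular.nonneg (hP : P.Regular K) : 0 ≤ K :=
  (abs_nonneg _).trans (hP.bdd.kern_le 0 (zero_mem_dom hP.adm))

/-- The speeds are bounded by `M`. -/
def SpeedLE (P : LaneModel N) (M : ℝ) : Prop := ∀ k x, ∀ w ∈ Icc (0 : ℝ) 1, |P.ν k x w| ≤ M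

lemma SpeedLE.nonneg {M : ℝ} (hM : P.SpeedLE M) (k : Fin N) : 0 ≤ M :=
  (abs_nonneg _).trans (hM k 0 0 (by simp))

lemma g_nonneg (hA : P.Admissible) (k : Fin N) {u : ℝ} (hu : u ∈ Icc (0 : ℝ) 1) :
    0 ≤ P.g k u := by
  rw [← hA.g_one k]; exact hA.g_anti k hu.2

@[simp] lemma f_zero (k : Fin N) : P.f k 0 = 0 := by simp [f]

lemma f_one (hA : P.Admissible) (k : Fin N) : P.f k 1 = 0 := by simp [f, hA.g_one]

lemma abs_f_le (hB : P.BoundedBy K) (k : Fin N) {u : ℝ} (hu : u ∈ Icc (0 : ℝ) 1) :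
    |P.f k u| ≤ K * u := by
  have h := hB.f_lip k u hu 0 (by simp)
  simpa [abs_of_nonneg hu.1] using h

lemma abs_f_le_one_sub (hP : P.Regular K) (k : Fin N) {u : ℝ} (hu : u ∈ Icc (0 : ℝ) 1)
    : |P.f k u| ≤ K * (1 - u) := by
  have h := hP.bdd.f_lip k u hu 1 (by simp)
  rwa [f_one hP.adm, sub_zero, abs_sub_comm u, abs_of_nonneg (show (0 : ℝ) ≤ 1 - u by linarith [hu.2])] at h

/-- The Lipschitz bound for `f` gives `v * g v ≤ K * v`. Division by `v` fails at `0`, where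
continuity takes over. Thus no separate bound on `g` enters the constants, although the Lipschitz
constant of `g` is not controlled by `K`. -/
lemma g_le (hP : P.Regular K) (k : Fin N) {u : ℝ} (hu : u ∈ Icc (0 : ℝ) 1) : P.g k u ≤ K := by
  have hpos : ∀ v ∈ Ioc (0 : ℝ) 1, P.g k v ≤ K := by
    intro v hv
    have h := (le_abs_self _).trans (abs_f_le hP.bdd k ⟨hv.1.le, hv.2⟩)
    unfold f at h
    rw [mul_comm] at h
    exact le_of_mul_le_mul_right h hv.1
  have h0 : P.g k 0 ≤ K := by
    have h1 : Tendsto (P.g k) (𝓝[>] 0) (𝓝 (P.g k 0)) :=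
      (continuous_g hP.adm k).continuousAt.tendsto.mono_left nhdsWithin_le_nhds
    refine le_of_tendsto h1 ?_
    filter_upwards [Ioc_mem_nhdsGT (zero_lt_one' ℝ)] with v hv using hpos v hv
  exact (hP.adm.g_anti k hu.1).trans h0

lemma abs_kruzkov_f_le_add (hB : P.BoundedBy K) (k : Fin N) {a : ℝ} (ha : a ∈ Icc (0 : ℝ) 1) (b : ℝ)
    : |kruzkov (P.f k) a b| ≤ K * a + |P.f k b| := by
  refine (abs_kruzkov_le _ _ _).trans ((abs_sub _ _).trans ?_)
  gcongr
  exact abs_f_le hB k ha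

/-! ### The velocity factors -/

lemma abs_ν_sub_le_x (hP : P.Regular K) (k : Fin N) (x y : ℝ) {u : ℝ} (hu : u ∈ Icc (0 : ℝ) 1)
    : |P.ν k x u - P.ν k y u| ≤ K * |x - y| := by
  have := Convex.norm_image_sub_le_of_norm_deriv_le (f := fun z => P.ν k z u) (s := univ) (C := K)
    (x := y) (y := x) (fun z _ => (hP.adm.ν_smooth_x k u).differentiable (by norm_num) z)
    (fun z _ => hP.bdd.ν_x k z u hu) convex_univ trivial trivial
  simpa using this

lemma abs_ν_sub_le_u (hP : P.Regular K) (k : Fin N) (x : ℝ) {u v : ℝ} (hu : u ∈ Icc (0 : ℝ) 1)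
    (hv : v ∈ Icc (0 : ℝ) 1) :
    |P.ν k x u - P.ν k x v| ≤ K * |u - v| := by
  have := Convex.norm_image_sub_le_of_norm_deriv_le (f := fun z => P.ν k x z) (s := Icc 0 1)
    (C := K) (x := v) (y := u) (fun z _ => (hP.adm.ν_smooth_u k x).differentiable (by norm_num) z)
    (fun z hz => hP.bdd.ν_u k x z hz) (convex_Icc 0 1) hv hu
  simpa using this

lemma abs_partialX_sub_le_x (hP : P.Regular K) (k : Fin N) (x y : ℝ) {u : ℝ}
    (hu : u ∈ Icc (0 : ℝ) 1) :
    |partialX (P.ν k) x u - partialX (P.ν k) y u| ≤ K * |x - y| := by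
  have hd : Differentiable ℝ (fun z => partialX (P.ν k) z u) :=
    (((contDiff_succ_iff_deriv (n := 1)).1 (hP.adm.ν_smooth_x k u)).2.2).differentiable (by norm_num)
  have := Convex.norm_image_sub_le_of_norm_deriv_le (f := fun z => partialX (P.ν k) z u)
    (s := univ) (C := K) (x := y) (y := x) (fun z _ => hd z)
    (fun z _ => hP.bdd.ν_xx k z u hu) convex_univ trivial trivial
  simpa using this

lemma abs_partialX_sub_le_u (hP : P.Regular K) (k : Fin N) (x : ℝ) {u v : ℝ}
    (hu : u ∈ Icc (0 : ℝ) 1) (hv : v ∈ Icc (0 : ℝ) 1) :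
    |partialX (P.ν k) x u - partialX (P.ν k) x v| ≤ K * |u - v| := by
  have := Convex.norm_image_sub_le_of_norm_deriv_le (f := fun z => partialX (P.ν k) x z)
    (s := Icc 0 1) (C := K) (x := v) (y := u) (fun z _ => hP.adm.ν_mixed_xu k x z)
    (fun z hz => hP.bdd.ν_xu k x z hz) (convex_Icc 0 1) hv hu
  simpa using this

lemma abs_partialU_sub_le_x (hP : P.Regular K) (k : Fin N) (x y : ℝ) {u : ℝ}
    (hu : u ∈ Icc (0 : ℝ) 1) :
    |partialU (P.ν k) x u - partialU (P.ν k) y u| ≤ K * |x - y| := by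
  have := Convex.norm_image_sub_le_of_norm_deriv_le (f := fun z => partialU (P.ν k) z u)
    (s := univ) (C := K) (x := y) (y := x) (fun z _ => hP.adm.ν_mixed_ux k u z)
    (fun z _ => hP.bdd.ν_ux k z u hu) convex_univ trivial trivial
  simpa using this

lemma abs_partialU_sub_le_u (hP : P.Regular K) (k : Fin N) (x : ℝ) {u v : ℝ}
    (hu : u ∈ Icc (0 : ℝ) 1) (hv : v ∈ Icc (0 : ℝ) 1) :
    |partialU (P.ν k) x u - partialU (P.ν k) x v| ≤ K * |u - v| := by
  have hd : Differentiable ℝ (fun z => partialU (P.ν k) x z) :=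
    (((contDiff_succ_iff_deriv (n := 1)).1 (hP.adm.ν_smooth_u k x)).2.2).differentiable (by norm_num)
  have := Convex.norm_image_sub_le_of_norm_deriv_le (f := fun z => partialU (P.ν k) x z)
    (s := Icc 0 1) (C := K) (x := v) (y := u) (fun z _ => hd z)
    (fun z hz => hP.bdd.ν_uu k x z hz) (convex_Icc 0 1) hv hu
  simpa using this

/-- First order Taylor expansion with quadratic remainder. -/
lemma _root_.abs_sub_sub_deriv_mul_le {F : ℝ → ℝ} {s : Set ℝ} (hs : s.OrdConnected) {C : ℝ}
    (hC : 0 ≤ C) (hd : ∀ z ∈ s, DifferentiableAt ℝ F z)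
    (hl : ∀ y ∈ s, ∀ z ∈ s, |deriv F y - deriv F z| ≤ C * |y - z|) {a b : ℝ} (ha : a ∈ s)
    (hb : b ∈ s) : |F b - F a - deriv F a * (b - a)| ≤ C * |b - a| ^ 2 := by
  have hsub : uIcc a b ⊆ s := hs.uIcc_subset ha hb
  have hd' : ∀ z ∈ uIcc a b, HasDerivAt (fun z => F z - deriv F a * z)
      (deriv F z - deriv F a) z := fun z hz => by
    have h := (hd z (hsub hz)).hasDerivAt.sub ((hasDerivAt_id z).const_mul (deriv F a))
    rw [mul_one] at h
    exact h
  have := Convex.norm_image_sub_le_of_norm_deriv_le (f := fun z => F z - deriv F a * z)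
    (s := uIcc a b) (C := C * |b - a|) (x := a) (y := b)
    (fun z hz => (hd' z hz).differentiableAt)
    (fun z hz => by
      rw [(hd' z hz).deriv, Real.norm_eq_abs]
      refine (hl z (hsub hz) a ha).trans ?_
      gcongr 1
      exact abs_sub_left_of_mem_uIcc hz)
    (convex_uIcc a b) left_mem_uIcc right_mem_uIcc
  rw [Real.norm_eq_abs, Real.norm_eq_abs] at this
  calc |F b - F a - deriv F a * (b - a)| = |F b - deriv F a * b - (F a - deriv F a * a)| := by
        congr 1; ring
    _ ≤ C * |b - a| * |b - a| := this
    _ = _ := by ring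

/-- Chain rule for the velocity along a curve of average densities in `[0, 1]`; the second
argument may touch the boundary of the strip on which `ν` is controlled. -/
lemma hasDerivAt_ν_comp (hP : P.Regular K) (k : Fin N) {A : ℝ → ℝ} (hAr : ∀ x, A x ∈ Icc (0 : ℝ) 1)
    {x A' : ℝ} (hd : HasDerivAt A A' x) :
    HasDerivAt (fun y => P.ν k y (A y))
      (partialX (P.ν k) x (A x) + partialU (P.ν k) x (A x) * A') x := by
  have hK := hP.nonneg
  set νx := partialX (P.ν k) x (A x) with hνx
  set νu := partialU (P.ν k) x (A x) with hνu
  have hdA : (fun y => A y - A x - A' * (y - x)) =o[𝓝 x] fun y => y - x := by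
    have := hasDerivAt_iff_isLittleO.1 hd
    simpa [mul_comm] using this
  have hAO : (fun y => A y - A x) =O[𝓝 x] fun y => y - x := hd.isBigO_sub
  have hyo : (fun y : ℝ => y - x) =o[𝓝 x] fun _ => (1 : ℝ) := by
    rw [Asymptotics.isLittleO_one_iff]
    have : Tendsto (fun y : ℝ => y - x) (𝓝 x) (𝓝 (x - x)) :=
      (continuous_id.sub continuous_const).tendsto x
    simpa using this
  -- Differentiability of `ν` is given in each variable separately, and bounds only on the strip.
  -- The increment is split at `(y, A x)`: a Taylor expansion in the state at `y`, one in space at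
  -- the state `A x`, and the change of the state derivative between `y` and `x`, which is what the
  -- mixed derivative controls.
  have hsmall : ∀ y, |P.ν k y (A y) - P.ν k x (A x) - νx * (y - x) - νu * (A y - A x)|
      ≤ K * |A y - A x| ^ 2 + K * |y - x| * |A y - A x| + K * |y - x| ^ 2 := by
    intro y
    have e1 : |P.ν k y (A y) - P.ν k y (A x) - partialU (P.ν k) y (A x) * (A y - A x)|
        ≤ K * |A y - A x| ^ 2 :=
      abs_sub_sub_deriv_mul_le (F := fun u => P.ν k y u) (s := Icc 0 1) ordConnected_Icc hK
        (fun z _ => (hP.adm.ν_smooth_u k y).differentiable (by norm_num) z)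
        (fun u hu v hv => abs_partialU_sub_le_u hP k y hu hv) (hAr x) (hAr y)
    have e2 : |P.ν k y (A x) - P.ν k x (A x) - νx * (y - x)| ≤ K * |y - x| ^ 2 :=
      abs_sub_sub_deriv_mul_le (F := fun z => P.ν k z (A x)) (s := univ) ordConnected_univ hK
        (fun z _ => (hP.adm.ν_smooth_x k (A x)).differentiable (by norm_num) z)
        (fun u _ v _ => abs_partialX_sub_le_x hP k u v (hAr x)) trivial trivial
    have e3 : |(partialU (P.ν k) y (A x) - νu) * (A y - A x)| ≤ K * |y - x| * |A y - A x| := by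
      rw [abs_mul]; gcongr; exact abs_partialU_sub_le_x hP k y x (hAr x)
    calc |P.ν k y (A y) - P.ν k x (A x) - νx * (y - x) - νu * (A y - A x)|
        = |(P.ν k y (A y) - P.ν k y (A x) - partialU (P.ν k) y (A x) * (A y - A x))
          + (partialU (P.ν k) y (A x) - νu) * (A y - A x)
          + (P.ν k y (A x) - P.ν k x (A x) - νx * (y - x))| := by congr 1; ring
      _ ≤ _ := (abs_add_three _ _ _).trans (by linarith)
  have hrem : (fun y => P.ν k y (A y) - P.ν k x (A x) - νx * (y - x) - νu * (A y - A x))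
      =o[𝓝 x] fun y => y - x := by
    have h1 : (fun y => K * |A y - A x| ^ 2 + K * |y - x| * |A y - A x| + K * |y - x| ^ 2)
        =o[𝓝 x] fun y => y - x := by
      have hq : ∀ u v : ℝ → ℝ, u =O[𝓝 x] (fun y => y - x) → v =O[𝓝 x] (fun y => y - x) →
          (fun y => u y * v y) =o[𝓝 x] fun y => y - x := fun u v hu hv => by
        have := (hu.mul hv).trans_isLittleO
          ((Asymptotics.isBigO_refl (fun y : ℝ => y - x) (𝓝 x)).mul_isLittleO hyo)
        simpa using this
      have hO := Asymptotics.isBigO_refl (fun y : ℝ => y - x) (𝓝 x)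
      have a1 := (hq _ _ hAO.abs_left hAO.abs_left).const_mul_left K
      have a2 := (hq _ _ hO.abs_left hAO.abs_left).const_mul_left K
      have a3 := (hq _ _ hO.abs_left hO.abs_left).const_mul_left K
      refine ((a1.add a2).add a3).congr_left fun y => by ring
    refine Asymptotics.IsBigO.trans_isLittleO ?_ h1
    exact Asymptotics.IsBigO.of_norm_le fun y => hsmall y
  rw [hasDerivAt_iff_isLittleO]
  have := hrem.add (hdA.const_mul_left νu)
  refine this.congr_left fun y => ?_
  simp only [smul_eq_mul]; ring

/-- The velocity factor with the second argument clamped to `[0, 1]`. -/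
lemma continuous_ν_clamp (hP : P.Regular K) (k : Fin N) :
    Continuous (fun p : ℝ × ℝ => P.ν k p.1 (max 0 (min p.2 1))) := by
  have hK := hP.nonneg
  have hm : ∀ u : ℝ, max 0 (min u 1) ∈ Icc (0 : ℝ) 1 := fun u =>
    ⟨le_max_left _ _, max_le zero_le_one (min_le_right _ _)⟩
  rw [continuous_iff_continuousAt]
  rintro ⟨x, u⟩
  rw [ContinuousAt, tendsto_iff_dist_tendsto_zero]
  refine squeeze_zero (fun _ => dist_nonneg) (g := fun p : ℝ × ℝ => K * |p.1 - x|
    + K * |max 0 (min p.2 1) - max 0 (min u 1)|) (fun p => ?_) ?_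
  · rw [Real.dist_eq]
    calc |P.ν k p.1 (max 0 (min p.2 1)) - P.ν k x (max 0 (min u 1))|
        ≤ |P.ν k p.1 (max 0 (min p.2 1)) - P.ν k x (max 0 (min p.2 1))|
          + |P.ν k x (max 0 (min p.2 1)) - P.ν k x (max 0 (min u 1))| := abs_sub_le _ _ _
      _ ≤ _ := add_le_add (abs_ν_sub_le_x hP k _ _ (hm _))
          (abs_ν_sub_le_u hP k x (hm _) (hm _))
  · have : Continuous (fun p : ℝ × ℝ => K * |p.1 - x|
      + K * |max 0 (min p.2 1) - max 0 (min u 1)|) := by fun_prop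
    simpa using this.tendsto (x, u)

lemma ν_clamp_eq (k : Fin N) (x : ℝ) {u : ℝ} (hu : u ∈ Icc (0 : ℝ) 1) :
    P.ν k x (max 0 (min u 1)) = P.ν k x u := by
  rw [min_eq_left hu.2, max_eq_right hu.1]

/-- Joint measurability comes from the clamped factor, which is continuous on the whole plane and
takes the same values along `A`. -/
lemma measurable_ν_comp {Ω : Type*} [MeasurableSpace Ω] (hP : P.Regular K) (k : Fin N) {X A : Ω → ℝ} (hX : Measurable X) (hAm : Measurable A)
    (hAr : ∀ ω, A ω ∈ Icc (0 : ℝ) 1) : Measurable (fun ω => P.ν k (X ω) (A ω)) := by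
  have := (continuous_ν_clamp hP k).measurable.comp (hX.prodMk hAm)
  have e : (fun ω => P.ν k (X ω) (A ω))
      = (fun p : ℝ × ℝ => P.ν k p.1 (max 0 (min p.2 1))) ∘ fun ω => (X ω, A ω) :=
    funext fun ω => (ν_clamp_eq k _ (hAr ω)).symm
  rwa [e]

/-! ### The exchange terms and the source -/

/-- The flow from lane `m` to lane `m + 1`, which is zero if one of the two does not exist. -/
def exch (P : LaneModel N) (x : ℝ) (a A : Fin N → ℝ) (m : ℕ) : ℝ :=
  if h : m + 1 < N then
    P.S ⟨m, by omega⟩ ⟨m + 1, h⟩ x (a ⟨m, by omega⟩) (a ⟨m + 1, h⟩) (A ⟨m, by omega⟩)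
      (A ⟨m + 1, h⟩)
  else 0

/-- The flow into lane `m` from lane `m - 1`. -/
def exchIn (P : LaneModel N) (x : ℝ) (a A : Fin N → ℝ) : ℕ → ℝ
  | 0 => 0
  | m + 1 => P.exch x a A m

lemma R_eq (k : Fin N) (x : ℝ) (a A : Fin N → ℝ) :
    P.R k x a A = P.exchIn x a A k - P.exch x a A k := by
  obtain ⟨m, hm⟩ := k
  unfold R
  congr 1
  cases m with
  | zero => simp [exchIn]
  | succ m => simp [exchIn, exch, hm]

/-- What leaves a lane enters the next one, so the sum telescopes; both end terms vanish because
nothing crosses the outer boundaries of the road. -/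
lemma sum_R_eq_zero (x : ℝ) (a A : Fin N → ℝ) : ∑ k, P.R k x a A = 0 := by
  simp only [R_eq]
  rw [Fin.sum_univ_eq_sum_range (fun m => P.exchIn x a A m - P.exch x a A m) N]
  have h : ∀ m, P.exchIn x a A m - P.exch x a A m
      = P.exchIn x a A m - P.exchIn x a A (m + 1) := fun m => rfl
  simp only [h]
  rw [Finset.sum_range_sub']
  cases N with
  | zero => simp
  | succ n => simp [exchIn, exch]

lemma add_le_sum {a : Fin N → ℝ} (h : ∀ j, 0 ≤ a j) {i j : Fin N} (hij : i ≠ j) :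
    a i + a j ≤ ∑ l, a l := by
  rw [← Finset.sum_pair hij]
  exact Finset.sum_le_sum_of_subset_of_nonneg (Finset.subset_univ _) fun l _ _ => h l

variable {a a' A A' : Fin N → ℝ}

lemma S_self (i j : Fin N) (x A B : ℝ) : P.S i j x 0 0 A B = 0 := by simp [S]

lemma abs_exch_sub_le (hP : P.Regular K) (x : ℝ) (ha : ∀ j, a j ∈ Icc (0 : ℝ) 1)
    (ha' : ∀ j, a' j ∈ Icc (0 : ℝ) 1) (hAr : ∀ j, A j ∈ Icc (0 : ℝ) 1)
    (hAr' : ∀ j, A' j ∈ Icc (0 : ℝ) 1) (m : ℕ) :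
    |P.exch x a A m - P.exch x a' A' m| ≤ K * ∑ j, (|a j - a' j| + |A j - A' j|) := by
  have hK := hP.nonneg
  unfold exch
  split_ifs with h
  · refine (hP.bdd.S_lip _ _ rfl x _ (ha _) _ (ha _) _ (hAr _) _ (hAr _) _ (ha' _) _ (ha' _) _
      (hAr' _) _ (hAr' _)).trans ?_
    gcongr
    have := add_le_sum (a := fun j => |a j - a' j| + |A j - A' j|) (fun j => by positivity)
      (i := ⟨m, by omega⟩) (j := ⟨m + 1, h⟩) (by simp)
    linarith
  · simp only [sub_self, abs_zero]
    exact mul_nonneg hK (Finset.sum_nonneg fun j _ => by positivity)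

/-- Comparison with zero densities and the same averages, for which the exchange vanishes. The
averages cancel, so the bound is by the densities alone and hence integrable. -/
lemma abs_exch_le (hP : P.Regular K) (x : ℝ) (ha : ∀ j, a j ∈ Icc (0 : ℝ) 1)
    (hAr : ∀ j, A j ∈ Icc (0 : ℝ) 1) (m : ℕ) : |P.exch x a A m| ≤ K * ∑ j, a j := by
  have h := abs_exch_sub_le hP x ha (a' := fun _ => 0) (A' := A) (fun j => by simp) hAr hAr m
  have h0 : P.exch x (fun _ => 0) A m = 0 := by
    unfold exch; split_ifs <;> simp [S_self]
  rw [h0, sub_zero] at h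
  refine h.trans_eq ?_
  congr 1
  exact Finset.sum_congr rfl fun j _ => by simp [abs_of_nonneg (ha j).1]

lemma _root_.abs_max_zero_sub_le (s t : ℝ) : |max s 0 - max t 0| ≤ |s - t| := by
  simpa using abs_max_sub_max_le_max s 0 t 0

lemma _root_.abs_min_zero_sub_le (s t : ℝ) : |min s 0 - min t 0| ≤ |s - t| := by
  simpa using abs_min_sub_min_le_max s 0 t 0

/-- The space dependence of the exchange enters through `ν` only, so it is governed by the bounds
for `g` and for the space derivative of `ν`. The density factors are kept, since a bound by `|x -
y|` alone would not be integrable on the line. -/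
lemma abs_exch_sub_le_x (hP : P.Regular K) (x y : ℝ) (ha : ∀ j, a j ∈ Icc (0 : ℝ) 1)
    (hAr : ∀ j, A j ∈ Icc (0 : ℝ) 1) (m : ℕ) :
    |P.exch x a A m - P.exch y a A m| ≤ 2 * K ^ 2 * |x - y| * ∑ j, a j := by
  have hK := hP.nonneg
  unfold exch
  split_ifs with h
  · set i : Fin N := ⟨m, by omega⟩
    set j : Fin N := ⟨m + 1, h⟩
    have hij : a i + a j ≤ ∑ l, a l := add_le_sum (fun j => (ha j).1) (by simp [i, j])
    unfold S
    have e : ∀ l : Fin N, |P.g l (a l) * P.ν l x (A l) - P.g l (a l) * P.ν l y (A l)|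
        ≤ K * (K * |x - y|) := fun l => by
      rw [← mul_sub, abs_mul, abs_of_nonneg (g_nonneg hP.adm l (ha l))]
      exact mul_le_mul (g_le hP l (ha l)) (abs_ν_sub_le_x hP l x y (hAr l)) (abs_nonneg _) hK
    set s := P.g j (a j) * P.ν j x (A j) - P.g i (a i) * P.ν i x (A i)
    set t := P.g j (a j) * P.ν j y (A j) - P.g i (a i) * P.ν i y (A i)
    have hst : |s - t| ≤ 2 * K ^ 2 * |x - y| := by
      calc |s - t| = |(P.g j (a j) * P.ν j x (A j) - P.g j (a j) * P.ν j y (A j))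
          - (P.g i (a i) * P.ν i x (A i) - P.g i (a i) * P.ν i y (A i))| := by
            congr 1; simp only [s, t]; ring
        _ ≤ _ := (abs_sub _ _).trans (by linarith [e i, e j])
    calc |max s 0 * a i - -min s 0 * a j - (max t 0 * a i - -min t 0 * a j)|
        = |(max s 0 - max t 0) * a i + (min s 0 - min t 0) * a j| := by congr 1; ring
      _ ≤ |max s 0 - max t 0| * a i + |min s 0 - min t 0| * a j := by
          refine (abs_add_le _ _).trans_eq ?_
          rw [abs_mul, abs_mul, abs_of_nonneg (ha i).1, abs_of_nonneg (ha j).1]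
      _ ≤ (2 * K ^ 2 * |x - y|) * a i + (2 * K ^ 2 * |x - y|) * a j := by
          gcongr
          · exact (ha i).1
          · exact (abs_max_zero_sub_le s t).trans hst
          · exact (ha j).1
          · exact (abs_min_zero_sub_le s t).trans hst
      _ = (2 * K ^ 2 * |x - y|) * (a i + a j) := by ring
      _ ≤ _ := by gcongr
  · simp only [sub_self, abs_zero]
    exact mul_nonneg (by positivity) (Finset.sum_nonneg fun j _ => (ha j).1)

/-- The outflow of a lane is controlled by its density, the inflow by its free space. -/
lemma exch_bounds (hP : P.Regular K) (hM : P.SpeedLE M) {L : ℝ}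
    (hL : ∀ k u v, |P.g k u - P.g k v| ≤ L * |u - v|) (x : ℝ) (ha : ∀ j, a j ∈ Icc (0 : ℝ) 1)
    (hAr : ∀ j, A j ∈ Icc (0 : ℝ) 1) (m : ℕ) (h : m + 1 < N) :
    P.exch x a A m ≤ K * M * a ⟨m, by omega⟩ ∧ -(K * M * a ⟨m + 1, h⟩) ≤ P.exch x a A m ∧
    P.exch x a A m ≤ L * M * (1 - a ⟨m + 1, h⟩) ∧
    -(L * M * (1 - a ⟨m, by omega⟩)) ≤ P.exch x a A m := by
  have hK := hP.nonneg
  unfold exch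
  rw [dif_pos h]
  set i : Fin N := ⟨m, by omega⟩
  set j : Fin N := ⟨m + 1, h⟩
  have hM0 : 0 ≤ M := (abs_nonneg _).trans (hM i x (A i) (hAr i))
  have hν0 : ∀ l, 0 ≤ P.ν l x (A l) := fun l => hP.adm.ν_nonneg l x _ (hAr l)
  have hνM : ∀ l, P.ν l x (A l) ≤ M := fun l => (le_abs_self _).trans (hM l x _ (hAr l))
  have hg0 : ∀ l, 0 ≤ P.g l (a l) := fun l => g_nonneg hP.adm l (ha l)
  have hgK : ∀ l, P.g l (a l) * P.ν l x (A l) ≤ K * M := fun l =>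
    mul_le_mul (g_le hP l (ha l)) (hνM l) (hν0 l) hK
  have hgL : ∀ l, P.g l (a l) * P.ν l x (A l) ≤ L * M * (1 - a l) := fun l => by
    have h1 := (le_abs_self _).trans (hL l (a l) 1)
    rw [hP.adm.g_one, sub_zero, abs_sub_comm, abs_of_nonneg (by linarith [(ha l).2])] at h1
    calc _ ≤ L * (1 - a l) * M := mul_le_mul h1 (hνM l) (hν0 l) ((hg0 l).trans h1)
      _ = _ := by ring
  have hp : ∀ l, 0 ≤ P.g l (a l) * P.ν l x (A l) := fun l => mul_nonneg (hg0 l) (hν0 l)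
  unfold S
  have hKi := hgK i
  have hKj := hgK j
  have hLi := hgL i
  have hLj := hgL j
  have hpi := hp i
  have hpj := hp j
  set p := P.g i (a i) * P.ν i x (A i)
  set q := P.g j (a j) * P.ν j x (A j)
  obtain ⟨hi0, hi1⟩ := ha i
  obtain ⟨hj0, hj1⟩ := ha j
  -- If `p ≤ q`, the flow is `(q - p) * a i ≥ 0`: it is at most `q * a i`, and also at most `q`,
  -- which is small when lane `j` is nearly full. Otherwise it is `-(p - q) * a j` and the lanes
  -- exchange their roles.
  rcases le_total 0 (q - p) with hs | hs
  · rw [max_eq_left hs, min_eq_right hs]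
    refine ⟨?_, ?_, ?_, ?_⟩
    · nlinarith
    · nlinarith
    · nlinarith
    · nlinarith
  · rw [max_eq_right hs, min_eq_left hs]
    refine ⟨?_, ?_, ?_, ?_⟩
    · nlinarith
    · nlinarith
    · nlinarith
    · nlinarith

lemma abs_R_sub_le (hP : P.Regular K) (k : Fin N) (x : ℝ) (ha : ∀ j, a j ∈ Icc (0 : ℝ) 1)
    (ha' : ∀ j, a' j ∈ Icc (0 : ℝ) 1) (hAr : ∀ j, A j ∈ Icc (0 : ℝ) 1)
    (hAr' : ∀ j, A' j ∈ Icc (0 : ℝ) 1) :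
    |P.R k x a A - P.R k x a' A'| ≤ 2 * K * ∑ j, (|a j - a' j| + |A j - A' j|) := by
  have hK := hP.nonneg
  have h0 : 0 ≤ K * ∑ j, (|a j - a' j| + |A j - A' j|) :=
    mul_nonneg hK (Finset.sum_nonneg fun j _ => by positivity)
  have hin : ∀ m, |P.exchIn x a A m - P.exchIn x a' A' m|
      ≤ K * ∑ j, (|a j - a' j| + |A j - A' j|) := by
    rintro (_ | m)
    · simpa [exchIn] using h0
    · exact abs_exch_sub_le hP x ha ha' hAr hAr' m
  rw [R_eq, R_eq, sub_sub_sub_comm]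
  refine (abs_sub _ _).trans ?_
  linarith [hin k, abs_exch_sub_le hP x ha ha' hAr hAr' k]

lemma abs_R_le (hP : P.Regular K) (k : Fin N) (x : ℝ) (ha : ∀ j, a j ∈ Icc (0 : ℝ) 1)
    (hAr : ∀ j, A j ∈ Icc (0 : ℝ) 1) :
    |P.R k x a A| ≤ 2 * K * ∑ j, a j := by
  have hK := hP.nonneg
  have hin : ∀ m, |P.exchIn x a A m| ≤ K * ∑ j, a j := by
    rintro (_ | m)
    · simpa [exchIn] using mul_nonneg hK (Finset.sum_nonneg fun j _ => (ha j).1)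
    · exact abs_exch_le hP x ha hAr m
  rw [R_eq]
  refine (abs_sub _ _).trans ?_
  linarith [hin k, abs_exch_le hP x ha hAr k]

lemma abs_R_sub_le_x (hP : P.Regular K) (k : Fin N) (x y : ℝ) (ha : ∀ j, a j ∈ Icc (0 : ℝ) 1)
    (hAr : ∀ j, A j ∈ Icc (0 : ℝ) 1) :
    |P.R k x a A - P.R k y a A| ≤ 4 * K ^ 2 * |x - y| * ∑ j, a j := by
  have hin : ∀ m, |P.exchIn x a A m - P.exchIn y a A m| ≤ 2 * K ^ 2 * |x - y| * ∑ j, a j := by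
    rintro (_ | m)
    · simpa [exchIn] using mul_nonneg (by positivity : 0 ≤ 2 * K ^ 2 * |x - y|)
        (Finset.sum_nonneg fun j _ => (ha j).1)
    · exact abs_exch_sub_le_x hP x y ha hAr m
  rw [R_eq, R_eq, sub_sub_sub_comm]
  refine (abs_sub _ _).trans ?_
  linarith [hin k, abs_exch_sub_le_x hP x y ha hAr k]

/-- These one-sided bounds make `[0, 1]` invariant: the loss vanishes with the density, the gain
with the free space. The second uses `g 1 = 0` together with the Lipschitz constant `L` of `g`,
which affects the admissible time step but none of the final constants. -/
lemma R_bounds (hP : P.Regular K) (hM : P.SpeedLE M) {L : ℝ} (hL0 : 0 ≤ L)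
    (hL : ∀ k u v, |P.g k u - P.g k v| ≤ L * |u - v|) (k : Fin N) (x : ℝ)
    (ha : ∀ j, a j ∈ Icc (0 : ℝ) 1) (hAr : ∀ j, A j ∈ Icc (0 : ℝ) 1) :
    -(2 * (K * M) * a k) ≤ P.R k x a A ∧ P.R k x a A ≤ 2 * (L * M) * (1 - a k) := by
  have hK := hP.nonneg
  have hM0 : 0 ≤ M := (abs_nonneg _).trans (hM k x (A k) (hAr k))
  obtain ⟨h0, h1⟩ := ha k
  have e1 : 0 ≤ K * M * a k := by positivity
  have e2 : 0 ≤ L * M * (1 - a k) := mul_nonneg (by positivity) (by linarith)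
  have hout : P.exch x a A k ≤ K * M * a k ∧ -(L * M * (1 - a k)) ≤ P.exch x a A k := by
    by_cases h : k.val + 1 < N
    · have := exch_bounds hP hM hL x ha hAr k.val h
      exact ⟨this.1, this.2.2.2⟩
    · simp only [exch, dif_neg h]
      exact ⟨e1, by linarith⟩
  have hin : -(K * M * a k) ≤ P.exchIn x a A k ∧ P.exchIn x a A k ≤ L * M * (1 - a k) := by
    obtain ⟨m, hm⟩ := k
    cases m with
    | zero => exact ⟨by simpa [exchIn] using e1, by simpa [exchIn] using e2⟩
    | succ m =>
      have := exch_bounds hP hM hL x ha hAr m hm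
      exact ⟨this.2.1, this.2.2.1⟩
  rw [R_eq]
  constructor <;> linarith [hin.1, hin.2, hout.1, hout.2]

lemma measurable_R_comp {Ω : Type*} [MeasurableSpace Ω] (hP : P.Regular K) (k : Fin N) {X : Ω → ℝ} {b B : Fin N → Ω → ℝ} (hX : Measurable X)
    (hb : ∀ j, Measurable (b j)) (hBm : ∀ j, Measurable (B j)) (hBr : ∀ j ω, B j ω ∈ Icc (0 : ℝ) 1)
    :
    Measurable (fun ω => P.R k (X ω) (fun j => b j ω) (fun j => B j ω)) := by
  have hgν : ∀ l, Measurable (fun ω => P.g l (b l ω) * P.ν l (X ω) (B l ω)) := fun l =>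
    ((continuous_g hP.adm l).measurable.comp (hb l)).mul (measurable_ν_comp hP l hX (hBm l) (hBr l))
  have hex : ∀ m, Measurable (fun ω => P.exch (X ω) (fun j => b j ω) (fun j => B j ω) m) := by
    intro m
    unfold exch
    split_ifs with h
    · unfold S
      exact (((((hgν _).sub (hgν _)).max measurable_const).mul (hb _))).sub
        ((((hgν _).sub (hgν _)).min measurable_const).neg.mul (hb _))
    · exact measurable_const
  have hin : ∀ m, Measurable (fun ω => P.exchIn (X ω) (fun j => b j ω) (fun j => B j ω) m) := by
    rintro (_ | m)
    · exact measurable_const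
    · exact hex m
  simp only [R_eq]
  exact (hin k).sub (hex k)

end LaneModel

/-- A measurable, integrable function on the line with values in `[0, 1]`. -/
structure IsDensity (a : ℝ → ℝ) : Prop where
  measurable : Measurable a
  mem : ∀ x, a x ∈ Icc (0 : ℝ) 1
  integrable : Integrable a

lemma IsDensity.comp_add {a : ℝ → ℝ} (ha : IsDensity a) (s : ℝ) :
    IsDensity (fun x => a (x + s)) :=
  ⟨ha.measurable.comp (measurable_id.add_const s), fun _ => ha.mem _, ha.integrable.comp_add_right s⟩

lemma integral_abs_le_sum {ι : Type*} [Fintype ι] (F : ι → ℝ → ℝ) (k : ι) :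
    ∫ x, |F k x| ≤ ∑ j, ∫ x, |F j x| :=
  Finset.single_le_sum (f := fun j => ∫ x, |F j x|)
    (fun _ _ => integral_nonneg fun _ => abs_nonneg _) (Finset.mem_univ k)

lemma integral_le_sum {ι : Type*} [Fintype ι] {a : ι → ℝ → ℝ} (ha : ∀ j, IsDensity (a j)) (k : ι) :
    ∫ x, a k x ≤ ∑ j, ∫ x, a j x :=
  Finset.single_le_sum (f := fun j => ∫ x, a j x)
    (fun j _ => integral_nonneg fun x => ((ha j).mem x).1) (Finset.mem_univ k)

lemma abs_sub_le_one_of_mem {a b : ℝ} (ha : a ∈ Icc (0 : ℝ) 1) (hb : b ∈ Icc (0 : ℝ) 1) :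
    |a - b| ≤ 1 := by
  rw [abs_le]; constructor <;> linarith [ha.1, ha.2, hb.1, hb.2]

namespace LaneModel

variable {N : ℕ} {P : LaneModel N} {K M : ℝ}

/-! ### The kernel extended by zero -/

/-- The kernel extended by zero to the whole line. -/
def ext (P : LaneModel N) : ℝ → ℝ := indicator P.dom P.kern

lemma ordConnected_dom : P.dom.OrdConnected :=
  ⟨fun _ hx _ hy _ hz => ⟨hx.1.trans hz.1, (EReal.coe_le_coe_iff.2 hz.2).trans hy.2⟩⟩

lemma measurableSet_dom : MeasurableSet P.dom := ordConnected_dom.measurableSet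

lemma measurable_ext (hA : P.Admissible) : Measurable P.ext := by
  classical
  have h := ContinuousOn.measurable_piecewise (f := P.kern) (g := fun _ => (0 : ℝ))
    hA.kern_smooth.continuousOn continuousOn_const measurableSet_dom
  have e : P.ext = P.dom.piecewise P.kern (fun _ => (0 : ℝ)) := by
    rw [ext, ← piecewise_eq_indicator]; rfl
  rwa [e]

lemma ext_nonneg (hA : P.Admissible) (z : ℝ) : 0 ≤ P.ext z :=
  indicator_nonneg (fun z hz => hA.kern_nonneg z hz) z

lemma ext_of_neg {z : ℝ} (hz : z < 0) : P.ext z = 0 :=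
  indicator_of_notMem (fun h => absurd h.1 (not_le.2 hz)) _

lemma ext_le (hP : P.Regular K) (z : ℝ) : P.ext z ≤ K := by
  unfold ext indicator
  split_ifs with h
  · exact (le_abs_self _).trans (hP.bdd.kern_le z h)
  · exact hP.nonneg

/-- The kernel is non-negative, so dropping to zero beyond its interval does not spoil monotonicity
on the half-line. -/
lemma ext_anti (hA : P.Admissible) {y z : ℝ} (hy : 0 ≤ y) (hyz : y ≤ z) :
    P.ext z ≤ P.ext y := by
  by_cases hz : z ∈ P.dom
  · have hy' : y ∈ P.dom := ⟨hy, (EReal.coe_le_coe_iff.2 hyz).trans hz.2⟩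
    rw [ext, indicator_of_mem hz, indicator_of_mem hy']
    exact hA.kern_anti hy' hz hyz
  · rw [show P.ext z = 0 from indicator_of_notMem hz _]
    exact ext_nonneg hA y

lemma integrable_ext (hA : P.Admissible) : Integrable P.ext :=
  (integrable_indicator_iff measurableSet_dom).2 hA.kern_int

lemma integral_ext (hA : P.Admissible) : ∫ z, P.ext z = 1 := by
  rw [ext, integral_indicator measurableSet_dom, hA.kern_one]

lemma integral_abs_ext (hA : P.Admissible) : ∫ z, |P.ext z| = 1 := by
  rw [← integral_ext hA]
  exact integral_congr_ae (.of_forall fun z => abs_of_nonneg (ext_nonneg hA z))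

/-- As a correlation with one fixed kernel on the line, the average is accessible to translation
invariance and Fubini, uniformly for finite and infinite `η`. -/
lemma avg_eq (v : ℝ → ℝ) (x : ℝ) : P.avg v x = ∫ z, P.ext z * v (x + z) := by
  have hm : MeasurableSet {y : ℝ | y - x ∈ P.dom} :=
    measurableSet_dom.preimage (measurable_id.sub_const x)
  unfold avg
  rw [← integral_indicator hm, ← integral_add_right_eq_self _ x]
  refine integral_congr_ae (.of_forall fun z => ?_)
  have hiff : z + x ∈ {y : ℝ | y - x ∈ P.dom} ↔ z ∈ P.dom := by
    change z + x - x ∈ P.dom ↔ z ∈ P.dom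
    rw [add_sub_cancel_right]
  by_cases hz : z ∈ P.dom
  · simp only [ext]
    rw [indicator_of_mem (hiff.2 hz), indicator_of_mem hz, add_sub_cancel_right, add_comm z x]
  · simp only [ext]
    rw [indicator_of_notMem (mt hiff.1 hz), indicator_of_notMem hz, zero_mul]

lemma integrable_ext_shift_sub (hA : P.Admissible) (δ : ℝ) :
    Integrable (fun z => P.ext (z - δ) - P.ext z) :=
  ((integrable_ext hA).comp_sub_right δ).sub (integrable_ext hA)

/-- The `L¹` modulus of continuity of a bounded non-increasing kernel on a half-line. -/
lemma integral_abs_ext_shift_sub_le (hP : P.Regular K) (δ : ℝ) :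
    ∫ z, |P.ext (z - δ) - P.ext z| ≤ 2 * K * |δ| := by
  have hK := hP.nonneg
  have main : ∀ δ : ℝ, 0 ≤ δ → ∫ z, |P.ext (z - δ) - P.ext z| ≤ 2 * K * δ := by
    intro δ hδ
    -- Beyond `δ` monotonicity removes the absolute value, and the plain difference integrates to
    -- zero over the line. Only the jump at the origin contributes, on an interval of length `δ`;
    -- the factor `2` there also compensates for the negative plain difference.
    have e : ∀ z, |P.ext (z - δ) - P.ext z|
        ≤ P.ext (z - δ) - P.ext z + (Ico 0 δ).indicator (fun _ => 2 * K) z := by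
      intro z
      rcases lt_or_ge z 0 with h | h
      · rw [ext_of_neg h, ext_of_neg (by linarith : z - δ < 0),
          indicator_of_notMem (fun h' => absurd h'.1 (not_le.2 h))]
        simp
      · rcases lt_or_ge z δ with h' | h'
        · rw [ext_of_neg (by linarith : z - δ < 0), indicator_of_mem (show z ∈ Ico 0 δ from ⟨h, h'⟩), zero_sub, abs_neg,
            abs_of_nonneg (ext_nonneg hP.adm z)]
          linarith [ext_le hP z]
        · rw [indicator_of_notMem (fun h'' => absurd h''.2 (not_lt.2 h')), add_zero,
            abs_of_nonneg]
          linarith [ext_anti hP.adm (by linarith : 0 ≤ z - δ) (by linarith : z - δ ≤ z)]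
    have hi : Integrable ((Ico 0 δ).indicator (fun _ : ℝ => 2 * K)) :=
      (integrable_indicator_iff measurableSet_Ico).2 (integrableOn_const (by simp))
    calc ∫ z, |P.ext (z - δ) - P.ext z|
        ≤ ∫ z, (P.ext (z - δ) - P.ext z + (Ico 0 δ).indicator (fun _ => 2 * K) z) :=
          integral_mono (integrable_ext_shift_sub hP.adm δ).abs
            ((integrable_ext_shift_sub hP.adm δ).add hi) e
      _ = 2 * K * δ := by
          rw [integral_add (integrable_ext_shift_sub hP.adm δ) hi,
            integral_sub ((integrable_ext hP.adm).comp_sub_right δ) (integrable_ext hP.adm),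
            integral_sub_right_eq_self, sub_self, zero_add, integral_indicator measurableSet_Ico]
          simp [hδ, mul_comm]
  rcases le_total 0 δ with h | h
  · rw [abs_of_nonneg h]; exact main δ h
  · rw [abs_of_nonpos h]
    refine le_trans (le_of_eq ?_) (main (-δ) (by linarith))
    rw [← integral_add_right_eq_self _ δ]
    refine integral_congr_ae (.of_forall fun z => ?_)
    simp only [add_sub_cancel_right, sub_neg_eq_add]
    exact abs_sub_comm _ _

/-! ### Averages -/

variable {w a b : ℝ → ℝ}

lemma integrable_ext_mul (hP : P.Regular K) (hw : Integrable w) (x : ℝ) :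
    Integrable (fun z => P.ext z * w (x + z)) := by
  refine (hw.comp_add_left x).bdd_mul (c := K) (measurable_ext hP.adm).aestronglyMeasurable ?_
  exact Eventually.of_forall fun z => by
    rw [Real.norm_eq_abs, abs_of_nonneg (ext_nonneg hP.adm z)]; exact ext_le hP z

lemma avg_sub (hP : P.Regular K) (ha : Integrable a) (hb : Integrable b) (x : ℝ)
    : P.avg (fun y => a y - b y) x = P.avg a x - P.avg b x := by
  simp only [avg_eq, mul_sub]
  exact integral_sub (integrable_ext_mul hP ha x) (integrable_ext_mul hP hb x)

lemma avg_comp_add (δ x : ℝ) : P.avg (fun y => a (y + δ)) x = P.avg a (x + δ) := by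
  simp only [avg_eq, add_right_comm]

lemma avg_congr_ae (h : a =ᵐ[volume] b) (x : ℝ) : P.avg a x = P.avg b x := by
  simp only [avg_eq]
  refine integral_congr_ae ?_
  have := (measurePreserving_add_left (volume : Measure ℝ) x).quasiMeasurePreserving.ae h
  filter_upwards [this] with z hz
  rw [hz]

lemma abs_avg_le (hP : P.Regular K) (hw : Integrable w) (x : ℝ) :
    |P.avg w x| ≤ K * ∫ y, |w y| := by
  rw [avg_eq]
  calc |∫ z, P.ext z * w (x + z)| ≤ ∫ z, |P.ext z * w (x + z)| := abs_integral_le_integral_abs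
    _ ≤ ∫ z, K * |w (x + z)| := by
        refine integral_mono (integrable_ext_mul hP hw x).abs
          ((hw.comp_add_left x).abs.const_mul K) fun z => ?_
        simp only [abs_mul, abs_of_nonneg (ext_nonneg hP.adm z)]
        gcongr
        exact ext_le hP z
    _ = K * ∫ y, |w y| := by
        rw [integral_const_mul, integral_add_left_eq_self (fun y => |w y|)]

lemma avg_mem (hP : P.Regular K) (ha : IsDensity a) (x : ℝ) :
    P.avg a x ∈ Icc (0 : ℝ) 1 := by
  rw [avg_eq]
  refine ⟨integral_nonneg fun z => mul_nonneg (ext_nonneg hP.adm z) (ha.mem _).1, ?_⟩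
  rw [← integral_ext hP.adm]
  exact integral_mono (integrable_ext_mul hP ha.integrable x) (integrable_ext hP.adm)
    fun z => mul_le_of_le_one_right (ext_nonneg hP.adm z) (ha.mem _).2

lemma integrable_avg (hA : P.Admissible) (hw : Integrable w) : Integrable (P.avg w) := by
  have := integrable_correlation (integrable_ext hA) hw
  simpa only [← avg_eq] using this

lemma integral_abs_avg_le (hA : P.Admissible) (hw : Integrable w) :
    ∫ x, |P.avg w x| ≤ ∫ x, |w x| := by
  simpa only [← avg_eq, integral_abs_ext hA, one_mul] using
    integral_abs_correlation_le (integrable_ext hA) hw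

/-- The translation is moved onto the kernel, so the increments of the average are estimated without
any regularity of `w`. -/
lemma avg_add_sub_avg (hP : P.Regular K) (hw : Integrable w) (x δ : ℝ) :
    P.avg w (x + δ) - P.avg w x = ∫ z, (P.ext (z - δ) - P.ext z) * w (x + z) := by
  have h1 : P.avg w (x + δ) = ∫ z, P.ext (z - δ) * w (x + z) := by
    rw [avg_eq, ← integral_sub_right_eq_self _ δ]
    refine integral_congr_ae (.of_forall fun z => ?_)
    simp only
    congr 2; ring
  have h2 : Integrable (fun z => P.ext (z - δ) * w (x + z)) := by
    have := (integrable_ext_mul hP hw (x + δ)).comp_sub_right δ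
    refine this.congr (.of_forall fun z => ?_)
    simp only
    congr 2; ring
  rw [h1, avg_eq, ← integral_sub h2 (integrable_ext_mul hP hw x)]
  simp only [sub_mul]

lemma abs_avg_add_sub_avg_le (hP : P.Regular K) (hw : Integrable w) (hb : ∀ x, |w x| ≤ 1) (x δ : ℝ)
    : |P.avg w (x + δ) - P.avg w x| ≤ 2 * K * |δ| := by
  rw [avg_add_sub_avg hP hw]
  refine abs_integral_le_integral_abs.trans ((integral_mono_of_nonneg
    (.of_forall fun z => abs_nonneg _) (integrable_ext_shift_sub hP.adm δ).abs
    (.of_forall fun z => ?_)).trans (integral_abs_ext_shift_sub_le hP δ))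
  simp only [abs_mul]
  exact mul_le_of_le_one_right (abs_nonneg _) (hb _)

lemma lipschitzWith_avg (hP : P.Regular K) (hw : Integrable w) (hb : ∀ x, |w x| ≤ 1)
    : LipschitzWith (Real.toNNReal (2 * K)) (P.avg w) := by
  refine LipschitzWith.of_dist_le_mul fun x y => ?_
  rw [Real.coe_toNNReal _ (by linarith [hP.nonneg]), Real.dist_eq, Real.dist_eq]
  simpa using abs_avg_add_sub_avg_le hP hw hb y (x - y)

/-- Young's inequality applied to the increments of the kernel. This is the gain from nonlocality:
the derivative of the average costs the `L¹` norm of `w`, not its variation. -/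
lemma integrable_deriv_avg (hP : P.Regular K) (hw : Integrable w) (hb : ∀ x, |w x| ≤ 1) :
    Integrable (deriv (P.avg w)) ∧ ∫ x, |deriv (P.avg w) x| ≤ 2 * K * ∫ x, |w x| := by
  have hK := hP.nonneg
  refine integrable_deriv_of_increments (lipschitzWith_avg hP hw hb)
    (mul_nonneg (by linarith) (integral_nonneg fun x => abs_nonneg _))
    (fun δ => ((integrable_avg hP.adm hw).comp_add_right δ).sub (integrable_avg hP.adm hw))
    fun δ hδ => ?_
  simp only [avg_add_sub_avg hP hw]
  refine (integral_abs_correlation_le (integrable_ext_shift_sub hP.adm δ) hw).trans ?_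
  rw [mul_right_comm]
  gcongr
  simpa [abs_of_pos hδ] using integral_abs_ext_shift_sub_le hP δ

lemma abs_deriv_avg_le (hP : P.Regular K) (ha : IsDensity a) (x : ℝ) :
    |deriv (P.avg a) x| ≤ 2 * K := by
  have h := (lipschitzWith_avg hP ha.integrable
    (fun x => by rw [abs_of_nonneg (ha.mem x).1]; exact (ha.mem x).2)).abs_deriv_le x
  rwa [Real.coe_toNNReal _ (by linarith [hP.nonneg])] at h

lemma lipschitzWith_avg_density (hP : P.Regular K) (ha : IsDensity a) :
    LipschitzWith (Real.toNNReal (2 * K)) (P.avg a) :=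
  lipschitzWith_avg hP ha.integrable
    (fun x => by rw [abs_of_nonneg (ha.mem x).1]; exact (ha.mem x).2)

lemma ae_differentiableAt_avg (hP : P.Regular K) (ha : IsDensity a) :
    ∀ᵐ x, DifferentiableAt ℝ (P.avg a) x :=
  (lipschitzWith_avg_density hP ha).ae_differentiableAt_real

lemma abs_avg_sub_avg_le (hP : P.Regular K) (ha : IsDensity a) (x y : ℝ) :
    |P.avg a x - P.avg a y| ≤ 2 * K * |x - y| := by
  have := abs_avg_add_sub_avg_le hP ha.integrable
    (fun x => by rw [abs_of_nonneg (ha.mem x).1]; exact (ha.mem x).2) y (x - y)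
  simpa using this

/-- The estimate for a single function is applied to `a - b`, which is also bounded by `1`; the
derivative of its average splits at almost every point only. -/
lemma integrable_deriv_avg_sub (hP : P.Regular K) (ha : IsDensity a) (hb : IsDensity b) :
    Integrable (fun x => deriv (P.avg a) x - deriv (P.avg b) x) ∧
      ∫ x, |deriv (P.avg a) x - deriv (P.avg b) x| ≤ 2 * K * ∫ x, |a x - b x| := by
  have h := integrable_deriv_avg hP (ha.integrable.sub hb.integrable)
    (fun x => abs_sub_le_one_of_mem (ha.mem x) (hb.mem x))
  have e : deriv (P.avg (a - b)) =ᵐ[volume]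
      fun x => deriv (P.avg a) x - deriv (P.avg b) x := by
    filter_upwards [ae_differentiableAt_avg hP ha, ae_differentiableAt_avg hP hb]
      with x hx hx'
    rw [show P.avg (a - b) = fun x => P.avg a x - P.avg b x from
      funext fun x => avg_sub hP ha.integrable hb.integrable x]
    exact deriv_fun_sub hx hx'
  refine ⟨h.1.congr e, le_trans (le_of_eq ?_) h.2⟩
  refine integral_congr_ae ?_
  filter_upwards [e] with x hx
  rw [hx]

lemma deriv_avg_comp_add (δ x : ℝ) :
    deriv (P.avg (fun y => a (y + δ))) x = deriv (P.avg a) (x + δ) := by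
  rw [show P.avg (fun y => a (y + δ)) = fun x => P.avg a (x + δ) from
    funext fun x => avg_comp_add δ x, deriv_comp_add_const]

lemma integrable_deriv_avg_shift_sub (hP : P.Regular K) (ha : IsDensity a) (δ : ℝ)
    : Integrable (fun x => deriv (P.avg a) (x + δ) - deriv (P.avg a) x) ∧
      ∫ x, |deriv (P.avg a) (x + δ) - deriv (P.avg a) x| ≤ 2 * K * ∫ x, |a (x + δ) - a x| := by
  simpa only [deriv_avg_comp_add] using integrable_deriv_avg_sub hP (ha.comp_add δ) ha

/-! ### Velocities -/

/-- The velocity in lane `k` for the density profile `a` in this lane. -/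
def speed (P : LaneModel N) (k : Fin N) (a : ℝ → ℝ) (x : ℝ) : ℝ := P.ν k x (P.avg a x)

lemma speed_congr_ae (k : Fin N) (h : a =ᵐ[volume] b) : P.speed k a = P.speed k b :=
  funext fun x => by unfold speed; rw [avg_congr_ae h]

lemma speed_comp_add_measurable (hP : P.Regular K) (k : Fin N) (ha : IsDensity a)
    : Measurable (P.speed k a) :=
  measurable_ν_comp hP k measurable_id
    (lipschitzWith_avg_density hP ha).continuous.measurable (avg_mem hP ha)

lemma abs_speed_sub_le (hP : P.Regular K) (k : Fin N) (ha : IsDensity a) (x y : ℝ)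
    : |P.speed k a x - P.speed k a y| ≤ (K + 2 * K ^ 2) * |x - y| := by
  have hK := hP.nonneg
  calc |P.speed k a x - P.speed k a y|
      ≤ |P.ν k x (P.avg a x) - P.ν k y (P.avg a x)|
        + |P.ν k y (P.avg a x) - P.ν k y (P.avg a y)| := abs_sub_le _ _ _
    _ ≤ K * |x - y| + K * (2 * K * |x - y|) := by
        refine add_le_add (abs_ν_sub_le_x hP k x y (avg_mem hP ha x))
          ((abs_ν_sub_le_u hP k y (avg_mem hP ha x) (avg_mem hP ha y)).trans ?_)
        gcongr
        exact abs_avg_sub_avg_le hP ha x y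
    _ = _ := by ring

lemma lipschitzWith_speed (hP : P.Regular K) (k : Fin N) (ha : IsDensity a)
    : LipschitzWith (Real.toNNReal (K + 2 * K ^ 2)) (P.speed k a) := by
  have hK := hP.nonneg
  refine LipschitzWith.of_dist_le_mul fun x y => ?_
  rw [Real.coe_toNNReal _ (by positivity), Real.dist_eq, Real.dist_eq]
  exact abs_speed_sub_le hP k ha x y

lemma abs_deriv_speed_le (hP : P.Regular K) (k : Fin N) (ha : IsDensity a) (x : ℝ)
    : |deriv (P.speed k a) x| ≤ K + 2 * K ^ 2 := by
  have hK := hP.nonneg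
  have h := (lipschitzWith_speed hP k ha).abs_deriv_le x
  rwa [Real.coe_toNNReal _ (by positivity)] at h

/-- The bounded kernel converts the `L¹` distance of two densities into a uniform distance of their
velocities. -/
lemma abs_speed_sub_speed_le (hP : P.Regular K) (k : Fin N) (ha : IsDensity a) (hb : IsDensity b)
    (x : ℝ) :
    |P.speed k a x - P.speed k b x| ≤ K ^ 2 * ∫ y, |a y - b y| := by
  have hK := hP.nonneg
  refine (abs_ν_sub_le_u hP k x (avg_mem hP ha x) (avg_mem hP hb x)).trans ?_
  rw [pow_two, mul_assoc]
  gcongr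
  rw [← avg_sub hP ha.integrable hb.integrable]
  exact abs_avg_le hP (ha.integrable.sub hb.integrable) x

lemma deriv_speed_eq (hP : P.Regular K) (k : Fin N) (ha : IsDensity a) {x : ℝ}
    (hx : DifferentiableAt ℝ (P.avg a) x) :
    deriv (P.speed k a) x = partialX (P.ν k) x (P.avg a x)
      + partialU (P.ν k) x (P.avg a x) * deriv (P.avg a) x :=
  (hasDerivAt_ν_comp hP k (avg_mem hP ha) hx.hasDerivAt).deriv

/-- The chain rule is compared at two different points, as the doubling of variables requires. The
differences of the averages are controlled pointwise; the derivatives of the averages are close in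
`L¹` only and are therefore kept as a separate term. -/
lemma abs_deriv_speed_sub_le (hP : P.Regular K) (k : Fin N) (ha : IsDensity a) (hb : IsDensity b)
    {x y : ℝ} (hx : DifferentiableAt ℝ (P.avg a) x) (hy : DifferentiableAt ℝ (P.avg b) y) :
    |deriv (P.speed k a) x - deriv (P.speed k b) y|
      ≤ (K + 2 * K ^ 2) * (|x - y| + |P.avg a x - P.avg b y|)
        + K * |deriv (P.avg a) x - deriv (P.avg b) y| := by
  have hK := hP.nonneg
  rw [deriv_speed_eq hP k ha hx, deriv_speed_eq hP k hb hy]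
  have hAa := avg_mem hP ha x
  have hAb := avg_mem hP hb y
  have e1 : |partialX (P.ν k) x (P.avg a x) - partialX (P.ν k) y (P.avg b y)|
      ≤ K * |x - y| + K * |P.avg a x - P.avg b y| :=
    (abs_sub_le _ (partialX (P.ν k) y (P.avg a x)) _).trans
      (add_le_add (abs_partialX_sub_le_x hP k x y hAa)
        (abs_partialX_sub_le_u hP k y hAa hAb))
  have e2 : |partialU (P.ν k) x (P.avg a x) - partialU (P.ν k) y (P.avg b y)|
      ≤ K * |x - y| + K * |P.avg a x - P.avg b y| :=
    (abs_sub_le _ (partialU (P.ν k) y (P.avg a x)) _).trans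
      (add_le_add (abs_partialU_sub_le_x hP k x y hAa)
        (abs_partialU_sub_le_u hP k y hAa hAb))
  set p := partialX (P.ν k) x (P.avg a x)
  set p' := partialX (P.ν k) y (P.avg b y)
  set q := partialU (P.ν k) x (P.avg a x)
  have hq' : |partialU (P.ν k) y (P.avg b y)| ≤ K := hP.bdd.ν_u k y _ hAb
  set q' := partialU (P.ν k) y (P.avg b y)
  have hd := abs_deriv_avg_le hP ha x
  set d := deriv (P.avg a) x
  set d' := deriv (P.avg b) y
  calc |p + q * d - (p' + q' * d')| = |(p - p') + (q - q') * d + q' * (d - d')| := by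
        congr 1; ring
    _ ≤ |p - p'| + |q - q'| * |d| + |q'| * |d - d'| := by
        refine (abs_add_three _ _ _).trans_eq ?_
        rw [abs_mul, abs_mul]
    _ ≤ (K * |x - y| + K * |P.avg a x - P.avg b y|)
        + (K * |x - y| + K * |P.avg a x - P.avg b y|) * (2 * K) + K * |d - d'| := by gcongr
    _ = _ := by ring

lemma ae_abs_deriv_speed_sub_le (hP : P.Regular K) (k : Fin N) (ha : IsDensity a) (hb : IsDensity b)
    :
    ∀ᵐ x, |deriv (P.speed k a) x - deriv (P.speed k b) x|
      ≤ (K + 2 * K ^ 2) * K * (∫ y, |a y - b y|)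
        + K * |deriv (P.avg a) x - deriv (P.avg b) x| := by
  have hK := hP.nonneg
  filter_upwards [ae_differentiableAt_avg hP ha, ae_differentiableAt_avg hP hb] with x hx hx'
  refine (abs_deriv_speed_sub_le hP k ha hb hx hx').trans ?_
  rw [sub_self, abs_zero, zero_add, mul_assoc (K + 2 * K ^ 2)]
  gcongr
  rw [← avg_sub hP ha.integrable hb.integrable]
  exact abs_avg_le hP (ha.integrable.sub hb.integrable) x

/-- The constant in the modulus of continuity of the derivative of the velocity. -/
lemma ae_abs_deriv_speed_shift_sub_le (hP : P.Regular K) (k : Fin N) (ha : IsDensity a) (δ : ℝ) :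
    ∀ᵐ x, |deriv (P.speed k a) (x + δ) - deriv (P.speed k a) x|
      ≤ (K + 2 * K ^ 2) * (1 + 2 * K) * |δ|
        + K * |deriv (P.avg a) (x + δ) - deriv (P.avg a) x| := by
  have hK := hP.nonneg
  have h := ae_differentiableAt_avg hP ha
  have h' := (measurePreserving_add_right (volume : Measure ℝ) δ).quasiMeasurePreserving.ae h
  filter_upwards [h, h'] with x hx hx'
  refine (abs_deriv_speed_sub_le hP k ha ha hx' hx).trans ?_
  rw [add_sub_cancel_left, mul_assoc (K + 2 * K ^ 2)]
  gcongr
  have := abs_avg_sub_avg_le hP ha (x + δ) x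
  rw [add_sub_cancel_left] at this
  linarith

end LaneModel

/-- Pointwise control of the increments of a Lipschitz function by an a.e. bound on its
derivative. -/
lemma LipschitzWith.abs_add_sub_le {F : ℝ → ℝ} {L : NNReal} (hF : LipschitzWith L F) {c : ℝ}
    {e : ℝ → ℝ} (he : Integrable e) (hae : ∀ᵐ x, |deriv F x| ≤ c + e x) {p : ℝ} (hp : 0 ≤ p) (x : ℝ)
    : |F (x + p) - F x| ≤ c * p + ∫ z, (Ioc 0 p).indicator 1 z * e (x + z) := by
  rw [hF.sub_eq_integral_deriv]
  have hae' := (measurePreserving_add_left (volume : Measure ℝ) x).quasiMeasurePreserving.ae hae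
  have hei : Integrable (fun s => e (x + s)) := he.comp_add_left x
  have hie : IntervalIntegrable (fun s => c + e (x + s)) volume 0 p :=
    (intervalIntegrable_const).add hei.intervalIntegrable
  calc |∫ s in (0 : ℝ)..p, deriv F (x + s)| ≤ ∫ s in (0 : ℝ)..p, (c + e (x + s)) := by
        rw [← Real.norm_eq_abs]
        refine intervalIntegral.norm_integral_le_of_norm_le hp ?_ hie
        filter_upwards [hae'] with s hs _ using hs
    _ = c * p + ∫ s in (0 : ℝ)..p, e (x + s) := by
        rw [intervalIntegral.integral_add intervalIntegrable_const hei.intervalIntegrable]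
        simp [mul_comm]
    _ = _ := by
        rw [intervalIntegral.integral_of_le hp, ← integral_indicator measurableSet_Ioc]
        congr 1
        refine integral_congr_ae (.of_forall fun z => ?_)
        by_cases hz : z ∈ Ioc 0 p <;> simp [hz]

lemma integrable_indicator_Ioc_one (p : ℝ) :
    Integrable ((Ioc 0 p).indicator (1 : ℝ → ℝ)) :=
  (integrable_indicator_iff measurableSet_Ioc).2 (integrableOn_const (by simp))

lemma integral_abs_indicator_Ioc_one {p : ℝ} (hp : 0 ≤ p) :
    ∫ z, |(Ioc 0 p).indicator (1 : ℝ → ℝ) z| = p := by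
  have : ∀ z, |(Ioc 0 p).indicator (1 : ℝ → ℝ) z| = (Ioc 0 p).indicator (1 : ℝ → ℝ) z :=
    fun z => abs_of_nonneg (indicator_nonneg (fun _ _ => zero_le_one) z)
  simp only [this]
  rw [integral_indicator measurableSet_Ioc]
  simp [hp]

namespace LaneModel

variable {N : ℕ} {P : LaneModel N} {K M : ℝ} {w : ℝ → ℝ}

/-- Weighted `L¹` estimate for the second differences of a velocity. -/
lemma integral_mul_abs_second_difference_le (hP : P.Regular K) (k : Fin N) {a w : ℝ → ℝ}
    (ha : IsDensity a) (hw : IsDensity w) (δ : ℝ) {p : ℝ} (hp : 0 ≤ p) :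
    Integrable (fun x => w x * |(P.speed k a (x + p + δ) - P.speed k a (x + p))
        - (P.speed k a (x + δ) - P.speed k a x)|) ∧
    ∫ x, w x * |(P.speed k a (x + p + δ) - P.speed k a (x + p))
        - (P.speed k a (x + δ) - P.speed k a x)|
      ≤ p * ((K + 2 * K ^ 2) * (1 + 2 * K) * |δ| * (∫ x, w x)
          + 2 * K ^ 2 * ∫ x, |a (x + δ) - a x|) := by
  have hK := hP.nonneg
  -- The second difference is the increment over `p` of the first difference `D`, so it is governed
  -- by `D'`, which is bounded by a constant multiple of `|δ|` plus an integrable function of `L¹`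
  -- size proportional to the variation of `a`.
  set D : ℝ → ℝ := fun x => P.speed k a (x + δ) - P.speed k a x with hD
  have hlip := lipschitzWith_speed hP k ha
  have hDl : LipschitzWith (Real.toNNReal (K + 2 * K ^ 2) + Real.toNNReal (K + 2 * K ^ 2)) D := by
    refine LipschitzWith.sub ?_ hlip
    have := hlip.comp (LipschitzWith.id.add (LipschitzWith.const δ))
    simpa [Function.comp_def] using this
  have he := integrable_deriv_avg_shift_sub hP ha δ
  have hV := hlip.ae_differentiableAt_real
  have hV' := (measurePreserving_add_right (volume : Measure ℝ) δ).quasiMeasurePreserving.ae hV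
  have hae : ∀ᵐ x, |deriv D x| ≤ (K + 2 * K ^ 2) * (1 + 2 * K) * |δ|
      + K * |deriv (P.avg a) (x + δ) - deriv (P.avg a) x| := by
    filter_upwards [hV, hV', ae_abs_deriv_speed_shift_sub_le hP k ha δ] with x h1 h2 h3
    refine le_trans (le_of_eq ?_) h3
    congr 1
    have h2' : DifferentiableAt ℝ (fun y => P.speed k a (y + δ)) x :=
      differentiableAt_comp_add_const.2 h2
    rw [hD, deriv_fun_sub h2' h1, deriv_comp_add_const]
  set e : ℝ → ℝ := fun x => K * |deriv (P.avg a) (x + δ) - deriv (P.avg a) x| with hedef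
  have hei : Integrable e := he.1.abs.const_mul K
  set c := (K + 2 * K ^ 2) * (1 + 2 * K) * |δ| with hc
  have hc0 : 0 ≤ c := by positivity
  have hpt := hDl.abs_add_sub_le hei hae hp
  have hci := integrable_correlation (integrable_indicator_Ioc_one p) hei
  have hcb := integral_abs_correlation_le (integrable_indicator_Ioc_one p) hei
  set E : ℝ → ℝ := fun x => ∫ z, (Ioc 0 p).indicator 1 z * e (x + z) with hE
  have hE0 : ∀ x, 0 ≤ E x := fun x => integral_nonneg fun z =>
    mul_nonneg (indicator_nonneg (fun _ _ => zero_le_one) z)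
      (mul_nonneg hK (abs_nonneg _))
  -- The weight `w` makes the constant part of the bound integrable; for the integrable part the
  -- weight is simply estimated by `1`.
  have hpt' : ∀ x, w x * |D (x + p) - D x| ≤ c * p * w x + E x := fun x => by
    calc w x * |D (x + p) - D x| ≤ w x * (c * p + E x) :=
          mul_le_mul_of_nonneg_left (hpt x) (hw.mem x).1
      _ = c * p * w x + w x * E x := by ring
      _ ≤ c * p * w x + E x := by
          gcongr; exact mul_le_of_le_one_left (hE0 x) (hw.mem x).2
  have hDm : Measurable D := hDl.continuous.measurable
  have hint : Integrable (fun x => w x * |D (x + p) - D x|) := by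
    refine Integrable.mono' ((hw.integrable.const_mul (c * p)).add hci) ?_
      (.of_forall fun x => ?_)
    · exact (hw.measurable.mul (continuous_abs.measurable.comp
        ((hDm.comp (measurable_id.add_const p)).sub hDm))).aestronglyMeasurable
    · rw [Real.norm_eq_abs, abs_of_nonneg (mul_nonneg (hw.mem x).1 (abs_nonneg _))]
      exact hpt' x
  refine ⟨hint, ?_⟩
  calc ∫ x, w x * |D (x + p) - D x| ≤ ∫ x, (c * p * w x + E x) :=
        integral_mono hint ((hw.integrable.const_mul (c * p)).add hci) hpt'
    _ = c * p * (∫ x, w x) + ∫ x, E x := by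
        rw [integral_add (hw.integrable.const_mul (c * p)) hci, integral_const_mul]
    _ ≤ c * p * (∫ x, w x) + p * (K * (2 * K * ∫ x, |a (x + δ) - a x|)) := by
        gcongr
        calc ∫ x, E x = ∫ x, |E x| :=
              integral_congr_ae (.of_forall fun x => (abs_of_nonneg (hE0 x)).symm)
          _ ≤ _ := hcb
          _ = p * (K * ∫ x, |deriv (P.avg a) (x + δ) - deriv (P.avg a) x|) := by
              rw [integral_abs_indicator_Ioc_one hp]
              simp only [hedef, abs_mul, abs_abs, abs_of_nonneg hK, integral_const_mul]
          _ ≤ _ := by gcongr; exact he.2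
    _ = _ := by ring

/-! ### Sources -/

/-- The source of lane `k` for the density profile `a`. -/
def source (P : LaneModel N) (k : Fin N) (a : Fin N → ℝ → ℝ) (x : ℝ) : ℝ :=
  P.R k x (fun j => a j x) (fun j => P.avg (a j) x)

variable {a b : Fin N → ℝ → ℝ}

lemma measurable_source (hP : P.Regular K) (k : Fin N) (ha : ∀ j, IsDensity (a j))
    : Measurable (P.source k a) :=
  measurable_R_comp hP k measurable_id (fun j => (ha j).measurable)
    (fun j => (lipschitzWith_avg_density hP (ha j)).continuous.measurable)
    fun j => avg_mem hP (ha j)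

lemma abs_source_le (hP : P.Regular K) (k : Fin N) (ha : ∀ j, IsDensity (a j)) (x : ℝ)
    : |P.source k a x| ≤ 2 * K * ∑ j, a j x :=
  abs_R_le hP k x (fun j => (ha j).mem x) fun j => avg_mem hP (ha j) x

lemma sum_le_card (ha : ∀ j, IsDensity (a j)) (x : ℝ) : ∑ j, a j x ≤ N := by
  have := Finset.sum_le_card_nsmul Finset.univ (fun j => a j x) 1 fun j _ => ((ha j).mem x).2
  simpa using this

lemma abs_source_le_card (hP : P.Regular K) (k : Fin N) (ha : ∀ j, IsDensity (a j)) (x : ℝ)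
    : |P.source k a x| ≤ 2 * K * N :=
  (abs_source_le hP k ha x).trans
    (mul_le_mul_of_nonneg_left (sum_le_card ha x) (by linarith [hP.nonneg]))

lemma integrable_source (hP : P.Regular K) (k : Fin N) (ha : ∀ j, IsDensity (a j))
    : Integrable (P.source k a) :=
  Integrable.mono' ((integrable_finsetSum _ fun j _ => (ha j).integrable).const_mul (2 * K))
    (measurable_source hP k ha).aestronglyMeasurable
    (.of_forall fun x => abs_source_le hP k ha x)

lemma integral_abs_source_le (hP : P.Regular K) (k : Fin N) (ha : ∀ j, IsDensity (a j))
    : ∫ x, |P.source k a x| ≤ 2 * K * ∑ j, ∫ x, a j x := by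
  rw [← integral_finsetSum _ fun j _ => (ha j).integrable, ← integral_const_mul]
  exact integral_mono (integrable_source hP k ha).abs
    ((integrable_finsetSum _ fun j _ => (ha j).integrable).const_mul (2 * K))
    (abs_source_le hP k ha)

lemma sum_source_eq_zero (a : Fin N → ℝ → ℝ) (x : ℝ) : ∑ k, P.source k a x = 0 :=
  sum_R_eq_zero _ _ _

lemma integral_abs_source_sub_le (hP : P.Regular K) (k : Fin N) (ha : ∀ j, IsDensity (a j))
    (hb : ∀ j, IsDensity (b j)) :
    ∫ x, |P.source k a x - P.source k b x| ≤ 4 * K * ∑ j, ∫ x, |a j x - b j x| := by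
  have hK := hP.nonneg
  have hi : ∀ j, Integrable (fun x => |a j x - b j x|) := fun j =>
    ((ha j).integrable.sub (hb j).integrable).abs
  have hij : ∀ j, Integrable (fun x => |a j x - b j x| + |P.avg (a j) x - P.avg (b j) x|) :=
    fun j => (hi j).add
      ((integrable_avg hP.adm (ha j).integrable).sub (integrable_avg hP.adm (hb j).integrable)).abs
  have hi' : ∀ j, Integrable (fun x => |P.avg (a j) x - P.avg (b j) x|) := fun j =>
    ((integrable_avg hP.adm (ha j).integrable).sub (integrable_avg hP.adm (hb j).integrable)).abs
  have hsum : Integrable (fun x => ∑ j, (|a j x - b j x| + |P.avg (a j) x - P.avg (b j) x|)) :=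
    integrable_finsetSum _ fun j _ => hij j
  calc ∫ x, |P.source k a x - P.source k b x|
      ≤ ∫ x, 2 * K * ∑ j, (|a j x - b j x| + |P.avg (a j) x - P.avg (b j) x|) :=
        integral_mono ((integrable_source hP k ha).sub (integrable_source hP k hb)).abs
          (hsum.const_mul _) fun x => abs_R_sub_le hP k x (fun j => (ha j).mem x)
            (fun j => (hb j).mem x) (fun j => avg_mem hP (ha j) x)
            fun j => avg_mem hP (hb j) x
    _ = 2 * K * ∑ j, ((∫ x, |a j x - b j x|) + ∫ x, |P.avg (a j) x - P.avg (b j) x|) := by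
        rw [integral_const_mul, integral_finsetSum _ fun j _ => hij j]
        congr 1
        exact Finset.sum_congr rfl fun j _ => integral_add (hi j) (hi' j)
    _ ≤ 2 * K * ∑ j, ((∫ x, |a j x - b j x|) + ∫ x, |a j x - b j x|) := by
        refine mul_le_mul_of_nonneg_left (Finset.sum_le_sum fun j _ => ?_) (by linarith)
        refine add_le_add_right ?_ _
        simp only [← avg_sub hP (ha j).integrable (hb j).integrable]
        exact integral_abs_avg_le hP.adm ((ha j).integrable.sub (hb j).integrable)
    _ = _ := by rw [Finset.sum_add_distrib]; ring

lemma source_comp_add (k : Fin N) (x y δ : ℝ) :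
    P.R k y (fun j => a j (x + δ)) (fun j => P.avg (a j) (x + δ))
      = P.R k y (fun j => (fun z => a j (z + δ)) x)
        (fun j => P.avg (fun z => a j (z + δ)) x) := by
  simp only [avg_comp_add]

/-- A translation changes the densities, which costs their variation, and the explicit position in
`ν`, which costs the mass. -/
lemma integral_abs_source_shift_sub_le (hP : P.Regular K) (k : Fin N) (ha : ∀ j, IsDensity (a j))
    (δ : ℝ) :
    ∫ x, |P.source k a (x + δ) - P.source k a x|
      ≤ 4 * K * (∑ j, ∫ x, |a j (x + δ) - a j x|) + 4 * K ^ 2 * |δ| * ∑ j, ∫ x, a j x := by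
  have hK := hP.nonneg
  set b : Fin N → ℝ → ℝ := fun j x => a j (x + δ) with hb
  have hbd : ∀ j, IsDensity (b j) := fun j => (ha j).comp_add δ
  have h1 : ∀ x, |P.source k a (x + δ) - P.source k a x|
      ≤ 4 * K ^ 2 * |δ| * (∑ j, b j x) + |P.source k b x - P.source k a x| := fun x => by
    refine (abs_sub_le _ (P.source k b x) _).trans (add_le_add_left ?_ _)
    unfold source
    rw [source_comp_add]
    have := abs_R_sub_le_x hP k (x + δ) x (fun j => (hbd j).mem x)
      (fun j => avg_mem hP (hbd j) x)
    rwa [add_sub_cancel_left] at this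
  have hi : Integrable (fun x => ∑ j, b j x) :=
    integrable_finsetSum _ fun j _ => (hbd j).integrable
  have hi2 : Integrable (fun x => |P.source k b x - P.source k a x|) :=
    ((integrable_source hP k hbd).sub (integrable_source hP k ha)).abs
  calc ∫ x, |P.source k a (x + δ) - P.source k a x|
      ≤ ∫ x, (4 * K ^ 2 * |δ| * (∑ j, b j x) + |P.source k b x - P.source k a x|) :=
        integral_mono (((integrable_source hP k ha).comp_add_right δ).sub
          (integrable_source hP k ha)).abs ((hi.const_mul _).add hi2) h1
    _ = 4 * K ^ 2 * |δ| * (∑ j, ∫ x, a j x) + ∫ x, |P.source k b x - P.source k a x| := by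
        rw [integral_add (hi.const_mul _) hi2, integral_const_mul,
          integral_finsetSum _ fun j _ => (hbd j).integrable]
        simp only [hb, integral_comp_add]
    _ ≤ _ := by
        rw [add_comm]
        exact add_le_add_left (integral_abs_source_sub_le hP k hbd ha) _

end LaneModel

/-! ### The scalar Lax–Friedrichs scheme and its `L¹` contraction -/

/-- One step of the Lax–Friedrichs scheme for `∂ₜ a + ∂ₓ (f(a) V) = 0`, with mesh size `h` and
mesh ratio `lam`, acting on functions on the line. -/
def laxFriedrichs (f V : ℝ → ℝ) (lam h : ℝ) (a : ℝ → ℝ) (x : ℝ) : ℝ :=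
  (a (x + h) + a (x - h)) / 2
    - lam / 2 * (f (a (x + h)) * V (x + h) - f (a (x - h)) * V (x - h))

/-- The step is the mean of two maps acting at the neighbouring nodes, and the hypothesis says that
neither reverses the order of `a` and `b`. At each node the absolute value then passes exactly into
the entropy flux; only the mean of the two nodes needs the triangle inequality. The same velocity
`V` must act on both functions. -/
lemma abs_laxFriedrichs_sub_le {f V : ℝ → ℝ} {lam h : ℝ} {a b : ℝ → ℝ}
    (hab : ∀ y, |lam * V y * (f (a y) - f (b y))| ≤ |a y - b y|) (x : ℝ) :
    |laxFriedrichs f V lam h a x - laxFriedrichs f V lam h b x|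
      ≤ (|a (x + h) - b (x + h)| + |a (x - h) - b (x - h)|) / 2
        - lam / 2 * (kruzkov f (a (x + h)) (b (x + h)) * V (x + h)
          - kruzkov f (a (x - h)) (b (x - h)) * V (x - h)) := by
  have e1 := abs_sub_sub_flux_eq (hab (x + h))
  have e2 := abs_sub_sub_flux_eq (f := f) (p := a (x - h)) (q := b (x - h))
    (c := -(lam * V (x - h))) (by rw [neg_mul, abs_neg]; exact hab (x - h))
  unfold laxFriedrichs
  set p := a (x + h) - b (x + h) - lam * V (x + h) * (f (a (x + h)) - f (b (x + h))) with hp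
  set q := a (x - h) - b (x - h) - -(lam * V (x - h)) * (f (a (x - h)) - f (b (x - h))) with hq
  calc _ = |p / 2 + q / 2| := by congr 1; simp only [hp, hq]; ring
    _ ≤ |p| / 2 + |q| / 2 := by
        refine (abs_add_le _ _).trans_eq ?_
        rw [abs_div, abs_div, abs_two]
    _ = _ := by rw [e1, e2]; ring

lemma integral_comp_sub' (w : ℝ → ℝ) (s : ℝ) : ∫ x, w (x - s) = ∫ x, w x :=
  integral_sub_right_eq_self w s

/-- The Lax–Friedrichs scheme contracts the `L¹` distance. -/
lemma integral_abs_laxFriedrichs_sub_le {f V : ℝ → ℝ} {lam h K M : ℝ} {a b : ℝ → ℝ}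
    (hf : ∀ u ∈ Icc (0 : ℝ) 1, ∀ v ∈ Icc (0 : ℝ) 1, |f u - f v| ≤ K * |u - v|) (hfc : Measurable f)
    (hVm : Measurable V) (hV : ∀ x, |V x| ≤ M) (hlam : 0 ≤ lam) (hcfl : lam * K * M ≤ 1)
    (hK : 0 ≤ K) (ha : IsDensity a) (hb : IsDensity b) :
    Integrable (fun x => laxFriedrichs f V lam h a x - laxFriedrichs f V lam h b x) ∧
    ∫ x, |laxFriedrichs f V lam h a x - laxFriedrichs f V lam h b x| ≤ ∫ x, |a x - b x| := by
  have hM : 0 ≤ M := (abs_nonneg _).trans (hV 0)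
  have hab : ∀ y, |lam * V y * (f (a y) - f (b y))| ≤ |a y - b y| := fun y => by
    rw [abs_mul, abs_mul, abs_of_nonneg hlam]
    calc lam * |V y| * |f (a y) - f (b y)| ≤ lam * M * (K * |a y - b y|) := by
          gcongr
          · exact hV y
          · exact hf _ (ha.mem y) _ (hb.mem y)
      _ = lam * K * M * |a y - b y| := by ring
      _ ≤ |a y - b y| := mul_le_of_le_one_left (abs_nonneg _) hcfl
  have hi : Integrable (fun x => |a x - b x|) := (ha.integrable.sub hb.integrable).abs
  have hkm : Measurable (fun x => kruzkov f (a x) (b x) * V x) := by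
    unfold kruzkov
    exact ((measurable_real_sign.comp (ha.measurable.sub hb.measurable)).mul
      ((hfc.comp ha.measurable).sub (hfc.comp hb.measurable))).mul hVm
  have hk : Integrable (fun x => kruzkov f (a x) (b x) * V x) := by
    refine Integrable.mono' (hi.const_mul (K * M)) hkm.aestronglyMeasurable
      (.of_forall fun x => ?_)
    rw [Real.norm_eq_abs, abs_mul]
    calc |kruzkov f (a x) (b x)| * |V x| ≤ (K * |a x - b x|) * M := by
          gcongr
          · exact (abs_kruzkov_le _ _ _).trans (hf _ (ha.mem x) _ (hb.mem x))
          · exact hV x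
      _ = _ := by ring
  have hr : Integrable (fun x => (|a (x + h) - b (x + h)| + |a (x - h) - b (x - h)|) / 2
        - lam / 2 * (kruzkov f (a (x + h)) (b (x + h)) * V (x + h)
          - kruzkov f (a (x - h)) (b (x - h)) * V (x - h))) :=
    (((hi.comp_add_right h).add (hi.comp_sub_right h)).div_const 2).sub
      (((hk.comp_add_right h).sub (hk.comp_sub_right h)).const_mul (lam / 2))
  have hlm : ∀ c : ℝ → ℝ, Measurable c → Measurable (laxFriedrichs f V lam h c) := fun c hc => by
    have h1 := hc.comp (measurable_id.add_const h)
    have h2 := hc.comp (measurable_id.sub_const h)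
    exact ((h1.add h2).div_const 2).sub ((((hfc.comp h1).mul
      (hVm.comp (measurable_id.add_const h))).sub ((hfc.comp h2).mul
      (hVm.comp (measurable_id.sub_const h)))).const_mul _)
  have hint : Integrable (fun x => laxFriedrichs f V lam h a x - laxFriedrichs f V lam h b x) :=
    Integrable.mono' hr ((hlm a ha.measurable).sub (hlm b hb.measurable)).aestronglyMeasurable
      (.of_forall fun x => abs_laxFriedrichs_sub_le hab x)
  refine ⟨hint, (integral_mono hint.abs hr fun x => abs_laxFriedrichs_sub_le hab x).trans_eq ?_⟩
  -- By translation invariance the two entropy flux terms have equal integrals and cancel.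
  rw [integral_sub, integral_const_mul, integral_sub, integral_div, integral_add,
    integral_comp_add (fun x => |a x - b x|), integral_comp_sub' (fun x => |a x - b x|),
    integral_comp_add (fun x => kruzkov f (a x) (b x) * V x),
    integral_comp_sub' (fun x => kruzkov f (a x) (b x) * V x)]
  · ring
  · exact hi.comp_add_right h
  · exact hi.comp_sub_right h
  · exact hk.comp_add_right h
  · exact hk.comp_sub_right h
  · exact ((hi.comp_add_right h).add (hi.comp_sub_right h)).div_const 2
  · exact ((hk.comp_add_right h).sub (hk.comp_sub_right h)).const_mul (lam / 2)

/-! ### One time step of the system: range, mass, variation and speed of change -/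

namespace LaneModel

variable {N : ℕ} {P : LaneModel N} {K M lam h : ℝ} {a : Fin N → ℝ → ℝ}

/-- One step of the scheme for the system, with time step `lam * h`. -/
def step (P : LaneModel N) (lam h : ℝ) (a : Fin N → ℝ → ℝ) (k : Fin N) (x : ℝ) : ℝ :=
  laxFriedrichs (P.f k) (P.speed k (a k)) lam h (a k) x
    + lam * h / 2 * (P.source k a (x + h) + P.source k a (x - h))

lemma measurable_laxFriedrichs {f V c : ℝ → ℝ} (hf : Measurable f) (hV : Measurable V)
    (hc : Measurable c) : Measurable (laxFriedrichs f V lam h c) := by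
  have h1 := hc.comp (measurable_id.add_const h)
  have h2 := hc.comp (measurable_id.sub_const h)
  exact ((h1.add h2).div_const 2).sub ((((hf.comp h1).mul
    (hV.comp (measurable_id.add_const h))).sub ((hf.comp h2).mul
    (hV.comp (measurable_id.sub_const h)))).const_mul _)

lemma measurable_f (hA : P.Admissible) (k : Fin N) : Measurable (P.f k) :=
  (continuous_f hA k).measurable

/-- The flux density of a lane. -/
lemma integrable_flux (hP : P.Regular K) (hM : P.SpeedLE M) (k : Fin N) {c : ℝ → ℝ}
    (hc : IsDensity c) : Integrable (fun x => P.f k (c x) * P.speed k c x) := by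
  refine Integrable.mono' (hc.integrable.const_mul (K * M))
    (((measurable_f hP.adm k).comp hc.measurable).mul
      (speed_comp_add_measurable hP k hc)).aestronglyMeasurable
    (.of_forall fun x => ?_)
  have hK := hP.nonneg
  rw [Real.norm_eq_abs, abs_mul]
  calc |P.f k (c x)| * |P.speed k c x| ≤ (K * c x) * M :=
        mul_le_mul (abs_f_le hP.bdd k (hc.mem x)) (hM k x _ (avg_mem hP hc x)) (abs_nonneg _)
          (mul_nonneg hK (hc.mem x).1)
    _ = _ := by ring

lemma integrable_step_and_integral (hP : P.Regular K) (hM : P.SpeedLE M) (ha : ∀ j, IsDensity (a j))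
    (k : Fin N) : Integrable (P.step lam h a k) ∧
      ∫ x, P.step lam h a k x = (∫ x, a k x) + lam * h * ∫ x, P.source k a x := by
  have i1 := (ha k).integrable
  have i2 := integrable_flux hP hM k (ha k)
  have i3 := integrable_source hP k ha
  have j1 : Integrable (fun x => (a k (x + h) + a k (x - h)) / 2) :=
    ((i1.comp_add_right h).add (i1.comp_sub_right h)).div_const 2
  have j2 : Integrable (fun x => lam / 2 * (P.f k (a k (x + h)) * P.speed k (a k) (x + h)
      - P.f k (a k (x - h)) * P.speed k (a k) (x - h))) :=
    ((i2.comp_add_right h).sub (i2.comp_sub_right h)).const_mul _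
  have j3 : Integrable (fun x => lam * h / 2 * (P.source k a (x + h) + P.source k a (x - h))) :=
    ((i3.comp_add_right h).add (i3.comp_sub_right h)).const_mul _
  have j12 : Integrable (fun x => (a k (x + h) + a k (x - h)) / 2
      - lam / 2 * (P.f k (a k (x + h)) * P.speed k (a k) (x + h)
      - P.f k (a k (x - h)) * P.speed k (a k) (x - h))) := j1.sub j2
  refine ⟨j12.add j3, ?_⟩
  unfold step laxFriedrichs
  rw [integral_add j12 j3, integral_sub j1 j2, integral_div,
    integral_add (i1.comp_add_right h) (i1.comp_sub_right h), integral_const_mul,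
    integral_sub (i2.comp_add_right h) (i2.comp_sub_right h), integral_const_mul,
    integral_add (i3.comp_add_right h) (i3.comp_sub_right h),
    integral_comp_add (a k), integral_comp_sub' (a k),
    integral_comp_add (P.source k a), integral_comp_sub' (P.source k a),
    integral_comp_add (fun x => P.f k (a k x) * P.speed k (a k) x),
    integral_comp_sub' (fun x => P.f k (a k x) * P.speed k (a k) x)]
  ring

lemma sum_integral_step (hP : P.Regular K) (hM : P.SpeedLE M) (ha : ∀ j, IsDensity (a j)) :
    ∑ k, ∫ x, P.step lam h a k x = ∑ k, ∫ x, a k x := by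
  simp only [(integrable_step_and_integral hP hM ha _).2, Finset.sum_add_distrib,
    ← Finset.mul_sum]
  rw [← integral_finsetSum _ fun k _ => integrable_source hP k ha]
  simp [sum_source_eq_zero]

/-- Admissible mesh parameters: the conditions under which the scheme preserves the range
`[0, 1]`; `L` is a Lipschitz constant of the functions `g k`. -/
structure StepSize (P : LaneModel N) (K M L lam h : ℝ) : Prop where
  lam_pos : 0 < lam
  h_pos : 0 < h
  h_le : h ≤ 1
  L_nonneg : 0 ≤ L
  g_lip : ∀ k u v, |P.g k u - P.g k v| ≤ L * |u - v|
  cfl : lam * K * M + 2 * (lam * h) * ((K + L) * M) ≤ 1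

variable {L : ℝ}

lemma StepSize.ratio (hs : P.StepSize K M L lam h) (hK : 0 ≤ K) (hM : 0 ≤ M) :
    lam * K * M ≤ 1 := by
  have h1 := hs.cfl
  have h2 : 0 ≤ 2 * (lam * h) * ((K + L) * M) := by
    have := hs.lam_pos; have := hs.h_pos; have := hs.L_nonneg
    positivity
  linarith

lemma isDensity_step (hP : P.Regular K) (hM : P.SpeedLE M) (hs : P.StepSize K M L lam h)
    (ha : ∀ j, IsDensity (a j)) (k : Fin N) : IsDensity (P.step lam h a k) := by
  have hK := hP.nonneg
  have hM0 := hM.nonneg k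
  have hlam := hs.lam_pos
  have hh := hs.h_pos
  have hL := hs.L_nonneg
  refine ⟨?_, fun x => ?_, (integrable_step_and_integral hP hM ha k).1⟩
  · have hS := measurable_source hP k ha
    exact (measurable_laxFriedrichs (measurable_f hP.adm k) (speed_comp_add_measurable hP k (ha k))
      (ha k).measurable).add (((hS.comp (measurable_id.add_const h)).add
      (hS.comp (measurable_id.sub_const h))).const_mul _)
  -- The step is the mean of two nodal contributions, and each of them stays in `[0, 1]` by itself.
  -- Near `0` flux and loss are at most proportional to the density, near `1` flux and gain to the
  -- free space; the mesh condition makes both proportions at most one.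
  · have node : ∀ y, ∀ c : ℝ, |c| = lam →
        a k y + c * (P.f k (a k y) * P.speed k (a k) y) + lam * h * P.source k a y
          ∈ Icc (0 : ℝ) 1 := by
      intro y c hc
      have hR := R_bounds hP hM hL hs.g_lip k y (fun j => (ha j).mem y)
        (fun j => avg_mem hP (ha j) y)
      change -(2 * (K * M) * a k y) ≤ P.source k a y ∧
        P.source k a y ≤ 2 * (L * M) * (1 - a k y) at hR
      obtain ⟨h0, h1⟩ := (ha k).mem y
      have hf1 := abs_f_le hP.bdd k ((ha k).mem y)
      have hf2 := abs_f_le_one_sub hP k ((ha k).mem y)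
      have hV : |P.speed k (a k) y| ≤ M := hM k y _ (avg_mem hP (ha k) y)
      have b1 : |c * (P.f k (a k y) * P.speed k (a k) y)| ≤ lam * K * M * a k y := by
        rw [abs_mul, abs_mul, hc]
        calc lam * (|P.f k (a k y)| * |P.speed k (a k) y|) ≤ lam * ((K * a k y) * M) := by
              gcongr
          _ = _ := by ring
      have b2 : |c * (P.f k (a k y) * P.speed k (a k) y)| ≤ lam * K * M * (1 - a k y) := by
        rw [abs_mul, abs_mul, hc]
        calc lam * (|P.f k (a k y)| * |P.speed k (a k) y|) ≤ lam * ((K * (1 - a k y)) * M) := by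
              gcongr
          _ = _ := by ring
      have hτ : 0 ≤ lam * h := by positivity
      have c1 := mul_le_mul_of_nonneg_left hR.1 hτ
      have c2 := mul_le_mul_of_nonneg_left hR.2 hτ
      have e1 : lam * K * M + 2 * (lam * h) * (K * M) ≤ 1 := by
        have : 0 ≤ 2 * (lam * h) * (L * M) := by positivity
        linarith [hs.cfl]
      have e2 : lam * K * M + 2 * (lam * h) * (L * M) ≤ 1 := by
        have : 0 ≤ 2 * (lam * h) * (K * M) := by positivity
        linarith [hs.cfl]
      have g1 := mul_le_mul_of_nonneg_right e1 h0
      have g2 := mul_le_mul_of_nonneg_right e2 (by linarith : 0 ≤ 1 - a k y)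
      constructor
      · linarith [neg_le_of_abs_le b1]
      · linarith [le_of_abs_le b2]
    have n1 := node (x + h) (-lam) (by rw [abs_neg, abs_of_pos hlam])
    have n2 := node (x - h) lam (abs_of_pos hlam)
    have e : P.step lam h a k x
        = ((a k (x + h) + -lam * (P.f k (a k (x + h)) * P.speed k (a k) (x + h))
          + lam * h * P.source k a (x + h))
          + (a k (x - h) + lam * (P.f k (a k (x - h)) * P.speed k (a k) (x - h))
          + lam * h * P.source k a (x - h))) / 2 := by
      unfold step laxFriedrichs; ring
    rw [e]
    constructor <;> linarith [n1.1, n1.2, n2.1, n2.2]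

lemma integrable_abs_sub {c d : ℝ → ℝ} (hc : Integrable c) (hd : Integrable d) :
    Integrable (fun x => |c x - d x|) := (hc.sub hd).abs

lemma integral_abs_shift_shift (c : ℝ → ℝ) (s t : ℝ) :
    ∫ x, |c (x + s) - c (x - t)| = ∫ x, |c (x + (s + t)) - c x| := by
  rw [← integral_sub_right_eq_self (fun x => |c (x + (s + t)) - c x|) t]
  refine integral_congr_ae (.of_forall fun x => ?_)
  simp only
  congr 3; ring

/-- Translating the result translates data, velocity and source alike. With the velocity frozen the
contraction bounds the effect of the translated data without loss. What remains are the increments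
of velocity and source, which carry a factor `lam * h * |δ|`. -/
lemma integral_abs_step_shift_sub_le (hP : P.Regular K) (hM : P.SpeedLE M)
    (hs : P.StepSize K M L lam h) (ha : ∀ j, IsDensity (a j)) {B m : ℝ}
    (hTV : ∀ δ, ∑ j, ∫ x, |a j (x + δ) - a j x| ≤ B * |δ|) (hm : ∑ j, ∫ x, a j x ≤ m) (k : Fin N)
    (δ : ℝ) :
    ∫ x, |P.step lam h a k (x + δ) - P.step lam h a k x| ≤ (∫ x, |a k (x + δ) - a k x|)
      + lam * h * |δ| * (K * (K + 2 * K ^ 2) * B + 2 * K ^ 3 * B + 4 * K * B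
        + K * (K + 2 * K ^ 2) * (1 + 2 * K) * m + 4 * K ^ 2 * m) := by
  have hK := hP.nonneg
  have hM0 := hM.nonneg k
  have hlam := hs.lam_pos
  have hh := hs.h_pos
  have hTVk : ∀ δ, ∫ x, |a k (x + δ) - a k x| ≤ B * |δ| := fun δ =>
    (integral_abs_le_sum (fun j x => a j (x + δ) - a j x) k).trans (hTV δ)
  have hmk : ∫ x, a k x ≤ m :=
    (integral_le_sum ha k).trans hm
  set c : ℝ → ℝ := fun x => a k (x + δ) with hc
  have hcd : IsDensity c := (ha k).comp_add δ
  set V := P.speed k (a k) with hV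
  set f := P.f k with hf
  set r := P.source k a with hr
  set CV := K + 2 * K ^ 2 with hCV
  have hCV0 : 0 ≤ CV := by positivity
  have hcontr := integral_abs_laxFriedrichs_sub_le (f := f) (V := V) (lam := lam) (h := h)
    (hP.bdd.f_lip k) (measurable_f hP.adm k) (speed_comp_add_measurable hP k (ha k))
    (fun x => hM k x _ (avg_mem hP (ha k) x)) hlam.le (hs.ratio hK hM0) hK hcd (ha k)
  have hsd := integral_mul_abs_second_difference_le hP k (ha k) hcd δ
    (by positivity : (0 : ℝ) ≤ h + h)
  set J : ℝ → ℝ := fun y => c y * |(V (y + (h + h) + δ) - V (y + (h + h)))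
    - (V (y + δ) - V y)| with hJ
  set T1 : ℝ → ℝ := fun x => |laxFriedrichs f V lam h c x - laxFriedrichs f V lam h (a k) x|
  set T2 : ℝ → ℝ := fun x => |c (x + h) - c (x - h)|
  set T4 : ℝ → ℝ := fun x => |r (x + δ) - r x|
  have i1 : Integrable T1 := hcontr.1.abs
  have i2 : Integrable T2 := integrable_abs_sub (hcd.integrable.comp_add_right h)
    (hcd.integrable.comp_sub_right h)
  have i3 : Integrable (fun x => J (x - h)) := hsd.1.comp_sub_right h
  have ir := integrable_source hP k ha
  have i4 : Integrable T4 := integrable_abs_sub (ir.comp_add_right δ) ir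
  have i23 : Integrable (fun x => lam / 2 * (K * CV * |δ| * T2 x + K * J (x - h))) :=
    ((i2.const_mul _).add (i3.const_mul _)).const_mul _
  have i44 : Integrable (fun x => lam * h / 2 * (T4 (x + h) + T4 (x - h))) :=
    ((i4.comp_add_right h).add (i4.comp_sub_right h)).const_mul _
  have i1234 : Integrable (fun x => T1 x + lam / 2 * (K * CV * |δ| * T2 x + K * J (x - h))) :=
    i1.add i23
  have hpt : ∀ x, |P.step lam h a k (x + δ) - P.step lam h a k x|
      ≤ T1 x + lam / 2 * (K * CV * |δ| * T2 x + K * J (x - h))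
        + lam * h / 2 * (T4 (x + h) + T4 (x - h)) := by
    intro x
    set D : ℝ → ℝ := fun y => V (y + δ) - V y with hD
    have hDb : |D (x + h)| ≤ CV * |δ| := by
      have := abs_speed_sub_le hP k (ha k) (x + h + δ) (x + h)
      rwa [add_sub_cancel_left] at this
    -- A discrete product rule for the velocity error. In the first product, increments of the flux
    -- over `2h` meet first differences of the velocity; in the second, the flux meets second
    -- differences, with the density as the weight that makes them integrable.
    have hdec : P.step lam h a k (x + δ) - P.step lam h a k x
        = (laxFriedrichs f V lam h c x - laxFriedrichs f V lam h (a k) x)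
          + -(lam / 2) * ((f (c (x + h)) - f (c (x - h))) * D (x + h)
            + f (c (x - h)) * (D (x + h) - D (x - h)))
          + lam * h / 2 * ((r (x + h + δ) - r (x + h)) + (r (x - h + δ) - r (x - h))) := by
      unfold step laxFriedrichs
      simp only [hc, hD, ← hV, ← hf, ← hr, add_right_comm x δ h, sub_add_eq_add_sub]
      ring
    have hJx : J (x - h) = c (x - h) * |D (x + h) - D (x - h)| := by
      simp only [hJ, hD]
      rw [show x - h + (h + h) = x + h by ring]
    rw [hdec]
    refine (abs_add_three _ _ _).trans ?_
    have b2 : |-(lam / 2) * ((f (c (x + h)) - f (c (x - h))) * D (x + h)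
            + f (c (x - h)) * (D (x + h) - D (x - h)))|
        ≤ lam / 2 * (K * CV * |δ| * T2 x + K * J (x - h)) := by
      rw [abs_mul, abs_neg, abs_of_pos (by positivity : 0 < lam / 2)]
      gcongr
      refine (abs_add_le _ _).trans (add_le_add ?_ ?_)
      · rw [abs_mul]
        calc |f (c (x + h)) - f (c (x - h))| * |D (x + h)|
            ≤ (K * |c (x + h) - c (x - h)|) * (CV * |δ|) :=
              mul_le_mul (hP.bdd.f_lip k _ (hcd.mem _) _ (hcd.mem _)) hDb (abs_nonneg _)
                (by positivity)
          _ = _ := by simp only [T2]; ring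
      · rw [abs_mul, hJx, ← mul_assoc]
        gcongr
        exact abs_f_le hP.bdd k (hcd.mem _)
    have b3 : |lam * h / 2 * ((r (x + h + δ) - r (x + h)) + (r (x - h + δ) - r (x - h)))|
        ≤ lam * h / 2 * (T4 (x + h) + T4 (x - h)) := by
      rw [abs_mul, abs_of_pos (by positivity : 0 < lam * h / 2)]
      gcongr
      exact abs_add_le _ _
    linarith
  have hstep := (integrable_step_and_integral (lam := lam) (h := h) hP hM ha k).1
  have hr4 := integral_abs_source_shift_sub_le hP k ha δ
  have hB0 : 0 ≤ B * |δ| :=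
    le_trans (Finset.sum_nonneg fun j _ => integral_nonneg fun x => abs_nonneg _) (hTV δ)
  calc ∫ x, |P.step lam h a k (x + δ) - P.step lam h a k x|
      ≤ ∫ x, (T1 x + lam / 2 * (K * CV * |δ| * T2 x + K * J (x - h))
        + lam * h / 2 * (T4 (x + h) + T4 (x - h))) :=
        integral_mono (integrable_abs_sub (hstep.comp_add_right δ) hstep) (i1234.add i44) hpt
    _ = (∫ x, T1 x) + lam / 2 * (K * CV * |δ| * (∫ x, T2 x) + K * ∫ x, J x)
        + lam * h / 2 * (2 * ∫ x, T4 x) := by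
        rw [integral_add i1234 i44, integral_add i1 i23, integral_const_mul, integral_const_mul,
          integral_add (i2.const_mul _) (i3.const_mul _), integral_const_mul, integral_const_mul,
          integral_add (i4.comp_add_right h) (i4.comp_sub_right h), integral_comp_add T4,
          integral_comp_sub' T4, integral_comp_sub' J]
        ring
    _ ≤ (∫ x, |a k (x + δ) - a k x|)
        + lam / 2 * (K * CV * |δ| * (B * (h + h))
          + K * ((h + h) * (CV * (1 + 2 * K) * |δ| * m + 2 * K ^ 2 * (B * |δ|))))
        + lam * h / 2 * (2 * (4 * K * (B * |δ|) + 4 * K ^ 2 * |δ| * m)) := by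
        have t2 : ∫ x, T2 x ≤ B * (h + h) := by
          simp only [T2, integral_abs_shift_shift]
          calc ∫ x, |c (x + (h + h)) - c x| = ∫ x, |a k (x + (h + h)) - a k x| := by
                rw [← integral_comp_add (fun x => |a k (x + (h + h)) - a k x|) δ]
                simp only [hc, add_right_comm]
            _ ≤ _ := by
                have := hTVk (h + h)
                rwa [abs_of_pos (by positivity : 0 < h + h)] at this
        have t3 : ∫ x, J x ≤ (h + h) * (CV * (1 + 2 * K) * |δ| * m
            + 2 * K ^ 2 * (B * |δ|)) := by
          refine hsd.2.trans ?_
          have e : ∫ x, c x = ∫ x, a k x := integral_comp_add (a k) δ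
          rw [e]
          gcongr
          exact hTVk δ
        have t4 : ∫ x, T4 x ≤ 4 * K * (B * |δ|) + 4 * K ^ 2 * |δ| * m := by
          refine hr4.trans ?_
          gcongr
          exact hTV δ
        refine add_le_add (add_le_add hcontr.2 ?_) ?_
        · gcongr
        · gcongr
    _ = _ := by ring

/-- The constant in the growth of the total variation along the scheme. -/
def tvRate (N : ℕ) (K : ℝ) : ℝ :=
  N * (K * (K + 2 * K ^ 2) + 2 * K ^ 3 + 4 * K + K ^ 2 * (K + 2 * K ^ 2) * (1 + 2 * K) + 4 * K ^ 3)

lemma tvRate_nonneg (hK : 0 ≤ K) : 0 ≤ tvRate N K := by unfold tvRate; positivity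

/-- The growth is affine in `B`, and bounding it by a multiple of `B + 1` lets `B + 1` grow
geometrically. Here `K` bounds the mass as well, so the rate depends on `N` and `K` only and not on
the bound `M` for the velocities. -/
lemma sum_integral_abs_step_shift_sub_le (hP : P.Regular K) (hM : P.SpeedLE M)
    (hs : P.StepSize K M L lam h) (ha : ∀ j, IsDensity (a j)) {B : ℝ} (hB0 : 0 ≤ B)
    (hTV : ∀ δ, ∑ j, ∫ x, |a j (x + δ) - a j x| ≤ B * |δ|) (hm : ∑ j, ∫ x, a j x ≤ K) (δ : ℝ) :
    ∑ k, ∫ x, |P.step lam h a k (x + δ) - P.step lam h a k x|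
      ≤ (B + lam * h * tvRate N K * (B + 1)) * |δ| := by
  have hK := hP.nonneg
  have hlam := hs.lam_pos
  have hh := hs.h_pos
  calc ∑ k, ∫ x, |P.step lam h a k (x + δ) - P.step lam h a k x|
      ≤ ∑ k : Fin N, ((∫ x, |a k (x + δ) - a k x|)
      + lam * h * |δ| * (K * (K + 2 * K ^ 2) * B + 2 * K ^ 3 * B + 4 * K * B
        + K * (K + 2 * K ^ 2) * (1 + 2 * K) * K + 4 * K ^ 2 * K)) :=
        Finset.sum_le_sum fun k _ =>
          integral_abs_step_shift_sub_le hP hM hs ha hTV hm k δ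
    _ = (∑ k : Fin N, ∫ x, |a k (x + δ) - a k x|)
      + lam * h * |δ| * (N * (K * (K + 2 * K ^ 2) * B + 2 * K ^ 3 * B + 4 * K * B
        + K * (K + 2 * K ^ 2) * (1 + 2 * K) * K + 4 * K ^ 2 * K)) := by
        rw [Finset.sum_add_distrib]; simp; ring
    _ ≤ B * |δ| + lam * h * |δ| * (tvRate N K * (B + 1)) := by
        refine add_le_add (hTV δ) (mul_le_mul_of_nonneg_left ?_ (by positivity))
        unfold tvRate
        rw [mul_assoc (N : ℝ) _ (B + 1)]
        refine mul_le_mul_of_nonneg_left ?_ (Nat.cast_nonneg (α := ℝ) N)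
        have e1 : 0 ≤ K * (K + 2 * K ^ 2) + 2 * K ^ 3 + 4 * K := by positivity
        have e2 : 0 ≤ (K ^ 2 * (K + 2 * K ^ 2) * (1 + 2 * K) + 4 * K ^ 3) * B := by positivity
        nlinarith
    _ = _ := by ring

/-- The averaging of the two neighbours displaces the profile by `B * h`, which equals `lam * h`
times `B / lam`; a speed bound uniform in `h` thus needs a fixed mesh ratio. The remaining terms
come from flux increments and sources. -/
lemma integral_abs_step_sub_le (hP : P.Regular K) (hM : P.SpeedLE M) (hs : P.StepSize K M L lam h)
    (ha : ∀ j, IsDensity (a j)) {B m : ℝ} (hTV : ∀ δ, ∑ j, ∫ x, |a j (x + δ) - a j x| ≤ B * |δ|)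
    (hm : ∑ j, ∫ x, a j x ≤ m) (k : Fin N) :
    ∫ x, |P.step lam h a k x - a k x|
      ≤ lam * h * (B / lam + K * M * B + K * (K + 2 * K ^ 2) * m + 2 * K * m) := by
  have hK := hP.nonneg
  have hM0 := hM.nonneg k
  have hlam := hs.lam_pos
  have hh := hs.h_pos
  have hTVk : ∀ δ, ∫ x, |a k (x + δ) - a k x| ≤ B * |δ| := fun δ =>
    (integral_abs_le_sum (fun j x => a j (x + δ) - a j x) k).trans (hTV δ)
  have hmk : ∫ x, a k x ≤ m :=
    (integral_le_sum ha k).trans hm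
  have hmm : 0 ≤ m :=
    le_trans (Finset.sum_nonneg fun j _ => integral_nonneg fun x => ((ha j).mem x).1) hm
  set CV := K + 2 * K ^ 2 with hCV
  have hCV0 : 0 ≤ CV := by positivity
  have i0 := (ha k).integrable
  have ir := integrable_source hP k ha
  have i1 : Integrable (fun x => |a k (x + h) - a k x|) :=
    integrable_abs_sub (i0.comp_add_right h) i0
  have i2 : Integrable (fun x => |a k (x + -h) - a k x|) :=
    integrable_abs_sub (i0.comp_add_right (-h)) i0
  have i3 : Integrable (fun x => |a k (x + h) - a k (x - h)|) :=
    integrable_abs_sub (i0.comp_add_right h) (i0.comp_sub_right h)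
  have i4 : Integrable (fun x => a k (x - h)) := i0.comp_sub_right h
  have i5 : Integrable (fun x => |P.source k a x|) := ir.abs
  have j12 : Integrable (fun x => |a k (x + h) - a k x| / 2 + |a k (x + -h) - a k x| / 2) :=
    (i1.div_const 2).add (i2.div_const 2)
  have j34 : Integrable (fun x => lam / 2 * (K * M * |a k (x + h) - a k (x - h)|
      + K * CV * (h + h) * a k (x - h))) :=
    ((i3.const_mul _).add (i4.const_mul _)).const_mul _
  have j1234 : Integrable (fun x => |a k (x + h) - a k x| / 2 + |a k (x + -h) - a k x| / 2
      + lam / 2 * (K * M * |a k (x + h) - a k (x - h)| + K * CV * (h + h) * a k (x - h))) :=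
    j12.add j34
  have j5 : Integrable (fun x => lam * h / 2 * (|P.source k a (x + h)|
      + |P.source k a (x - h)|)) :=
    ((i5.comp_add_right h).add (i5.comp_sub_right h)).const_mul _
  have hpt : ∀ x, |P.step lam h a k x - a k x| ≤ |a k (x + h) - a k x| / 2
      + |a k (x + -h) - a k x| / 2
      + lam / 2 * (K * M * |a k (x + h) - a k (x - h)| + K * CV * (h + h) * a k (x - h))
      + lam * h / 2 * (|P.source k a (x + h)| + |P.source k a (x - h)|) := by
    intro x
    set V := P.speed k (a k)
    have hdec : P.step lam h a k x - a k x = ((a k (x + h) - a k x) / 2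
        + (a k (x + -h) - a k x) / 2)
        + -(lam / 2) * ((P.f k (a k (x + h)) - P.f k (a k (x - h))) * V (x + h)
          + P.f k (a k (x - h)) * (V (x + h) - V (x - h)))
        + lam * h / 2 * (P.source k a (x + h) + P.source k a (x - h)) := by
      unfold step laxFriedrichs
      rw [← sub_eq_add_neg]; ring
    rw [hdec]
    refine (abs_add_three _ _ _).trans (add_le_add (add_le_add ?_ ?_) ?_)
    · refine (abs_add_le _ _).trans_eq ?_
      rw [abs_div, abs_div, abs_two]
    · rw [abs_mul, abs_neg, abs_of_pos (by positivity : 0 < lam / 2)]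
      gcongr
      refine (abs_add_le _ _).trans (add_le_add ?_ ?_)
      · rw [abs_mul]
        calc |P.f k (a k (x + h)) - P.f k (a k (x - h))| * |V (x + h)|
            ≤ (K * |a k (x + h) - a k (x - h)|) * M :=
              mul_le_mul (hP.bdd.f_lip k _ ((ha k).mem _) _ ((ha k).mem _))
                (hM k _ _ (avg_mem hP (ha k) _)) (abs_nonneg _) (by positivity)
          _ = _ := by ring
      · rw [abs_mul]
        have hVd := abs_speed_sub_le hP k (ha k) (x + h) (x - h)
        rw [show x + h - (x - h) = h + h by ring, abs_of_pos (by positivity : 0 < h + h)] at hVd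
        calc |P.f k (a k (x - h))| * |V (x + h) - V (x - h)|
            ≤ (K * a k (x - h)) * (CV * (h + h)) :=
              mul_le_mul (abs_f_le hP.bdd k ((ha k).mem _)) hVd (abs_nonneg _)
                (mul_nonneg hK ((ha k).mem _).1)
          _ = _ := by ring
    · rw [abs_mul, abs_of_pos (by positivity : 0 < lam * h / 2)]
      gcongr
      exact abs_add_le _ _
  have hstep := (integrable_step_and_integral (lam := lam) (h := h) hP hM ha k).1
  calc ∫ x, |P.step lam h a k x - a k x| ≤ _ :=
        integral_mono (integrable_abs_sub hstep i0) (j1234.add j5) hpt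
    _ = (∫ x, |a k (x + h) - a k x|) / 2 + (∫ x, |a k (x + -h) - a k x|) / 2
        + lam / 2 * (K * M * (∫ x, |a k (x + (h + h)) - a k x|) + K * CV * (h + h) * ∫ x, a k x)
        + lam * h * ∫ x, |P.source k a x| := by
        simp only [Pi.add_apply]
        rw [integral_add j1234 j5, integral_add j12 j34,
          integral_add (i1.div_const 2) (i2.div_const 2), integral_div, integral_div,
          integral_const_mul, integral_add (i3.const_mul _) (i4.const_mul _),
          integral_const_mul, integral_const_mul, integral_const_mul,
          integral_add (i5.comp_add_right h) (i5.comp_sub_right h),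
          integral_comp_add (fun x => |P.source k a x|),
          integral_comp_sub' (fun x => |P.source k a x|), integral_comp_sub' (a k),
          integral_abs_shift_shift]
        ring
    _ ≤ (B * h) / 2 + (B * h) / 2
        + lam / 2 * (K * M * (B * (h + h)) + K * CV * (h + h) * m)
        + lam * h * (2 * K * m) := by
        have t1 := hTVk h
        have t2 := hTVk (-h)
        have t3 := hTVk (h + h)
        rw [abs_neg] at t2
        rw [abs_of_pos hh] at t1 t2
        rw [abs_of_pos (by positivity : 0 < h + h)] at t3
        have t5 := (integral_abs_source_le hP k ha).trans
          (mul_le_mul_of_nonneg_left hm (by positivity : (0 : ℝ) ≤ 2 * K))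
        gcongr
    _ = _ := by field_simp; ring

end LaneModel

/-! ### Test functions with an integrable majorant, and symmetric difference quotients -/

/-- A bounded measurable function times an integrable one. -/
lemma MeasureTheory.Integrable.bdd_mul_of_abs_le {f g : ℝ → ℝ} (hg : Integrable g) (hf : Measurable f) {C : ℝ}
    (hC : ∀ x, |f x| ≤ C) : Integrable (fun x => f x * g x) :=
  hg.bdd_mul hf.aestronglyMeasurable (.of_forall hC)

/-- `ψ` is a non-negative smooth test function on the line, and `m` dominates `ψ` and its first two
derivatives on unit neighbourhoods. -/
structure IsTest (ψ m : ℝ → ℝ) : Prop where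
  smooth : ContDiff ℝ 2 ψ
  nonneg : ∀ x, 0 ≤ ψ x
  le : ∀ x s, |s| ≤ 1 → ψ (x + s) ≤ m x
  deriv_le : ∀ x s, |s| ≤ 1 → |deriv ψ (x + s)| ≤ m x
  deriv_deriv_le : ∀ x s, |s| ≤ 1 → |deriv (deriv ψ) (x + s)| ≤ m x
  measurable : Measurable m
  integrable : Integrable m
  bdd : ∃ C, ∀ x, m x ≤ C

namespace IsTest

variable {ψ m : ℝ → ℝ}

lemma major_nonneg (hψ : IsTest ψ m) (x : ℝ) : 0 ≤ m x :=
  (hψ.nonneg _).trans (hψ.le x 0 (by simp))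

lemma continuous (hψ : IsTest ψ m) : Continuous ψ := hψ.smooth.continuous

lemma continuous_deriv (hψ : IsTest ψ m) : Continuous (deriv ψ) :=
  hψ.smooth.continuous_deriv (by norm_num)

lemma differentiable (hψ : IsTest ψ m) : Differentiable ℝ ψ :=
  hψ.smooth.differentiable (by norm_num)

lemma differentiable_deriv (hψ : IsTest ψ m) : Differentiable ℝ (deriv ψ) :=
  (((contDiff_succ_iff_deriv (n := 1)).1 hψ.smooth).2.2).differentiable (by norm_num)

lemma integrable_self (hψ : IsTest ψ m) {s : ℝ} (hs : |s| ≤ 1) :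
    Integrable (fun x => ψ (x + s)) :=
  hψ.integrable.mono' (hψ.continuous.comp (continuous_id.add continuous_const)).aestronglyMeasurable
    (.of_forall fun x => by
      rw [Real.norm_eq_abs, abs_of_nonneg (hψ.nonneg _)]; exact hψ.le x s hs)

lemma integrable_fun (hψ : IsTest ψ m) : Integrable ψ := by simpa using hψ.integrable_self (s := 0) (by simp)

lemma exists_abs_le (hψ : IsTest ψ m) : ∃ C, ∀ x, |ψ x| ≤ C := by
  obtain ⟨C, hC⟩ := hψ.bdd
  refine ⟨C, fun x => ?_⟩
  rw [abs_of_nonneg (hψ.nonneg x)]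
  simpa using (hψ.le x 0 (by simp)).trans (hC x)

lemma integrable_deriv (hψ : IsTest ψ m) : Integrable (deriv ψ) :=
  hψ.integrable.mono' hψ.continuous_deriv.aestronglyMeasurable
    (.of_forall fun x => by simpa using hψ.deriv_le x 0 (by simp))

lemma abs_taylor_le (hψ : IsTest ψ m) (x : ℝ) {s : ℝ} (hs : |s| ≤ 1) :
    |ψ (x + s) - ψ x - deriv ψ x * s| ≤ m x * s ^ 2 := by
  have hmem : ∀ z ∈ Icc (x - |s|) (x + |s|), |deriv (deriv ψ) z| ≤ m x := fun z hz => by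
    have := hψ.deriv_deriv_le x (z - x) (by
      rw [abs_le]; constructor <;> linarith [hz.1, hz.2])
    simpa using this
  have := abs_sub_sub_deriv_mul_le (F := ψ) (s := Icc (x - |s|) (x + |s|)) ordConnected_Icc
    (hψ.major_nonneg x) (fun z _ => hψ.differentiable z)
    (fun y hy z hz => by
      have := Convex.norm_image_sub_le_of_norm_deriv_le (f := deriv ψ)
        (s := Icc (x - |s|) (x + |s|)) (C := m x) (x := z) (y := y)
        (fun z _ => hψ.differentiable_deriv z) hmem (convex_Icc _ _) hz hy
      simpa using this)
    (a := x) (b := x + s) ⟨by linarith [abs_nonneg s], by linarith [abs_nonneg s]⟩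
    ⟨by linarith [neg_abs_le s], by linarith [le_abs_self s]⟩
  simpa using this

lemma integrable_mul (hψ : IsTest ψ m) {E : ℝ → ℝ} (hE : Integrable E) :
    Integrable (fun x => m x * E x) := by
  obtain ⟨C, hC⟩ := hψ.bdd
  exact hE.bdd_mul_of_abs_le hψ.measurable (C := C) fun x => by
    rw [abs_of_nonneg (hψ.major_nonneg x)]; exact hC x

end IsTest

/-- Symmetric difference quotients of a Lipschitz function are close in `L¹` to the derivative if
the derivative has an `L¹` modulus of continuity. -/
lemma LipschitzWith.exists_abs_central_difference_le {F q : ℝ → ℝ} {L : NNReal}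
    (hF : LipschitzWith L F) (hq : Integrable q) {c C K h : ℝ} (hc : 0 ≤ c) (hC : 0 ≤ C)
    (hh : 0 ≤ h) (hqc : ∀ s, ∫ x, |q (x + s) - q x| ≤ c * |s|)
    (hae : ∀ᵐ x, ∀ᵐ y, |deriv F y - deriv F x| ≤ C * |y - x| + K * |q y - q x|) :
    ∃ e : ℝ → ℝ, Integrable e ∧ (∀ x, 0 ≤ e x) ∧ ∫ x, e x ≤ c * h * (2 * h) ∧
      ∀ᵐ x, |F (x + h) - F (x - h) - 2 * h * deriv F x| ≤ C * h * (2 * h) + K * e x := by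
  set χ : ℝ → ℝ := (Ioc (-h) h).indicator 1 with hχ
  have hχ0 : ∀ s, 0 ≤ χ s := fun s => indicator_nonneg (fun _ _ => zero_le_one) s
  have hχi : Integrable χ := (integrable_indicator_iff measurableSet_Ioc).2
    (integrableOn_const (by simp))
  have hχint : ∫ s, χ s = 2 * h := by
    rw [hχ, integral_indicator measurableSet_Ioc]
    simp [hh, two_mul]
  have hprod : Integrable (fun p : ℝ × ℝ => χ p.2 * |q (p.1 + p.2) - q p.1|)
      (volume.prod volume) := by
    have h1 := integrable_prod_mul_comp_add hχi hq
    have h2 : Integrable (fun p : ℝ × ℝ => q p.1 * χ p.2) (volume.prod volume) := hq.mul_prod hχi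
    refine (h1.sub h2).abs.congr (.of_forall fun p => ?_)
    simp only [Pi.sub_apply]
    rw [mul_comm (q p.1), ← mul_sub, abs_mul, abs_of_nonneg (hχ0 _)]
  -- The error function is the oscillation of `q` over the window `(-h, h]`. The derivative of an
  -- average has only an `L¹` modulus of continuity, so the error of the quotient is small in the
  -- mean and not pointwise.
  refine ⟨fun x => ∫ s, χ s * |q (x + s) - q x|, hprod.integral_prod_left,
    fun x => integral_nonneg fun s => mul_nonneg (hχ0 s) (abs_nonneg _), ?_, ?_⟩
  · rw [integral_integral_swap hprod]
    calc ∫ s, ∫ x, χ s * |q (x + s) - q x| ≤ ∫ s, (c * h) * χ s := by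
          refine integral_mono hprod.integral_prod_right (hχi.const_mul _) fun s => ?_
          simp only [integral_const_mul]
          by_cases hs : s ∈ Ioc (-h) h
          · have e : χ s = 1 := by simp [hχ, hs]
            rw [e, one_mul, mul_one]
            refine (hqc s).trans ?_
            gcongr
            exact abs_le.2 ⟨hs.1.le, hs.2⟩
          · have e : χ s = 0 := by simp [hχ, hs]
            rw [e]; simp
      _ = c * h * (2 * h) := by rw [integral_const_mul, hχint]
  · filter_upwards [hae, hprod.prod_right_ae] with x hx hxi
    have hx' := (measurePreserving_add_left (volume : Measure ℝ) x).quasiMeasurePreserving.ae hx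
    have e1 : F (x + h) - F (x - h) - 2 * h * deriv F x
        = ∫ s in (-h)..h, (deriv F (x + s) - deriv F x) := by
      have h1 := hF.sub_eq_integral_deriv x h
      have h2 := hF.sub_eq_integral_deriv x (-h)
      have hii : ∀ a b : ℝ, IntervalIntegrable (fun s => deriv F (x + s)) volume a b := by
        intro a b
        refine (intervalIntegrable_const (c := (L : ℝ))).mono_fun
          ((measurable_deriv F).comp (measurable_id.const_add x)).aestronglyMeasurable
          (.of_forall fun s => ?_)
        simpa using hF.abs_deriv_le (x + s)
      rw [intervalIntegral.integral_sub (hii _ _) intervalIntegrable_const,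
        ← intervalIntegral.integral_add_adjacent_intervals (hii (-h) 0) (hii 0 h), ← h1,
        intervalIntegral.integral_symm, ← h2]
      simp only [intervalIntegral.integral_const, smul_eq_mul, ← sub_eq_add_neg]
      ring
    have hle : -h ≤ h := by linarith
    rw [e1, intervalIntegral.integral_of_le hle, ← integral_indicator measurableSet_Ioc]
    calc |∫ s, (Ioc (-h) h).indicator (fun s => deriv F (x + s) - deriv F x) s|
        ≤ ∫ s, |(Ioc (-h) h).indicator (fun s => deriv F (x + s) - deriv F x) s| :=
          abs_integral_le_integral_abs
      _ ≤ ∫ s, (C * h * χ s + K * (χ s * |q (x + s) - q x|)) := by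
          refine integral_mono_of_nonneg (.of_forall fun s => abs_nonneg _)
            ((hχi.const_mul _).add (hxi.const_mul _)) ?_
          filter_upwards [hx'] with s hs
          by_cases hsm : s ∈ Ioc (-h) h
          · have e : χ s = 1 := by simp [hχ, hsm]
            rw [e, indicator_of_mem hsm, one_mul, mul_one]
            refine hs.trans ?_
            rw [add_sub_cancel_left]
            gcongr
            exact abs_le.2 ⟨hsm.1.le, hsm.2⟩
          · have e : χ s = 0 := by simp [hχ, hsm]
            rw [e, indicator_of_notMem hsm]; simp
      _ = C * h * (2 * h) + K * ∫ s, χ s * |q (x + s) - q x| := by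
          rw [integral_add (hχi.const_mul _) (hxi.const_mul _), integral_const_mul,
            integral_const_mul, hχint]

/-! ### Discrete entropy inequality and consistency error of the scheme -/

namespace LaneModel

variable {N : ℕ} {P : LaneModel N} {K M lam h L : ℝ} {a b : Fin N → ℝ → ℝ}

/-- The spatial part of the Kruzkov entropy inequality for the profile `a`, the constant `α` and
the test function `ψ`. -/
def rate (P : LaneModel N) (k : Fin N) (a : Fin N → ℝ → ℝ) (α : ℝ) (ψ : ℝ → ℝ) : ℝ :=
  ∫ x, (kruzkov (P.f k) (a k x) α * P.speed k (a k) x * deriv ψ x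
    + Real.sign (a k x - α) * (P.source k a x - P.f k α * deriv (P.speed k (a k)) x) * ψ x)

/-- The discrete entropy inequality of the scheme. -/
lemma abs_step_sub_le (hP : P.Regular K) (hM : P.SpeedLE M) (hs : P.StepSize K M L lam h)
    (ha : ∀ j, IsDensity (a j)) (k : Fin N) (α x : ℝ) :
    |P.step lam h a k x - α| ≤ (|a k (x + h) - α| + |a k (x - h) - α|) / 2
      - lam / 2 * (kruzkov (P.f k) (a k (x + h)) α * P.speed k (a k) (x + h)
        - kruzkov (P.f k) (a k (x - h)) α * P.speed k (a k) (x - h))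
      + Real.sign (P.step lam h a k x - α)
        * (lam * h / 2 * (P.source k a (x + h) + P.source k a (x - h))
          - lam / 2 * P.f k α * (P.speed k (a k) (x + h) - P.speed k (a k) (x - h))) := by
  have hK := hP.nonneg
  have hM0 := hM.nonneg k
  have hst := (isDensity_step hP hM hs ha k).mem x
  -- Outside `[0, 1]` no bound by `K` is available for `f`. There all the signs are constant, so the
  -- inequality is an identity; the same holds for constants above `1`.
  by_cases hα0 : α < 0
  · have hp : ∀ p ∈ Icc (0 : ℝ) 1, |p - α| = p - α ∧ kruzkov (P.f k) p α = P.f k p - P.f k α :=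
      fun p hp => by
        have : 0 < p - α := by linarith [hp.1]
        exact ⟨abs_of_pos this, by unfold kruzkov; rw [Real.sign_of_pos this, one_mul]⟩
    rw [(hp _ hst).1, (hp _ ((ha k).mem (x + h))).1, (hp _ ((ha k).mem (x - h))).1,
      (hp _ ((ha k).mem (x + h))).2, (hp _ ((ha k).mem (x - h))).2,
      Real.sign_of_pos (by linarith [hst.1])]
    unfold step laxFriedrichs
    apply le_of_eq; ring
  by_cases hα1 : 1 < α
  · have hp : ∀ p ∈ Icc (0 : ℝ) 1, |p - α| = -(p - α) ∧
        kruzkov (P.f k) p α = -(P.f k p - P.f k α) := fun p hp => by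
        have : p - α < 0 := by linarith [hp.2]
        exact ⟨abs_of_neg this, by unfold kruzkov; rw [Real.sign_of_neg this]; ring⟩
    rw [(hp _ hst).1, (hp _ ((ha k).mem (x + h))).1, (hp _ ((ha k).mem (x - h))).1,
      (hp _ ((ha k).mem (x + h))).2, (hp _ ((ha k).mem (x - h))).2,
      Real.sign_of_neg (by linarith [hst.2])]
    unfold step laxFriedrichs
    apply le_of_eq; ring
  have hα : α ∈ Icc (0 : ℝ) 1 := ⟨not_lt.1 hα0, not_lt.1 hα1⟩
  have hab : ∀ y, |lam * P.speed k (a k) y * (P.f k (a k y) - P.f k α)| ≤ |a k y - α| := by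
    intro y
    rw [abs_mul, abs_mul, abs_of_pos hs.lam_pos]
    calc lam * |P.speed k (a k) y| * |P.f k (a k y) - P.f k α|
        ≤ lam * M * (K * |a k y - α|) := by
          have := hs.lam_pos
          gcongr
          · exact hM k y _ (avg_mem hP (ha k) y)
          · exact hP.bdd.f_lip k _ ((ha k).mem y) _ hα
      _ = lam * K * M * |a k y - α| := by ring
      _ ≤ |a k y - α| := mul_le_of_le_one_left (abs_nonneg _) (hs.ratio hK hM0)
  have h1 := abs_laxFriedrichs_sub_le (f := P.f k) (V := P.speed k (a k)) (lam := lam) (h := h)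
    (a := a k) (b := fun _ => α) hab x
  set s := P.step lam h a k x with hsdef
  set l := laxFriedrichs (P.f k) (P.speed k (a k)) lam h (a k) x with hl
  set lα := laxFriedrichs (P.f k) (P.speed k (a k)) lam h (fun _ => α) x with hlα
  -- Constants are not stationary when the velocity varies. This defect produces the term with `P.f
  -- k α` and the difference of velocities. Multiplying by the sign of the new value minus `α` keeps
  -- defect and source as linear terms rather than absolute values.
  have e1 : lα = α - lam / 2 * P.f k α * (P.speed k (a k) (x + h) - P.speed k (a k) (x - h)) := by
    rw [hlα]; unfold laxFriedrichs; ring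
  have e2 : s - α = (l - lα) + (lam * h / 2 * (P.source k a (x + h) + P.source k a (x - h))
      - lam / 2 * P.f k α * (P.speed k (a k) (x + h) - P.speed k (a k) (x - h))) := by
    rw [e1, hsdef]; unfold step; ring
  have e3 := sign_mul_le_abs (s - α) (l - lα)
  calc |s - α| = Real.sign (s - α) * (s - α) := (sign_mul_self_eq_abs _).symm
    _ = Real.sign (s - α) * (l - lα) + Real.sign (s - α)
        * (lam * h / 2 * (P.source k a (x + h) + P.source k a (x - h))
          - lam / 2 * P.f k α * (P.speed k (a k) (x + h) - P.speed k (a k) (x - h))) := by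
        rw [← mul_add, ← e2]
    _ ≤ _ := by linarith

lemma measurable_kruzkov_const (hA : P.Admissible) (k : Fin N) {c : ℝ → ℝ} (hc : Measurable c)
    (α : ℝ) : Measurable (fun x => kruzkov (P.f k) (c x) α) :=
  (continuous_kruzkov (continuous_f hA k)).measurable.comp (hc.prodMk measurable_const)

end LaneModel

namespace LaneModel

variable {N : ℕ} {P : LaneModel N} {K M lam h L : ℝ} {a b : Fin N → ℝ → ℝ} {ψ m : ℝ → ℝ}

lemma abs_sub_le_one_add {p : ℝ} (hp : p ∈ Icc (0 : ℝ) 1) (α : ℝ) : |p - α| ≤ 1 + |α| := by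
  refine (abs_sub _ _).trans ?_
  rw [abs_of_nonneg hp.1]
  linarith [hp.2]

lemma abs_kruzkov_mul_speed_le (hP : P.Regular K) (hM : P.SpeedLE M) (k : Fin N) {c : ℝ → ℝ}
    (hc : IsDensity c) (α x : ℝ) :
    |kruzkov (P.f k) (c x) α * P.speed k c x| ≤ (K * c x + |P.f k α|) * M := by
  have hK := hP.nonneg
  rw [abs_mul]
  exact mul_le_mul (abs_kruzkov_f_le_add hP.bdd k (hc.mem x) α)
    (hM k x _ (avg_mem hP hc x)) (abs_nonneg _)
    (add_nonneg (mul_nonneg hK (hc.mem x).1) (abs_nonneg _))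

lemma abs_kruzkov_mul_speed_le' (hP : P.Regular K) (hM : P.SpeedLE M) (k : Fin N) {c : ℝ → ℝ}
    (hc : IsDensity c) (α x : ℝ) :
    |kruzkov (P.f k) (c x) α * P.speed k c x| ≤ (K + |P.f k α|) * M := by
  have hK := hP.nonneg
  have hM0 := hM.nonneg k
  refine (abs_kruzkov_mul_speed_le hP hM k hc α x).trans ?_
  gcongr
  exact mul_le_of_le_one_right hK (hc.mem x).2

lemma measurable_kruzkov_mul_speed (hP : P.Regular K) (k : Fin N) {c : ℝ → ℝ} (hc : IsDensity c)
    (α : ℝ) :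
    Measurable (fun x => kruzkov (P.f k) (c x) α * P.speed k c x) :=
  (measurable_kruzkov_const hP.adm k hc.measurable α).mul (speed_comp_add_measurable hP k hc)

lemma measurable_sign_sub {c : ℝ → ℝ} (hc : Measurable c) (α : ℝ) :
    Measurable (fun x => Real.sign (c x - α)) :=
  measurable_real_sign.comp (hc.sub_const α)

/-- The density `w` under the sign is separated from the profiles `b` that determine velocity and
source, so that in a limit the latter can be frozen. The number `F` instead of `|P.f k α|` provides
one dominating function for a whole sequence of constants. -/
lemma abs_rate_integrand_le (hP : P.Regular K) (hM : P.SpeedLE M) (k : Fin N) {w : ℝ → ℝ}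
    (hw : IsDensity w) (hb : ∀ j, IsDensity (b j)) {α F : ℝ} (hF : |P.f k α| ≤ F) (ψ : ℝ → ℝ)
    (x : ℝ) :
    |kruzkov (P.f k) (w x) α * P.speed k (b k) x * deriv ψ x
      + Real.sign (w x - α) * (P.source k b x - P.f k α * deriv (P.speed k (b k)) x) * ψ x|
    ≤ (K + F) * M * |deriv ψ x| + (2 * K * N + F * (K + 2 * K ^ 2)) * |ψ x| := by
  have hK := hP.nonneg
  have hM0 := hM.nonneg k
  have hF0 : 0 ≤ F := (abs_nonneg _).trans hF
  refine (abs_add_le _ _).trans (add_le_add ?_ ?_)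
  · rw [abs_mul, abs_mul]
    refine mul_le_mul_of_nonneg_right (mul_le_mul ?_ (hM k x _ (avg_mem hP (hb k) x))
      (abs_nonneg _) (by positivity)) (abs_nonneg _)
    refine (abs_kruzkov_f_le_add hP.bdd k (hw.mem x) α).trans (add_le_add ?_ hF)
    exact mul_le_of_le_one_right hK (hw.mem x).2
  · rw [abs_mul]
    refine mul_le_mul_of_nonneg_right ?_ (abs_nonneg _)
    refine (abs_sign_mul_le _ _).trans ((abs_sub _ _).trans ?_)
    rw [abs_mul]
    exact add_le_add (abs_source_le_card hP k hb x)
      (mul_le_mul hF (abs_deriv_speed_le hP k (hb k) x) (abs_nonneg _) hF0)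

lemma measurable_rate_integrand (hP : P.Regular K) (k : Fin N) {w : ℝ → ℝ} (hw : IsDensity w)
    (hb : ∀ j, IsDensity (b j)) (α : ℝ) (hψ : IsTest ψ m) :
    Measurable (fun x => kruzkov (P.f k) (w x) α * P.speed k (b k) x * deriv ψ x
      + Real.sign (w x - α) * (P.source k b x - P.f k α * deriv (P.speed k (b k)) x) * ψ x) :=
  (((measurable_kruzkov_const hP.adm k hw.measurable α).mul
    (speed_comp_add_measurable hP k (hb k))).mul (measurable_deriv ψ)).add
    (((measurable_sign_sub hw.measurable α).mul ((measurable_source hP k hb).sub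
      ((measurable_deriv _).const_mul _))).mul hψ.continuous.measurable)

lemma integrable_rate_bound (hψ : IsTest ψ m) (C D : ℝ) :
    Integrable (fun x => C * |deriv ψ x| + D * |ψ x|) :=
  (hψ.integrable_deriv.abs.const_mul _).add (hψ.integrable_fun.abs.const_mul _)

lemma integrable_rate (hP : P.Regular K) (hM : P.SpeedLE M) (k : Fin N) {w : ℝ → ℝ}
    (hw : IsDensity w) (hb : ∀ j, IsDensity (b j)) (α : ℝ) (hψ : IsTest ψ m) :
    Integrable (fun x => kruzkov (P.f k) (w x) α * P.speed k (b k) x * deriv ψ x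
      + Real.sign (w x - α) * (P.source k b x - P.f k α * deriv (P.speed k (b k)) x) * ψ x) :=
  (integrable_rate_bound hψ _ _).mono'
    (measurable_rate_integrand hP k hw hb α hψ).aestronglyMeasurable
    (.of_forall (abs_rate_integrand_le hP hM k hw hb le_rfl ψ))

set_option maxHeartbeats 1600000 in
/-- The rounding error of one step, tested with a function whose derivatives are at most `1`. -/
theorem exists_entropy_error (hP : P.Regular K) (hM : P.SpeedLE M) (hM0 : 0 ≤ M) (hlam : 0 < lam)
    {B μ Λ : ℝ} (hB0 : 0 ≤ B) (hμ0 : 0 ≤ μ) (hΛ0 : 0 ≤ Λ) :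
    ∃ C, 0 ≤ C ∧ ∀ (L h : ℝ) (a : Fin N → ℝ → ℝ), P.StepSize K M L lam h →
      (∀ j, IsDensity (a j)) → (∀ δ, ∑ j, ∫ x, |a j (x + δ) - a j x| ≤ B * |δ|) →
      (∑ j, ∫ x, a j x ≤ μ) → (∑ j, ∫ x, |P.step lam h a j x - a j x| ≤ Λ * (lam * h)) →
      ∀ k, ∃ E : ℝ → ℝ, Integrable E ∧ (∀ x, 0 ≤ E x) ∧ ∫ x, E x ≤ C * (lam * h * h) ∧
        ∀ (α : ℝ) (ψ m : ℝ → ℝ), IsTest ψ m →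
          ∫ x, |P.step lam h a k x - α| * ψ x ≤ (∫ x, |a k x - α| * ψ x)
            + lam * h * P.rate k (P.step lam h a) α ψ
            + ∫ x, m x * ((1 + |P.f k α|) * E x + C * (lam * h * h) * (|α| + |P.f k α|)) := by
  have hK := hP.nonneg
  set CV := K + 2 * K ^ 2 with hCV
  have hCV0 : 0 ≤ CV := by positivity
  -- `C₁` is the `L¹` size of the error function in units of `lam * h * h`. `C₂` collects the
  -- coefficients of the terms that carry only `|α|` or `|P.f k α|` and no integrable factor. Both
  -- are fixed before `h` and the profile are given.
  set C₁ := μ / lam + K * M * μ + (K * M * Λ + K ^ 3 * Λ * μ) * lam + (4 * K * B + 4 * K ^ 2 * μ)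
    + 4 * K * Λ * lam + 2 * K ^ 2 * B + 2 * K ^ 2 * Λ * lam with hC₁
  set C₂ := 1 / lam + M + K ^ 2 * Λ * lam + CV * (1 + 2 * K) + CV * K * Λ * lam with hC₂
  have hC₁0 : 0 ≤ C₁ := by positivity
  have hC₂0 : 0 ≤ C₂ := by positivity
  refine ⟨C₁ + C₂, by positivity, fun L h a hs ha hTV hm hΛ k => ?_⟩
  have hh := hs.h_pos
  set τ := lam * h with hτ
  have hτ0 : 0 < τ := by positivity
  set b := P.step lam h a with hb
  have hbd : ∀ j, IsDensity (b j) := isDensity_step hP hM hs ha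
  have hTVk : ∀ δ, ∫ x, |a k (x + δ) - a k x| ≤ B * |δ| := fun δ =>
    (integral_abs_le_sum (fun j x => a j (x + δ) - a j x) k).trans (hTV δ)
  have hmk : ∫ x, a k x ≤ μ :=
    (integral_le_sum ha k).trans hm
  have hmbk : ∫ x, b k x ≤ μ :=
    (integral_le_sum hbd k).trans
      ((sum_integral_step hP hM ha).trans_le hm)
  have hΛk : ∫ x, |b k x - a k x| ≤ Λ * τ :=
    (integral_abs_le_sum (fun j x => b j x - a j x) k).trans hΛ
  set Va := P.speed k (a k) with hVa
  set Vb := P.speed k (b k) with hVb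
  set r := P.source k a with hr
  set rb := P.source k b with hrb
  -- the error of the symmetric difference quotient of the velocity
  obtain ⟨e₂, he₂i, he₂0, he₂, he₂ae⟩ :=
    (lipschitzWith_speed hP k (ha k)).exists_abs_central_difference_le
      (q := deriv (P.avg (a k))) (c := 2 * K * B) (C := CV * (1 + 2 * K)) (K := K) (h := h)
      (integrable_deriv_avg hP (ha k).integrable (fun x => by
        rw [abs_of_nonneg ((ha k).mem x).1]; exact ((ha k).mem x).2)).1 (by positivity)
      (by positivity) hh.le
      (fun s => ((integrable_deriv_avg_shift_sub hP (ha k) s).2).trans (by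
        rw [mul_assoc (2 * K)]; gcongr; exact hTVk s))
      (by
        have hd := ae_differentiableAt_avg hP (ha k)
        filter_upwards [hd] with x hx
        filter_upwards [hd] with y hy
        refine (abs_deriv_speed_sub_le hP k (ha k) (ha k) hy hx).trans ?_
        rw [mul_assoc CV]
        gcongr
        linarith [abs_avg_sub_avg_le hP (ha k) y x])
  set e₁ : ℝ → ℝ := fun x => |deriv (P.avg (b k)) x - deriv (P.avg (a k)) x| with he₁
  have he₁i := integrable_deriv_avg_sub hP (hbd k) (ha k)
  have he₁ae := ae_abs_deriv_speed_sub_le hP k (hbd k) (ha k)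
  have ira := integrable_source hP k ha
  have irb := integrable_source hP k hbd
  set d : ℝ → ℝ := fun x => |b k x - a k x| with hd
  set ρ₁ : ℝ → ℝ := fun x => |r (x + h) - r x| with hρ₁
  set ρ₂ : ℝ → ℝ := fun x => |r (x + -h) - r x| with hρ₂
  set ρ₃ : ℝ → ℝ := fun x => |rb x - r x| with hρ₃
  have id : Integrable d := integrable_abs_sub (hbd k).integrable (ha k).integrable
  have iρ₁ : Integrable ρ₁ := integrable_abs_sub (ira.comp_add_right h) ira
  have iρ₂ : Integrable ρ₂ := integrable_abs_sub (ira.comp_add_right (-h)) ira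
  have iρ₃ : Integrable ρ₃ := integrable_abs_sub irb ira
  have ie₁ : Integrable e₁ := he₁i.1.abs
  -- All errors with an integrable factor. The sign in the discrete inequality belongs to the new
  -- value, so the rate is evaluated at `b`; the terms with `d`, `b k`, `ρ₃` and `e₁` pay for
  -- exchanging `a` with `b`, the others for replacing differences by derivatives or removing
  -- shifts.
  set E : ℝ → ℝ := fun x => (h ^ 2 + lam * K * M * h ^ 2) * a k x + τ * K * M * d x
    + τ * (K ^ 3 * (Λ * τ)) * b k x + τ / 2 * ρ₁ x + τ / 2 * ρ₂ x + τ * ρ₃ x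
    + lam / 2 * K * e₂ x + τ * K * e₁ x with hE
  have i1 := (ha k).integrable.const_mul (h ^ 2 + lam * K * M * h ^ 2)
  have i2 := id.const_mul (τ * K * M)
  have i3 := (hbd k).integrable.const_mul (τ * (K ^ 3 * (Λ * τ)))
  have i4 := iρ₁.const_mul (τ / 2)
  have i5 := iρ₂.const_mul (τ / 2)
  have i6 := iρ₃.const_mul τ
  have i7 := he₂i.const_mul (lam / 2 * K)
  have i8 := ie₁.const_mul (τ * K)
  have hEi : Integrable E := ((((((i1.add i2).add i3).add i4).add i5).add i6).add i7).add i8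
  have hE0 : ∀ x, 0 ≤ E x := fun x => by
    have h1 := ((ha k).mem x).1
    have h2 := ((hbd k).mem x).1
    have h3 := he₂0 x
    simp only [hE, hd, hρ₁, hρ₂, hρ₃, he₁]
    positivity
  refine ⟨E, hEi, hE0, ?_, fun α ψ m hψ => ?_⟩
  · have hsplit : ∫ x, E x = (h ^ 2 + lam * K * M * h ^ 2) * (∫ x, a k x) + τ * K * M * (∫ x, d x)
        + τ * (K ^ 3 * (Λ * τ)) * (∫ x, b k x) + τ / 2 * (∫ x, ρ₁ x) + τ / 2 * (∫ x, ρ₂ x)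
        + τ * (∫ x, ρ₃ x) + lam / 2 * K * (∫ x, e₂ x) + τ * K * ∫ x, e₁ x := by
      simp only [← integral_const_mul]
      rw [← integral_add' i1 i2, ← integral_add' (i1.add i2) i3,
        ← integral_add' ((i1.add i2).add i3) i4, ← integral_add' (((i1.add i2).add i3).add i4) i5,
        ← integral_add' ((((i1.add i2).add i3).add i4).add i5) i6,
        ← integral_add' (((((i1.add i2).add i3).add i4).add i5).add i6) i7,
        ← integral_add' ((((((i1.add i2).add i3).add i4).add i5).add i6).add i7) i8]
      rfl
    have b4 : ∫ x, ρ₁ x ≤ 4 * K * (B * h) + 4 * K ^ 2 * h * μ := by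
      refine (integral_abs_source_shift_sub_le hP k ha h).trans ?_
      have := hTV h
      rw [abs_of_pos hh] at this ⊢
      gcongr
    have b5 : ∫ x, ρ₂ x ≤ 4 * K * (B * h) + 4 * K ^ 2 * h * μ := by
      refine (integral_abs_source_shift_sub_le hP k ha (-h)).trans ?_
      have := hTV (-h)
      rw [abs_neg, abs_of_pos hh] at this ⊢
      gcongr
    have b6 : ∫ x, ρ₃ x ≤ 4 * K * (Λ * τ) := by
      refine (integral_abs_source_sub_le hP k hbd ha).trans ?_
      gcongr
    have b8 : ∫ x, e₁ x ≤ 2 * K * (Λ * τ) := by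
      refine he₁i.2.trans ?_
      gcongr
    rw [hsplit]
    calc _ ≤ (h ^ 2 + lam * K * M * h ^ 2) * μ + τ * K * M * (Λ * τ)
        + τ * (K ^ 3 * (Λ * τ)) * μ + τ / 2 * (4 * K * (B * h) + 4 * K ^ 2 * h * μ)
        + τ / 2 * (4 * K * (B * h) + 4 * K ^ 2 * h * μ)
        + τ * (4 * K * (Λ * τ)) + lam / 2 * K * (2 * K * B * h * (2 * h))
        + τ * K * (2 * K * (Λ * τ)) := by gcongr
      _ = C₁ * (lam * h * h) := by
        simp only [hC₁, hτ]; field_simp; ring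
      _ ≤ (C₁ + C₂) * (τ * h) := by
        rw [hτ]; gcongr; linarith
  · -- the entropy inequality
    have h1 : |h| ≤ 1 := by rw [abs_of_pos hh]; exact hs.h_le
    have h1' : |-h| ≤ 1 := by rwa [abs_neg]
    have iψ := hψ.integrable_fun
    have iψp := hψ.integrable_self h1
    have iψm := hψ.integrable_self h1'
    have hψc := hψ.continuous.measurable
    set κ : ℝ → ℝ := fun x => kruzkov (P.f k) (a k x) α * Va x with hκ
    set κb : ℝ → ℝ := fun x => kruzkov (P.f k) (b k x) α * Vb x with hκb
    set σ : ℝ → ℝ := fun x => Real.sign (b k x - α) with hσ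
    have mκ : Measurable κ := measurable_kruzkov_mul_speed hP k (ha k) α
    have bκ : ∀ x, |κ x| ≤ (K + |P.f k α|) * M := abs_kruzkov_mul_speed_le' hP hM k (ha k) α
    have ma : Measurable (fun x => |a k x - α|) :=
      continuous_abs.measurable.comp ((ha k).measurable.sub_const α)
    have mb : Measurable (fun x => |b k x - α|) :=
      continuous_abs.measurable.comp ((hbd k).measurable.sub_const α)
    have ba : ∀ x, |(|a k x - α|)| ≤ 1 + |α| := fun x => by
      rw [abs_abs]; exact abs_sub_le_one_add ((ha k).mem x) α
    have bb : ∀ x, |(|b k x - α|)| ≤ 1 + |α| := fun x => by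
      rw [abs_abs]; exact abs_sub_le_one_add ((hbd k).mem x) α
    have mr := measurable_source hP k ha
    have mVa := speed_comp_add_measurable hP k (ha k)
    have mσ : Measurable σ := measurable_sign_sub (hbd k).measurable α
    have bVa : ∀ x, |Va x| ≤ M := fun x => hM k x _ (avg_mem hP (ha k) x)
    -- integrability of all the terms
    have q1 : Integrable (fun x => |b k x - α| * ψ x) := iψ.bdd_mul_of_abs_le mb bb
    have q2 : Integrable (fun x => |a k x - α| * ψ x) := iψ.bdd_mul_of_abs_le ma ba
    have q3 : Integrable (fun x => |a k (x + h) - α| * ψ x) :=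
      iψ.bdd_mul_of_abs_le (ma.comp (measurable_id.add_const h)) fun x => ba _
    have q4 : Integrable (fun x => |a k (x - h) - α| * ψ x) :=
      iψ.bdd_mul_of_abs_le (ma.comp (measurable_id.sub_const h)) fun x => ba _
    have q5 : Integrable (fun x => κ (x + h) * ψ x) :=
      iψ.bdd_mul_of_abs_le (mκ.comp (measurable_id.add_const h)) fun x => bκ _
    have q6 : Integrable (fun x => κ (x - h) * ψ x) :=
      iψ.bdd_mul_of_abs_le (mκ.comp (measurable_id.sub_const h)) fun x => bκ _
    have q3' : Integrable (fun x => |a k x - α| * ψ (x + -h)) := iψm.bdd_mul_of_abs_le ma ba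
    have q4' : Integrable (fun x => |a k x - α| * ψ (x + h)) := iψp.bdd_mul_of_abs_le ma ba
    have q5' : Integrable (fun x => κ x * ψ (x + -h)) := iψm.bdd_mul_of_abs_le mκ bκ
    have q6' : Integrable (fun x => κ x * ψ (x + h)) := iψp.bdd_mul_of_abs_le mκ bκ
    set g : ℝ → ℝ := fun x => σ x * (τ / 2 * (r (x + h) + r (x - h))
      - lam / 2 * P.f k α * (Va (x + h) - Va (x - h))) with hg
    have q7 : Integrable (fun x => g x * ψ x) := by
      refine iψ.bdd_mul_of_abs_le (mσ.mul ((((mr.comp (measurable_id.add_const h)).add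
        (mr.comp (measurable_id.sub_const h))).const_mul _).sub
        (((mVa.comp (measurable_id.add_const h)).sub
        (mVa.comp (measurable_id.sub_const h))).const_mul _)))
        (C := τ / 2 * (2 * K * N + 2 * K * N) + lam / 2 * |P.f k α| * (M + M)) fun x => ?_
      refine (abs_sign_mul_le _ _).trans ((abs_sub _ _).trans (add_le_add ?_ ?_))
      · rw [abs_mul, abs_of_pos (by positivity : 0 < τ / 2)]
        gcongr
        exact (abs_add_le _ _).trans (add_le_add (abs_source_le_card hP k ha _)
          (abs_source_le_card hP k ha _))
      · rw [abs_mul, abs_mul, abs_of_pos (by positivity : 0 < lam / 2)]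
        gcongr
        exact (abs_sub _ _).trans (add_le_add (bVa _) (bVa _))
    have q8 := integrable_rate hP hM k (hbd k) hbd α hψ
    have q9 : Integrable (fun x => m x * ((1 + |P.f k α|) * E x
        + (C₁ + C₂) * (τ * h) * (|α| + |P.f k α|))) := by
      refine ((hψ.integrable_mul (hEi.const_mul (1 + |P.f k α|))).add (hψ.integrable.mul_const ((C₁ + C₂) * (τ * h) * (|α| + |P.f k α|)))).congr
        (.of_forall fun x => ?_)
      simp only [Pi.add_apply]; ring
    -- summation by parts
    have hsum : ∫ x, |b k x - α| * ψ x
        ≤ ∫ x, (|a k x - α| * ((ψ (x + -h) + ψ (x + h)) / 2)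
          + lam / 2 * (κ x * (ψ (x + h) - ψ (x + -h))) + g x * ψ x) := by
      have t1 : ∫ x, |b k x - α| * ψ x
          ≤ ∫ x, (((|a k (x + h) - α| * ψ x + |a k (x - h) - α| * ψ x) / 2
            - lam / 2 * (κ (x + h) * ψ x - κ (x - h) * ψ x)) + g x * ψ x) := by
        refine integral_mono q1 ((((q3.add q4).div_const 2).sub
          ((q5.sub q6).const_mul _)).add q7) fun x => ?_
        have := mul_le_mul_of_nonneg_right (abs_step_sub_le hP hM hs ha k α x) (hψ.nonneg x)
        refine this.trans_eq ?_
        simp only [hκ, hg, hσ, hVa, hr, hb, hτ]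
        ring
      refine t1.trans_eq ?_
      have s1 : ∫ x, |a k (x + h) - α| * ψ x = ∫ x, |a k x - α| * ψ (x + -h) := by
        rw [← integral_comp_add (fun x => |a k x - α| * ψ (x + -h)) h]
        simp
      have s2 : ∫ x, |a k (x - h) - α| * ψ x = ∫ x, |a k x - α| * ψ (x + h) := by
        rw [← integral_comp_sub' (fun x => |a k x - α| * ψ (x + h)) h]
        simp
      have s3 : ∫ x, κ (x + h) * ψ x = ∫ x, κ x * ψ (x + -h) := by
        rw [← integral_comp_add (fun x => κ x * ψ (x + -h)) h]
        simp
      have s4 : ∫ x, κ (x - h) * ψ x = ∫ x, κ x * ψ (x + h) := by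
        rw [← integral_comp_sub' (fun x => κ x * ψ (x + h)) h]
        simp
      have j1 : Integrable (fun x => (|a k (x + h) - α| * ψ x + |a k (x - h) - α| * ψ x) / 2) :=
        (q3.add q4).div_const 2
      have j2 : Integrable (fun x => lam / 2 * (κ (x + h) * ψ x - κ (x - h) * ψ x)) :=
        (q5.sub q6).const_mul _
      have j1' : Integrable (fun x => |a k x - α| * ((ψ (x + -h) + ψ (x + h)) / 2)) :=
        ((q3'.add q4').div_const 2).congr (.of_forall fun x => by
          simp only [Pi.add_apply]; ring)
      have j2' : Integrable (fun x => lam / 2 * (κ x * (ψ (x + h) - ψ (x + -h)))) :=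
        ((q6'.sub q5').const_mul (lam / 2)).congr (.of_forall fun x => by
          simp only [Pi.sub_apply]; ring)
      have j12 : Integrable (fun x => (|a k (x + h) - α| * ψ x + |a k (x - h) - α| * ψ x) / 2
        - lam / 2 * (κ (x + h) * ψ x - κ (x - h) * ψ x)) := j1.sub j2
      have j12' : Integrable (fun x => |a k x - α| * ((ψ (x + -h) + ψ (x + h)) / 2)
          + lam / 2 * (κ x * (ψ (x + h) - ψ (x + -h)))) := j1'.add j2'
      rw [integral_add j12 q7, integral_add j12' q7, integral_sub j1 j2, integral_add j1' j2']
      congr 1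
      have u1 : ∫ x, |a k x - α| * ((ψ (x + -h) + ψ (x + h)) / 2)
          = ((∫ x, |a k x - α| * ψ (x + -h)) + ∫ x, |a k x - α| * ψ (x + h)) / 2 := by
        rw [← integral_add q3' q4', ← integral_div]
        exact integral_congr_ae (.of_forall fun x => by simp only; ring)
      have u2 : ∫ x, κ x * (ψ (x + h) - ψ (x + -h))
          = (∫ x, κ x * ψ (x + h)) - ∫ x, κ x * ψ (x + -h) := by
        rw [← integral_sub q6' q5']
        exact integral_congr_ae (.of_forall fun x => by simp only; ring)
      rw [integral_div, integral_add q3 q4, integral_const_mul, integral_sub q5 q6, s1, s2, s3,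
        s4, u1, integral_const_mul, u2]
      ring
    refine hsum.trans ?_
    have q8' := q8.const_mul τ
    unfold rate
    have q28 : Integrable (fun x => |a k x - α| * ψ x
        + τ * (kruzkov (P.f k) (b k x) α * P.speed k (b k) x * deriv ψ x
          + Real.sign (b k x - α) * (P.source k b x - P.f k α * deriv (P.speed k (b k)) x) * ψ x)) :=
      q2.add q8'
    rw [← integral_const_mul, ← integral_add q2 q8', ← integral_add q28 q9]
    have jl : Integrable (fun x => |a k x - α| * ((ψ (x + -h) + ψ (x + h)) / 2)
          + lam / 2 * (κ x * (ψ (x + h) - ψ (x + -h))) + g x * ψ x) := by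
      refine (((q3'.add q4').div_const 2).add ((q6'.sub q5').const_mul (lam / 2))).add q7 |>.congr
        (.of_forall fun x => ?_)
      simp only [Pi.add_apply, Pi.sub_apply]; ring
    refine integral_mono_ae jl (q28.add q9) ?_
    filter_upwards [he₂ae, he₁ae] with x hx₂ hx₁
    -- pointwise comparison
    have hmx := hψ.major_nonneg x
    have hψm : ψ x ≤ m x := by simpa using hψ.le x 0 (by simp)
    have hψ0 := hψ.nonneg x
    have hψ'm : |deriv ψ x| ≤ m x := by simpa using hψ.deriv_le x 0 (by simp)
    have tp := hψ.abs_taylor_le x h1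
    have tm := hψ.abs_taylor_le x h1'
    rw [neg_sq] at tm
    have hax := (ha k).mem x
    have hbx := (hbd k).mem x
    -- Four sources of error: averaging of the neighbours, the difference quotient of the test
    -- function, the exchange of `a` with `b` in the flux, and finally source and velocity
    -- derivative.
    have z1 : |a k x - α| * ((ψ (x + -h) + ψ (x + h)) / 2 - ψ x)
        ≤ (a k x + |α|) * (m x * h ^ 2) := by
      have w1 : |a k x - α| ≤ a k x + |α| := by
        refine (abs_sub _ _).trans_eq ?_
        rw [abs_of_nonneg hax.1]
      have w2 : (ψ (x + -h) + ψ (x + h)) / 2 - ψ x ≤ m x * h ^ 2 := by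
        linarith [le_of_abs_le tp, le_of_abs_le tm]
      exact (mul_le_mul_of_nonneg_left w2 (abs_nonneg _)).trans
        (mul_le_mul_of_nonneg_right w1 (by positivity))
    have z2 : lam / 2 * (κ x * (ψ (x + h) - ψ (x + -h))) - τ * (κ x * deriv ψ x)
        ≤ lam * ((K * a k x + |P.f k α|) * M) * (m x * h ^ 2) := by
      have w1 : |ψ (x + h) - ψ (x + -h) - 2 * h * deriv ψ x| ≤ 2 * (m x * h ^ 2) := by
        rw [abs_le]
        constructor <;> linarith [abs_le.1 tp, abs_le.1 tm]
      have w2 := abs_kruzkov_mul_speed_le hP hM k (ha k) α x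
      calc _ = lam / 2 * (κ x * (ψ (x + h) - ψ (x + -h) - 2 * h * deriv ψ x)) := by
            simp only [hτ]; ring
        _ ≤ lam / 2 * (|κ x| * |ψ (x + h) - ψ (x + -h) - 2 * h * deriv ψ x|) := by
            rw [← abs_mul]; gcongr; exact le_abs_self _
        _ ≤ lam / 2 * (((K * a k x + |P.f k α|) * M) * (2 * (m x * h ^ 2))) := by
            have := (abs_nonneg _).trans w2
            gcongr
        _ = _ := by ring
    have hVab : |Va x - Vb x| ≤ K ^ 2 * (Λ * τ) := by
      refine (abs_speed_sub_speed_le hP k (ha k) (hbd k) x).trans ?_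
      gcongr
      refine le_trans (le_of_eq ?_) hΛk
      simp only [hd, abs_sub_comm]
    have z3 : τ * (κ x * deriv ψ x) - τ * (κb x * deriv ψ x)
        ≤ τ * ((K * d x * M + (K * b k x + |P.f k α|) * (K ^ 2 * (Λ * τ))) * m x) := by
      have w1 : |κ x - κb x| ≤ K * d x * M + (K * b k x + |P.f k α|) * (K ^ 2 * (Λ * τ)) := by
        calc |κ x - κb x| = |(kruzkov (P.f k) (a k x) α - kruzkov (P.f k) (b k x) α) * Va x
              + kruzkov (P.f k) (b k x) α * (Va x - Vb x)| := by
              congr 1; simp only [hκ, hκb]; ring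
          _ ≤ _ := by
              refine (abs_add_le _ _).trans ?_
              rw [abs_mul, abs_mul]
              have w3 := abs_kruzkov_sub_le (hP.bdd.f_lip k) hax hbx α
              rw [abs_sub_comm (a k x)] at w3
              have w4 : 0 ≤ K * b k x + |P.f k α| :=
                add_nonneg (mul_nonneg hK hbx.1) (abs_nonneg _)
              have w5 := abs_kruzkov_f_le_add hP.bdd k hbx α
              have w6 := bVa x
              have w7 : 0 ≤ d x := abs_nonneg _
              change |kruzkov (P.f k) (a k x) α - kruzkov (P.f k) (b k x) α| ≤ K * d x at w3
              gcongr
      calc _ = τ * ((κ x - κb x) * deriv ψ x) := by ring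
        _ ≤ τ * (|κ x - κb x| * |deriv ψ x|) := by
            rw [← abs_mul]; gcongr; exact le_abs_self _
        _ ≤ _ := by
            have := (abs_nonneg _).trans w1
            gcongr
    have z4 : g x * ψ x - τ * (σ x * (rb x - P.f k α * deriv Vb x) * ψ x)
        ≤ (τ * (ρ₁ x / 2 + ρ₂ x / 2 + ρ₃ x)
          + |P.f k α| * (lam / 2 * (CV * (1 + 2 * K) * h * (2 * h) + K * e₂ x)
            + τ * (CV * K * (Λ * τ) + K * e₁ x))) * m x := by
      set G1 := τ / 2 * ((r (x + h) - r x) + (r (x + -h) - r x)) - τ * (rb x - r x) with hG1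
      set G2 := lam / 2 * (Va (x + h) - Va (x - h) - 2 * h * deriv Va x)
        - τ * (deriv Vb x - deriv Va x) with hG2
      have w0 : g x * ψ x - τ * (σ x * (rb x - P.f k α * deriv Vb x) * ψ x)
          = σ x * (G1 - P.f k α * G2) * ψ x := by
        simp only [hg, hG1, hG2, hτ, ← sub_eq_add_neg]; ring
      have w1 : |G1| ≤ τ * (ρ₁ x / 2 + ρ₂ x / 2 + ρ₃ x) := by
        calc |G1| ≤ |τ / 2 * ((r (x + h) - r x) + (r (x + -h) - r x))| + |τ * (rb x - r x)| :=
              abs_sub _ _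
          _ ≤ τ / 2 * (ρ₁ x + ρ₂ x) + τ * ρ₃ x := by
              rw [abs_mul, abs_mul, abs_of_pos hτ0, abs_of_pos (by positivity : 0 < τ / 2)]
              gcongr
              exact abs_add_le _ _
          _ = _ := by ring
      have w2 : |G2| ≤ lam / 2 * (CV * (1 + 2 * K) * h * (2 * h) + K * e₂ x)
            + τ * (CV * K * (Λ * τ) + K * e₁ x) := by
        refine (abs_sub _ _).trans ?_
        rw [abs_mul, abs_mul, abs_of_pos hτ0, abs_of_pos (by positivity : 0 < lam / 2)]
        gcongr
        refine hx₁.trans ?_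
        gcongr
      rw [w0]
      have w3 : σ x * (G1 - P.f k α * G2) ≤ |G1| + |P.f k α| * |G2| := by
        refine (sign_mul_le_abs _ _).trans ((abs_sub _ _).trans_eq ?_)
        rw [abs_mul]
      have w4 : 0 ≤ |G1| + |P.f k α| * |G2| := by positivity
      refine (mul_le_mul_of_nonneg_right w3 hψ0).trans
        ((mul_le_mul_of_nonneg_left hψm w4).trans ?_)
      gcongr
    change _ ≤ |a k x - α| * ψ x + τ * (κb x * deriv ψ x
      + σ x * (rb x - P.f k α * deriv Vb x) * ψ x)
      + m x * ((1 + |P.f k α|) * E x + (C₁ + C₂) * (τ * h) * (|α| + |P.f k α|))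
    have hfin : (a k x + |α|) * (m x * h ^ 2)
        + lam * ((K * a k x + |P.f k α|) * M) * (m x * h ^ 2)
        + τ * ((K * d x * M + (K * b k x + |P.f k α|) * (K ^ 2 * (Λ * τ))) * m x)
        + (τ * (ρ₁ x / 2 + ρ₂ x / 2 + ρ₃ x)
          + |P.f k α| * (lam / 2 * (CV * (1 + 2 * K) * h * (2 * h) + K * e₂ x)
            + τ * (CV * K * (Λ * τ) + K * e₁ x))) * m x
        ≤ m x * ((1 + |P.f k α|) * E x + (C₁ + C₂) * (τ * h) * (|α| + |P.f k α|)) := by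
      -- Terms with a density factor regroup into `E`, those with only `|α|` or `|P.f k α|` into the
      -- last bracket. The velocity errors `e₂` and `e₁` appear multiplied by `|P.f k α|`, which the
      -- factor `1 + |P.f k α|` in front of `E` absorbs.
      have y0 : (a k x + |α|) * (m x * h ^ 2)
        + lam * ((K * a k x + |P.f k α|) * M) * (m x * h ^ 2)
        + τ * ((K * d x * M + (K * b k x + |P.f k α|) * (K ^ 2 * (Λ * τ))) * m x)
        + (τ * (ρ₁ x / 2 + ρ₂ x / 2 + ρ₃ x)
          + |P.f k α| * (lam / 2 * (CV * (1 + 2 * K) * h * (2 * h) + K * e₂ x)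
            + τ * (CV * K * (Λ * τ) + K * e₁ x))) * m x
        = m x * ((E x - (lam / 2 * K * e₂ x + τ * K * e₁ x))
          + |P.f k α| * (lam / 2 * K * e₂ x + τ * K * e₁ x)
          + (1 / lam * (τ * h) * |α| + (M + K ^ 2 * Λ * lam + CV * (1 + 2 * K)
            + CV * K * Λ * lam) * (τ * h) * |P.f k α|)) := by
        simp only [hE, hτ]; field_simp; ring
      rw [y0]
      have y1 : 0 ≤ lam / 2 * K * e₂ x + τ * K * e₁ x := by
        have := he₂0 x
        have : 0 ≤ e₁ x := abs_nonneg _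
        positivity
      have y2 : lam / 2 * K * e₂ x + τ * K * e₁ x ≤ E x := by
        have h1 := hax.1
        have h2 := hbx.1
        have : 0 ≤ (h ^ 2 + lam * K * M * h ^ 2) * a k x + τ * K * M * d x
          + τ * (K ^ 3 * (Λ * τ)) * b k x + τ / 2 * ρ₁ x + τ / 2 * ρ₂ x + τ * ρ₃ x := by
          simp only [hd, hρ₁, hρ₂, hρ₃]
          positivity
        simp only [hE]; linarith
      have y3 : |P.f k α| * (lam / 2 * K * e₂ x + τ * K * e₁ x) ≤ |P.f k α| * E x :=
        mul_le_mul_of_nonneg_left y2 (abs_nonneg _)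
      have y4 : 1 / lam * (τ * h) * |α| ≤ (C₁ + C₂) * (τ * h) * |α| := by
        gcongr
        have : 0 ≤ M + K ^ 2 * Λ * lam + CV * (1 + 2 * K) + CV * K * Λ * lam := by positivity
        linarith
      have y5 : (M + K ^ 2 * Λ * lam + CV * (1 + 2 * K) + CV * K * Λ * lam) * (τ * h)
          * |P.f k α| ≤ (C₁ + C₂) * (τ * h) * |P.f k α| := by
        refine mul_le_mul_of_nonneg_right (mul_le_mul_of_nonneg_right ?_ (by positivity))
          (abs_nonneg _)
        have : 0 ≤ 1 / lam := by positivity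
        linarith
      refine mul_le_mul_of_nonneg_left ?_ hmx
      linarith
    linarith [z1, z2, z3, z4, hfin]

end LaneModel

/-! ### Approximate entropy solutions and the iterates of the scheme -/

namespace LaneModel

variable {N : ℕ} {P : LaneModel N} {K M lam h L : ℝ} {a b : Fin N → ℝ → ℝ} {ψ m : ℝ → ℝ}

/-- `u` satisfies the Kruzkov entropy inequalities of the model on `[0, T]` up to an error of size
`ε`, and obeys the bounds `μ` on the mass, `B` on the variation and `L` on the speed of change. -/
structure IsApprox (P : LaneModel N) (T μ B L ε : ℝ) (u : Fin N → ℝ → ℝ → ℝ) : Prop where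
  measurable : ∀ k, Measurable (fun p : ℝ × ℝ => u k p.1 p.2)
  measurable_deriv : ∀ k, Measurable (fun p : ℝ × ℝ => deriv (P.speed k (u k p.1)) p.2)
  density : ∀ k t, IsDensity (u k t)
  mass : ∀ t, ∑ j, ∫ x, u j t x ≤ μ
  shift : ∀ t δ, ∑ j, ∫ x, |u j t (x + δ) - u j t x| ≤ B * |δ|
  time : ∀ k s t, ∫ x, |u k s x - u k t x| ≤ L * |s - t| + ε
  -- The error function must not depend on `α` and `ψ`: later `α` becomes `w y` and `ψ` becomes a
  -- mollifier centred at `y`, and `y` is integrated over the line. Then the term with `E` gives a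
  -- convolution with `m`, and the other one is integrable because `|α| + |P.f k α|` is at most a
  -- multiple of `w y`.
  entropy : ∀ s t, 0 ≤ s → s ≤ t → t ≤ T → ∀ k, ∃ E : ℝ → ℝ, Integrable E ∧ (∀ x, 0 ≤ E x) ∧
    ∫ x, E x ≤ ε ∧ ∀ (α : ℝ) (ψ m : ℝ → ℝ), IsTest ψ m → ContDiff ℝ (⊤ : ℕ∞) ψ →
      HasCompactSupport ψ →
      ∫ x, |u k t x - α| * ψ x ≤ (∫ x, |u k s x - α| * ψ x)
        + (∫ r in s..t, P.rate k (fun j => u j r) α ψ)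
        + ((1 + |P.f k α|) * (∫ x, m x * E x) + ε * (|α| + |P.f k α|) * ∫ x, m x)

lemma _root_.IsTest.integral_nonneg (hψ : IsTest ψ m) : 0 ≤ ∫ x, m x :=
  MeasureTheory.integral_nonneg hψ.major_nonneg

/-- The constant in the bound for the entropy rate. -/
def rateBound (K M : ℝ) : ℝ := K * M + M + 2 * K + (K + 2 * K ^ 2)

lemma rateBound_nonneg (hK : 0 ≤ K) (hM : 0 ≤ M) : 0 ≤ rateBound K M := by
  unfold rateBound; positivity

/-- The two summands match the two kinds of error admitted in `IsApprox`, one weighted by densities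
and one by `|P.f k α|`. This pays for the mismatch between arbitrary times and times of the grid. -/
lemma abs_rate_le (hP : P.Regular K) (hM : P.SpeedLE M) (k : Fin N) (ha : ∀ j, IsDensity (a j))
    (α : ℝ) (hψ : IsTest ψ m) :
    |P.rate k a α ψ| ≤ rateBound K M * ((∫ x, m x * ∑ j, a j x) + |P.f k α| * ∫ x, m x) := by
  have hK := hP.nonneg
  have hM0 := hM.nonneg k
  have i1 : Integrable (fun x => ∑ j, a j x) :=
    integrable_finsetSum _ fun j _ => (ha j).integrable
  have i2 := hψ.integrable_mul i1
  have i3 : Integrable (fun x => |P.f k α| * m x) := hψ.integrable.const_mul _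
  rw [← integral_const_mul, ← integral_add i2 i3, ← integral_const_mul]
  refine abs_integral_le_integral_abs.trans
    (integral_mono (integrable_rate hP hM k (ha k) ha α hψ).abs ((i2.add i3).const_mul _) fun x => ?_)
  have h0 := hψ.major_nonneg x
  have h1 := abs_kruzkov_mul_speed_le hP hM k (ha k) α x
  have h2 : |deriv ψ x| ≤ m x := by simpa using hψ.deriv_le x 0 (by simp)
  have h3 : |ψ x| ≤ m x := by
    rw [abs_of_nonneg (hψ.nonneg x)]; simpa using hψ.le x 0 (by simp)
  have h4 := abs_source_le hP k ha x
  have h5 := abs_deriv_speed_le hP k (ha k) x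
  have h6 : a k x ≤ ∑ j, a j x :=
    Finset.single_le_sum (f := fun j => a j x) (fun j _ => ((ha j).mem x).1) (Finset.mem_univ k)
  have h7 := ((ha k).mem x).1
  have h8 : 0 ≤ ∑ j, a j x := h7.trans h6
  have h9 := abs_nonneg (P.f k α)
  calc _ ≤ (K * a k x + |P.f k α|) * M * m x
        + (2 * K * ∑ j, a j x + |P.f k α| * (K + 2 * K ^ 2)) * m x := by
        refine (abs_add_le _ _).trans (add_le_add ?_ ?_)
        · rw [abs_mul]
          exact mul_le_mul h1 h2 (abs_nonneg _) (by positivity)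
        · rw [abs_mul]
          refine mul_le_mul ?_ h3 (abs_nonneg _) (by positivity)
          refine (abs_sign_mul_le _ _).trans ((abs_sub _ _).trans (add_le_add h4 ?_))
          rw [abs_mul]; gcongr
    _ ≤ (K * (∑ j, a j x) + |P.f k α|) * M * m x
        + (2 * K * ∑ j, a j x + |P.f k α| * (K + 2 * K ^ 2)) * m x := by gcongr
    _ ≤ _ := by
        have e1 : 0 ≤ (∑ j, a j x) * m x := by positivity
        have e2 : 0 ≤ |P.f k α| * m x := by positivity
        have e3 : 0 ≤ M * ((∑ j, a j x) * m x) := by positivity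
        have e4 : 0 ≤ K * ((∑ j, a j x) * m x) := by positivity
        have e5 : 0 ≤ K ^ 2 * ((∑ j, a j x) * m x) := by positivity
        have e6 : 0 ≤ K * M * (|P.f k α| * m x) := by positivity
        have e7 : 0 ≤ K * (|P.f k α| * m x) := by positivity
        simp only [rateBound]
        nlinarith

/-- The iterates of the scheme. -/
def iterate (P : LaneModel N) (lam h : ℝ) (a : Fin N → ℝ → ℝ) : ℕ → Fin N → ℝ → ℝ
  | 0 => a
  | n + 1 => P.step lam h (P.iterate lam h a n)

section iterate

variable (hP : P.Regular K)
  (hM : P.SpeedLE M) (hs : P.StepSize K M L lam h)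
  (ha : ∀ j, IsDensity (a j))
include hP hM hs ha

lemma isDensity_iterate (n : ℕ) (j : Fin N) : IsDensity (P.iterate lam h a n j) := by
  induction n generalizing j with
  | zero => exact ha j
  | succ n ih => exact isDensity_step hP hM hs ih j

lemma sum_integral_iterate (n : ℕ) :
    ∑ j, ∫ x, P.iterate lam h a n j x = ∑ j, ∫ x, a j x := by
  induction n with
  | zero => rfl
  | succ n ih =>
    rw [← ih]
    exact sum_integral_step hP hM (isDensity_iterate hP hM hs ha n)

/-- Discrete Gronwall for the quantity variation plus one, with `1 + c τ ≤ exp (c τ)` in each step;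
the mass bound needed for a step persists by conservation. -/
lemma sum_integral_abs_iterate_shift_sub_le {B : ℝ} (hB0 : 0 ≤ B)
    (hTV : ∀ δ, ∑ j, ∫ x, |a j (x + δ) - a j x| ≤ B * |δ|) (hm : ∑ j, ∫ x, a j x ≤ K) (n : ℕ)
    (δ : ℝ) :
    ∑ j, ∫ x, |P.iterate lam h a n j (x + δ) - P.iterate lam h a n j x|
      ≤ (Real.exp (tvRate N K * (n * (lam * h))) * (B + 1) - 1) * |δ| := by
  have hK := hP.nonneg
  have hc := tvRate_nonneg (N := N) hK
  have hτ : 0 < lam * h := mul_pos hs.lam_pos hs.h_pos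
  induction n generalizing δ with
  | zero => simpa [iterate] using hTV δ
  | succ n ih =>
    set c := tvRate N K
    have hexp : 1 ≤ Real.exp (c * (n * (lam * h))) := Real.one_le_exp (by positivity)
    refine (sum_integral_abs_step_shift_sub_le hP hM hs
      (isDensity_iterate hP hM hs ha n) (by nlinarith) ih
      ((sum_integral_iterate hP hM hs ha n).trans_le hm) δ).trans ?_
    gcongr
    have e1 : Real.exp (c * ((n + 1 : ℕ) * (lam * h)))
        = Real.exp (c * (n * (lam * h))) * Real.exp (c * (lam * h)) := by
      rw [← Real.exp_add]; congr 1; push_cast; ring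
    have e2 := Real.add_one_le_exp (c * (lam * h))
    rw [e1]
    have e3 : Real.exp (c * (n * (lam * h))) * (c * (lam * h) + 1) * (B + 1)
        ≤ Real.exp (c * (n * (lam * h))) * Real.exp (c * (lam * h)) * (B + 1) := by gcongr
    linarith

lemma integral_abs_iterate_sub_le {Λ : ℝ} (n : ℕ)
    (hΛ : ∀ i < n, ∀ k, ∫ x, |P.iterate lam h a (i + 1) k x - P.iterate lam h a i k x|
      ≤ Λ * (lam * h)) {i j : ℕ} (hij : i ≤ j) (hj : j ≤ n) (k : Fin N) :
    ∫ x, |P.iterate lam h a j k x - P.iterate lam h a i k x| ≤ Λ * (lam * h) * (j - i) := by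
  induction j, hij using Nat.le_induction with
  | base => simp
  | succ j hij ih =>
    have hd := fun n => (isDensity_iterate hP hM hs ha n k).integrable
    have i1 := integrable_abs_sub (hd (j + 1)) (hd j)
    have i2 := integrable_abs_sub (hd j) (hd i)
    calc _ ≤ ∫ x, (|P.iterate lam h a (j + 1) k x - P.iterate lam h a j k x|
          + |P.iterate lam h a j k x - P.iterate lam h a i k x|) :=
          integral_mono (integrable_abs_sub (hd (j + 1)) (hd i)) (i1.add i2)
            fun x => abs_sub_le _ _ _
      _ ≤ Λ * (lam * h) + Λ * (lam * h) * (j - i) := by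
          rw [integral_add i1 i2]
          exact add_le_add (hΛ j hj k) (ih (by omega))
      _ = _ := by push_cast; ring

end iterate

end LaneModel

/-! ### Piecewise constant interpolation in time -/

/-- The index of the time step at time `t`, for `n` steps of length `τ`. -/
def stepIndex (τ : ℝ) (n : ℕ) (t : ℝ) : ℕ := min ⌈t / τ⌉₊ n

section stepIndex

variable {τ : ℝ} {n : ℕ}

lemma measurable_stepIndex (τ : ℝ) (n : ℕ) : Measurable (stepIndex τ n) :=
  (Nat.measurable_ceil.comp (measurable_id.div_const τ)).min measurable_const

lemma stepIndex_le (τ : ℝ) (n : ℕ) (t : ℝ) : stepIndex τ n t ≤ n := min_le_right _ _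

lemma stepIndex_mono (hτ : 0 < τ) : Monotone (stepIndex τ n) := fun s t hst =>
  min_le_min_right _ (Nat.ceil_mono (by gcongr))

lemma stepIndex_zero : stepIndex τ n 0 = 0 := by simp [stepIndex]

lemma stepIndex_eq_ceil (hτ : 0 < τ) {t : ℝ} (ht : t ≤ n * τ) :
    stepIndex τ n t = ⌈t / τ⌉₊ :=
  min_eq_left (Nat.ceil_le.2 ((div_le_iff₀ hτ).2 ht))

lemma le_stepIndex_mul (hτ : 0 < τ) {t : ℝ} (ht : t ≤ n * τ) : t ≤ stepIndex τ n t * τ := by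
  rw [stepIndex_eq_ceil hτ ht]
  exact (div_le_iff₀ hτ).1 (Nat.le_ceil _)

lemma stepIndex_mul_le (hτ : 0 < τ) {t : ℝ} (ht : 0 ≤ t) : stepIndex τ n t * τ ≤ t + τ := by
  have h1 : (stepIndex τ n t : ℝ) ≤ ⌈t / τ⌉₊ := by exact_mod_cast min_le_left _ _
  have h2 := (Nat.ceil_lt_add_one (div_nonneg ht hτ.le)).le
  calc _ ≤ (t / τ + 1) * τ := by gcongr; exact h1.trans h2
    _ = t + τ := by field_simp

lemma stepIndex_sub_mul_le (hτ : 0 < τ) {s t : ℝ} (hst : s ≤ t) :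
    ((stepIndex τ n t : ℝ) - stepIndex τ n s) * τ ≤ (t - s) + τ := by
  have h1 : ⌈t / τ⌉₊ ≤ ⌈s / τ⌉₊ + ⌈(t - s) / τ⌉₊ := by
    have : t / τ = s / τ + (t - s) / τ := by ring
    rw [this]; exact Nat.ceil_add_le _ _
  have h2 : stepIndex τ n t ≤ stepIndex τ n s + ⌈(t - s) / τ⌉₊ := by
    unfold stepIndex; omega
  have h3 : (stepIndex τ n t : ℝ) ≤ stepIndex τ n s + ⌈(t - s) / τ⌉₊ := by exact_mod_cast h2
  have h4 := (Nat.ceil_lt_add_one (div_nonneg (sub_nonneg.2 hst) hτ.le)).le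
  calc _ ≤ ((t - s) / τ + 1) * τ := by gcongr; linarith
    _ = _ := by field_simp

lemma stepIndex_of_mem (hτ : 0 < τ) {s r : ℝ} (hr : r ∈ Ioc s (stepIndex τ n s * τ))
    : stepIndex τ n r = stepIndex τ n s := by
  refine le_antisymm ?_ (stepIndex_mono hτ hr.1.le)
  exact (min_le_left _ _).trans (Nat.ceil_le.2 ((div_le_iff₀ hτ).2 hr.2))

/-- The ceiling assigns to an interval the iterate at its right end. This agrees with the one-step
entropy inequality, whose rate is evaluated at the new iterate, so sums of rates are exactly time
integrals of the interpolation. -/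
lemma stepIndex_of_mem_Ioc (hτ : 0 < τ) {l : ℕ} (hl : l < n) {r : ℝ}
    (hr : r ∈ Ioc (l * τ) ((l + 1 : ℕ) * τ)) : stepIndex τ n r = l + 1 := by
  have h1 : ⌈r / τ⌉₊ = l + 1 := by
    rw [Nat.ceil_eq_iff (by omega)]
    exact ⟨by simpa using (lt_div_iff₀ hτ).2 hr.1, (div_le_iff₀ hτ).2 hr.2⟩
  unfold stepIndex; omega

lemma intervalIntegrable_comp_stepIndex (g : ℕ → ℝ) (s t : ℝ) :
    IntervalIntegrable (fun r => g (stepIndex τ n r)) volume s t := by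
  obtain ⟨G, hG⟩ := ((Finset.range (n + 1)).image fun i => |g i|).bddAbove
  refine (intervalIntegrable_const (c := G)).mono_fun
    ((measurable_from_nat (f := g)).comp (measurable_stepIndex τ n)).aestronglyMeasurable
    (.of_forall fun r => ?_)
  have : |g (stepIndex τ n r)| ≤ G := hG (by
    simp only [Finset.coe_image, mem_image, Finset.coe_range, mem_Iio]
    exact ⟨_, Nat.lt_succ_of_le (stepIndex_le τ n r), rfl⟩)
  exact this.trans (le_abs_self G)

lemma integral_comp_stepIndex_of_mem (hτ : 0 < τ) (g : ℕ → ℝ) {s : ℝ} (hs : s ≤ n * τ) :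
    ∫ r in s..(stepIndex τ n s * τ), g (stepIndex τ n r)
      = (stepIndex τ n s * τ - s) * g (stepIndex τ n s) := by
  have hle := le_stepIndex_mul hτ hs
  rw [intervalIntegral.integral_of_le hle,
    setIntegral_congr_fun measurableSet_Ioc (g := fun _ => g (stepIndex τ n s))
      (fun r hr => by simp only [stepIndex_of_mem hτ hr]),
    ← intervalIntegral.integral_of_le hle]
  simp

lemma integral_comp_stepIndex_step (hτ : 0 < τ) (g : ℕ → ℝ) {l : ℕ} (hl : l < n) :
    ∫ r in (l * τ)..((l + 1 : ℕ) * τ), g (stepIndex τ n r) = τ * g (l + 1) := by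
  have hle : l * τ ≤ (l + 1 : ℕ) * τ := by gcongr; simp
  rw [intervalIntegral.integral_of_le hle,
    setIntegral_congr_fun measurableSet_Ioc (g := fun _ => g (l + 1))
      (fun r hr => by simp only [stepIndex_of_mem_Ioc hτ hl hr]),
    ← intervalIntegral.integral_of_le hle, intervalIntegral.integral_const, smul_eq_mul]
  push_cast; ring

/-- The one-step inequalities add up between grid times only. The grid interval differs from the
given one by at most one step at each end, and on these pieces the integrand is constant. -/
lemma integral_comp_stepIndex_le (hτ : 0 < τ) (g : ℕ → ℝ) {s t : ℝ} (hs0 : 0 ≤ s) (ht0 : 0 ≤ t)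
    (hs : s ≤ n * τ) (ht : t ≤ n * τ) :
    ∫ r in (stepIndex τ n s * τ)..(stepIndex τ n t * τ), g (stepIndex τ n r)
      ≤ (∫ r in s..t, g (stepIndex τ n r))
        + τ * (|g (stepIndex τ n s)| + |g (stepIndex τ n t)|) := by
  have hi := fun a b => intervalIntegrable_comp_stepIndex (τ := τ) (n := n) g a b
  have e1 := intervalIntegral.integral_add_adjacent_intervals
    (hi s (stepIndex τ n s * τ)) (hi (stepIndex τ n s * τ) (stepIndex τ n t * τ))
  have e2 := intervalIntegral.integral_add_adjacent_intervals (hi s t) (hi t (stepIndex τ n t * τ))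
  rw [integral_comp_stepIndex_of_mem hτ g hs] at e1
  rw [integral_comp_stepIndex_of_mem hτ g ht] at e2
  have b : ∀ s, 0 ≤ s → s ≤ n * τ → |(stepIndex τ n s * τ - s) * g (stepIndex τ n s)|
      ≤ τ * |g (stepIndex τ n s)| := fun s h0 h1 => by
    have := le_stepIndex_mul hτ h1
    have := stepIndex_mul_le (n := n) hτ h0
    rw [abs_mul, abs_of_nonneg (show 0 ≤ stepIndex τ n s * τ - s by linarith)]
    gcongr; linarith
  linarith [abs_le.1 (b s hs0 hs), abs_le.1 (b t ht0 ht)]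

end stepIndex

/-! ### Existence of approximate entropy solutions -/

namespace LaneModel

variable {N : ℕ} {P : LaneModel N} {K M lam h L : ℝ} {a b : Fin N → ℝ → ℝ} {ψ m : ℝ → ℝ}

/-- The bound for the speed of change of the scheme in `L¹` per lane. -/
def speedBound (K M B lam : ℝ) : ℝ :=
  B / lam + K * M * B + K * (K + 2 * K ^ 2) * K + 2 * K * K

set_option maxHeartbeats 1000000 in
/-- Existence of approximate entropy solutions: the scheme converges. -/
theorem exists_isApprox (hP : P.Regular K) (hM : P.SpeedLE M) (hM0 : 0 ≤ M) {T : ℝ} (hT : 0 < T)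
    (ha : ∀ j, IsDensity (a j)) (hm : ∑ j, ∫ x, a j x ≤ K) {B V : ℝ} (hB0 : 0 ≤ B) (hV : B ≤ V)
    (hTV : ∀ δ, ∑ j, ∫ x, |a j (x + δ) - a j x| ≤ B * |δ|) {ε : ℝ} (hε : 0 < ε) :
    ∃ u : Fin N → ℝ → ℝ → ℝ,
      P.IsApprox T K (Real.exp (tvRate N K * T) * (V + 1))
        (speedBound K M (Real.exp (tvRate N K * T) * (V + 1)) (1 / (2 * K * M + 1))) ε u ∧
      (∀ k, u k 0 = a k) ∧ (∀ t, ∑ j, ∫ x, u j t x = ∑ j, ∫ x, a j x) ∧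
      ∀ t, 0 ≤ t → ∀ δ, ∑ j, ∫ x, |u j t (x + δ) - u j t x|
        ≤ (Real.exp (tvRate N K * (t + ε)) * (B + 1) - 1) * |δ| := by
  have hK := hP.nonneg
  have hc := tvRate_nonneg (N := N) hK
  obtain ⟨L, hL0, hL⟩ : ∃ L : ℝ, 0 ≤ L ∧ ∀ k u v, |P.g k u - P.g k v| ≤ L * |u - v| :=
    exists_lipschitz_g hP.adm
  -- This ratio makes `lam * K * M ≤ 1 / 2` and stays positive even if `K * M = 0`; the other half
  -- of the mesh condition is left for the source, through small `τ`.
  set lam := 1 / (2 * K * M + 1) with hlam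
  have hlam0 : 0 < lam := by positivity
  have hV0 : 0 ≤ V := hB0.trans hV
  set B' := Real.exp (tvRate N K * T) * (V + 1) with hP.bdd'
  have hP.bdd'0 : 0 ≤ B' := by positivity
  set Λ := speedBound K M B' lam with hΛ
  have hΛ0 : 0 ≤ Λ := by unfold speedBound at hΛ; rw [hΛ]; positivity
  obtain ⟨C, hC0, hC⟩ := exists_entropy_error hP hM hM0 hlam0 hP.bdd'0 hK
    (mul_nonneg (Nat.cast_nonneg (α := ℝ) N) hΛ0)
  have hr0 := rateBound_nonneg hK hM0
  -- the choice of the step size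
  obtain ⟨n, hn⟩ := exists_nat_gt (T * (1 + 1 / lam + 4 * ((K + L) * M) + (Λ + 1
    + C * T / lam + 2 * rateBound K M * (K + 1)) / ε))
  have hn0 : (0 : ℝ) < n := lt_of_le_of_lt (by positivity) hn
  set τ := T / n with hτ
  have hτ0 : 0 < τ := by positivity
  have hTn : (n : ℝ) * τ = T := by rw [hτ]; field_simp
  have hτle : τ * (1 + 1 / lam + 4 * ((K + L) * M) + (Λ + 1
    + C * T / lam + 2 * rateBound K M * (K + 1)) / ε) ≤ 1 := by
    rw [hτ, div_mul_eq_mul_div]; exact (div_le_one hn0).2 hn.le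
  -- The number of steps was chosen to satisfy one inequality for a sum. Since all the summands are
  -- non-negative, the separate requirements, namely `h ≤ 1`, the mesh condition and the size of the
  -- error, can be read off from it.
  have f1 : 0 ≤ τ * (1 / lam) := by positivity
  have f2 : 0 ≤ τ * (4 * ((K + L) * M)) := by positivity
  have f3 : 0 ≤ τ * ((Λ + 1 + C * T / lam + 2 * rateBound K M * (K + 1)) / ε) := by positivity
  have hτε : τ * (Λ + 1 + C * T / lam + 2 * rateBound K M * (K + 1)) ≤ ε := by
    have : τ * ((Λ + 1 + C * T / lam + 2 * rateBound K M * (K + 1)) / ε) ≤ 1 := by linarith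
    rwa [← mul_div_assoc, div_le_one hε] at this
  have g1 : 0 ≤ τ * Λ := by positivity
  have g2 : 0 ≤ τ * (C * T / lam) := by positivity
  have g3 : 0 ≤ τ * (2 * rateBound K M * (K + 1)) := by positivity
  set h := τ / lam with hh
  have hlh : lam * h = τ := by rw [hh]; field_simp
  have hs : P.StepSize K M L lam h := by
    refine ⟨hlam0, by positivity, ?_, hL0, hL, ?_⟩
    · rw [hh, div_eq_mul_one_div]; linarith
    · rw [hlh]
      have : lam * K * M ≤ 1 / 2 := by
        rw [hlam, mul_assoc, one_div_mul_eq_div, div_le_div_iff₀ (by positivity) (by norm_num)]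
        nlinarith [mul_nonneg hK hM0]
      linarith
  set U := P.iterate lam h a with hU
  have hUd := isDensity_iterate hP hM hs ha
  have hUm := sum_integral_iterate hP hM hs ha
  have hUs := sum_integral_abs_iterate_shift_sub_le hP hM hs ha hB0 hTV hm
  rw [hlh] at hUs
  have hUs' : ∀ i ≤ n, ∀ δ, ∑ j, ∫ x, |U i j (x + δ) - U i j x| ≤ B' * |δ| := fun i hi δ => by
    refine (hUs i δ).trans ?_
    gcongr
    have : (i : ℝ) * τ ≤ T := by rw [← hTn]; gcongr
    have e : Real.exp (tvRate N K * (i * τ)) * (B + 1) ≤ B' := by rw [hP.bdd']; gcongr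
    linarith
  have hUt : ∀ i < n, ∀ k, ∫ x, |U (i + 1) k x - U i k x| ≤ Λ * (lam * h) := fun i hi k => by
    refine (integral_abs_step_sub_le hP hM hs (hUd i) (hUs' i hi.le)
      ((hUm i).trans_le hm) k).trans_eq ?_
    rw [hΛ, speedBound]; ring
  have hUij : ∀ i j, i ≤ j → j ≤ n → ∀ k, ∫ x, |U j k x - U i k x| ≤ Λ * (((j : ℝ) - i) * τ) :=
    fun i j hij hj k => by
      refine (integral_abs_iterate_sub_le hP hM hs ha n hUt hij hj k).trans_eq ?_
      rw [hlh]; ring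
  set ι := stepIndex τ n with hι
  have hιm : Measurable ι := measurable_stepIndex τ n
  have hmeas : ∀ F : ℕ → ℝ → ℝ, (∀ i, Measurable (F i)) →
      Measurable (fun p : ℝ × ℝ => F (ι p.1) p.2) := fun F hF => by
    have h1 : Measurable (fun q : ℕ × ℝ => F q.1 q.2) := measurable_from_prod_countable_right hF
    exact h1.comp ((hιm.comp measurable_fst).prodMk measurable_snd)
  refine ⟨fun k t => U (ι t) k, ⟨?_, ?_, ?_, ?_, ?_, ?_, ?_⟩, ?_, ?_, ?_⟩
  · exact fun k => hmeas (fun i => U i k) fun i => (hUd i k).measurable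
  · exact fun k => hmeas (fun i => deriv (P.speed k (U i k))) fun i => measurable_deriv _
  · exact fun k t => hUd _ k
  · exact fun t => (hUm _).trans_le hm
  · exact fun t δ => hUs' _ (stepIndex_le _ _ _) δ
  · have key : ∀ k s t, s ≤ t → ∫ x, |U (ι t) k x - U (ι s) k x| ≤ Λ * (t - s) + ε :=
      fun k s t hst => by
      refine (hUij _ _ (stepIndex_mono hτ0 hst) (stepIndex_le _ _ _) k).trans ?_
      have := stepIndex_sub_mul_le (n := n) hτ0 hst
      calc _ ≤ Λ * ((t - s) + τ) := by gcongr
        _ ≤ _ := by linarith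
    intro k s t
    rcases le_total s t with hst | hst
    · rw [abs_sub_comm s t, abs_of_nonneg (sub_nonneg.2 hst)]
      simpa only [abs_sub_comm] using key k s t hst
    · rw [abs_of_nonneg (sub_nonneg.2 hst)]
      exact key k t s hst
  · intro s t hs0 hst htT k
    -- The condition `i < n` stands inside the existential, so that `choose` gives a family indexed
    -- by all natural numbers.
    have herr : ∀ i, ∃ E : ℝ → ℝ, i < n → Integrable E ∧ (∀ x, 0 ≤ E x) ∧
        ∫ x, E x ≤ C * (τ * h) ∧ ∀ (α : ℝ) (ψ m : ℝ → ℝ), IsTest ψ m →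
          ∫ x, |U (i + 1) k x - α| * ψ x ≤ (∫ x, |U i k x - α| * ψ x)
            + τ * P.rate k (U (i + 1)) α ψ
            + ∫ x, m x * ((1 + |P.f k α|) * E x + C * (τ * h) * (|α| + |P.f k α|)) := by
      intro i
      by_cases hi : i < n
      · obtain ⟨E, h1, h2, h3, h4⟩ := hC L h (U i) hs (hUd i) (hUs' i hi.le)
          ((hUm i).trans_le hm) (by
            refine (Finset.sum_le_sum fun j _ => hUt i hi j).trans_eq ?_
            simp; ring) k
        rw [hlh] at h3 h4
        exact ⟨E, fun _ => ⟨h1, h2, h3, h4⟩⟩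
      · exact ⟨0, fun h => absurd h hi⟩
    choose E hE using herr
    set i := ι s with hi
    set j := ι t with hj
    have hij : i ≤ j := stepIndex_mono hτ0 hst
    have hjn : j ≤ n := stepIndex_le _ _ _
    have hEi : ∀ l ∈ Finset.Ico i j, l < n := fun l hl => by
      have := (Finset.mem_Ico.1 hl).2; omega
    have iS : ∀ q, Integrable (fun x => ∑ l, U q l x) := fun q =>
      integrable_finsetSum _ fun l _ => (hUd q l).integrable
    have nS : ∀ q x, 0 ≤ ∑ l, U q l x := fun q x => Finset.sum_nonneg fun l _ => ((hUd q l).mem x).1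
    have mS : ∀ q, ∫ x, ∑ l, U q l x ≤ K := fun q => by
      rw [integral_finsetSum _ fun l _ => (hUd q l).integrable]
      exact (hUm q).trans_le hm
    have iSE : ∀ l, j = l ∨ l < j → i ≤ l → Integrable (fun x => ∑ q ∈ Finset.Ico i l, E q x) :=
      fun l hl _ => integrable_finsetSum _ fun q hq => (hE q (by
        have := (Finset.mem_Ico.1 hq).2; omega)).1
    -- The part of the error that accounts for the incomplete time steps at `s` and `t`, with the
    -- total densities of the two profiles involved.
    set Sx : ℝ → ℝ := fun x => τ * rateBound K M * ((∑ l, U i l x) + ∑ l, U j l x) with hSx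
    have iSx : Integrable Sx := ((iS i).add (iS j)).const_mul _
    have hsum := iSE j (Or.inl rfl) hij
    refine ⟨fun x => (∑ q ∈ Finset.Ico i j, E q x) + Sx x, hsum.add iSx, fun x => ?_, ?_, ?_⟩
    · refine add_nonneg (Finset.sum_nonneg fun q hq => (hE q (hEi q hq)).2.1 x) ?_
      have := nS i x; have := nS j x
      simp only [hSx]; positivity
    · rw [integral_add hsum iSx, integral_finsetSum _ fun q hq => (hE q (hEi q hq)).1]
      have e1 : ∑ q ∈ Finset.Ico i j, ∫ x, E q x ≤ C * T / lam * τ := by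
        calc _ ≤ ∑ q ∈ Finset.Ico i j, C * (τ * h) :=
              Finset.sum_le_sum fun q hq => (hE q (hEi q hq)).2.2.1
          _ = ((j - i : ℕ) : ℝ) * (C * (τ * h)) := by simp
          _ ≤ n * (C * (τ * h)) := by
              gcongr; omega
          _ = C * (n * τ) / lam * τ := by rw [hh]; ring
          _ = _ := by rw [hTn]
      have e2 : ∫ x, Sx x ≤ τ * rateBound K M * (K + K) := by
        rw [hSx, integral_const_mul, integral_add (iS i) (iS j)]
        gcongr
        · exact mS i
        · exact mS j
      have e3 : 0 ≤ τ * rateBound K M := by positivity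
      linarith
    · intro α ψ m hψ _ _
      have hmi := hψ.integral_nonneg
      have hf := abs_nonneg (P.f k α)
      -- Sum of the one-step inequalities from index `i` to `l`, with the sum of the rates already
      -- written as an integral over the grid interval.
      have hind : ∀ l, i ≤ l → l ≤ j → ∫ x, |U l k x - α| * ψ x
          ≤ (∫ x, |U i k x - α| * ψ x)
            + (∫ r in (i * τ)..(l * τ), P.rate k (U (ι r)) α ψ)
            + ((1 + |P.f k α|) * (∫ x, m x * ∑ q ∈ Finset.Ico i l, E q x)
              + ((l : ℝ) - i) * (C * (τ * h)) * (|α| + |P.f k α|) * ∫ x, m x) := by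
        intro l hil
        induction l, hil using Nat.le_induction with
        | base => intro _; simp
        | succ l hil ih =>
          intro hlj
          have hln : l < n := by omega
          have h1 := ih (by omega)
          have h2 := (hE l hln).2.2.2 α ψ m hψ
          have w1 := hψ.integrable_mul (hE l hln).1
          have w2 := hψ.integrable_mul (iSE l (by omega) hil)
          have e1 : ∫ x, m x * ((1 + |P.f k α|) * E l x + C * (τ * h) * (|α| + |P.f k α|))
              = (1 + |P.f k α|) * (∫ x, m x * E l x)
                + C * (τ * h) * (|α| + |P.f k α|) * ∫ x, m x := by
            rw [← integral_const_mul, ← integral_const_mul,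
              ← integral_add (w1.const_mul _) (hψ.integrable.const_mul _)]
            exact integral_congr_ae (.of_forall fun x => by simp only; ring)
          have e2 : ∫ x, m x * ∑ q ∈ Finset.Ico i (l + 1), E q x
              = (∫ x, m x * ∑ q ∈ Finset.Ico i l, E q x) + ∫ x, m x * E l x := by
            rw [← integral_add w2 w1]
            refine integral_congr_ae (.of_forall fun x => ?_)
            simp only
            rw [Finset.sum_Ico_succ_top hil, mul_add]
          have e3 : ∫ r in (i * τ)..((l + 1 : ℕ) * τ), P.rate k (U (ι r)) α ψ
              = (∫ r in (i * τ)..(l * τ), P.rate k (U (ι r)) α ψ)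
                + τ * P.rate k (U (l + 1)) α ψ := by
            rw [← integral_comp_stepIndex_step hτ0 (fun q => P.rate k (U q) α ψ) hln]
            exact (intervalIntegral.integral_add_adjacent_intervals
              (intervalIntegrable_comp_stepIndex (fun q => P.rate k (U q) α ψ) _ _)
              (intervalIntegrable_comp_stepIndex (fun q => P.rate k (U q) α ψ) _ _)).symm
          rw [e1] at h2
          rw [e2, e3]
          push_cast
          linarith
      have h1 := hind j hij le_rfl
      have h2 := integral_comp_stepIndex_le (n := n) hτ0 (fun q => P.rate k (U q) α ψ) hs0
        (hs0.trans hst) ((hst.trans htT).trans_eq hTn.symm) (htT.trans_eq hTn.symm)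
      have h3 := abs_rate_le hP hM k (hUd i) α hψ
      have h4 := abs_rate_le hP hM k (hUd j) α hψ
      have w2 := hψ.integrable_mul hsum
      have w3 := hψ.integrable_mul iSx
      have e1 : ∫ x, m x * ((∑ q ∈ Finset.Ico i j, E q x) + Sx x)
          = (∫ x, m x * ∑ q ∈ Finset.Ico i j, E q x) + ∫ x, m x * Sx x := by
        rw [← integral_add w2 w3]
        exact integral_congr_ae (.of_forall fun x => by simp only; ring)
      have e2 : ∫ x, m x * Sx x = τ * rateBound K M * ((∫ x, m x * ∑ l, U i l x)
          + ∫ x, m x * ∑ l, U j l x) := by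
        rw [← integral_add (hψ.integrable_mul (iS i)) (hψ.integrable_mul (iS j)),
          ← integral_const_mul]
        exact integral_congr_ae (.of_forall fun x => by simp only [hSx]; ring)
      have e3 : 0 ≤ ∫ x, m x * Sx x := integral_nonneg fun x => mul_nonneg (hψ.major_nonneg x) (by
        have := nS i x; have := nS j x
        simp only [hSx]; positivity)
      have e4 : ((j : ℝ) - i) * (C * (τ * h)) ≤ C * T / lam * τ := by
        have : (j : ℝ) - i ≤ n := by
          have : (j : ℝ) ≤ n := by exact_mod_cast hjn
          have := Nat.cast_nonneg (α := ℝ) i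
          linarith
        calc _ ≤ n * (C * (τ * h)) := by gcongr
          _ = C * (n * τ) / lam * τ := by rw [hh]; ring
          _ = _ := by rw [hTn]
      have e5 : τ * (|P.rate k (U i) α ψ| + |P.rate k (U j) α ψ|)
          ≤ (∫ x, m x * Sx x) + 2 * rateBound K M * τ * |P.f k α| * ∫ x, m x := by
        rw [e2]
        have := mul_le_mul_of_nonneg_left (add_le_add h3 h4) hτ0.le
        refine this.trans_eq ?_
        ring
      have e6 : ((j : ℝ) - i) * (C * (τ * h)) * (|α| + |P.f k α|) * (∫ x, m x)
          + 2 * rateBound K M * τ * |P.f k α| * (∫ x, m x)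
          ≤ ε * (|α| + |P.f k α|) * ∫ x, m x := by
        have q1 : ((j : ℝ) - i) * (C * (τ * h)) * (|α| + |P.f k α|)
            ≤ C * T / lam * τ * (|α| + |P.f k α|) := by gcongr
        have q2 : 2 * rateBound K M * τ * |P.f k α|
            ≤ 2 * rateBound K M * τ * (|α| + |P.f k α|) := by
          gcongr; linarith [abs_nonneg α]
        have q3 : (C * T / lam * τ + 2 * rateBound K M * τ) * (|α| + |P.f k α|)
            ≤ ε * (|α| + |P.f k α|) := by
          gcongr
          have : 0 ≤ τ * (2 * rateBound K M * K) := by positivity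
          linarith
        rw [← add_mul]
        gcongr
        linarith
      have e7 : (∫ x, m x * Sx x) ≤ (1 + |P.f k α|) * ∫ x, m x * Sx x :=
        le_mul_of_one_le_left e3 (by linarith)
      rw [e1, mul_add]
      change _ ≤ (∫ x, |U i k x - α| * ψ x) + (∫ r in s..t, P.rate k (U (ι r)) α ψ) + _
      change (∫ r in (i * τ)..(j * τ), P.rate k (U (ι r)) α ψ) ≤ (∫ r in s..t, P.rate k (U (ι r)) α ψ)
        + τ * (|P.rate k (U i) α ψ| + |P.rate k (U j) α ψ|) at h2
      linarith
  · intro k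
    simp only [hι, stepIndex_zero]
    rfl
  · exact fun t => hUm _
  · intro t ht δ
    refine (hUs _ δ).trans ?_
    have h1 := stepIndex_mul_le (n := n) hτ0 ht
    have h2 : τ ≤ ε := by linarith
    gcongr
    linarith

end LaneModel

/-! ### Compactly supported test functions and mollifiers -/

lemma exists_isTest {ψ : ℝ → ℝ} (hψ : ContDiff ℝ 2 ψ) (hs : HasCompactSupport ψ) (h0 : ∀ x, 0 ≤ ψ x)
    : ∃ m, IsTest ψ m := by
  have hc1 : Continuous (deriv ψ) := hψ.continuous_deriv (by norm_num)
  have hc2 : Continuous (deriv (deriv ψ)) :=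
    (((contDiff_succ_iff_deriv (n := 1)).1 hψ).2.2).continuous_deriv (by norm_num)
  have hs1 := hs.deriv
  have hs2 := hs1.deriv
  obtain ⟨C₀, hC₀⟩ := hs.exists_bound_of_continuous hψ.continuous
  obtain ⟨C₁, hC₁⟩ := hs1.exists_bound_of_continuous hc1
  obtain ⟨C₂, hC₂⟩ := hs2.exists_bound_of_continuous hc2
  obtain ⟨r, hr⟩ := hs.isCompact.isBounded.subset_closedBall 0
  set C := max C₀ (max C₁ C₂) with hC
  have hCnn : 0 ≤ C := ((norm_nonneg _).trans (hC₀ 0)).trans (le_max_left _ _)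
  have key : ∀ g : ℝ → ℝ, tsupport g ⊆ tsupport ψ → (∀ x, ‖g x‖ ≤ C) → ∀ x s : ℝ, |s| ≤ 1 →
      |g (x + s)| ≤ (Icc (-(r + 1)) (r + 1)).indicator (fun _ => C) x := by
    intro g hg hb x s hsx
    by_cases hx : x ∈ Icc (-(r + 1)) (r + 1)
    · rw [indicator_of_mem hx]; exact hb _
    · rw [indicator_of_notMem hx]
      have : x + s ∉ tsupport g := fun hmem => by
        have h1 := hr (hg hmem)
        rw [mem_closedBall_zero_iff, Real.norm_eq_abs, abs_le] at h1
        rw [abs_le] at hsx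
        exact hx ⟨by linarith, by linarith⟩
      rw [image_eq_zero_of_notMem_tsupport this, abs_zero]
  have t1 : tsupport (deriv ψ) ⊆ tsupport ψ := tsupport_deriv_subset
  refine ⟨(Icc (-(r + 1)) (r + 1)).indicator (fun _ => C), hψ, h0, fun x s hsx => ?_,
    key _ t1 fun x => (hC₁ x).trans ((le_max_left _ _).trans (le_max_right _ _)),
    key _ (tsupport_deriv_subset.trans t1)
      fun x => (hC₂ x).trans ((le_max_right _ _).trans (le_max_right _ _)),
    measurable_const.indicator measurableSet_Icc,
    (integrable_indicator_iff measurableSet_Icc).2 (integrableOn_const (by simp)), C,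
    fun x => indicator_le_self' (fun _ _ => hCnn) x⟩
  exact (le_abs_self _).trans (key ψ subset_rfl (fun x => (hC₀ x).trans (le_max_left _ _)) x s hsx)

lemma IsTest.comp_sub {ψ m : ℝ → ℝ} (hψ : IsTest ψ m) (y : ℝ) :
    IsTest (fun x => ψ (x - y)) (fun x => m (x - y)) := by
  have e1 : deriv (fun x => ψ (x - y)) = fun x => deriv ψ (x - y) := by
    ext x; exact deriv_comp_sub_const ..
  have e2 : deriv (deriv (fun x => ψ (x - y))) = fun x => deriv (deriv ψ) (x - y) := by
    rw [e1]; ext x; exact deriv_comp_sub_const ..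
  have es : ∀ x s, x + s - y = (x - y) + s := fun x s => by ring
  refine ⟨hψ.smooth.comp (contDiff_id.sub contDiff_const), fun x => hψ.nonneg _,
    fun x s hs => ?_, fun x s hs => ?_, fun x s hs => ?_,
    hψ.measurable.comp (measurable_id.sub_const y), hψ.integrable.comp_sub_right y, ?_⟩
  · rw [es]; exact hψ.le _ _ hs
  · rw [e1]; simp only [es]; exact hψ.deriv_le _ _ hs
  · rw [e2]; simp only [es]; exact hψ.deriv_deriv_le _ _ hs
  · obtain ⟨C, hC⟩ := hψ.bdd
    exact ⟨C, fun x => hC _⟩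

lemma IsTest.abs_sub_le {ψ m : ℝ → ℝ} (hψ : IsTest ψ m) (x : ℝ) {s : ℝ} (hs : |s| ≤ 1) :
    |ψ (x + s) - ψ x| ≤ m x * |s| := by
  have hb : ∀ z ∈ Icc (x - 1) (x + 1), ‖deriv ψ z‖ ≤ m x := fun z hz => by
    have := hψ.deriv_le x (z - x) (abs_le.2 ⟨by linarith [hz.1], by linarith [hz.2]⟩)
    simpa using this
  have hs' := abs_le.1 hs
  have := Convex.norm_image_sub_le_of_norm_deriv_le (f := ψ) (s := Icc (x - 1) (x + 1))
    (fun z _ => hψ.differentiable z) hb (convex_Icc _ _)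
    (x := x) (y := x + s) ⟨by linarith, by linarith⟩ ⟨by linarith, by linarith⟩
  simpa using this

/-- `ρ` is an even smooth probability density supported in `[-δ, δ]`. -/
structure IsMollifier (ρ : ℝ → ℝ) (δ : ℝ) : Prop where
  smooth : ContDiff ℝ (⊤ : ℕ∞) ρ
  nonneg : ∀ x, 0 ≤ ρ x
  even : ∀ x, ρ (-x) = ρ x
  eq_zero : ∀ x, δ < |x| → ρ x = 0
  compact : HasCompactSupport ρ
  integral : ∫ x, ρ x = 1

lemma exists_isMollifier {δ : ℝ} (hδ : 0 < δ) : ∃ ρ, IsMollifier ρ δ := by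
  let b : ContDiffBump (0 : ℝ) := ⟨δ / 2, δ, by positivity, by linarith⟩
  refine ⟨b.normed volume, b.contDiff_normed, b.nonneg_normed, fun x => b.normed_neg x,
    fun x hx => ?_, b.hasCompactSupport_normed, b.integral_normed⟩
  have : x ∉ Function.support (b.normed volume) := by
    rw [b.support_normed_eq]
    simpa using hx.le
  simpa using this

namespace IsMollifier

variable {ρ : ℝ → ℝ} {δ : ℝ}

lemma continuous (h : IsMollifier ρ δ) : Continuous ρ := h.smooth.continuous

lemma smooth_two (h : IsMollifier ρ δ) : ContDiff ℝ 2 ρ :=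
  contDiff_infty.1 h.smooth 2

lemma continuous_deriv (h : IsMollifier ρ δ) : Continuous (deriv ρ) :=
  h.smooth_two.continuous_deriv (by norm_num)

lemma integrable (h : IsMollifier ρ δ) : Integrable ρ :=
  h.continuous.integrable_of_hasCompactSupport h.compact

lemma integrable_deriv (h : IsMollifier ρ δ) : Integrable (deriv ρ) :=
  h.continuous_deriv.integrable_of_hasCompactSupport h.compact.deriv

lemma deriv_neg (h : IsMollifier ρ δ) (x : ℝ) : deriv ρ (-x) = -deriv ρ x := by
  have e : (fun x => ρ (-x)) = ρ := funext h.even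
  have := deriv_comp_neg ρ x
  rw [e] at this
  rw [this, neg_neg]

lemma exists_isTest (h : IsMollifier ρ δ) : ∃ m, IsTest ρ m :=
  _root_.exists_isTest h.smooth_two h.compact h.nonneg

lemma mul_le_mul_of_abs_le (h : IsMollifier ρ δ) {z c c' : ℝ} (hc : |z| ≤ δ → c ≤ c') :
    c * ρ z ≤ c' * ρ z := by
  by_cases hz : |z| ≤ δ
  · exact mul_le_mul_of_nonneg_right (hc hz) (h.nonneg z)
  · rw [h.eq_zero z (not_le.1 hz)]; simp

lemma integral_snd (h : IsMollifier ρ δ) (x : ℝ) : ∫ y, ρ (x - y) = 1 := by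
  rw [integral_sub_left_eq_self ρ volume x, h.integral]

lemma integral_fst (h : IsMollifier ρ δ) (y : ℝ) : ∫ x, ρ (x - y) = 1 := by
  rw [integral_sub_right_eq_self ρ y, h.integral]

lemma integral_prod_fst (h : IsMollifier ρ δ) {w : ℝ → ℝ} (hw : Integrable w) :
    ∫ p : ℝ × ℝ, w p.1 * ρ (p.1 - p.2) ∂(volume.prod volume) = ∫ x, w x := by
  rw [integral_prod _ (integrable_prod_mul_comp_sub_left h.integrable hw)]
  simp only [integral_const_mul, h.integral_snd, mul_one]

lemma integral_prod_snd (h : IsMollifier ρ δ) {w : ℝ → ℝ} (hw : Integrable w) :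
    ∫ p : ℝ × ℝ, w p.2 * ρ (p.1 - p.2) ∂(volume.prod volume) = ∫ x, w x := by
  rw [integral_prod_symm _ (integrable_prod_mul_comp_sub h.integrable hw)]
  simp only [integral_const_mul, h.integral_fst, mul_one]

/-- Doubling of variables: integrability of the mollified distance. -/
lemma integrable_abs_sub_mul (h : IsMollifier ρ δ) {F H : ℝ → ℝ} (hF : Integrable F)
    (hH : Integrable H) :
    Integrable (fun p : ℝ × ℝ => |F p.1 - H p.2| * ρ (p.1 - p.2)) (volume.prod volume) := by
  refine ((integrable_prod_mul_comp_sub_left h.integrable hF).sub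
    (integrable_prod_mul_comp_sub h.integrable hH)).abs.congr (.of_forall fun p => ?_)
  simp only [Pi.sub_apply]
  rw [← sub_mul, abs_mul, abs_of_nonneg (h.nonneg _)]

lemma integral_abs_self_sub_mul_le (h : IsMollifier ρ δ) {F : ℝ → ℝ} (hF : Integrable F) {c : ℝ}
    (hc : ∀ s, ∫ x, |F (x + s) - F x| ≤ c * |s|) :
    ∫ p : ℝ × ℝ, |F p.1 - F p.2| * ρ (p.1 - p.2) ∂(volume.prod volume) ≤ c * δ := by
  have hc0 : 0 ≤ c := by
    have := (integral_nonneg fun x => abs_nonneg _).trans (hc 1)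
    simpa using this
  have h1 : Integrable (fun p : ℝ × ℝ => ρ p.2 * |F (p.1 + p.2) - F p.1|)
      (volume.prod volume) := by
    refine ((integrable_prod_mul_comp_add h.integrable hF).sub
      (hF.mul_prod h.integrable)).abs.congr (.of_forall fun p => ?_)
    simp only [Pi.sub_apply]
    rw [mul_comm (F p.1), ← mul_sub, abs_mul, abs_of_nonneg (h.nonneg _)]
  calc _ = ∫ y, ∫ x, |F x - F y| * ρ (x - y) :=
        integral_prod_symm _ (h.integrable_abs_sub_mul hF hF)
    _ = ∫ y, ∫ z, ρ z * |F (y + z) - F y| := by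
        congr 1; ext y
        rw [← integral_comp_add (fun x => |F x - F y| * ρ (x - y)) y]
        refine integral_congr_ae (.of_forall fun z => ?_)
        simp only
        rw [add_sub_cancel_right, add_comm z y, mul_comm]
    _ = ∫ z, ∫ y, ρ z * |F (y + z) - F y| := integral_integral_swap h1
    _ ≤ ∫ z, ρ z * (c * δ) := by
        refine integral_mono h1.integral_prod_right (h.integrable.mul_const _) fun z => ?_
        simp only [integral_const_mul]
        rw [mul_comm, mul_comm (ρ z)]
        refine h.mul_le_mul_of_abs_le fun hz => (hc z).trans ?_
        gcongr
    _ = c * δ := by rw [integral_mul_const, h.integral, one_mul]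

/-- With `integral_abs_sub_le` this shows that the mollified and the true distance differ by at most
`c * δ`. Only the function `F` needs a bound on its translates; `H` may be any integrable function.
-/
lemma integral_abs_sub_mul_le (h : IsMollifier ρ δ) {F H : ℝ → ℝ} (hF : Integrable F)
    (hH : Integrable H) {c : ℝ} (hc : ∀ s, ∫ x, |F (x + s) - F x| ≤ c * |s|) :
    ∫ p : ℝ × ℝ, |F p.1 - H p.2| * ρ (p.1 - p.2) ∂(volume.prod volume)
      ≤ (∫ x, |F x - H x|) + c * δ := by
  have hi : Integrable (fun x => |F x - H x|) := (hF.sub hH).abs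
  have h1 := integrable_prod_mul_comp_sub h.integrable hi
  have h2 := h.integrable_abs_sub_mul hF hF
  calc _ ≤ ∫ p : ℝ × ℝ, (|F p.2 - H p.2| * ρ (p.1 - p.2) + |F p.1 - F p.2| * ρ (p.1 - p.2))
        ∂(volume.prod volume) := by
        refine integral_mono (h.integrable_abs_sub_mul hF hH) (h1.add h2) fun p => ?_
        simp only
        rw [← add_mul]
        refine mul_le_mul_of_nonneg_right ?_ (h.nonneg _)
        linarith [abs_sub_le (F p.1) (F p.2) (H p.2)]
    _ ≤ _ := by
        rw [integral_add h1 h2, h.integral_prod_snd hi]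
        gcongr
        exact h.integral_abs_self_sub_mul_le hF hc

lemma integral_abs_sub_le (h : IsMollifier ρ δ) {F H : ℝ → ℝ} (hF : Integrable F)
    (hH : Integrable H) {c : ℝ} (hc : ∀ s, ∫ x, |F (x + s) - F x| ≤ c * |s|) :
    ∫ x, |F x - H x|
      ≤ (∫ p : ℝ × ℝ, |F p.1 - H p.2| * ρ (p.1 - p.2) ∂(volume.prod volume)) + c * δ := by
  have hi : Integrable (fun x => |F x - H x|) := (hF.sub hH).abs
  have h1 := h.integrable_abs_sub_mul hF hH
  have h2 := h.integrable_abs_sub_mul hF hF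
  calc _ = ∫ p : ℝ × ℝ, |F p.2 - H p.2| * ρ (p.1 - p.2) ∂(volume.prod volume) :=
        (h.integral_prod_snd hi).symm
    _ ≤ ∫ p : ℝ × ℝ, (|F p.1 - H p.2| * ρ (p.1 - p.2) + |F p.1 - F p.2| * ρ (p.1 - p.2))
        ∂(volume.prod volume) := by
        refine integral_mono (integrable_prod_mul_comp_sub h.integrable hi) (h1.add h2) fun p => ?_
        simp only
        rw [← add_mul]
        refine mul_le_mul_of_nonneg_right ?_ (h.nonneg _)
        have := abs_sub_le (F p.2) (F p.1) (H p.2)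
        rw [abs_sub_comm (F p.2) (F p.1)] at this
        linarith
    _ ≤ _ := by
        rw [integral_add h1 h2]
        gcongr
        exact h.integral_abs_self_sub_mul_le hF hc

end IsMollifier

/-! ### Doubling of the space variable -/

namespace LaneModel

variable {N : ℕ} {P : LaneModel N} {K M : ℝ} {a b : Fin N → ℝ → ℝ} {w : ℝ → ℝ} {ρ m : ℝ → ℝ}
  {δ : ℝ}

/-- The integrand of the entropy rate after the doubling of variables, for the profile `a` and the
Kruzkov constants given by `w`. -/
def entropyFlow (P : LaneModel N) (k : Fin N) (a : Fin N → ℝ → ℝ) (w ρ : ℝ → ℝ) (p : ℝ × ℝ) : ℝ :=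
  kruzkov (P.f k) (a k p.1) (w p.2) * P.speed k (a k) p.1 * deriv ρ (p.1 - p.2)
    + Real.sign (a k p.1 - w p.2) * (P.source k a p.1
      - P.f k (w p.2) * deriv (P.speed k (a k)) p.1) * ρ (p.1 - p.2)

lemma rate_eq_integral_entropyFlow (k : Fin N) (a : Fin N → ℝ → ℝ) (w ρ : ℝ → ℝ) (y : ℝ) :
    P.rate k a (w y) (fun x => ρ (x - y)) = ∫ x, P.entropyFlow k a w ρ (x, y) := by
  have e1 : deriv (fun x => ρ (x - y)) = fun x => deriv ρ (x - y) := by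
    ext x; exact deriv_comp_sub_const ..
  unfold rate entropyFlow
  rw [e1]

/-- Because `|f (w y)| ≤ K * w y`, every term carries a density in `x` or in `y`, and the mollifier
or its derivative is integrable in the other variable. This makes the doubled integrand integrable
on the plane. -/
lemma abs_entropyFlow_le (hP : P.Regular K) (hM : P.SpeedLE M) (k : Fin N)
    (ha : ∀ j, IsDensity (a j)) (hw : IsDensity w) (hρ : IsMollifier ρ δ) (p : ℝ × ℝ) :
    |P.entropyFlow k a w ρ p| ≤ (K * M + 2 * K + K * (K + 2 * K ^ 2))
      * ((∑ j, a j p.1 + w p.2) * (|deriv ρ (p.1 - p.2)| + ρ (p.1 - p.2))) := by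
  have hK := hP.nonneg
  have hM0 := hM.nonneg k
  have h1 := abs_kruzkov_mul_speed_le hP hM k (ha k) (w p.2) p.1
  have h4 := abs_source_le hP k ha p.1
  have h5 := abs_deriv_speed_le hP k (ha k) p.1
  have h6 : a k p.1 ≤ ∑ j, a j p.1 :=
    Finset.single_le_sum (f := fun j => a j p.1) (fun j _ => ((ha j).mem p.1).1)
      (Finset.mem_univ k)
  have h7 := ((ha k).mem p.1).1
  have h8 : 0 ≤ ∑ j, a j p.1 := h7.trans h6
  have h9 := abs_f_le hP.bdd k (hw.mem p.2)
  have h10 := (hw.mem p.2).1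
  have h11 := hρ.nonneg (p.1 - p.2)
  have h12 := abs_nonneg (deriv ρ (p.1 - p.2))
  set S := ∑ j, a j p.1
  calc _ ≤ (K * S + K * w p.2) * M * |deriv ρ (p.1 - p.2)|
        + (2 * K * S + K * w p.2 * (K + 2 * K ^ 2)) * ρ (p.1 - p.2) := by
        refine (abs_add_le _ _).trans (add_le_add ?_ ?_)
        · rw [abs_mul]
          refine mul_le_mul_of_nonneg_right (h1.trans ?_) (abs_nonneg _)
          gcongr
        · rw [abs_mul, abs_of_nonneg h11]
          refine mul_le_mul_of_nonneg_right ?_ h11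
          refine (abs_sign_mul_le _ _).trans ((abs_sub _ _).trans (add_le_add h4 ?_))
          rw [abs_mul]
          exact mul_le_mul h9 h5 (abs_nonneg _) (by positivity)
    _ ≤ _ := by
        set r := ρ (p.1 - p.2)
        set r' := |deriv ρ (p.1 - p.2)|
        set CV := K + 2 * K ^ 2 with hCV
        have hCV0 : 0 ≤ CV := by positivity
        have e1 : 0 ≤ K * M * ((S + w p.2) * r) := by positivity
        have e2 : 0 ≤ 2 * K * ((S + w p.2) * r') := by positivity
        have e3 : 0 ≤ 2 * K * (w p.2 * r) := by positivity
        have e4 : 0 ≤ K * CV * ((S + w p.2) * r') := by positivity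
        have e5 : 0 ≤ K * CV * (S * r) := by positivity
        nlinarith

/-- Measurability of the doubled integrand, with the profiles depending on parameters. -/
lemma measurable_entropyFlow_comp {α : Type*} [MeasurableSpace α] (hA : P.Admissible) (k : Fin N)
    {c d V V' S r r' : α → ℝ} (hc : Measurable c) (hd : Measurable d) (hV : Measurable V)
    (hV' : Measurable V') (hS : Measurable S) (hr : Measurable r) (hr' : Measurable r') :
    Measurable (fun z => kruzkov (P.f k) (c z) (d z) * V z * r' z
      + Real.sign (c z - d z) * (S z - P.f k (d z) * V' z) * r z) := by
  have h1 : Measurable (fun z => kruzkov (P.f k) (c z) (d z)) :=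
    (continuous_kruzkov (continuous_f hA k)).measurable.comp (hc.prodMk hd)
  have h2 : Measurable (fun z => P.f k (d z)) := (continuous_f hA k).measurable.comp hd
  exact ((h1.mul hV).mul hr').add
    (((measurable_real_sign.comp (hc.sub hd)).mul (hS.sub (h2.mul hV'))).mul hr)

lemma measurable_entropyFlow (hP : P.Regular K) (k : Fin N) (ha : ∀ j, IsDensity (a j))
    (hw : IsDensity w) (hρ : IsMollifier ρ δ) :
    Measurable (P.entropyFlow k a w ρ) := by
  have hs : Measurable (fun p : ℝ × ℝ => p.1 - p.2) := measurable_fst.sub measurable_snd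
  exact measurable_entropyFlow_comp hP.adm k ((ha k).measurable.comp measurable_fst)
    (hw.measurable.comp measurable_snd)
    ((speed_comp_add_measurable hP k (ha k)).comp measurable_fst)
    ((measurable_deriv _).comp measurable_fst) ((measurable_source hP k ha).comp measurable_fst)
    (hρ.continuous.measurable.comp hs) ((measurable_deriv ρ).comp hs)

/-- The `L¹` bound for the doubled integrand. -/
def flowBound (K M μ : ℝ) (ρ : ℝ → ℝ) : ℝ :=
  (K * M + 2 * K + K * (K + 2 * K ^ 2)) * ((μ + μ) * ∫ z, (|deriv ρ z| + ρ z))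

lemma flowBound_nonneg {μ : ℝ} (hK : 0 ≤ K) (hM : 0 ≤ M) (hμ : 0 ≤ μ) (hρ : IsMollifier ρ δ) :
    0 ≤ flowBound K M μ ρ := by
  have : 0 ≤ ∫ z, (|deriv ρ z| + ρ z) :=
    integral_nonneg fun z => add_nonneg (abs_nonneg _) (hρ.nonneg z)
  unfold flowBound; positivity

lemma integrable_entropyFlow (hP : P.Regular K) (hM : P.SpeedLE M) (k : Fin N)
    (ha : ∀ j, IsDensity (a j)) (hw : IsDensity w) (hρ : IsMollifier ρ δ) {μ : ℝ}
    (hma : ∑ j, ∫ x, a j x ≤ μ) (hmw : ∫ x, w x ≤ μ) :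
    Integrable (P.entropyFlow k a w ρ) (volume.prod volume) ∧
      ∫ p, |P.entropyFlow k a w ρ p| ∂(volume.prod volume) ≤ flowBound K M μ ρ := by
  have hK := hP.nonneg
  have hM0 := hM.nonneg k
  set κ : ℝ → ℝ := fun z => |deriv ρ z| + ρ z with hκ
  have iκ : Integrable κ := hρ.integrable_deriv.abs.add hρ.integrable
  have κ0 : ∀ z, 0 ≤ κ z := fun z => add_nonneg (abs_nonneg _) (hρ.nonneg z)
  have iS : Integrable (fun x => ∑ j, a j x) := integrable_finsetSum _ fun j _ => (ha j).integrable
  have i1 := integrable_prod_mul_comp_sub_left iκ iS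
  have i2 := integrable_prod_mul_comp_sub iκ hw.integrable
  have i3 : Integrable (fun p : ℝ × ℝ => (K * M + 2 * K + K * (K + 2 * K ^ 2))
      * ((∑ j, a j p.1) * κ (p.1 - p.2) + w p.2 * κ (p.1 - p.2))) (volume.prod volume) :=
    (i1.add i2).const_mul _
  have hb : ∀ p, |P.entropyFlow k a w ρ p| ≤ (K * M + 2 * K + K * (K + 2 * K ^ 2))
      * ((∑ j, a j p.1) * κ (p.1 - p.2) + w p.2 * κ (p.1 - p.2)) := fun p => by
    rw [← add_mul]; exact abs_entropyFlow_le hP hM k ha hw hρ p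
  have hi : Integrable (P.entropyFlow k a w ρ) (volume.prod volume) :=
    i3.mono' (measurable_entropyFlow hP k ha hw hρ).aestronglyMeasurable
      (.of_forall hb)
  refine ⟨hi, (integral_mono hi.abs i3 hb).trans ?_⟩
  rw [integral_const_mul, integral_add i1 i2, integral_prod _ i1, integral_prod_symm _ i2]
  simp only [integral_const_mul, integral_sub_left_eq_self κ volume, integral_sub_right_eq_self κ]
  rw [integral_mul_const, integral_mul_const, integral_finsetSum _ fun j _ => (ha j).integrable,
    ← add_mul]
  have : 0 ≤ ∫ z, κ z := integral_nonneg fun z => κ0 z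
  unfold flowBound
  gcongr

/-- The constant of the stability estimate. -/
def pairBound (K B μ : ℝ) : ℝ :=
  K * B * (K ^ 2 + (K + 2 * K ^ 2)) + K * ((K + 2 * K ^ 2) * (1 + 3 * K) * μ + (2 * K ^ 2 + 2 * K ^ 2 * B))
    + (4 * K + 4 * K * B + 4 * K ^ 2 * μ)

/-- The transport part of the stability estimate: integration by parts in the doubled variables. -/
lemma integral_kruzkov_mul_le (hP : P.Regular K) (hM : P.SpeedLE M) (k : Fin N) {c d : ℝ → ℝ}
    (hc : IsDensity c) (hd : IsDensity d) (hρ : IsMollifier ρ δ) (hδ : 0 ≤ δ) {B : ℝ}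
    (hTV : ∀ s, ∫ x, |c (x + s) - c x| ≤ B * |s|) :
    Integrable (fun p : ℝ × ℝ => kruzkov (P.f k) (c p.1) (d p.2)
      * ((P.speed k c p.1 - P.speed k d p.2) * deriv ρ (p.1 - p.2)
        + deriv (P.speed k c) p.1 * ρ (p.1 - p.2))) (volume.prod volume) ∧
    ∫ p : ℝ × ℝ, kruzkov (P.f k) (c p.1) (d p.2)
      * ((P.speed k c p.1 - P.speed k d p.2) * deriv ρ (p.1 - p.2)
        + deriv (P.speed k c) p.1 * ρ (p.1 - p.2)) ∂(volume.prod volume)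
      ≤ K * B * (K ^ 2 * (∫ x, |c x - d x|) + (K + 2 * K ^ 2) * δ) := by
  have hK := hP.nonneg
  have hM0 := hM.nonneg k
  set CV := K + 2 * K ^ 2 with hCV
  have hCV0 : 0 ≤ CV := by positivity
  have hB0 : 0 ≤ B := by
    have := (integral_nonneg fun x => abs_nonneg _).trans (hTV 1)
    simpa using this
  obtain ⟨m, hm⟩ := hρ.exists_isTest
  set V := P.speed k c with hV
  set W := P.speed k d with hW
  set n := ∫ x, |c x - d x| with hn
  have hn0 : 0 ≤ n := integral_nonneg fun x => abs_nonneg _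
  set G : ℝ × ℝ → ℝ := fun p => kruzkov (P.f k) (c p.1) (d p.2) with hG
  set H : ℝ × ℝ → ℝ := fun p => (V p.1 - W p.2) * ρ (p.1 - p.2) with hH
  have mV : Measurable V := speed_comp_add_measurable hP k hc
  have mW : Measurable W := speed_comp_add_measurable hP k hd
  have ms : Measurable (fun p : ℝ × ℝ => p.1 - p.2) := measurable_fst.sub measurable_snd
  have mG : Measurable G := (continuous_kruzkov (continuous_f hP.adm k)).measurable.comp
    ((hc.measurable.comp measurable_fst).prodMk (hd.measurable.comp measurable_snd))
  have mH : Measurable H := ((mV.comp measurable_fst).sub (mW.comp measurable_snd)).mul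
    (hρ.continuous.measurable.comp ms)
  have bV : ∀ x, |V x| ≤ M := fun x => hM k x _ (avg_mem hP hc x)
  have bW : ∀ x, |W x| ≤ M := fun x => hM k x _ (avg_mem hP hd x)
  have bVW : ∀ x y, |V x - W y| ≤ 2 * M := fun x y => by
    linarith [abs_sub (V x) (W y), bV x, bW y]
  have bG : ∀ p, |G p| ≤ K * c p.1 + K * d p.2 := fun p =>
    (abs_kruzkov_f_le_add hP.bdd k (hc.mem p.1) _).trans
      (add_le_add le_rfl (abs_f_le hP.bdd k (hd.mem p.2)))
  have i1 := integrable_prod_mul_comp_sub_left hm.integrable hc.integrable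
  have i2 := integrable_prod_mul_comp_sub hm.integrable hd.integrable
  -- the dominating function
  set Φ : ℝ × ℝ → ℝ := fun p =>
    (K * c p.1 + K * d p.2) * ((CV + 2 * M) * m (p.1 - p.2)) with hΦ
  have iΦ : Integrable Φ (volume.prod volume) := by
    refine ((i1.const_mul (K * (CV + 2 * M))).add (i2.const_mul (K * (CV + 2 * M)))).congr
      (.of_forall fun p => ?_)
    simp only [Pi.add_apply, hΦ]; ring
  have hm0 : ∀ z, ρ z ≤ m z := fun z => by simpa using hm.le z 0 (by simp)
  set s : ℕ → ℝ := fun i => 1 / ((i : ℝ) + 1) with hs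
  have s0 : ∀ i, 0 < s i := fun i => by positivity
  have s1 : ∀ i, |s i| ≤ 1 := fun i => by
    rw [abs_of_pos (s0 i), hs]
    exact (div_le_one (by positivity)).2 (by linarith [Nat.cast_nonneg (α := ℝ) i])
  have slim : Tendsto s atTop (𝓝 0) := tendsto_one_div_add_atTop_nhds_zero_nat
  -- The factor multiplying `G` in the claim is the `x`-derivative of `H`, while `G` need not be
  -- differentiable. The integration by parts is therefore done for difference quotients: the shift
  -- moves from `H` to `G`, where the translates of `c` cost `B * s i`, and dominated convergence
  -- recovers the derivative.
  set F : ℕ → ℝ × ℝ → ℝ := fun i p => G p * ((H (p.1 + s i, p.2) - H p) / s i) with hF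
  have mF : ∀ i, Measurable (F i) := fun i => mG.mul
    (((mH.comp ((measurable_fst.add_const _).prodMk measurable_snd)).sub mH).div_const _)
  have bH : ∀ i p, |H (p.1 + s i, p.2) - H p| ≤ ((CV + 2 * M) * m (p.1 - p.2)) * s i := by
    intro i p
    have e : H (p.1 + s i, p.2) - H p = (V (p.1 + s i) - V p.1) * ρ (p.1 - p.2 + s i)
        + (V p.1 - W p.2) * (ρ (p.1 - p.2 + s i) - ρ (p.1 - p.2)) := by
      simp only [hH]; rw [show p.1 + s i - p.2 = p.1 - p.2 + s i by ring]; ring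
    have h1 : |V (p.1 + s i) - V p.1| ≤ CV * s i := by
      have := abs_speed_sub_le hP k hc (p.1 + s i) p.1
      rwa [add_sub_cancel_left, abs_of_pos (s0 i)] at this
    have h2 := hm.abs_sub_le (p.1 - p.2) (s1 i)
    rw [abs_of_pos (s0 i)] at h2
    have h3 : |ρ (p.1 - p.2 + s i)| ≤ m (p.1 - p.2) := by
      rw [abs_of_nonneg (hρ.nonneg _)]; exact hm.le _ _ (s1 i)
    have h4 := hm.major_nonneg (p.1 - p.2)
    have h5 := (s0 i).le
    rw [e]
    calc _ ≤ (CV * s i) * m (p.1 - p.2) + 2 * M * (m (p.1 - p.2) * s i) := by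
          refine (abs_add_le _ _).trans (add_le_add ?_ ?_)
          · rw [abs_mul]; exact mul_le_mul h1 h3 (abs_nonneg _) (by positivity)
          · rw [abs_mul]; exact mul_le_mul (bVW _ _) h2 (abs_nonneg _) (by positivity)
      _ = _ := by ring
  have bF : ∀ i p, ‖F i p‖ ≤ Φ p := by
    intro i p
    rw [Real.norm_eq_abs, abs_mul, abs_div, abs_of_pos (s0 i)]
    refine mul_le_mul (bG p) ((div_le_iff₀ (s0 i)).2 (bH i p)) (by have := s0 i; positivity) ?_
    have := (hc.mem p.1).1
    have := (hd.mem p.2).1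
    positivity
  have hVd : ∀ᵐ p : ℝ × ℝ ∂(volume.prod volume), DifferentiableAt ℝ V p.1 :=
    Measure.quasiMeasurePreserving_fst.ae (lipschitzWith_speed hP k hc).ae_differentiableAt_real
  have hlim : ∀ᵐ p ∂(volume.prod volume), Tendsto (fun i => F i p) atTop
      (𝓝 (G p * ((V p.1 - W p.2) * deriv ρ (p.1 - p.2) + deriv V p.1 * ρ (p.1 - p.2)))) := by
    filter_upwards [hVd] with p hp
    refine Tendsto.const_mul _ ?_
    have hρd : HasDerivAt (fun x => ρ (x - p.2)) (deriv ρ (p.1 - p.2)) p.1 := by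
      have := (hm.differentiable (p.1 - p.2)).hasDerivAt
      simpa using this.comp_sub_const p.1 p.2
    have hHd : HasDerivAt (fun x => H (x, p.2))
        (deriv V p.1 * ρ (p.1 - p.2) + (V p.1 - W p.2) * deriv ρ (p.1 - p.2)) p.1 :=
      (hp.hasDerivAt.sub_const (W p.2)).mul hρd
    have h1 := hHd.tendsto_slope_zero
    have h2 : Tendsto s atTop (𝓝[≠] 0) :=
      tendsto_nhdsWithin_iff.2 ⟨slim, Eventually.of_forall fun i => (s0 i).ne'⟩
    have h3 := h1.comp h2
    rw [add_comm] at h3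
    refine h3.congr fun i => ?_
    simp only [Function.comp_apply, smul_eq_mul, div_eq_inv_mul]
  have hDCT := tendsto_integral_of_dominated_convergence Φ
    (fun i => (mF i).aestronglyMeasurable) iΦ (fun i => Eventually.of_forall (bF i)) hlim
  constructor
  · refine iΦ.mono' ?_ ?_
    · exact (mG.mul ((((mV.comp measurable_fst).sub (mW.comp measurable_snd)).mul
        ((measurable_deriv ρ).comp ms)).add (((measurable_deriv V).comp measurable_fst).mul
        (hρ.continuous.measurable.comp ms)))).aestronglyMeasurable
    · filter_upwards [hlim] with p hp
      exact le_of_tendsto hp.norm (.of_forall fun i => bF i p)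
  · refine le_of_tendsto hDCT (.of_forall fun i => ?_)
    have iGH : Integrable (fun p => G p * H p) (volume.prod volume) := by
      refine iΦ.mono' (mG.mul mH).aestronglyMeasurable (.of_forall fun p => ?_)
      rw [Real.norm_eq_abs, abs_mul]
      have q1 := (hc.mem p.1).1
      have q2 := (hd.mem p.2).1
      refine mul_le_mul (bG p) ?_ (abs_nonneg _) (by positivity)
      rw [abs_mul, abs_of_nonneg (hρ.nonneg _)]
      have q3 := hm.major_nonneg (p.1 - p.2)
      calc _ ≤ 2 * M * m (p.1 - p.2) := by
            have := hρ.nonneg (p.1 - p.2); gcongr; exacts [bVW _ _, hm0 _]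
        _ ≤ _ := by gcongr; linarith
    have iGH' : Integrable (fun p : ℝ × ℝ => G p * H (p.1 + s i, p.2)) (volume.prod volume) := by
      refine (iGH.add (((iΦ.mono' (mF i).aestronglyMeasurable
        (.of_forall (bF i))).const_mul (s i)))).congr (.of_forall fun p => ?_)
      have := (s0 i).ne'
      simp only [Pi.add_apply, hF]; field_simp; ring
    have e1 : ∫ p : ℝ × ℝ, G p * H (p.1 + s i, p.2) ∂(volume.prod volume)
        = ∫ p : ℝ × ℝ, G (p.1 - s i, p.2) * H p ∂(volume.prod volume) := by
      rw [← integral_add_right_eq_self (fun p : ℝ × ℝ => G (p.1 - s i, p.2) * H p)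
        ((s i, 0) : ℝ × ℝ)]
      refine integral_congr_ae (.of_forall fun p => ?_)
      have : p + (s i, 0) = (p.1 + s i, p.2) := Prod.ext rfl (add_zero _)
      simp only [this, add_sub_cancel_right]
    have iGH'' : Integrable (fun p : ℝ × ℝ => G (p.1 - s i, p.2) * H p) (volume.prod volume) := by
      refine (iGH'.comp_sub_right ((s i, 0) : ℝ × ℝ)).congr (.of_forall fun p => ?_)
      have : p - (s i, 0) = (p.1 - s i, p.2) := Prod.ext rfl (sub_zero _)
      simp only [this, sub_add_cancel]
    have hcs : Integrable (fun x => |c (x + -s i) - c x|) :=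
      integrable_abs_sub (hc.integrable.comp_add_right (-s i)) hc.integrable
    have i4 := (integrable_prod_mul_comp_sub_left hρ.integrable hcs).const_mul
      (K * (K ^ 2 * n + CV * δ))
    calc ∫ p, F i p ∂(volume.prod volume)
        = (1 / s i) * ∫ p : ℝ × ℝ, (G (p.1 - s i, p.2) - G p) * H p ∂(volume.prod volume) := by
          have e2 : ∫ p : ℝ × ℝ, (G (p.1 - s i, p.2) - G p) * H p ∂(volume.prod volume)
              = ∫ p : ℝ × ℝ, (G p * H (p.1 + s i, p.2) - G p * H p) ∂(volume.prod volume) := by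
            rw [integral_sub iGH' iGH, e1, ← integral_sub iGH'' iGH]
            simp only [sub_mul]
          rw [e2, ← integral_const_mul]
          refine integral_congr_ae (.of_forall fun p => ?_)
          simp only [hF]; ring
      _ ≤ (1 / s i) * ∫ p : ℝ × ℝ, K * (K ^ 2 * n + CV * δ)
            * (|c (p.1 + -s i) - c p.1| * ρ (p.1 - p.2)) ∂(volume.prod volume) := by
          refine mul_le_mul_of_nonneg_left ?_ (by have := s0 i; positivity)
          refine integral_mono ((iGH''.sub iGH).congr (.of_forall fun p => by
            simp only [Pi.sub_apply, sub_mul])) i4 fun p => ?_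
          refine (le_abs_self _).trans ?_
          simp only [hH]
          rw [abs_mul, abs_mul, abs_of_nonneg (hρ.nonneg (p.1 - p.2))]
          have q1 : |G (p.1 - s i, p.2) - G p| ≤ K * |c (p.1 + -s i) - c p.1| :=
            abs_kruzkov_sub_le (hP.bdd.f_lip k) (hc.mem _) (hc.mem _) _
          -- On the support of the mollifier the two velocities are close, by their uniform distance
          -- plus their modulus over `δ`. After the shift only `ρ` and not its derivative appears,
          -- so nothing degenerates with `δ`.
          have q2 : |V p.1 - W p.2| * ρ (p.1 - p.2) ≤ (K ^ 2 * n + CV * δ) * ρ (p.1 - p.2) :=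
            hρ.mul_le_mul_of_abs_le fun hz => by
              have r1 := abs_speed_sub_le hP k hc p.1 p.2
              have r2 := abs_speed_sub_speed_le hP k hc hd p.2
              have r3 : CV * |p.1 - p.2| ≤ CV * δ := by gcongr
              linarith [abs_sub_le (V p.1) (V p.2) (W p.2)]
          calc _ ≤ K * |c (p.1 + -s i) - c p.1| * ((K ^ 2 * n + CV * δ) * ρ (p.1 - p.2)) :=
                mul_le_mul q1 q2 (mul_nonneg (abs_nonneg _) (hρ.nonneg _)) (by positivity)
            _ = _ := by ring
      _ ≤ (1 / s i) * (K * (K ^ 2 * n + CV * δ) * (B * s i)) := by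
          have := s0 i
          rw [integral_const_mul, hρ.integral_prod_fst hcs]
          gcongr
          have := hTV (-s i)
          rwa [abs_neg, abs_of_pos (s0 i)] at this
      _ = _ := by have := (s0 i).ne'; field_simp

set_option maxHeartbeats 1000000 in
/-- The stability estimate for the doubled entropy rates. -/
theorem integral_entropyFlow_add_le (hP : P.Regular K) (hM : P.SpeedLE M) (k : Fin N)
    (ha : ∀ j, IsDensity (a j)) (hb : ∀ j, IsDensity (b j)) (hρ : IsMollifier ρ δ) (hδ : 0 ≤ δ)
    {B μ : ℝ} (hTV : ∀ s, ∑ j, ∫ x, |a j (x + s) - a j x| ≤ B * |s|) (hma : ∑ j, ∫ x, a j x ≤ μ)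
    (hmb : ∑ j, ∫ x, b j x ≤ μ) :
    ∫ p, P.entropyFlow k a (b k) ρ p ∂(volume.prod volume)
      + ∫ p, P.entropyFlow k b (a k) ρ p ∂(volume.prod volume)
      ≤ pairBound K B μ * ((∑ j, ∫ x, |a j x - b j x|) + δ) := by
  have hK := hP.nonneg
  set CV := K + 2 * K ^ 2 with hCV
  have hCV0 : 0 ≤ CV := by positivity
  have hB0 : 0 ≤ B := by
    have := (Finset.sum_nonneg fun j _ => integral_nonneg fun x => abs_nonneg _).trans (hTV 1)
    simpa using this
  have hk : ∀ c : Fin N → ℝ → ℝ, (∀ j, IsDensity (c j)) → ∫ x, c k x ≤ ∑ j, ∫ x, c j x :=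
    fun c hc => integral_le_sum hc k
  have hTVk : ∀ s, ∫ x, |a k (x + s) - a k x| ≤ B * |s| := fun s =>
    (integral_abs_le_sum (fun j x => a j (x + s) - a j x) k).trans (hTV s)
  set n := ∑ j, ∫ x, |a j x - b j x| with hn
  have hnk : ∫ x, |a k x - b k x| ≤ n :=
    integral_abs_le_sum (fun j x => a j x - b j x) k
  have hn0 : 0 ≤ n := (integral_nonneg fun x => abs_nonneg _).trans hnk
  have hμ0 : 0 ≤ μ := ((integral_nonneg fun x => ((ha k).mem x).1).trans (hk a ha)).trans hma
  obtain ⟨j1, -⟩ := integrable_entropyFlow hP hM k ha (hb k) hρ hma ((hk b hb).trans hmb)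
  obtain ⟨j2, -⟩ := integrable_entropyFlow hP hM k hb (ha k) hρ hmb ((hk a ha).trans hma)
  obtain ⟨t1, T1⟩ := integral_kruzkov_mul_le hP hM k (ha k) (hb k) hρ hδ hTVk
  set V := P.speed k (a k) with hV
  set W := P.speed k (b k) with hW
  set A' := deriv (P.avg (a k)) with hP.adm'
  set B' := deriv (P.avg (b k)) with hP.bdd'
  have bd : ∀ {c : ℝ → ℝ}, IsDensity c → ∀ x, |c x| ≤ 1 := fun hc x => by
    rw [abs_of_nonneg (hc.mem x).1]; exact (hc.mem x).2
  have iA' : Integrable A' := (integrable_deriv_avg hP (ha k).integrable (bd (ha k))).1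
  have iB' : Integrable B' := (integrable_deriv_avg hP (hb k).integrable (bd (hb k))).1
  have iSa := integrable_source hP k ha
  have iSb := integrable_source hP k hb
  have t2 := (integrable_prod_mul_comp_sub_left hρ.integrable (ha k).integrable).const_mul
    (K * (CV * ((1 + 2 * K) * δ + K * n)))
  have t3 := (hρ.integrable_abs_sub_mul iA' iB').const_mul (K * K)
  have t4 := hρ.integrable_abs_sub_mul iSa iSb
  have T3 := hρ.integral_abs_sub_mul_le iA' iB' (c := 2 * K * B) fun s =>
    ((integrable_deriv_avg_shift_sub hP (ha k) s).2).trans (by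
      rw [mul_assoc (2 * K)]; gcongr; exact hTVk s)
  have T3' := (integrable_deriv_avg_sub hP (ha k) (hb k)).2
  have T4 := hρ.integral_abs_sub_mul_le iSa iSb (c := 4 * K * B + 4 * K ^ 2 * μ) fun s => by
    refine (integral_abs_source_shift_sub_le hP k ha s).trans ?_
    have h1 : 4 * K * (∑ j, ∫ x, |a j (x + s) - a j x|) ≤ 4 * K * (B * |s|) := by
      gcongr; exact hTV s
    have h2 : 4 * K ^ 2 * |s| * (∑ j, ∫ x, a j x) ≤ 4 * K ^ 2 * |s| * μ := by gcongr
    linarith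
  have T4' := integral_abs_source_sub_le hP k ha hb
  have hda := ae_differentiableAt_avg hP (ha k)
  have hdb := ae_differentiableAt_avg hP (hb k)
  have hda' : ∀ᵐ p : ℝ × ℝ ∂(volume.prod volume), DifferentiableAt ℝ (P.avg (a k)) p.1 :=
    Measure.quasiMeasurePreserving_fst.ae hda
  have hdb' : ∀ᵐ p : ℝ × ℝ ∂(volume.prod volume), DifferentiableAt ℝ (P.avg (b k)) p.2 :=
    Measure.quasiMeasurePreserving_snd.ae hdb
  have j2' : Integrable (fun p : ℝ × ℝ => P.entropyFlow k b (a k) ρ p.swap)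
    (volume.prod volume) := j2.swap
  have t23 : Integrable (fun p : ℝ × ℝ => K * (CV * ((1 + 2 * K) * δ + K * n))
      * (a k p.1 * ρ (p.1 - p.2)) + K * K * (|A' p.1 - B' p.2| * ρ (p.1 - p.2)))
      (volume.prod volume) := t2.add t3
  have t234 : Integrable (fun p : ℝ × ℝ => K * (CV * ((1 + 2 * K) * δ + K * n))
      * (a k p.1 * ρ (p.1 - p.2)) + K * K * (|A' p.1 - B' p.2| * ρ (p.1 - p.2))
      + |P.source k a p.1 - P.source k b p.2| * ρ (p.1 - p.2))
      (volume.prod volume) := t23.add t4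
  rw [← integral_prod_swap (P.entropyFlow k b (a k) ρ), ← integral_add j1 j2']
  calc _ ≤ ∫ p : ℝ × ℝ, (kruzkov (P.f k) (a k p.1) (b k p.2)
          * ((V p.1 - W p.2) * deriv ρ (p.1 - p.2) + deriv V p.1 * ρ (p.1 - p.2))
        + (K * (CV * ((1 + 2 * K) * δ + K * n)) * (a k p.1 * ρ (p.1 - p.2))
          + K * K * (|A' p.1 - B' p.2| * ρ (p.1 - p.2))
          + |P.source k a p.1 - P.source k b p.2| * ρ (p.1 - p.2))) ∂(volume.prod volume) := by
        refine integral_mono_ae (j1.add j2') (t1.add t234) ?_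
        filter_upwards [hda', hdb'] with p hp1 hp2
        set r := ρ (p.1 - p.2) with hr
        have hr0 : 0 ≤ r := hρ.nonneg _
        have er : ρ (p.2 - p.1) = r := by rw [← hρ.even, neg_sub]
        have er' : deriv ρ (p.2 - p.1) = -deriv ρ (p.1 - p.2) := by rw [← hρ.deriv_neg, neg_sub]
        set σ := Real.sign (a k p.1 - b k p.2) with hσ
        have eσ : Real.sign (b k p.2 - a k p.1) = -σ := by rw [sign_sub_comm]
        -- The mollifier is even and its derivative odd, so the flux terms combine with the
        -- difference of the velocities. Splitting `f (b) V'` by means of the entropy flux leaves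
        -- the derivative of a product, to be integrated by parts, and the difference of the
        -- velocity derivatives weighted by `f (a)`.
        have e1 : P.entropyFlow k a (b k) ρ p + P.entropyFlow k b (a k) ρ p.swap
            = kruzkov (P.f k) (a k p.1) (b k p.2)
              * ((V p.1 - W p.2) * deriv ρ (p.1 - p.2) + deriv V p.1 * r)
              + σ * (P.f k (a k p.1) * (deriv W p.2 - deriv V p.1)) * r
              + σ * (P.source k a p.1 - P.source k b p.2) * r := by
          simp only [entropyFlow, Prod.fst_swap, Prod.snd_swap, er, er', eσ]
          rw [kruzkov_comm _ (b k p.2) (a k p.1)]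
          simp only [kruzkov, ← hσ]
          ring
        have ha1 := (ha k).mem p.1
        have y1 : σ * (P.source k a p.1 - P.source k b p.2) * r
            ≤ |P.source k a p.1 - P.source k b p.2| * r :=
          mul_le_mul_of_nonneg_right (sign_mul_le_abs _ _) hr0
        have y2 : σ * (P.f k (a k p.1) * (deriv W p.2 - deriv V p.1)) * r
            ≤ K * (CV * ((1 + 2 * K) * δ + K * n)) * (a k p.1 * r)
              + K * K * (|A' p.1 - B' p.2| * r) := by
          have z0 : σ * (P.f k (a k p.1) * (deriv W p.2 - deriv V p.1)) * r
              ≤ (K * (CV * ((1 + 2 * K) * δ + K * n)) * a k p.1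
                + K * K * |A' p.1 - B' p.2|) * r := by
            refine hρ.mul_le_mul_of_abs_le fun hz => (sign_mul_le_abs _ _).trans ?_
            have z1 := abs_deriv_speed_sub_le hP k (ha k) (hb k) hp1 hp2
            have z2 : |P.avg (a k) p.1 - P.avg (b k) p.2| ≤ 2 * K * δ + K * n := by
              have q1 := abs_avg_sub_avg_le hP (ha k) p.1 p.2
              have q2 : |P.avg (a k) p.2 - P.avg (b k) p.2| ≤ K * ∫ x, |a k x - b k x| := by
                rw [← avg_sub hP (ha k).integrable (hb k).integrable]
                exact abs_avg_le hP ((ha k).integrable.sub (hb k).integrable) _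
              have q3 : 2 * K * |p.1 - p.2| ≤ 2 * K * δ := by gcongr
              have q4 : K * (∫ x, |a k x - b k x|) ≤ K * n := by gcongr
              linarith [abs_sub_le (P.avg (a k) p.1) (P.avg (a k) p.2) (P.avg (b k) p.2)]
            have z3 : |deriv W p.2 - deriv V p.1| ≤ CV * ((1 + 2 * K) * δ + K * n)
                + K * |A' p.1 - B' p.2| := by
              rw [abs_sub_comm]
              refine z1.trans (add_le_add (mul_le_mul_of_nonneg_left ?_ hCV0) le_rfl)
              linarith
            rw [abs_mul]
            have z4 : 0 ≤ CV * ((1 + 2 * K) * δ + K * n) := by positivity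
            calc _ ≤ (K * a k p.1) * (CV * ((1 + 2 * K) * δ + K * n) + K * |A' p.1 - B' p.2|) :=
                  mul_le_mul (abs_f_le hP.bdd k ha1) z3 (abs_nonneg _) (mul_nonneg hK ha1.1)
              _ = K * (CV * ((1 + 2 * K) * δ + K * n)) * a k p.1
                  + K * K * |A' p.1 - B' p.2| * a k p.1 := by ring
              _ ≤ _ := add_le_add le_rfl (mul_le_of_le_one_right (by positivity) ha1.2)
          refine z0.trans_eq (by ring)
        linarith
    _ ≤ _ := by
        rw [integral_add t1 t234, integral_add t23 t4, integral_add t2 t3, integral_const_mul,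
          integral_const_mul, hρ.integral_prod_fst (ha k).integrable]
        have hak := (hk a ha).trans hma
        have u1 : K * B * (K ^ 2 * (∫ x, |a k x - b k x|) + CV * δ)
            ≤ K * B * (K ^ 2 * n + CV * δ) := by gcongr
        have u2 : K * (CV * ((1 + 2 * K) * δ + K * n)) * (∫ x, a k x)
            ≤ K * (CV * ((1 + 2 * K) * δ + K * n)) * μ := by gcongr
        have u3 : K * K * (∫ p : ℝ × ℝ, |A' p.1 - B' p.2| * ρ (p.1 - p.2) ∂(volume.prod volume))
            ≤ K * K * (2 * K * n + 2 * K * B * δ) := by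
          have : 2 * K * (∫ x, |a k x - b k x|) ≤ 2 * K * n := by gcongr
          gcongr; linarith
        have u5 : 0 ≤ K * B * K ^ 2 * δ := by positivity
        have u6 : 0 ≤ K * B * CV * n := by positivity
        have u7 : 0 ≤ K * CV * μ * K * δ := by positivity
        have u8 : 0 ≤ K * CV * (1 + 2 * K) * μ * n := by positivity
        have u9 : 0 ≤ K * K * (2 * K) * δ := by positivity
        have u10 : 0 ≤ K * K * (2 * K) * B * n := by positivity
        have u11 : 0 ≤ 4 * K * δ := by positivity
        have u12 : 0 ≤ (4 * K * B + 4 * K ^ 2 * μ) * n := by positivity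
        have e : pairBound K B μ * (n + δ) = K * B * (K ^ 2 * n + CV * δ)
            + K * (CV * ((1 + 2 * K) * δ + K * n)) * μ + K * K * (2 * K * n + 2 * K * B * δ)
            + (4 * K * n + (4 * K * B + 4 * K ^ 2 * μ) * δ) + (K * B * K ^ 2 * δ + K * B * CV * n
            + K * CV * μ * K * δ + K * CV * (1 + 2 * K) * μ * n + K * K * (2 * K) * δ
            + K * K * (2 * K) * B * n + 4 * K * δ + (4 * K * B + 4 * K ^ 2 * μ) * n) := by
          simp only [pairBound, hCV]; ring
        rw [e]
        linarith

end LaneModel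

/-! ### Measurability in the parameters, and integration over the Kruzkov constants -/

namespace LaneModel

variable {N : ℕ} {P : LaneModel N} {K M : ℝ} {ρ m : ℝ → ℝ} {δ : ℝ}

section Measurability

variable {Ω : Type*} [MeasurableSpace Ω]

lemma measurable_avg_comp (hA : P.Admissible) {c : Ω → ℝ → ℝ}
    (hc : Measurable (fun p : Ω × ℝ => c p.1 p.2)) :
    Measurable (fun p : Ω × ℝ => P.avg (c p.1) p.2) := by
  simp only [avg_eq]
  have h : Measurable (Function.uncurry fun (p : Ω × ℝ) (z : ℝ) => P.ext z * c p.1 (p.2 + z)) :=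
    ((measurable_ext hA).comp measurable_snd).mul
      (hc.comp ((measurable_fst.comp measurable_fst).prodMk
        ((measurable_snd.comp measurable_fst).add measurable_snd)))
  exact h.stronglyMeasurable.integral_prod_right.measurable

lemma measurable_speed_comp (hP : P.Regular K) (k : Fin N) {c : Ω → ℝ → ℝ}
    (hc : Measurable (fun p : Ω × ℝ => c p.1 p.2)) (hd : ∀ ω, IsDensity (c ω)) :
    Measurable (fun p : Ω × ℝ => P.speed k (c p.1) p.2) :=
  measurable_ν_comp hP k measurable_snd (measurable_avg_comp hP.adm hc)
    fun p => avg_mem hP (hd p.1) p.2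

lemma measurable_source_comp (hP : P.Regular K) (k : Fin N) {c : Fin N → Ω → ℝ → ℝ}
    (hc : ∀ j, Measurable (fun p : Ω × ℝ => c j p.1 p.2)) (hd : ∀ j ω, IsDensity (c j ω)) :
    Measurable (fun p : Ω × ℝ => P.source k (fun j => c j p.1) p.2) :=
  measurable_R_comp hP k measurable_snd hc (fun j => measurable_avg_comp hP.adm (hc j))
    fun j p => avg_mem hP (hd j p.1) p.2

lemma measurable_entropyFlow_param (hP : P.Regular K) (k : Fin N) {c : Fin N → Ω → ℝ → ℝ}
    {w : Ω → ℝ → ℝ} (hc : ∀ j, Measurable (fun p : Ω × ℝ => c j p.1 p.2))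
    (hd : ∀ j ω, IsDensity (c j ω))
    (hc' : Measurable (fun p : Ω × ℝ => deriv (P.speed k (c k p.1)) p.2))
    (hw : Measurable (fun p : Ω × ℝ => w p.1 p.2)) (hρ : IsMollifier ρ δ) :
    Measurable (fun q : Ω × ℝ × ℝ => P.entropyFlow k (fun j => c j q.1) (w q.1) ρ q.2) := by
  have h1 : Measurable (fun q : Ω × ℝ × ℝ => (q.1, q.2.1)) :=
    measurable_fst.prodMk (measurable_fst.comp measurable_snd)
  have h2 : Measurable (fun q : Ω × ℝ × ℝ => (q.1, q.2.2)) :=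
    measurable_fst.prodMk (measurable_snd.comp measurable_snd)
  have hs : Measurable (fun q : Ω × ℝ × ℝ => q.2.1 - q.2.2) :=
    (measurable_fst.comp measurable_snd).sub (measurable_snd.comp measurable_snd)
  have m1 : Measurable (fun q : Ω × ℝ × ℝ => c k q.1 q.2.1) := (hc k).comp h1
  have m2 : Measurable (fun q : Ω × ℝ × ℝ => w q.1 q.2.2) := hw.comp h2
  have m3 : Measurable (fun q : Ω × ℝ × ℝ => P.speed k (c k q.1) q.2.1) :=
    (measurable_speed_comp hP k (hc k) (hd k)).comp h1
  have m4 : Measurable (fun q : Ω × ℝ × ℝ => deriv (P.speed k (c k q.1)) q.2.1) := hc'.comp h1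
  have m5 : Measurable (fun q : Ω × ℝ × ℝ => P.source k (fun j => c j q.1) q.2.1) := by
    have h5 := (measurable_source_comp (c := c) hP k hc hd).comp h1
    simpa only [Function.comp_def] using h5
  have m6 : Measurable (fun q : Ω × ℝ × ℝ => ρ (q.2.1 - q.2.2)) := hρ.continuous.measurable.comp hs
  have m7 : Measurable (fun q : Ω × ℝ × ℝ => deriv ρ (q.2.1 - q.2.2)) :=
    (measurable_deriv ρ).comp hs
  unfold entropyFlow
  exact measurable_entropyFlow_comp hP.adm k m1 m2 m3 m4 m5 m6 m7

end Measurability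

/-- The entropy rate integrated over the Kruzkov constants. -/
def totalFlow (P : LaneModel N) (k : Fin N) (a : Fin N → ℝ → ℝ) (w ρ : ℝ → ℝ) : ℝ :=
  ∫ p, P.entropyFlow k a w ρ p ∂(volume.prod volume)

variable {T μ B L ε : ℝ} {u v : Fin N → ℝ → ℝ → ℝ}

lemma IsApprox.lane_mass (hu : P.IsApprox T μ B L ε u) (k : Fin N) (t : ℝ) :
    ∫ x, u k t x ≤ μ :=
  (integral_le_sum (fun j => hu.density j t) k).trans
    (hu.mass t)

lemma abs_totalFlow_le (hP : P.Regular K) (hM : P.SpeedLE M) (k : Fin N) {a : Fin N → ℝ → ℝ}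
    (ha : ∀ j, IsDensity (a j)) {w : ℝ → ℝ} (hw : IsDensity w) (hρ : IsMollifier ρ δ)
    (hma : ∑ j, ∫ x, a j x ≤ μ) (hmw : ∫ x, w x ≤ μ) :
    |P.totalFlow k a w ρ| ≤ flowBound K M μ ρ :=
  abs_integral_le_integral_abs.trans (integrable_entropyFlow hP hM k ha hw hρ hma hmw).2

/-- Joint measurability in the two times is required because the rates are later averaged over
squares of times. -/
lemma measurable_totalFlow (hP : P.Regular K) (k : Fin N) (hu : P.IsApprox T μ B L ε u)
    (hv : P.IsApprox T μ B L ε v) (hρ : IsMollifier ρ δ) :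
    Measurable (fun q : ℝ × ℝ => P.totalFlow k (fun j => u j q.1) (v k q.2) ρ) := by
  have h1 : Measurable (fun p : (ℝ × ℝ) × ℝ => (p.1.1, p.2)) :=
    (measurable_fst.comp measurable_fst).prodMk measurable_snd
  have h2 : Measurable (fun p : (ℝ × ℝ) × ℝ => (p.1.2, p.2)) :=
    (measurable_snd.comp measurable_fst).prodMk measurable_snd
  have h := measurable_entropyFlow_param (Ω := ℝ × ℝ) hP k (c := fun j q => u j q.1)
    (w := fun q => v k q.2) (fun j => (hu.measurable j).comp h1) (fun j q => hu.density j q.1)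
    ((hu.measurable_deriv k).comp h1) ((hv.measurable k).comp h2) hρ
  exact (StronglyMeasurable.integral_prod_right (ν := (volume : Measure ℝ).prod volume)
    (f := fun (q : ℝ × ℝ) (p : ℝ × ℝ) => P.entropyFlow k (fun j => u j q.1) (v k q.2) ρ p)
    h.stronglyMeasurable).measurable

/-- The entropy inequality integrated over the Kruzkov constants. -/
theorem IsApprox.doubled_le (hP : P.Regular K) (hM : P.SpeedLE M) (hu : P.IsApprox T μ B L ε u)
    (hε : 0 ≤ ε) (k : Fin N) {w : ℝ → ℝ} (hw : IsDensity w) (hmw : ∫ x, w x ≤ μ)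
    (hρ : IsMollifier ρ δ) (hm : IsTest ρ m) {s t : ℝ} (hs : 0 ≤ s) (hst : s ≤ t) (ht : t ≤ T) :
    ∫ p : ℝ × ℝ, |u k t p.1 - w p.2| * ρ (p.1 - p.2) ∂(volume.prod volume)
      ≤ (∫ p : ℝ × ℝ, |u k s p.1 - w p.2| * ρ (p.1 - p.2) ∂(volume.prod volume))
        + (∫ r in s..t, P.totalFlow k (fun j => u j r) w ρ)
        + (1 + K) * (1 + μ) * (∫ z, m z) * ε := by
  have hK := hP.nonneg
  obtain ⟨E, iE, E0, hE, hent⟩ := hu.entropy s t hs hst ht k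
  have ha : ∀ r j, IsDensity (u j r) := fun r j => hu.density j r
  set h : ℝ → ℝ → ℝ := fun r y => ∫ x, P.entropyFlow k (fun j => u j r) w ρ (x, y) with hh
  have hflow := fun r => integrable_entropyFlow hP hM k (ha r) hw hρ (hu.mass r) hmw
  have mh : Measurable (Function.uncurry h) := by
    have h1 := measurable_entropyFlow_param (Ω := ℝ) hP k (c := u) (w := fun _ => w)
      hu.measurable hu.density (hu.measurable_deriv k) (hw.measurable.comp measurable_snd) hρ
    have h2 : Measurable (fun q : (ℝ × ℝ) × ℝ => (q.1.1, (q.2, q.1.2))) :=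
      (measurable_fst.comp measurable_fst).prodMk
        (measurable_snd.prodMk (measurable_snd.comp measurable_fst))
    exact (StronglyMeasurable.integral_prod_right (ν := (volume : Measure ℝ))
      (f := fun (q : ℝ × ℝ) (x : ℝ) => P.entropyFlow k (fun j => u j q.1) w ρ (x, q.2))
      (h1.comp h2).stronglyMeasurable).measurable
  have hi : ∀ r, Integrable (h r) := fun r => (hflow r).1.integral_prod_right
  have hib : ∀ r, ∫ y, |h r y| ≤ flowBound K M μ ρ := fun r => by
    refine le_trans ?_ (hflow r).2
    rw [integral_prod_symm _ (hflow r).1.abs]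
    exact integral_mono (hi r).abs (hflow r).1.abs.integral_prod_right
      fun y => abs_integral_le_integral_abs
  have hint : Integrable (Function.uncurry h) ((volume.restrict (Ioc s t)).prod volume) := by
    refine (integrable_prod_iff mh.aestronglyMeasurable).2 ⟨Eventually.of_forall hi, ?_⟩
    refine Integrable.mono' (integrable_const (flowBound K M μ ρ))
      mh.aestronglyMeasurable.norm.integral_prod_right' (.of_forall fun r => ?_)
    rw [Real.norm_eq_abs, abs_of_nonneg (integral_nonneg fun y => norm_nonneg _)]
    exact hib r
  have hswap : ∫ y, (∫ r in s..t, h r y) = ∫ r in s..t, P.totalFlow k (fun j => u j r) w ρ := by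
    simp only [intervalIntegral.integral_of_le hst]
    rw [← integral_integral_swap hint]
    refine integral_congr_ae (.of_forall fun r => ?_)
    exact (integral_prod_symm _ (hflow r).1).symm
  have iH : Integrable (fun y => ∫ r in s..t, h r y) := by
    simp only [intervalIntegral.integral_of_le hst]
    exact hint.integral_prod_right
  have iD : ∀ r, Integrable (fun p : ℝ × ℝ => |u k r p.1 - w p.2| * ρ (p.1 - p.2))
    (volume.prod volume) := fun r => hρ.integrable_abs_sub_mul (ha r k).integrable hw.integrable
  have iD' : ∀ r, Integrable (fun y => ∫ x, |u k r x - w y| * ρ (x - y)) := fun r =>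
    (iD r).integral_prod_right
  have iE' := (integrable_prod_mul_comp_sub_left hm.integrable iE).integral_prod_right
  set I := ∫ z, m z with hI
  have hI0 : 0 ≤ I := hm.integral_nonneg
  have i3 : Integrable (fun y => (1 + K) * (∫ x, E x * m (x - y)) + ε * (1 + K) * I * w y) :=
    (iE'.const_mul _).add (hw.integrable.const_mul _)
  have i12 : Integrable (fun y => (∫ x, |u k s x - w y| * ρ (x - y)) + ∫ r in s..t, h r y) :=
    (iD' s).add iH
  rw [integral_prod_symm _ (iD t), integral_prod_symm _ (iD s), ← hswap]
  calc _ ≤ ∫ y, ((∫ x, |u k s x - w y| * ρ (x - y)) + (∫ r in s..t, h r y)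
        + ((1 + K) * (∫ x, E x * m (x - y)) + ε * (1 + K) * I * w y)) := by
        refine integral_mono (iD' t) (i12.add i3) fun y => ?_
        -- For each `y` the Kruzkov constant is `w y` and the test function is the mollifier centred
        -- at `y`.
        have hψ := hm.comp_sub y
        have h1 := hent (w y) (fun x => ρ (x - y)) (fun x => m (x - y)) hψ
          (hρ.smooth.comp (contDiff_id.sub contDiff_const))
          (hρ.compact.comp_homeomorph (Homeomorph.subRight y))
        have e1 : ∀ r, P.rate k (fun j => u j r) (w y) (fun x => ρ (x - y)) = h r y := fun r =>
          rate_eq_integral_entropyFlow k _ w ρ y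
        simp only [e1] at h1
        refine h1.trans (add_le_add le_rfl ?_)
        have hwy := hw.mem y
        have hf := abs_f_le hP.bdd k hwy
        have hf1 : |P.f k (w y)| ≤ K := hf.trans (mul_le_of_le_one_right hK hwy.2)
        rw [integral_sub_right_eq_self m y, abs_of_nonneg hwy.1]
        have e2 : ∫ x, m (x - y) * E x = ∫ x, E x * m (x - y) := by simp only [mul_comm]
        have e3 : 0 ≤ ∫ x, E x * m (x - y) :=
          integral_nonneg fun x => mul_nonneg (E0 x) (hm.major_nonneg _)
        rw [e2]
        refine add_le_add (mul_le_mul_of_nonneg_right (by linarith) e3) ?_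
        have : ε * (w y + |P.f k (w y)|) ≤ ε * (w y + K * w y) := by gcongr
        calc _ ≤ ε * (w y + K * w y) * I := by gcongr
          _ = _ := by ring
    _ ≤ _ := by
        rw [integral_add i12 i3, integral_add (iD' s) iH]
        refine add_le_add le_rfl ?_
        rw [integral_add (iE'.const_mul _) (hw.integrable.const_mul _), integral_const_mul,
          integral_const_mul]
        -- Integrating out `y` turns the error function into the product of its integral with that
        -- of `m`, independently of where the error is located.
        have e1 : ∫ y, ∫ x, E x * m (x - y) = (∫ x, E x) * I := by
          rw [← integral_prod_symm _ (integrable_prod_mul_comp_sub_left hm.integrable iE),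
            integral_prod _ (integrable_prod_mul_comp_sub_left hm.integrable iE)]
          simp only [integral_const_mul, integral_sub_left_eq_self m volume]
          rw [integral_mul_const]
        rw [e1]
        have e2 : (1 + K) * ((∫ x, E x) * I) ≤ (1 + K) * (ε * I) := by gcongr
        have e3 : ε * (1 + K) * I * (∫ x, w x) ≤ ε * (1 + K) * I * μ := by gcongr
        calc _ ≤ (1 + K) * (ε * I) + ε * (1 + K) * I * μ := add_le_add e2 e3
          _ = _ := by ring

end LaneModel

/-! ### Growth of a function of two times along the diagonal -/

lemma intervalIntegrable_of_abs_le {f : ℝ → ℝ} (hf : Measurable f) {C : ℝ} (hC : ∀ x, |f x| ≤ C)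
    (a b : ℝ) : IntervalIntegrable f volume a b :=
  (intervalIntegrable_const (c := C)).mono_fun hf.aestronglyMeasurable
    (.of_forall fun x => (hC x).trans (le_abs_self C))

lemma abs_intervalIntegral_le_of_abs_le {g : ℝ → ℝ} {Q : ℝ} (hQ : ∀ x, |g x| ≤ Q) (a b : ℝ) :
    |∫ x in a..b, g x| ≤ Q * |b - a| := by
  rw [← Real.norm_eq_abs]
  exact intervalIntegral.norm_integral_le_of_norm_le_const fun x _ => hQ x

lemma abs_integral_comp_add_sub_le {g : ℝ → ℝ} (hg : Measurable g) {Q : ℝ} (hQ : ∀ x, |g x| ≤ Q)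
    (t a σ : ℝ) : |(∫ x in (0 : ℝ)..σ, g (t + a + x)) - ∫ x in (0 : ℝ)..σ, g (t + x)|
      ≤ 2 * |a| * Q := by
  have hi := intervalIntegrable_of_abs_le hg hQ
  have hb := abs_intervalIntegral_le_of_abs_le hQ
  rw [intervalIntegral.integral_comp_add_left g, intervalIntegral.integral_comp_add_left g]
  have e : (∫ x in (t + a + 0)..(t + a + σ), g x) - ∫ x in (t + 0)..(t + σ), g x
      = (∫ x in (t + σ)..(t + a + σ), g x) - ∫ x in t..(t + a), g x := by
    have h1 := intervalIntegral.integral_add_adjacent_intervals (hi t (t + a)) (hi (t + a) (t + a + σ))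
    have h2 := intervalIntegral.integral_add_adjacent_intervals (hi t (t + σ)) (hi (t + σ) (t + a + σ))
    simp only [add_zero]
    linarith
  rw [e]
  have h1 := hb (t + σ) (t + a + σ)
  have h2 := hb t (t + a)
  rw [show t + a + σ - (t + σ) = a by ring] at h1
  rw [show t + a - t = a by ring] at h2
  refine (abs_sub _ _).trans ?_
  linarith

/-- Averaging a one-sided growth bound over a window of length `σ`. -/
lemma integral_window_le {d q : ℝ → ℝ} (hd : Measurable d) {Db : ℝ} (hdb : ∀ x, |d x| ≤ Db)
    (hq : Measurable q) {Q : ℝ} (hQ : ∀ x, |q x| ≤ Q) {t a σ e : ℝ} (ha : 0 ≤ a) (hσ : 0 ≤ σ)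
    (h : ∀ x ∈ Icc (0 : ℝ) σ, d (t + a + x) ≤ d (t + x) + (∫ r in (t + x)..(t + a + x), q r) + e) :
    ∫ x in (0 : ℝ)..σ, d (t + a + x) ≤ (∫ x in (0 : ℝ)..σ, d (t + x))
      + a * (∫ x in (0 : ℝ)..σ, q (t + x)) + (2 * a ^ 2 * Q + e * σ) := by
  set A : ℝ → ℝ := fun x => ∫ r in (0 : ℝ)..x, q r with hA
  have hi := intervalIntegrable_of_abs_le hq hQ
  have hAd : ∀ x y, A y - A x = ∫ r in x..y, q r := fun x y =>
    intervalIntegral.integral_interval_sub_left (hi 0 y) (hi 0 x)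
  have hAl : ∀ x y, |A y - A x| ≤ Q * |y - x| := fun x y => by
    rw [hAd]; exact abs_intervalIntegral_le_of_abs_le hQ x y
  have hQ0 : 0 ≤ Q := (abs_nonneg _).trans (hQ 0)
  have hAc : Continuous A := by
    refine (LipschitzWith.of_dist_le_mul (K := Real.toNNReal Q) fun x y => ?_).continuous
    rw [Real.coe_toNNReal _ hQ0, Real.dist_eq, Real.dist_eq]
    exact hAl y x
  have ii : ∀ s a b : ℝ, IntervalIntegrable (fun x => A (s + x)) volume a b := fun s a b =>
    (hAc.comp (continuous_const.add continuous_id)).intervalIntegrable a b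
  have i1 : ∀ s, IntervalIntegrable (fun x => d (s + x)) volume 0 σ := fun s =>
    intervalIntegrable_of_abs_le (hd.comp (measurable_id.const_add s)) (fun x => hdb _) _ _
  -- With `A` a primitive of `q`: shifting a window of length `σ` by `a` has the same effect as
  -- shifting a window of length `a` by `σ`. On the short window `A` is constant up to `a * Q`, so
  -- the result is `a` times the increment of `A` over `σ`, up to order `a ^ 2`.
  have key : (∫ x in (0 : ℝ)..σ, (A (t + a + x) - A (t + x)))
      ≤ a * (A (t + σ) - A t) + 2 * a ^ 2 * Q := by
    have e1 : (∫ x in (0 : ℝ)..σ, A (t + a + x)) = ∫ x in a..(a + σ), A (t + x) := by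
      rw [intervalIntegral.integral_comp_add_left A, intervalIntegral.integral_comp_add_left A]
      simp only [add_zero, add_assoc]
    have e2 : (∫ x in σ..(a + σ), A (t + x)) = ∫ x in (0 : ℝ)..a, A (t + σ + x) := by
      rw [intervalIntegral.integral_comp_add_left A, intervalIntegral.integral_comp_add_left A,
        add_zero, add_assoc, add_comm σ a]
    have h1 := intervalIntegral.integral_add_adjacent_intervals (ii t 0 a) (ii t a (a + σ))
    have h2 := intervalIntegral.integral_add_adjacent_intervals (ii t 0 σ) (ii t σ (a + σ))
    rw [intervalIntegral.integral_sub (ii _ _ _) (ii _ _ _), e1]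
    have e3 : (∫ x in a..(a + σ), A (t + x)) - ∫ x in (0 : ℝ)..σ, A (t + x)
        = ∫ x in (0 : ℝ)..a, (A (t + σ + x) - A (t + x)) := by
      rw [intervalIntegral.integral_sub (ii _ _ _) (ii _ _ _), ← e2]; linarith
    rw [e3]
    calc _ ≤ ∫ x in (0 : ℝ)..a, (A (t + σ) - A t + 2 * a * Q) := by
          refine intervalIntegral.integral_mono_on ha ((ii _ _ _).sub (ii _ _ _))
            intervalIntegrable_const fun x hx => ?_
          have q1 := hAl (t + σ) (t + σ + x)
          have q2 := hAl t (t + x)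
          rw [add_sub_cancel_left, abs_of_nonneg hx.1] at q1 q2
          have q3 : Q * x ≤ Q * a := by gcongr; exact hx.2
          linarith [abs_le.1 q1, abs_le.1 q2]
      _ = _ := by simp; ring
  have e4 : A (t + σ) - A t = ∫ x in (0 : ℝ)..σ, q (t + x) := by
    rw [hAd, intervalIntegral.integral_comp_add_left q, add_zero]
  rw [e4] at key
  calc _ ≤ ∫ x in (0 : ℝ)..σ, (d (t + x) + (A (t + a + x) - A (t + x)) + e) := by
        refine intervalIntegral.integral_mono_on hσ (i1 _)
          (((i1 _).add ((ii _ _ _).sub (ii _ _ _))).add intervalIntegrable_const) fun x hx => ?_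
        rw [hAd]; exact h x hx
    _ = (∫ x in (0 : ℝ)..σ, d (t + x)) + (∫ x in (0 : ℝ)..σ, (A (t + a + x) - A (t + x)))
        + e * σ := by
        rw [intervalIntegral.integral_add ((i1 _).add ((ii _ _ _).sub (ii _ _ _)))
          intervalIntegrable_const, intervalIntegral.integral_add (i1 _)
          ((ii _ _ _).sub (ii _ _ _))]
        simp; ring
    _ ≤ _ := by linarith

lemma le_exp_mul_of_succ_le {x : ℕ → ℝ} {c d : ℝ} (hc : 0 ≤ c) (hd : 0 ≤ d) (hx : 0 ≤ x 0) {n : ℕ}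
    (h : ∀ i < n, x (i + 1) ≤ (1 + c) * x i + d) : x n ≤ Real.exp (n * c) * (x 0 + n * d) := by
  induction n with
  | zero => simp
  | succ n ih =>
    have h1 := ih fun i hi => h i (by omega)
    have h2 := h n (by omega)
    have e1 : Real.exp ((n + 1 : ℕ) * c) = Real.exp (n * c) * Real.exp c := by
      rw [← Real.exp_add]; congr 1; push_cast; ring
    have e2 : 1 + c ≤ Real.exp c := by linarith [Real.add_one_le_exp c]
    have e3 : 1 ≤ Real.exp (n * c) * Real.exp c := by
      rw [← Real.exp_add]; exact Real.one_le_exp (by positivity)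
    calc x (n + 1) ≤ (1 + c) * (Real.exp (n * c) * (x 0 + n * d)) + d := by
          refine h2.trans (add_le_add ?_ le_rfl); gcongr
      _ ≤ Real.exp c * (Real.exp (n * c) * (x 0 + n * d))
          + Real.exp (n * c) * Real.exp c * d := by
          gcongr
          exact le_mul_of_one_le_left hd e3
      _ = _ := by rw [e1]; push_cast; ring

/-- Growth of a function of two times along the diagonal, from bounds for its growth in each of
the two times whose rates are controlled only in sum. -/
theorem diagonal_growth {D q₁ q₂ : ℝ → ℝ → ℝ} {T Db Q L e e' C c : ℝ}
    (mD : Measurable (Function.uncurry D)) (m₁ : Measurable (Function.uncurry q₁))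
    (m₂ : Measurable (Function.uncurry q₂)) (hD0 : ∀ r s, 0 ≤ D r s) (hDb : ∀ r s, D r s ≤ Db)
    (hQ₁ : ∀ r s, |q₁ r s| ≤ Q) (hQ₂ : ∀ r s, |q₂ r s| ≤ Q) (hC : 0 ≤ C) (hc : 0 ≤ c) (he : 0 ≤ e)
    (hq : ∀ r s, q₁ r s + q₂ r s ≤ C * D r s + c)
    (h₁ : ∀ s t r, 0 ≤ s → s ≤ t → t ≤ T → D t r ≤ D s r + (∫ x in s..t, q₁ x r) + e)
    (h₂ : ∀ s t r, 0 ≤ s → s ≤ t → t ≤ T → D r t ≤ D r s + (∫ x in s..t, q₂ r x) + e) (hL0 : 0 ≤ L)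
    (hL : ∀ r s r' s', |D r s - D r' s'| ≤ L * (|r - r'| + |s - s'|) + e') {σ : ℝ} (hσ : 0 < σ)
    (hσT : σ ≤ T) {n : ℕ} (hn : 0 < n) {t : ℝ} (ht0 : 0 ≤ t) (htT : t ≤ T) :
    D t t ≤ Real.exp (C * T) * (D 0 0 + (2 * L * σ + e')
      + (T * c + 6 * T ^ 2 * Q / (n * σ) + 2 * n * e)) + 2 * (2 * L * σ + e') := by
  have hT : 0 < T := hσ.trans_le hσT
  have hQ0 : 0 ≤ Q := (abs_nonneg _).trans (hQ₁ 0 0)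
  set ω := 2 * L * σ + e' with hω
  have hω0 : 0 ≤ ω := by
    have := (abs_nonneg _).trans (hL 0 0 0 0)
    simp at this
    positivity
  have aDb : ∀ r s, |D r s| ≤ Db := fun r s => by rw [abs_of_nonneg (hD0 r s)]; exact hDb r s
  have sec₁ : ∀ {F : ℝ → ℝ → ℝ}, Measurable (Function.uncurry F) → ∀ s,
    Measurable (fun x => F x s) := fun hF s => hF.comp (measurable_id.prodMk measurable_const)
  have sec₂ : ∀ {F : ℝ → ℝ → ℝ}, Measurable (Function.uncurry F) → ∀ s,
    Measurable (fun x => F s x) := fun hF s => hF.comp (measurable_const.prodMk measurable_id)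
  have trans : ∀ {F : ℝ → ℝ → ℝ}, Measurable (Function.uncurry F) → ∀ s t,
      Measurable (Function.uncurry fun x y => F (s + x) (t + y)) := fun hF s t =>
    hF.comp ((measurable_fst.const_add s).prodMk (measurable_snd.const_add t))
  -- inner integrals are measurable and bounded
  have inner : ∀ {F : ℝ → ℝ → ℝ} {b : ℝ}, Measurable (Function.uncurry F) → (∀ r s, |F r s| ≤ b) →
      Measurable (fun x => ∫ y in (0 : ℝ)..σ, F x y) ∧
        ∀ x, |∫ y in (0 : ℝ)..σ, F x y| ≤ b * σ := by
    intro F b hF hb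
    constructor
    · simp only [intervalIntegral.integral_of_le hσ.le]
      exact (hF.stronglyMeasurable.integral_prod_right (ν := volume.restrict (Ioc 0 σ))).measurable
    · intro x
      have := intervalIntegral.norm_integral_le_of_norm_le_const (a := 0) (b := σ)
        (f := F x) (C := b) fun y _ => hb x y
      simpa [abs_of_pos hσ] using this
  have swap : ∀ {F : ℝ → ℝ → ℝ} {b : ℝ}, Measurable (Function.uncurry F) → (∀ r s, |F r s| ≤ b) →
      ∫ x in (0 : ℝ)..σ, ∫ y in (0 : ℝ)..σ, F x y
        = ∫ y in (0 : ℝ)..σ, ∫ x in (0 : ℝ)..σ, F x y := by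
    intro F b hF hb
    refine intervalIntegral_intervalIntegral_swap ?_
    have hfin : volume (uIoc (0 : ℝ) σ ×ˢ uIoc (0 : ℝ) σ) ≠ ⊤ := by
      rw [Measure.volume_eq_prod, Measure.prod_prod]
      simp [uIoc_of_le hσ.le, ENNReal.mul_eq_top]
    exact Integrable.mono' (integrableOn_const (C := b) hfin) hF.aestronglyMeasurable
      (.of_forall fun p => hb p.1 p.2)
  have flip : ∀ {F : ℝ → ℝ → ℝ}, Measurable (Function.uncurry F) →
      Measurable (Function.uncurry fun x y => F y x) := fun hF => hF.comp measurable_swap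
  -- The rates are merely bounded and measurable, and the diagonal is a null set on which they carry
  -- no information. The mean over a small square at the diagonal is used instead: it is moved in
  -- the first time and then in the second, and the two rates meet on the same square up to second
  -- order.
  set J : ℝ → ℝ := fun t => ∫ y in (0 : ℝ)..σ, ∫ x in (0 : ℝ)..σ, D (t + x) (t + y) with hJ
  -- one step
  have step : ∀ t a, 0 ≤ t → 0 ≤ a → t + a + σ ≤ T →
      J (t + a) ≤ (1 + a * C) * J t + (a * c * σ ^ 2 + 6 * a ^ 2 * Q * σ + 2 * e * σ ^ 2) := by
    intro t a ht ha hta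
    have s1 : ∀ s, ∫ x in (0 : ℝ)..σ, D (t + a + x) s ≤ (∫ x in (0 : ℝ)..σ, D (t + x) s)
        + a * (∫ x in (0 : ℝ)..σ, q₁ (t + x) s) + (2 * a ^ 2 * Q + e * σ) := fun s =>
      integral_window_le (sec₁ mD s) (fun x => aDb x s) (sec₁ m₁ s) (fun x => hQ₁ x s) ha hσ.le
        fun x hx => h₁ _ _ s (by linarith [hx.1]) (by linarith) (by linarith [hx.2])
    have s2 : ∀ r, ∫ y in (0 : ℝ)..σ, D r (t + a + y) ≤ (∫ y in (0 : ℝ)..σ, D r (t + y))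
        + a * (∫ y in (0 : ℝ)..σ, q₂ r (t + y)) + (2 * a ^ 2 * Q + e * σ) := fun r =>
      integral_window_le (sec₂ mD r) (fun x => aDb r x) (sec₂ m₂ r) (fun x => hQ₂ r x) ha hσ.le
        fun x hx => h₂ _ _ r (by linarith [hx.1]) (by linarith) (by linarith [hx.2])
    -- the functions of `y` and of `x`
    have n1 := inner (F := fun y x => D (t + a + x) (t + a + y)) (flip (trans mD _ _)) fun _ _ => aDb _ _
    have n2 := inner (F := fun y x => D (t + x) (t + a + y)) (flip (trans mD _ _)) fun _ _ => aDb _ _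
    have n3 := inner (F := fun s x => q₁ (t + x) s)
      (m₁.comp ((measurable_snd.const_add t).prodMk measurable_fst)) fun _ _ => hQ₁ _ _
    have n3' : Measurable (fun y => ∫ x in (0 : ℝ)..σ, q₁ (t + x) (t + a + y)) :=
      n3.1.comp (measurable_id.const_add (t + a))
    have n3'' : Measurable (fun y => ∫ x in (0 : ℝ)..σ, q₁ (t + x) (t + y)) :=
      n3.1.comp (measurable_id.const_add t)
    have n4 := inner (F := fun x y => D (t + x) (t + a + y)) (trans mD _ _) fun _ _ => aDb _ _
    have n5 := inner (F := fun x y => D (t + x) (t + y)) (trans mD _ _) fun _ _ => aDb _ _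
    have n6 := inner (F := fun x y => q₂ (t + x) (t + y)) (trans m₂ _ _) fun _ _ => hQ₂ _ _
    have n7 := inner (F := fun y x => D (t + x) (t + y)) (flip (trans mD _ _)) fun _ _ => aDb _ _
    have n8 := inner (F := fun y x => q₂ (t + x) (t + y)) (flip (trans m₂ _ _)) fun _ _ => hQ₂ _ _
    have I := fun {f : ℝ → ℝ} (h : Measurable f) {b : ℝ} (hb : ∀ x, |f x| ≤ b) =>
      intervalIntegrable_of_abs_le h hb 0 σ
    have I2 := I n2.1 n2.2
    have I3 := (I n3' fun y => n3.2 _).const_mul a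
    have I5 := I n5.1 n5.2
    have I6 := (I n6.1 n6.2).const_mul a
    have r1 : J (t + a) ≤ (∫ y in (0 : ℝ)..σ, ∫ x in (0 : ℝ)..σ, D (t + x) (t + a + y))
        + a * (∫ y in (0 : ℝ)..σ, ∫ x in (0 : ℝ)..σ, q₁ (t + x) (t + a + y))
        + (2 * a ^ 2 * Q + e * σ) * σ := by
      calc _ ≤ ∫ y in (0 : ℝ)..σ, ((∫ x in (0 : ℝ)..σ, D (t + x) (t + a + y))
            + a * (∫ x in (0 : ℝ)..σ, q₁ (t + x) (t + a + y)) + (2 * a ^ 2 * Q + e * σ)) :=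
            intervalIntegral.integral_mono_on hσ.le (I n1.1 n1.2)
              ((I2.add I3).add intervalIntegrable_const) fun y _ => s1 (t + a + y)
        _ = _ := by
            rw [intervalIntegral.integral_add (I2.add I3) intervalIntegrable_const,
              intervalIntegral.integral_add I2 I3, intervalIntegral.integral_const_mul]
            simp; ring
    have r2 : ∫ x in (0 : ℝ)..σ, ∫ y in (0 : ℝ)..σ, D (t + x) (t + a + y)
        ≤ (∫ x in (0 : ℝ)..σ, ∫ y in (0 : ℝ)..σ, D (t + x) (t + y))
        + a * (∫ x in (0 : ℝ)..σ, ∫ y in (0 : ℝ)..σ, q₂ (t + x) (t + y))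
        + (2 * a ^ 2 * Q + e * σ) * σ := by
      calc _ ≤ ∫ x in (0 : ℝ)..σ, ((∫ y in (0 : ℝ)..σ, D (t + x) (t + y))
            + a * (∫ y in (0 : ℝ)..σ, q₂ (t + x) (t + y)) + (2 * a ^ 2 * Q + e * σ)) :=
            intervalIntegral.integral_mono_on hσ.le (I n4.1 n4.2)
              ((I5.add I6).add intervalIntegrable_const) fun x _ => s2 (t + x)
        _ = _ := by
            rw [intervalIntegral.integral_add (I5.add I6) intervalIntegrable_const,
              intervalIntegral.integral_add I5 I6, intervalIntegral.integral_const_mul]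
            simp; ring
    -- The first move leaves `q₁` at second times shifted by `a`. Shifting them back changes two end
    -- pieces of the window, a cost of order `a ^ 2` after multiplication by `a`; then `q₁` and `q₂`
    -- can be added.
    have r3 := abs_integral_comp_add_sub_le n3.1 n3.2 t a σ
    rw [abs_of_nonneg ha] at r3
    have r4 : a * (∫ y in (0 : ℝ)..σ, ∫ x in (0 : ℝ)..σ, q₁ (t + x) (t + a + y))
        ≤ a * ((∫ y in (0 : ℝ)..σ, ∫ x in (0 : ℝ)..σ, q₁ (t + x) (t + y)) + 2 * a * (Q * σ)) := by
      gcongr; linarith [(abs_le.1 r3).2]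
    have r5 : (∫ y in (0 : ℝ)..σ, ∫ x in (0 : ℝ)..σ, q₁ (t + x) (t + y))
        + (∫ y in (0 : ℝ)..σ, ∫ x in (0 : ℝ)..σ, q₂ (t + x) (t + y)) ≤ C * J t + c * σ ^ 2 := by
      have J1 := I n3'' fun y => n3.2 _
      have J2 := I n8.1 n8.2
      have J3 := (I n7.1 n7.2).const_mul C
      rw [← intervalIntegral.integral_add J1 J2]
      calc _ ≤ ∫ y in (0 : ℝ)..σ, (C * (∫ x in (0 : ℝ)..σ, D (t + x) (t + y)) + c * σ) := by
            refine intervalIntegral.integral_mono_on hσ.le (J1.add J2)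
              (J3.add intervalIntegrable_const) fun y _ => ?_
            have K1 := intervalIntegrable_of_abs_le ((sec₁ m₁ (t + y)).comp (measurable_id.const_add t))
              (fun x => hQ₁ (t + x) (t + y)) 0 σ
            have K2 := intervalIntegrable_of_abs_le ((sec₁ m₂ (t + y)).comp (measurable_id.const_add t))
              (fun x => hQ₂ (t + x) (t + y)) 0 σ
            have K3 := (intervalIntegrable_of_abs_le
              ((sec₁ mD (t + y)).comp (measurable_id.const_add t))
              (fun x => aDb (t + x) (t + y)) 0 σ).const_mul C
            simp only [Function.comp_def, id_eq] at K1 K2 K3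
            rw [← intervalIntegral.integral_add K1 K2]
            calc _ ≤ ∫ x in (0 : ℝ)..σ, (C * D (t + x) (t + y) + c) :=
                  intervalIntegral.integral_mono_on hσ.le (K1.add K2)
                    (K3.add intervalIntegrable_const) fun x _ => hq _ _
              _ = _ := by
                  rw [intervalIntegral.integral_add K3 intervalIntegrable_const,
                    intervalIntegral.integral_const_mul]
                  simp; ring
        _ = _ := by
            rw [intervalIntegral.integral_add J3 intervalIntegrable_const,
              intervalIntegral.integral_const_mul]
            simp; ring
    have w1 := swap (F := fun x y => D (t + x) (t + a + y)) (trans mD _ _) fun _ _ => aDb _ _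
    have w2 := swap (F := fun x y => D (t + x) (t + y)) (trans mD _ _) fun _ _ => aDb _ _
    have w3 := swap (F := fun x y => q₂ (t + x) (t + y)) (trans m₂ _ _) fun _ _ => hQ₂ _ _
    rw [w1, w2, w3] at r2
    have r6 := mul_le_mul_of_nonneg_left r5 ha
    change _ ≤ J t + _ + _ at r2
    linarith
  -- comparison of the averages with the values on the diagonal
  have near : ∀ t, |J t - σ ^ 2 * D t t| ≤ σ ^ 2 * ω := by
    intro t
    have n7 := inner (F := fun y x => D (t + x) (t + y)) (flip (trans mD _ _)) fun _ _ => aDb _ _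
    have J3 := intervalIntegrable_of_abs_le n7.1 n7.2 0 σ
    have e1 : J t - σ ^ 2 * D t t
        = ∫ y in (0 : ℝ)..σ, ((∫ x in (0 : ℝ)..σ, D (t + x) (t + y)) - σ * D t t) := by
      rw [intervalIntegral.integral_sub J3 intervalIntegrable_const]
      simp; ring
    rw [e1]
    have := intervalIntegral.norm_integral_le_of_norm_le_const (a := 0) (b := σ) (C := σ * ω)
      (f := fun y => (∫ x in (0 : ℝ)..σ, D (t + x) (t + y)) - σ * D t t) fun y hy => by
        rw [uIoc_of_le hσ.le] at hy
        have K3 := (intervalIntegrable_of_abs_le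
          ((sec₁ mD (t + y)).comp (measurable_id.const_add t)) (fun x => aDb (t + x) (t + y)) 0 σ)
        simp only [Function.comp_def, id_eq] at K3
        have e2 : (∫ x in (0 : ℝ)..σ, D (t + x) (t + y)) - σ * D t t
            = ∫ x in (0 : ℝ)..σ, (D (t + x) (t + y) - D t t) := by
          rw [intervalIntegral.integral_sub K3 intervalIntegrable_const]
          simp
        rw [e2]
        have := intervalIntegral.norm_integral_le_of_norm_le_const (a := 0) (b := σ) (C := ω)
          (f := fun x => D (t + x) (t + y) - D t t) fun x hx => by
            rw [uIoc_of_le hσ.le] at hx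
            refine (hL _ _ _ _).trans ?_
            rw [add_sub_cancel_left, add_sub_cancel_left, abs_of_pos hx.1, abs_of_pos hy.1, hω]
            have : L * (x + y) ≤ L * (σ + σ) := by gcongr; exacts [hx.2, hy.2]
            linarith
        rw [sub_zero, abs_of_pos hσ] at this
        linarith
    rw [sub_zero, abs_of_pos hσ] at this
    calc _ ≤ _ := this
      _ = _ := by ring
  -- up to the time `T - σ`
  have main : ∀ τ, 0 ≤ τ → τ + σ ≤ T → D τ τ ≤ Real.exp (C * T) * (D 0 0 + ω
      + (T * c + 6 * T ^ 2 * Q / (n * σ) + 2 * n * e)) + ω := by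
    intro τ hτ0 hτσ
    have hn' : (0 : ℝ) < n := by exact_mod_cast hn
    -- Each of the `n` moves has an error of order `a ^ 2`, so the total is of order `1 / n`;
    -- division by the area `σ ^ 2` leaves `σ` in the denominator.
    set a := τ / n with ha
    have ha0 : 0 ≤ a := by positivity
    have hna : n * a = τ := by rw [ha]; field_simp
    have hτT : τ ≤ T := by linarith
    set d := a * c * σ ^ 2 + 6 * a ^ 2 * Q * σ + 2 * e * σ ^ 2 with hd
    have hJ0 : 0 ≤ J 0 := intervalIntegral.integral_nonneg hσ.le fun y _ =>
      intervalIntegral.integral_nonneg hσ.le fun x _ => hD0 _ _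
    have g := le_exp_mul_of_succ_le (x := fun i => J (i * a)) (c := a * C) (d := d) (n := n)
      (by positivity) (by positivity) (by simpa using hJ0) fun i hi => by
        have h1 : ((i : ℝ) + 1) * a ≤ τ := by
          rw [← hna]; gcongr; exact_mod_cast hi
        have := step (i * a) a (by positivity) ha0 (by linarith)
        push_cast
        rwa [add_mul, one_mul]
    simp only [Nat.cast_zero, zero_mul, hna] at g
    have b1 := (abs_le.1 (near τ)).1
    have b2 := (abs_le.1 (near 0)).2
    have e1 : (n : ℝ) * (a * C) ≤ C * T := by
      rw [← mul_assoc, hna, mul_comm]; gcongr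
    have hσ2 : 0 < σ ^ 2 := by positivity
    have e2 : n * d ≤ σ ^ 2 * (T * c + 6 * T ^ 2 * Q / (n * σ) + 2 * n * e) := by
      have q1 : n * d = σ ^ 2 * (τ * c + 6 * τ ^ 2 * Q / (n * σ) + 2 * n * e) := by
        rw [hd, ← hna]; field_simp
      rw [q1]; gcongr
    have e3 : J 0 + n * d ≤ σ ^ 2 * (D 0 0 + ω
        + (T * c + 6 * T ^ 2 * Q / (n * σ) + 2 * n * e)) := by linarith
    have e4 : J τ ≤ Real.exp (C * T) * (σ ^ 2 * (D 0 0 + ω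
        + (T * c + 6 * T ^ 2 * Q / (n * σ) + 2 * n * e))) := by
      refine g.trans (mul_le_mul (Real.exp_le_exp.2 e1) e3 ?_ (Real.exp_pos _).le)
      positivity
    refine le_of_mul_le_mul_left ?_ hσ2
    calc σ ^ 2 * D τ τ ≤ J τ + σ ^ 2 * ω := by linarith
      _ ≤ _ := add_le_add e4 le_rfl
      _ = _ := by ring
  -- Squares starting later than `T - σ` leave the time interval; there the modulus of continuity of
  -- `D` in time bridges the gap.
  rcases le_total (t + σ) T with h | h
  · linarith [main t ht0 h]
  · have h3 := main (T - σ) (by linarith) (by linarith)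
    have h4 := hL t t (T - σ) (T - σ)
    have h5 : |t - (T - σ)| ≤ σ := by rw [abs_of_nonneg (by linarith)]; linarith
    have h6 : L * (|t - (T - σ)| + |t - (T - σ)|) ≤ L * (σ + σ) := by gcongr
    linarith [(abs_le.1 h4).2]

lemma exists_pos_mul_le {a κ : ℝ} (ha : 0 ≤ a) (hκ : 0 < κ) : ∃ x, 0 < x ∧ a * x ≤ κ := by
  refine ⟨κ / (a + 1), by positivity, ?_⟩
  rw [← mul_div_assoc, div_le_iff₀ (by positivity)]
  nlinarith

/-! ### Stability of approximate entropy solutions -/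

namespace LaneModel

variable {N : ℕ} {P : LaneModel N} {K M : ℝ} {ρ m : ℝ → ℝ} {δ : ℝ}

variable {T μ B L ε : ℝ} {u v : Fin N → ℝ → ℝ → ℝ}

/-- The mollified distance of two profiles after the doubling of variables. -/
def doubledDist (a b : Fin N → ℝ → ℝ) (ρ : ℝ → ℝ) : ℝ :=
  ∑ k, ∫ p : ℝ × ℝ, |a k p.1 - b k p.2| * ρ (p.1 - p.2) ∂(volume.prod volume)

lemma doubledDist_nonneg (a b : Fin N → ℝ → ℝ) (hρ : IsMollifier ρ δ) :
    0 ≤ doubledDist a b ρ :=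
  Finset.sum_nonneg fun _ _ => integral_nonneg fun _ => mul_nonneg (abs_nonneg _) (hρ.nonneg _)

lemma integral_abs_sub_mul_comm (a b : ℝ → ℝ) (hρ : IsMollifier ρ δ) :
    ∫ p : ℝ × ℝ, |a p.1 - b p.2| * ρ (p.1 - p.2) ∂(volume.prod volume)
      = ∫ p : ℝ × ℝ, |b p.1 - a p.2| * ρ (p.1 - p.2) ∂(volume.prod volume) := by
  rw [← integral_prod_swap]
  refine integral_congr_ae (.of_forall fun p => ?_)
  simp only [Prod.fst_swap, Prod.snd_swap]
  rw [abs_sub_comm, ← hρ.even, neg_sub]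

lemma IsApprox.lane_shift (hu : P.IsApprox T μ B L ε u) (k : Fin N) (t s : ℝ) :
    ∫ x, |u k t (x + s) - u k t x| ≤ B * |s| :=
  (integral_abs_le_sum (fun j x => u j t (x + s) - u j t x) k).trans (hu.shift t s)

lemma IsApprox.sum_integral_abs_sub_le (hu : P.IsApprox T μ B L ε u) (hv : P.IsApprox T μ B L ε v)
    (hρ : IsMollifier ρ δ) (r s : ℝ) :
    ∑ k, ∫ x, |u k r x - v k s x|
      ≤ doubledDist (fun k => u k r) (fun k => v k s) ρ + N * (B * δ) := by
  refine (Finset.sum_le_sum fun k _ => hρ.integral_abs_sub_le (hu.density k r).integrable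
    (hv.density k s).integrable (hu.lane_shift k r)).trans_eq ?_
  rw [Finset.sum_add_distrib]; simp [doubledDist]

lemma IsApprox.doubledDist_le (hu : P.IsApprox T μ B L ε u) (hv : P.IsApprox T μ B L ε v)
    (hρ : IsMollifier ρ δ) (r s : ℝ) :
    doubledDist (fun k => u k r) (fun k => v k s) ρ
      ≤ (∑ k, ∫ x, |u k r x - v k s x|) + N * (B * δ) := by
  refine (Finset.sum_le_sum fun k _ => hρ.integral_abs_sub_mul_le (hu.density k r).integrable
    (hv.density k s).integrable (hu.lane_shift k r)).trans_eq ?_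
  rw [Finset.sum_add_distrib]; simp

lemma IsApprox.doubledDist_le_mass (hu : P.IsApprox T μ B L ε u) (hv : P.IsApprox T μ B L ε v)
    (hρ : IsMollifier ρ δ) (r s : ℝ) :
    doubledDist (fun k => u k r) (fun k => v k s) ρ ≤ 2 * μ := by
  have h : ∀ k, ∫ p : ℝ × ℝ, |u k r p.1 - v k s p.2| * ρ (p.1 - p.2) ∂(volume.prod volume)
      ≤ (∫ x, u k r x) + ∫ x, v k s x := fun k => by
    have i1 := integrable_prod_mul_comp_sub_left hρ.integrable (hu.density k r).integrable
    have i2 := integrable_prod_mul_comp_sub hρ.integrable (hv.density k s).integrable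
    rw [← hρ.integral_prod_fst (hu.density k r).integrable,
      ← hρ.integral_prod_snd (hv.density k s).integrable, ← integral_add i1 i2]
    refine integral_mono (hρ.integrable_abs_sub_mul (hu.density k r).integrable
      (hv.density k s).integrable) (i1.add i2) fun p => ?_
    simp only [← add_mul]
    refine mul_le_mul_of_nonneg_right ((abs_sub _ _).trans_eq ?_) (hρ.nonneg _)
    rw [abs_of_nonneg ((hu.density k r).mem _).1, abs_of_nonneg ((hv.density k s).mem _).1]
  refine (Finset.sum_le_sum fun k _ => h k).trans ?_
  rw [Finset.sum_add_distrib]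
  linarith [hu.mass r, hv.mass s]

lemma IsApprox.abs_doubledDist_sub_le (hu : P.IsApprox T μ B L ε u) (hv : P.IsApprox T μ B L ε v)
    (hρ : IsMollifier ρ δ) (r s r' s' : ℝ) :
    |doubledDist (fun k => u k r) (fun k => v k s) ρ
      - doubledDist (fun k => u k r') (fun k => v k s') ρ|
      ≤ N * L * (|r - r'| + |s - s'|) + 2 * N * ε := by
  have hi := fun r s k => hρ.integrable_abs_sub_mul (hu.density k r).integrable
    (hv.density k s).integrable
  have h : ∀ k, |(∫ p : ℝ × ℝ, |u k r p.1 - v k s p.2| * ρ (p.1 - p.2) ∂(volume.prod volume))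
      - ∫ p : ℝ × ℝ, |u k r' p.1 - v k s' p.2| * ρ (p.1 - p.2) ∂(volume.prod volume)|
      ≤ (L * |r - r'| + ε) + (L * |s - s'| + ε) := fun k => by
    have j1 := integrable_abs_sub (hu.density k r).integrable (hu.density k r').integrable
    have j2 := integrable_abs_sub (hv.density k s).integrable (hv.density k s').integrable
    have i1 := integrable_prod_mul_comp_sub_left hρ.integrable j1
    have i2 := integrable_prod_mul_comp_sub hρ.integrable j2
    refine le_trans ?_ (add_le_add (hu.time k r r') (hv.time k s s'))
    rw [← hρ.integral_prod_fst j1, ← hρ.integral_prod_snd j2, ← integral_add i1 i2,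
      ← integral_sub (hi r s k) (hi r' s' k)]
    refine abs_integral_le_integral_abs.trans (integral_mono ((hi r s k).sub (hi r' s' k)).abs
      (i1.add i2) fun p => ?_)
    simp only [← add_mul]
    rw [← sub_mul, abs_mul, abs_of_nonneg (hρ.nonneg _)]
    refine mul_le_mul_of_nonneg_right ((abs_abs_sub_abs_le_abs_sub _ _).trans ?_) (hρ.nonneg _)
    rw [show u k r p.1 - v k s p.2 - (u k r' p.1 - v k s' p.2)
      = (u k r p.1 - u k r' p.1) - (v k s p.2 - v k s' p.2) by ring]
    exact abs_sub _ _
  unfold doubledDist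
  rw [← Finset.sum_sub_distrib]
  refine (Finset.abs_sum_le_sum_abs _ _).trans ((Finset.sum_le_sum fun k _ => h k).trans_eq ?_)
  simp; ring

lemma IsApprox.measurable_doubledDist (hu : P.IsApprox T μ B L ε u) (hv : P.IsApprox T μ B L ε v)
    (hρ : IsMollifier ρ δ) :
    Measurable (fun q : ℝ × ℝ => doubledDist (fun k => u k q.1) (fun k => v k q.2) ρ) := by
  refine Finset.measurable_fun_sum _ fun k _ => ?_
  have h1 : Measurable (fun q : (ℝ × ℝ) × (ℝ × ℝ) => u k q.1.1 q.2.1) :=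
    (hu.measurable k).comp ((measurable_fst.comp measurable_fst).prodMk
      (measurable_fst.comp measurable_snd))
  have h2 : Measurable (fun q : (ℝ × ℝ) × (ℝ × ℝ) => v k q.1.2 q.2.2) :=
    (hv.measurable k).comp ((measurable_snd.comp measurable_fst).prodMk
      (measurable_snd.comp measurable_snd))
  have h3 : Measurable (fun q : (ℝ × ℝ) × (ℝ × ℝ) => ρ (q.2.1 - q.2.2)) :=
    hρ.continuous.measurable.comp
      ((measurable_fst.comp measurable_snd).sub (measurable_snd.comp measurable_snd))
  have h4 : Measurable (fun q : (ℝ × ℝ) × (ℝ × ℝ) =>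
      |u k q.1.1 q.2.1 - v k q.1.2 q.2.2| * ρ (q.2.1 - q.2.2)) :=
    (continuous_abs.measurable.comp (h1.sub h2)).mul h3
  exact (StronglyMeasurable.integral_prod_right (ν := (volume : Measure ℝ).prod volume)
    (f := fun (q : ℝ × ℝ) (p : ℝ × ℝ) => |u k q.1 p.1 - v k q.2 p.2| * ρ (p.1 - p.2))
    h4.stronglyMeasurable).measurable

lemma pairBound_nonneg (hK : 0 ≤ K) (hB : 0 ≤ B) (hμ : 0 ≤ μ) : 0 ≤ pairBound K B μ := by
  unfold pairBound; positivity

set_option maxHeartbeats 1000000 in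
/-- Stability of approximate entropy solutions. -/
theorem exists_stability (hP : P.Regular K) (hM : P.SpeedLE M) (hM0 : 0 ≤ M) (hT : 0 < T)
    (hμ : 0 ≤ μ) (hB0 : 0 ≤ B) (hL : 0 ≤ L) {κ : ℝ} (hκ : 0 < κ) :
    ∃ ε₀, 0 < ε₀ ∧ ∀ (ε : ℝ) (u v : Fin N → ℝ → ℝ → ℝ), 0 ≤ ε → ε ≤ ε₀ →
      P.IsApprox T μ B L ε u → P.IsApprox T μ B L ε v →
      (∑ k, ∫ x, |u k 0 x - v k 0 x| ≤ ε₀) →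
      ∀ t ∈ Icc 0 T, ∑ k, ∫ x, |u k t x - v k t x| ≤ κ := by
  have hK := hP.nonneg
  have hN : (0 : ℝ) ≤ N := Nat.cast_nonneg N
  have hpB := pairBound_nonneg (B := B) (μ := μ) hK hB0 hμ
  set C := N * pairBound K B μ with hC
  have hC0 : 0 ≤ C := by positivity
  set X := Real.exp (C * T) with hX
  have hX0 : 0 < X := Real.exp_pos _
  -- Each of four contributions gets a quarter of `κ`. The order matters: `δ` fixes the mollifier
  -- and thereby the bound `Q` of the rates; then come the side `σ` of the square and the number `n`
  -- of moves, which depends on `Q` and `σ`; the tolerance `ε₀` comes last, as it is multiplied by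
  -- `n` and by the mass of the majorant.
  obtain ⟨δ, hδ, hδκ⟩ := exists_pos_mul_le
    (a := X * (N * B + T * (C * (N * B + 1))) + N * B) (by positivity) (by positivity : 0 < κ / 4)
  obtain ⟨ρ, hρ⟩ := exists_isMollifier hδ
  obtain ⟨m, hm⟩ := hρ.exists_isTest
  have hI0 := hm.integral_nonneg
  obtain ⟨σ', hσ', hσκ'⟩ := exists_pos_mul_le
    (a := (X + 2) * (2 * (N * L))) (by positivity) (by positivity : 0 < κ / 4)
  set σ := min σ' T with hσdef
  have hσ : 0 < σ := lt_min hσ' hT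
  have hσT : σ ≤ T := min_le_right _ _
  have hσκ : (X + 2) * (2 * (N * L)) * σ ≤ κ / 4 :=
    (mul_le_mul_of_nonneg_left (min_le_left _ _) (by positivity)).trans hσκ'
  have hfB := flowBound_nonneg (μ := μ) hK hM0 hμ hρ
  set Q := N * flowBound K M μ ρ with hQ
  have hQ0 : 0 ≤ Q := by positivity
  obtain ⟨n, hn⟩ := exists_nat_gt (X * (6 * T ^ 2 * Q) / σ / (κ / 4))
  have hn0 : (0 : ℝ) < n := lt_of_le_of_lt (by positivity) hn
  have hnκ : X * (6 * T ^ 2 * Q / (n * σ)) ≤ κ / 4 := by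
    have h1 := ((div_lt_iff₀ (by positivity)).1 hn).le
    calc _ = X * (6 * T ^ 2 * Q) / σ / n := by field_simp
      _ ≤ κ / 4 := (div_le_iff₀ hn0).2 (by linarith)
  set Eb := N * ((1 + K) * (1 + μ) * ∫ z, m z) with hEb
  have hEb0 : 0 ≤ Eb := by positivity
  obtain ⟨ε₀, hε₀, hεκ⟩ := exists_pos_mul_le
    (a := X * (1 + 2 * N + 2 * n * Eb) + 4 * N) (by positivity) (by positivity : 0 < κ / 4)
  refine ⟨ε₀, hε₀, fun ε u v hε hεε hu hv h0 t ht => ?_⟩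
  set D : ℝ → ℝ → ℝ := fun r s => doubledDist (fun k => u k r) (fun k => v k s) ρ with hD
  set q₁ : ℝ → ℝ → ℝ := fun r s => ∑ k, P.totalFlow k (fun j => u j r) (v k s) ρ with hq₁
  set q₂ : ℝ → ℝ → ℝ := fun r s => ∑ k, P.totalFlow k (fun j => v j s) (u k r) ρ with hq₂
  have m₁ : Measurable (Function.uncurry q₁) :=
    Finset.measurable_fun_sum _ fun k _ => measurable_totalFlow hP k hu hv hρ
  have m₂ : Measurable (Function.uncurry q₂) :=
    Finset.measurable_fun_sum _ fun k _ =>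
      (measurable_totalFlow hP k hv hu hρ).comp measurable_swap
  have bsum : ∀ F : Fin N → ℝ, (∀ k, |F k| ≤ flowBound K M μ ρ) → |∑ k, F k| ≤ Q := fun F hF => by
    refine (Finset.abs_sum_le_sum_abs _ _).trans ((Finset.sum_le_sum fun k _ => hF k).trans_eq ?_)
    simp [hQ]
  have b₁ : ∀ k r s, |P.totalFlow k (fun j => u j r) (v k s) ρ| ≤ flowBound K M μ ρ := fun k r s =>
    abs_totalFlow_le hP hM k (fun j => hu.density j r) (hv.density k s) hρ (hu.mass r)
      (hv.lane_mass k s)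
  have b₂ : ∀ k r s, |P.totalFlow k (fun j => v j s) (u k r) ρ| ≤ flowBound K M μ ρ := fun k r s =>
    abs_totalFlow_le hP hM k (fun j => hv.density j s) (hu.density k r) hρ (hv.mass s)
      (hu.lane_mass k r)
  have sec : ∀ k, ∀ s, Measurable (fun r => P.totalFlow k (fun j => u j r) (v k s) ρ) :=
    fun k s => (measurable_totalFlow hP k hu hv hρ).comp (measurable_id.prodMk measurable_const)
  have sec' : ∀ k, ∀ r, Measurable (fun s => P.totalFlow k (fun j => v j s) (u k r) ρ) :=
    fun k r => (measurable_totalFlow hP k hv hu hρ).comp (measurable_id.prodMk measurable_const)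
  have key := diagonal_growth (D := D) (q₁ := q₁) (q₂ := q₂) (T := T) (Db := 2 * μ) (Q := Q)
    (L := N * L) (e := Eb * ε) (e' := 2 * N * ε) (C := C) (c := C * (N * B + 1) * δ)
    (hu.measurable_doubledDist hv hρ) m₁ m₂ (fun r s => doubledDist_nonneg _ _ hρ)
    (hu.doubledDist_le_mass hv hρ) (fun r s => bsum _ fun k => b₁ k r s)
    (fun r s => bsum _ fun k => b₂ k r s) hC0 (by positivity) (by positivity)
    (fun r s => by
      have h1 := hu.sum_integral_abs_sub_le hv hρ r s
      calc q₁ r s + q₂ r s ≤ ∑ k : Fin N, pairBound K B μ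
            * ((∑ j, ∫ x, |u j r x - v j s x|) + δ) := by
            simp only [hq₁, hq₂]
            rw [← Finset.sum_add_distrib]
            exact Finset.sum_le_sum fun k _ => integral_entropyFlow_add_le hP hM k
              (fun j => hu.density j r) (fun j => hv.density j s) hρ hδ.le (hu.shift r)
              (hu.mass r) (hv.mass s)
        _ = C * ((∑ j, ∫ x, |u j r x - v j s x|) + δ) := by simp [hC]; ring
        _ ≤ C * ((D r s + N * (B * δ)) + δ) := by gcongr
        _ = _ := by ring)
    (fun s t r hs hst ht => by
      calc D t r ≤ ∑ k, ((∫ p : ℝ × ℝ, |u k s p.1 - v k r p.2| * ρ (p.1 - p.2)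
              ∂(volume.prod volume)) + (∫ x in s..t, P.totalFlow k (fun j => u j x) (v k r) ρ)
              + (1 + K) * (1 + μ) * (∫ z, m z) * ε) :=
            Finset.sum_le_sum fun k _ => hu.doubled_le hP hM hε k (hv.density k r)
              (hv.lane_mass k r) hρ hm hs hst ht
        _ = _ := by
            rw [Finset.sum_add_distrib, Finset.sum_add_distrib,
              ← intervalIntegral.integral_finsetSum fun k _ =>
                intervalIntegrable_of_abs_le (sec k r) (fun x => b₁ k x r) s t]
            simp [hD, doubledDist, hq₁, hEb]; ring)
    (fun s t r hs hst ht => by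
      calc D r t = ∑ k, ∫ p : ℝ × ℝ, |v k t p.1 - u k r p.2| * ρ (p.1 - p.2)
              ∂(volume.prod volume) :=
            Finset.sum_congr rfl fun k _ => integral_abs_sub_mul_comm _ _ hρ
        _ ≤ ∑ k, ((∫ p : ℝ × ℝ, |v k s p.1 - u k r p.2| * ρ (p.1 - p.2)
              ∂(volume.prod volume)) + (∫ x in s..t, P.totalFlow k (fun j => v j x) (u k r) ρ)
              + (1 + K) * (1 + μ) * (∫ z, m z) * ε) :=
            Finset.sum_le_sum fun k _ => hv.doubled_le hP hM hε k (hu.density k r)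
              (hu.lane_mass k r) hρ hm hs hst ht
        _ = ∑ k, ((∫ p : ℝ × ℝ, |u k r p.1 - v k s p.2| * ρ (p.1 - p.2)
              ∂(volume.prod volume)) + (∫ x in s..t, P.totalFlow k (fun j => v j x) (u k r) ρ)
              + (1 + K) * (1 + μ) * (∫ z, m z) * ε) :=
            Finset.sum_congr rfl fun k _ => by rw [integral_abs_sub_mul_comm (u k r) _ hρ]
        _ = _ := by
            rw [Finset.sum_add_distrib, Finset.sum_add_distrib,
              ← intervalIntegral.integral_finsetSum fun k _ =>
                intervalIntegrable_of_abs_le (sec' k r) (fun x => b₂ k r x) s t]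
            simp [hD, doubledDist, hq₂, hEb]; ring)
    (by positivity) (hu.abs_doubledDist_sub_le hv hρ) hσ hσT (n := n) (by exact_mod_cast hn0)
    ht.1 ht.2
  have g1 := hu.sum_integral_abs_sub_le hv hρ t t
  have g2 := hu.doubledDist_le hv hρ 0 0
  have g3 : X * (D 0 0) ≤ X * (ε₀ + N * (B * δ)) := by gcongr; linarith
  have g4 : (X * (2 * N + 2 * n * Eb) + 4 * N) * ε ≤ (X * (2 * N + 2 * n * Eb) + 4 * N) * ε₀ := by
    gcongr
  change D t t ≤ X * (D 0 0 + (2 * (N * L) * σ + 2 * N * ε) + (T * (C * (N * B + 1) * δ)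
    + 6 * T ^ 2 * Q / (n * σ) + 2 * n * (Eb * ε))) + 2 * (2 * (N * L) * σ + 2 * N * ε) at key
  change _ ≤ D t t + N * (B * δ) at g1
  linarith

end LaneModel

/-! ### Jointly measurable limits -/

/-- A sequence of jointly measurable density profiles that converges fast in `L¹`, uniformly in
time, has a jointly measurable limit. -/
theorem exists_measurable_limit {w : ℕ → ℝ → ℝ → ℝ}
    (hm : ∀ n, Measurable (fun p : ℝ × ℝ => w n p.1 p.2)) (hd : ∀ n t, IsDensity (w n t))
    (hc : ∀ n t, ∫ x, |w n t x - w (n + 1) t x| ≤ (1 / 2) ^ n) :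
    ∃ W : ℝ → ℝ → ℝ, Measurable (fun p : ℝ × ℝ => W p.1 p.2) ∧ ∀ t, IsDensity (W t) ∧
      (∀ n, ∫ x, |w n t x - W t x| ≤ 2 * (1 / 2) ^ n) ∧
      ∀ᵐ x, Tendsto (fun n => w n t x) atTop (𝓝 (W t x)) := by
  -- The upper limit is defined at every point and is jointly measurable. It agrees almost
  -- everywhere with the `L¹` limit at every single time, so no choice of representatives depending
  -- on `t` is involved.
  obtain ⟨W, hWdef⟩ : ∃ W : ℝ → ℝ → ℝ, ∀ t x, W t x = limsup (fun n => w n t x) atTop :=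
    ⟨_, fun _ _ => rfl⟩
  have hW : Measurable (fun p : ℝ × ℝ => W p.1 p.2) := by
    simp only [hWdef]
    exact Measurable.limsup hm
  have hsec : ∀ t, Measurable (W t) := fun t =>
    hW.comp (measurable_const.prodMk measurable_id)
  refine ⟨W, hW, fun t => ?_⟩
  have hmem : ∀ x, W t x ∈ Icc (0 : ℝ) 1 := fun x => by
    have hb : IsBoundedUnder (· ≤ ·) atTop (fun n => w n t x) :=
      isBoundedUnder_of ⟨1, fun n => ((hd n t).mem x).2⟩
    have hb' : IsBoundedUnder (· ≥ ·) atTop (fun n => w n t x) :=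
      isBoundedUnder_of ⟨0, fun n => ((hd n t).mem x).1⟩
    rw [hWdef]
    exact ⟨le_limsup_of_frequently_le (Frequently.of_forall fun n => ((hd n t).mem x).1) hb,
      limsup_le_of_le hb'.isCoboundedUnder_flip (.of_forall fun n => ((hd n t).mem x).2)⟩
  set e : ℕ → ℝ → ℝ≥0∞ := fun n x => edist (w n t x) (w (n + 1) t x) with he
  have hem : ∀ n, Measurable (e n) := fun n => (hd n t).measurable.edist (hd (n + 1) t).measurable
  have hei : ∀ n, ∫⁻ x, e n x ≤ ENNReal.ofReal ((1 / 2) ^ n) := fun n => by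
    have h := ofReal_integral_norm_eq_lintegral_enorm
      ((hd n t).integrable.sub (hd (n + 1) t).integrable)
    simp only [he, edist_eq_enorm_sub]
    simp only [Pi.sub_apply] at h
    rw [← h]
    exact ENNReal.ofReal_le_ofReal (hc n t)
  have hsum : ∀ n, ∑' m, ENNReal.ofReal ((1 / 2) ^ (n + m)) = ENNReal.ofReal (2 * (1 / 2) ^ n) := by
    intro n
    have h1 : HasSum (fun m : ℕ => (1 / 2 : ℝ) ^ (n + m)) (2 * (1 / 2) ^ n) := by
      have := hasSum_geometric_two.mul_left ((1 / 2 : ℝ) ^ n)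
      simpa only [← pow_add, mul_comm] using this
    rw [← ENNReal.ofReal_tsum_of_nonneg (fun m => by positivity) h1.summable, h1.tsum_eq]
  have htail : ∀ n, ∫⁻ x, ∑' m, e (n + m) x ≤ ENNReal.ofReal (2 * (1 / 2) ^ n) := fun n => by
    rw [lintegral_tsum fun m => (hem _).aemeasurable, ← hsum n]
    exact ENNReal.tsum_le_tsum fun m => hei _
  have hfin : ∀ᵐ x, ∑' m, e (0 + m) x < ⊤ :=
    ae_lt_top (Measurable.tsum fun m => hem _)
      (ne_top_of_le_ne_top ENNReal.ofReal_ne_top (htail 0))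
  have hlim : ∀ᵐ x, Tendsto (fun n => w n t x) atTop
      (𝓝 (W t x)) := by
    filter_upwards [hfin] with x hx
    simp only [zero_add] at hx
    obtain ⟨l, hl⟩ := cauchySeq_tendsto_of_complete
      (cauchySeq_of_edist_le_of_tsum_ne_top (f := fun n => w n t x) (fun n => e n x)
        (fun n => le_rfl) hx.ne)
    rwa [hWdef, hl.limsup_eq]
  have hdist : ∀ n, ∫⁻ x, ‖w n t x - W t x‖ₑ
      ≤ ENNReal.ofReal (2 * (1 / 2) ^ n) := fun n => by
    refine (lintegral_mono_ae ?_).trans (htail n)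
    filter_upwards [hlim] with x hx
    rw [← edist_eq_enorm_sub]
    exact edist_le_tsum_of_edist_le_of_tendsto (fun n => e n x) (fun n => le_rfl) hx n
  have hint : ∀ n, Integrable (fun x => w n t x - W t x) := fun n =>
    ⟨((hd n t).measurable.sub (hsec t)).aestronglyMeasurable,
      (hdist n).trans_lt ENNReal.ofReal_lt_top⟩
  refine ⟨⟨hsec t, hmem, ?_⟩, fun n => ?_, hlim⟩
  · exact ((hd 0 t).integrable.sub (hint 0)).congr (.of_forall fun x => by simp)
  · have h := (ofReal_integral_norm_eq_lintegral_enorm (hint n)).trans_le (hdist n)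
    exact (ENNReal.ofReal_le_ofReal_iff (by positivity)).1 h

/-! ### Approximate solutions without error -/

namespace LaneModel

variable {N : ℕ} {P : LaneModel N} {K M T μ B L : ℝ} {u : Fin N → ℝ → ℝ → ℝ}

/-- The velocity is jointly continuous if the density is Lipschitz continuous in time. -/
lemma continuous_speed_of_time (hP : P.Regular K) (k : Fin N) {c : ℝ → ℝ → ℝ}
    (hd : ∀ t, IsDensity (c t)) (hL : ∀ s t, ∫ x, |c s x - c t x| ≤ L * |s - t|) :
    Continuous (Function.uncurry fun t => P.speed k (c t)) := by
  have hK := hP.nonneg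
  have hL0 : 0 ≤ L := by
    have := (integral_nonneg fun x => abs_nonneg _).trans (hL 1 0)
    simpa using this
  refine (LipschitzWith.of_dist_le_mul (K := Real.toNNReal (K ^ 2 * L + (K + 2 * K ^ 2)))
    fun p q => ?_).continuous
  rw [Real.coe_toNNReal _ (by positivity), Real.dist_eq]
  have h1 := abs_speed_sub_speed_le hP k (hd p.1) (hd q.1) p.2
  have h2 := abs_speed_sub_le hP k (hd q.1) p.2 q.2
  have h3 : |p.1 - q.1| ≤ dist p q := le_max_left _ _
  have h4 : |p.2 - q.2| ≤ dist p q := le_max_right _ _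
  calc _ ≤ K ^ 2 * (L * |p.1 - q.1|) + (K + 2 * K ^ 2) * |p.2 - q.2| := by
        refine (abs_sub_le _ (P.speed k (c q.1) p.2) _).trans (add_le_add (h1.trans ?_) h2)
        gcongr
        exact hL _ _
    _ ≤ K ^ 2 * (L * dist p q) + (K + 2 * K ^ 2) * dist p q := by gcongr
    _ = _ := by ring

/-- Profiles with exact entropy inequalities are approximate entropy solutions without error. -/
lemma isApprox_zero (hP : P.Regular K) (hm : ∀ k, Measurable (fun p : ℝ × ℝ => u k p.1 p.2))
    (hd : ∀ k t, IsDensity (u k t)) (hmass : ∀ t, ∑ j, ∫ x, u j t x ≤ μ)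
    (hs : ∀ t δ, ∑ j, ∫ x, |u j t (x + δ) - u j t x| ≤ B * |δ|)
    (hL : ∀ k s t, ∫ x, |u k s x - u k t x| ≤ L * |s - t|)
    (hent : ∀ s t, 0 ≤ s → s ≤ t → t ≤ T → ∀ k α (ψ m : ℝ → ℝ), IsTest ψ m →
      ContDiff ℝ (⊤ : ℕ∞) ψ → HasCompactSupport ψ → ∫ x, |u k t x - α| * ψ x
        ≤ (∫ x, |u k s x - α| * ψ x) + ∫ r in s..t, P.rate k (fun j => u j r) α ψ) :
    P.IsApprox T μ B L 0 u where
  measurable := hm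
  -- Lipschitz continuity in time makes the velocity jointly continuous, and the space derivative of
  -- a jointly continuous function is jointly measurable.
  measurable_deriv k := measurable_deriv_with_param (continuous_speed_of_time hP k (hd k) (hL k))
  density := hd
  mass := hmass
  shift := hs
  time k s t := by simpa using hL k s t
  entropy s t hs0 hst htT k := ⟨0, integrable_zero _ _ _, fun x => le_rfl, by simp,
    fun α ψ m hψ hψs hψc => by simpa using hent s t hs0 hst htT k α ψ m hψ hψs hψc⟩

lemma IsApprox.mono {μ' B' L' ε ε' : ℝ} (hu : P.IsApprox T μ B L ε u) (hμ : μ ≤ μ') (hB : B ≤ B')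
    (hL : L ≤ L') (h : ε ≤ ε') : P.IsApprox T μ' B' L' ε' u where
  measurable := hu.measurable
  measurable_deriv := hu.measurable_deriv
  density := hu.density
  mass t := (hu.mass t).trans hμ
  shift t δ := (hu.shift t δ).trans (by gcongr)
  time k s t := (hu.time k s t).trans (by gcongr)
  entropy s t hs0 hst htT k := by
    obtain ⟨E, h1, h2, h3, h4⟩ := hu.entropy s t hs0 hst htT k
    refine ⟨E, h1, h2, h3.trans h, fun α ψ m hψ hψs hψc => (h4 α ψ m hψ hψs hψc).trans ?_⟩
    have := hψ.integral_nonneg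
    gcongr

end LaneModel

/-! ### Measurable representatives of curves in `L¹` -/

lemma ae_eq_of_integral_abs_sub_nonpos {a b : ℝ → ℝ} (ha : Integrable a) (hb : Integrable b)
    (h : ∫ x, |a x - b x| ≤ 0) : a =ᵐ[volume] b := by
  have h0 : (fun x => |a x - b x|) =ᵐ[volume] 0 :=
    (integral_eq_zero_iff_of_nonneg (fun x => abs_nonneg _) (LaneModel.integrable_abs_sub ha hb)).1
      (le_antisymm h (integral_nonneg fun x => abs_nonneg _))
  exact h0.mono fun x hx => sub_eq_zero.1 (abs_eq_zero.1 hx)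

lemma exists_isDensity_ae_eq {w : ℝ → ℝ} (hi : Integrable w) (hr : ∀ᵐ x, w x ∈ Icc (0 : ℝ) 1) :
    ∃ a : ℝ → ℝ, IsDensity a ∧ a =ᵐ[volume] w := by
  have h1 := hi.aestronglyMeasurable
  have hbm : Measurable (h1.mk w) := h1.stronglyMeasurable_mk.measurable
  have hae : (fun x => max 0 (min (h1.mk w x) 1)) =ᵐ[volume] w := by
    filter_upwards [h1.ae_eq_mk, hr] with x h2 h3
    rw [← h2, min_eq_left h3.2, max_eq_right h3.1]
  exact ⟨_, ⟨measurable_const.max (hbm.min measurable_const),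
    fun x => ⟨le_max_left _ _, max_le zero_le_one (min_le_right _ _)⟩, hi.congr hae.symm⟩, hae⟩

lemma abs_clamp_sub_clamp_le (T s t : ℝ) :
    |max 0 (min s T) - max 0 (min t T)| ≤ |s - t| := by
  have h1 : |min s T - min t T| ≤ |s - t| := by
    simpa using abs_min_sub_min_le_max s T t T
  have h2 : |max (min s T) 0 - max (min t T) 0| ≤ |min s T - min t T| :=
    abs_max_sub_max_le_abs _ _ _
  simpa only [max_comm (0 : ℝ)] using h2.trans h1

/-- A family of integrable functions with values in `[0, 1]` that is Lipschitz continuous in time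
on `[0, T]` has a jointly measurable representative, extended by constants outside `[0, T]`. -/
theorem exists_measurable_version {v : ℝ → ℝ → ℝ} {T L : ℝ} (hT : 0 < T) (hL : 0 ≤ L)
    (hi : ∀ t ∈ Icc 0 T, Integrable (v t)) (hr : ∀ t ∈ Icc 0 T, ∀ᵐ x, v t x ∈ Icc (0 : ℝ) 1)
    (hl : ∀ s ∈ Icc 0 T, ∀ t ∈ Icc 0 T, ∫ x, |v s x - v t x| ≤ L * |s - t|) :
    ∃ W : ℝ → ℝ → ℝ, Measurable (fun p : ℝ × ℝ => W p.1 p.2) ∧ (∀ t, IsDensity (W t)) ∧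
      ∀ t, W t =ᵐ[volume] v (max 0 (min t T)) := by
  set cl : ℝ → ℝ := fun t => max 0 (min t T) with hcl
  have hclm : ∀ t, cl t ∈ Icc 0 T := fun t =>
    ⟨le_max_left _ _, max_le hT.le (min_le_right _ _)⟩
  have hclc : Continuous cl := continuous_const.max (continuous_id.min continuous_const)
  -- measurable representatives at every single time
  have hrep : ∀ t, ∃ a : ℝ → ℝ, IsDensity a ∧ a =ᵐ[volume] v (cl t) := fun t =>
    exists_isDensity_ae_eq (hi _ (hclm t)) (hr _ (hclm t))
  choose a ha hav using hrep
  -- piecewise constant interpolation on grids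
  obtain ⟨τ₀, hτ₀, hτL⟩ := exists_pos_mul_le (a := 2 * L) (by positivity) zero_lt_one
  set τ : ℕ → ℝ := fun n => τ₀ * (1 / 2) ^ n with hτ
  have hτ0 : ∀ n, 0 < τ n := fun n => by positivity
  set γ : ℕ → ℝ → ℝ := fun n t => (⌈cl t / τ n⌉₊ : ℝ) * τ n with hγ
  have hγb : ∀ n t, |γ n t - cl t| ≤ τ n := fun n t => by
    have h1 : cl t ≤ γ n t := (div_le_iff₀ (hτ0 n)).1 (Nat.le_ceil _)
    have h2 : γ n t ≤ cl t + τ n := by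
      have := (Nat.ceil_lt_add_one (div_nonneg (hclm t).1 (hτ0 n).le)).le
      calc _ ≤ (cl t / τ n + 1) * τ n := by have := hτ0 n; simp only [hγ]; gcongr
        _ = _ := by have := (hτ0 n).ne'; field_simp
    rw [abs_le]; constructor <;> linarith [hτ0 n]
  have hcl1 : ∀ s t, |cl s - cl t| ≤ |s - t| := abs_clamp_sub_clamp_le T
  have hcl2 : ∀ t, cl (cl t) = cl t := fun t => by
    have := hclm t
    change max 0 (min (cl t) T) = cl t
    rw [min_eq_left this.2, max_eq_right this.1]
  have hdist : ∀ s t, ∫ x, |a s x - a t x| ≤ L * |cl s - cl t| := fun s t => by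
    refine le_trans (le_of_eq (integral_congr_ae ?_)) (hl _ (hclm s) _ (hclm t))
    filter_upwards [hav s, hav t] with x h1 h2
    rw [h1, h2]
  have hclγ : ∀ n t, |cl (γ n t) - cl t| ≤ τ n := fun n t => by
    have := hcl1 (γ n t) (cl t)
    rw [hcl2] at this
    exact this.trans (hγb n t)
  -- The representatives `a t` are chosen without any measurability in `t`. Each interpolation uses
  -- only countably many of them and is therefore jointly measurable; the choice of `τ₀` makes
  -- consecutive interpolations differ by at most `(1 / 2) ^ n`.
  obtain ⟨W, hWm, hW⟩ := exists_measurable_limit (w := fun n t => a (γ n t))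
    (fun n => by
      have h1 : Measurable (fun q : ℕ × ℝ => a (q.1 * τ n) q.2) :=
        measurable_from_prod_countable_right (f := fun q : ℕ × ℝ => a (q.1 * τ n) q.2)
          fun i => (ha (i * τ n)).measurable
      have h2 : Measurable (fun t => ⌈cl t / τ n⌉₊) :=
        Nat.measurable_ceil.comp (hclc.measurable.div_const _)
      exact h1.comp ((h2.comp measurable_fst).prodMk measurable_snd))
    (fun n t => ha _) (fun n t => by
      refine (hdist _ _).trans ?_
      have h1 := hclγ n t
      have h2 := hclγ (n + 1) t
      have h3 : τ (n + 1) ≤ τ n := by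
        simp only [hτ]
        gcongr ?_ * ?_
        exact pow_le_pow_of_le_one (by norm_num) (by norm_num) (by omega)
      have h4 : |cl (γ n t) - cl (γ (n + 1) t)| ≤ 2 * τ n := by
        rw [abs_sub_comm] at h2
        linarith [abs_sub_le (cl (γ n t)) (cl t) (cl (γ (n + 1) t))]
      calc _ ≤ L * (2 * τ n) := by gcongr
        _ = 2 * L * τ₀ * (1 / 2) ^ n := by simp only [hτ]; ring
        _ ≤ 1 * (1 / 2) ^ n := by gcongr
        _ = _ := one_mul _)
  refine ⟨W, hWm, fun t => (hW t).1, fun t => ?_⟩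
  have hWi := (hW t).1.integrable
  have hz : ∫ x, |a t x - W t x| ≤ 0 := by
    have hlim : Tendsto (fun n : ℕ => (L * τ₀ + 2) * (1 / 2 : ℝ) ^ n) atTop (𝓝 0) := by
      simpa using (tendsto_pow_atTop_nhds_zero_of_lt_one (r := (1 / 2 : ℝ))
        (by norm_num) (by norm_num)).const_mul (L * τ₀ + 2)
    refine ge_of_tendsto hlim (.of_forall fun n => ?_)
    · have i1 := LaneModel.integrable_abs_sub (ha t).integrable (ha (γ n t)).integrable
      have i2 := LaneModel.integrable_abs_sub (ha (γ n t)).integrable hWi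
      calc _ ≤ ∫ x, (|a t x - a (γ n t) x| + |a (γ n t) x - W t x|) :=
            integral_mono (LaneModel.integrable_abs_sub (ha t).integrable hWi) (i1.add i2)
              fun x => abs_sub_le _ _ _
        _ ≤ L * τ n + 2 * (1 / 2) ^ n := by
            rw [integral_add i1 i2]
            refine add_le_add ((hdist _ _).trans ?_) ((hW t).2.1 n)
            rw [abs_sub_comm]
            exact mul_le_mul_of_nonneg_left (hclγ n t) hL
        _ = _ := by simp only [hτ]; ring
  exact (ae_eq_of_integral_abs_sub_nonpos (ha t).integrable hWi hz).symm.trans (hav t)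

/-! ### Test functions on the plane, and the weak formulation as an iterated integral -/

section Partials

variable {φ : ℝ → ℝ → ℝ}

lemma hasDerivAt_fst_of_contDiff (hφ : ContDiff ℝ (⊤ : ℕ∞) (fun p : ℝ × ℝ => φ p.1 p.2)) (t x : ℝ) :
    HasDerivAt (fun t => φ t x) (fderiv ℝ (fun p : ℝ × ℝ => φ p.1 p.2) (t, x) (1, 0)) t := by
  have h1 := (hφ.differentiable (by simp) (t, x)).hasFDerivAt
  have h2 : HasDerivAt (fun t : ℝ => (t, x)) ((1 : ℝ), (0 : ℝ)) t :=
    (hasDerivAt_id t).prodMk (hasDerivAt_const t x)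
  exact h1.comp_hasDerivAt t h2

lemma hasDerivAt_snd_of_contDiff (hφ : ContDiff ℝ (⊤ : ℕ∞) (fun p : ℝ × ℝ => φ p.1 p.2)) (t x : ℝ) :
    HasDerivAt (φ t) (fderiv ℝ (fun p : ℝ × ℝ => φ p.1 p.2) (t, x) (0, 1)) x := by
  have h1 := (hφ.differentiable (by simp) (t, x)).hasFDerivAt
  have h2 : HasDerivAt (fun x : ℝ => (t, x)) ((0 : ℝ), (1 : ℝ)) x :=
    (hasDerivAt_const x t).prodMk (hasDerivAt_id x)
  exact h1.comp_hasDerivAt x h2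

lemma contDiff_fderiv_apply_pair (hφ : ContDiff ℝ (⊤ : ℕ∞) (fun p : ℝ × ℝ => φ p.1 p.2)) (e : ℝ × ℝ)
    :
    ContDiff ℝ (⊤ : ℕ∞) (fun p => fderiv ℝ (fun p : ℝ × ℝ => φ p.1 p.2) p e) :=
  (hφ.fderiv_right (m := (⊤ : ℕ∞)) (by simp)).clm_apply contDiff_const

lemma contDiff_deriv_fst (hφ : ContDiff ℝ (⊤ : ℕ∞) (fun p : ℝ × ℝ => φ p.1 p.2)) :
    ContDiff ℝ (⊤ : ℕ∞) (fun p : ℝ × ℝ => deriv (fun t => φ t p.2) p.1) := by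
  have e : (fun p : ℝ × ℝ => deriv (fun t => φ t p.2) p.1)
      = fun p => fderiv ℝ (fun p : ℝ × ℝ => φ p.1 p.2) p (1, 0) :=
    funext fun p => (hasDerivAt_fst_of_contDiff hφ p.1 p.2).deriv
  rw [e]
  exact contDiff_fderiv_apply_pair hφ _

lemma contDiff_deriv_snd (hφ : ContDiff ℝ (⊤ : ℕ∞) (fun p : ℝ × ℝ => φ p.1 p.2)) :
    ContDiff ℝ (⊤ : ℕ∞) (fun p : ℝ × ℝ => deriv (φ p.1) p.2) := by
  have e : (fun p : ℝ × ℝ => deriv (φ p.1) p.2)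
      = fun p => fderiv ℝ (fun p : ℝ × ℝ => φ p.1 p.2) p (0, 1) :=
    funext fun p => (hasDerivAt_snd_of_contDiff hφ p.1 p.2).deriv
  rw [e]
  exact contDiff_fderiv_apply_pair hφ _

lemma hasCompactSupport_deriv_fst (hφ : ContDiff ℝ (⊤ : ℕ∞) (fun p : ℝ × ℝ => φ p.1 p.2))
    (hs : HasCompactSupport (fun p : ℝ × ℝ => φ p.1 p.2)) :
    HasCompactSupport (fun p : ℝ × ℝ => deriv (fun t => φ t p.2) p.1) := by
  have e : (fun p : ℝ × ℝ => deriv (fun t => φ t p.2) p.1)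
      = fun p => fderiv ℝ (fun p : ℝ × ℝ => φ p.1 p.2) p (1, 0) :=
    funext fun p => (hasDerivAt_fst_of_contDiff hφ p.1 p.2).deriv
  rw [e]
  exact hs.fderiv_apply ℝ _

lemma hasCompactSupport_deriv_snd (hφ : ContDiff ℝ (⊤ : ℕ∞) (fun p : ℝ × ℝ => φ p.1 p.2))
    (hs : HasCompactSupport (fun p : ℝ × ℝ => φ p.1 p.2)) :
    HasCompactSupport (fun p : ℝ × ℝ => deriv (φ p.1) p.2) := by
  have e : (fun p : ℝ × ℝ => deriv (φ p.1) p.2)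
      = fun p => fderiv ℝ (fun p : ℝ × ℝ => φ p.1 p.2) p (0, 1) :=
    funext fun p => (hasDerivAt_snd_of_contDiff hφ p.1 p.2).deriv
  rw [e]
  exact hs.fderiv_apply ℝ _

end Partials

/-- A bounded measurable function times a continuous one with compact support. -/
lemma integrable_mul_of_hasCompactSupport {g h : ℝ × ℝ → ℝ} (hg : Measurable g) {C : ℝ}
    (hC : ∀ p, |g p| ≤ C) (hh : Continuous h) (hs : HasCompactSupport h) :
    Integrable (fun p => g p * h p) :=
  (hh.integrable_of_hasCompactSupport hs).bdd_mul hg.aestronglyMeasurable (.of_forall hC)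

lemma setIntegral_strip {F : ℝ × ℝ → ℝ} (hF : Integrable F) {T : ℝ} (hT : 0 ≤ T) :
    ∫ p in Ioo 0 T ×ˢ univ, F p = ∫ t in (0 : ℝ)..T, ∫ x, F (t, x) := by
  rw [Measure.volume_eq_prod, setIntegral_prod _ (by exact hF.integrableOn),
    intervalIntegral.integral_of_le hT, integral_Ioc_eq_integral_Ioo]
  simp

lemma integral_add_sub_add {Ω : Type*} [MeasurableSpace Ω] {μ : Measure Ω} {A B C D : Ω → ℝ}
    (hA : Integrable A μ) (hB : Integrable B μ) (hC : Integrable C μ) (hD : Integrable D μ) :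
    ∫ x, A x ∂μ + ∫ x, B x ∂μ - ∫ x, C x ∂μ + ∫ x, D x ∂μ
      = ∫ x, (A x + B x - C x + D x) ∂μ := by
  have h1 : Integrable (fun x => A x + B x) μ := hA.add hB
  have h2 : Integrable (fun x => A x + B x - C x) μ := h1.sub hC
  rw [integral_add h2 hD, integral_sub h1 hC, integral_add hA hB]

namespace LaneModel

variable {N : ℕ} {P : LaneModel N} {K M T μ B L : ℝ} {u : Fin N → ℝ → ℝ → ℝ}
  {φ : ℝ → ℝ → ℝ}

lemma G_eq_kruzkov (k : Fin N) (a b : ℝ) : P.G k a b = kruzkov (P.f k) a b := rfl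

lemma vel_eq_speed (k : Fin N) (t : ℝ) : P.vel u k t = P.speed k (u k t) := rfl

lemma src_eq_source (k : Fin N) (t : ℝ) : P.src u k t = P.source k (fun j => u j t) := rfl

lemma integrable_weak_terms (hP : P.Regular K) (hM : P.SpeedLE M)
    (hm : ∀ k, Measurable (fun p : ℝ × ℝ => u k p.1 p.2))
    (hmd : ∀ k, Measurable (fun p : ℝ × ℝ => deriv (P.speed k (u k p.1)) p.2))
    (hd : ∀ k t, IsDensity (u k t)) (hφ : ContDiff ℝ (⊤ : ℕ∞) (fun p : ℝ × ℝ => φ p.1 p.2))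
    (hs : HasCompactSupport (fun p : ℝ × ℝ => φ p.1 p.2)) (k : Fin N) (α : ℝ) :
    Integrable (fun p : ℝ × ℝ => |u k p.1 p.2 - α| * deriv (fun t => φ t p.2) p.1) ∧
    Integrable (fun p : ℝ × ℝ => kruzkov (P.f k) (u k p.1 p.2) α * P.speed k (u k p.1) p.2
      * deriv (φ p.1) p.2) ∧
    Integrable (fun p : ℝ × ℝ => Real.sign (u k p.1 p.2 - α) * P.f k α
      * deriv (P.speed k (u k p.1)) p.2 * φ p.1 p.2) ∧
    Integrable (fun p : ℝ × ℝ => Real.sign (u k p.1 p.2 - α) * P.source k (fun j => u j p.1) p.2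
      * φ p.1 p.2) := by
  have mu := hm k
  have ms : Measurable (fun p : ℝ × ℝ => Real.sign (u k p.1 p.2 - α)) :=
    measurable_real_sign.comp (mu.sub_const α)
  have mk : Measurable (fun p : ℝ × ℝ => kruzkov (P.f k) (u k p.1 p.2) α) :=
    (continuous_kruzkov (continuous_f hP.adm k)).measurable.comp (mu.prodMk (measurable_const (a := α)))
  have mv := measurable_speed_comp hP k (hm k) (hd k)
  have mr := measurable_source_comp (c := u) hP k hm hd
  refine ⟨integrable_mul_of_hasCompactSupport (measurable_norm.comp (mu.sub_const α))
      (C := 1 + |α|) (fun p => ?_) (contDiff_deriv_fst hφ).continuous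
      (hasCompactSupport_deriv_fst hφ hs),
    integrable_mul_of_hasCompactSupport (mk.mul mv) (C := (K + |P.f k α|) * M) (fun p => ?_)
      (contDiff_deriv_snd hφ).continuous (hasCompactSupport_deriv_snd hφ hs),
    integrable_mul_of_hasCompactSupport ((ms.mul_const _).mul (hmd k))
      (C := |P.f k α| * (K + 2 * K ^ 2)) (fun p => ?_) hφ.continuous hs,
    integrable_mul_of_hasCompactSupport (ms.mul mr) (C := 2 * K * N) (fun p => ?_)
      hφ.continuous hs⟩
  · refine (abs_abs _).trans_le ?_
    exact abs_sub_le_one_add ((hd k p.1).mem p.2) α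
  · exact abs_kruzkov_mul_speed_le' hP hM k (hd k p.1) α p.2
  · rw [mul_assoc]
    refine (abs_sign_mul_le _ _).trans ?_
    rw [abs_mul]
    exact mul_le_mul_of_nonneg_left (abs_deriv_speed_le hP k (hd k p.1) p.2) (abs_nonneg _)
  · exact (abs_sign_mul_le _ _).trans (abs_source_le_card hP k (fun j => hd j p.1) p.2)

/-- The weak form of the entropy inequality as an iterated integral. -/
theorem weak_form_eq (hP : P.Regular K) (hM : P.SpeedLE M)
    (hm : ∀ k, Measurable (fun p : ℝ × ℝ => u k p.1 p.2))
    (hmd : ∀ k, Measurable (fun p : ℝ × ℝ => deriv (P.speed k (u k p.1)) p.2))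
    (hd : ∀ k t, IsDensity (u k t)) (hφ : ContDiff ℝ (⊤ : ℕ∞) (fun p : ℝ × ℝ => φ p.1 p.2))
    (hs : HasCompactSupport (fun p : ℝ × ℝ => φ p.1 p.2)) (hT : 0 ≤ T) (k : Fin N) (α : ℝ) :
    Integrable (fun t => (∫ x, |u k t x - α| * deriv (fun s => φ s x) t)
      + P.rate k (fun j => u j t) α (φ t)) ∧
    (∫ p in Ioo 0 T ×ˢ univ, |u k p.1 p.2 - α| * deriv (fun t => φ t p.2) p.1)
      + (∫ p in Ioo 0 T ×ˢ univ,
          P.G k (u k p.1 p.2) α * P.vel u k p.1 p.2 * deriv (fun x => φ p.1 x) p.2)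
      - (∫ p in Ioo 0 T ×ˢ univ,
          Real.sign (u k p.1 p.2 - α) * P.f k α * deriv (fun x => P.vel u k p.1 x) p.2
            * φ p.1 p.2)
      + (∫ p in Ioo 0 T ×ˢ univ, Real.sign (u k p.1 p.2 - α) * P.src u k p.1 p.2 * φ p.1 p.2)
    = ∫ t in (0 : ℝ)..T, ((∫ x, |u k t x - α| * deriv (fun s => φ s x) t)
      + P.rate k (fun j => u j t) α (φ t)) := by
  simp only [G_eq_kruzkov, vel_eq_speed, src_eq_source]
  obtain ⟨i1, i2, i3, i4⟩ := integrable_weak_terms hP hM hm hmd hd hφ hs k α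
  have i5 : Integrable (fun p : ℝ × ℝ => |u k p.1 p.2 - α| * deriv (fun t => φ t p.2) p.1
      + kruzkov (P.f k) (u k p.1 p.2) α * P.speed k (u k p.1) p.2 * deriv (φ p.1) p.2
      - Real.sign (u k p.1 p.2 - α) * P.f k α * deriv (P.speed k (u k p.1)) p.2 * φ p.1 p.2
      + Real.sign (u k p.1 p.2 - α) * P.source k (fun j => u j p.1) p.2 * φ p.1 p.2) :=
    ((i1.add i2).sub i3).add i4
  rw [integral_add_sub_add i1.integrableOn i2.integrableOn i3.integrableOn i4.integrableOn]
  have key : ∀ᵐ t, ∫ x, (|u k t x - α| * deriv (fun t => φ t x) t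
      + kruzkov (P.f k) (u k t x) α * P.speed k (u k t) x * deriv (φ t) x
      - Real.sign (u k t x - α) * P.f k α * deriv (P.speed k (u k t)) x * φ t x
      + Real.sign (u k t x - α) * P.source k (fun j => u j t) x * φ t x)
      = (∫ x, |u k t x - α| * deriv (fun s => φ s x) t) + P.rate k (fun j => u j t) α (φ t) := by
    filter_upwards [i1.prod_right_ae, i2.prod_right_ae, i3.prod_right_ae, i4.prod_right_ae]
      with t j1 j2 j3 j4
    have j5 : Integrable (fun x => kruzkov (P.f k) (u k t x) α * P.speed k (u k t) x * deriv (φ t) x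
        + Real.sign (u k t x - α) * (P.source k (fun j => u j t) x
          - P.f k α * deriv (P.speed k (u k t)) x) * φ t x) :=
      ((j2.sub j3).add j4).congr (.of_forall fun x => by
        simp only [Pi.add_apply, Pi.sub_apply]; ring)
    rw [rate, ← integral_add j1 j5]
    exact integral_congr_ae (.of_forall fun x => by ring)
  refine ⟨i5.integral_prod_left.congr key, ?_⟩
  rw [setIntegral_strip i5 hT]
  exact intervalIntegral.integral_congr_ae (key.mono fun t ht _ => ht)

end LaneModel

/-! ### Total variation and `L¹` distances of translates -/

lemma integrable_mul_of_continuous {v ψ : ℝ → ℝ} (hv : Integrable v) (hc : Continuous ψ)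
    (hs : HasCompactSupport ψ) : Integrable (fun x => v x * ψ x) := by
  obtain ⟨C, hC⟩ := hs.exists_bound_of_continuous hc
  simpa only [mul_comm] using
    hv.bdd_mul hc.aestronglyMeasurable (.of_forall hC)

/-- The `L¹` norm by duality with continuous functions. -/
lemma integral_abs_le_of_forall_integral_mul_le {w : ℝ → ℝ} (hw : Integrable w) {C : ℝ}
    (h : ∀ ψ : ℝ → ℝ, Continuous ψ → HasCompactSupport ψ → (∀ x, |ψ x| ≤ 1) →
      ∫ x, w x * ψ x ≤ C) : ∫ x, |w x| ≤ C := by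
  refine le_of_forall_pos_le_add fun κ hκ => ?_
  obtain ⟨g, hgs, hgw, hgc, hgi⟩ := hw.exists_hasCompactSupport_integral_sub_le
    (show 0 < κ / 4 by positivity)
  obtain ⟨ι, hι, hιm⟩ := exists_pos_mul_le (a := volume.real (tsupport g)) (by positivity)
    (show 0 < κ / 4 by positivity)
  -- A continuous version of the sign of `g`, equal to it where `|g| ≥ ι`; elsewhere on the support
  -- of `g` the loss is at most `ι` per unit length.
  set ψ : ℝ → ℝ := fun x => g x / max |g x| ι with hψ
  have hpos : ∀ x, 0 < max |g x| ι := fun x => hι.trans_le (le_max_right _ _)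
  have hψc : Continuous ψ := hgc.div (by fun_prop) fun x => (hpos x).ne'
  have hψs : HasCompactSupport ψ := by
    refine hgs.mono' fun x hx => subset_tsupport _ ?_
    contrapose! hx
    simp only [Function.mem_support, not_not] at hx ⊢
    simp [hψ, hx]
  have hψ1 : ∀ x, |ψ x| ≤ 1 := fun x => by
    rw [hψ, abs_div, abs_of_pos (hpos x)]
    exact (div_le_one (hpos x)).2 (le_max_left _ _)
  have hsub : Integrable (fun x => w x - g x) := hw.sub hgi
  have hgw' : ∫ x, |w x - g x| ≤ κ / 4 := hgw
  have hind : Integrable ((tsupport g).indicator fun _ => ι) :=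
    (integrable_indicator_iff (isClosed_tsupport g).measurableSet).2
      (integrableOn_const hgs.isCompact.measure_lt_top.ne)
  have hindi : ∫ x, (tsupport g).indicator (fun _ => ι) x ≤ κ / 4 := by
    rw [integral_indicator (isClosed_tsupport g).measurableSet, setIntegral_const, smul_eq_mul]
    exact hιm
  have hpt : ∀ x, |g x| ≤ g x * ψ x + (tsupport g).indicator (fun _ => ι) x := fun x => by
    by_cases hx : x ∈ tsupport g
    · rw [indicator_of_mem hx]
      simp only [hψ]
      rcases le_total ι |g x| with h1 | h1
      · rw [max_eq_left h1, ← mul_div_assoc, ← pow_two, ← sq_abs, pow_two,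
          mul_div_assoc, div_self (hι.trans_le h1).ne']
        linarith
      · rw [max_eq_right h1, ← mul_div_assoc, ← pow_two]
        have : 0 ≤ g x ^ 2 / ι := by positivity
        linarith
    · rw [indicator_of_notMem hx, image_eq_zero_of_notMem_tsupport hx]; simp
  have i1 := integrable_mul_of_continuous hgi hψc hψs
  have i2 := integrable_mul_of_continuous hw hψc hψs
  calc ∫ x, |w x| ≤ ∫ x, (w x * ψ x + 2 * |w x - g x| + (tsupport g).indicator (fun _ => ι) x) := by
        refine integral_mono hw.abs ((i2.add (hsub.abs.const_mul 2)).add hind) fun x => ?_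
        have h1 := hpt x
        have h2 : |w x| ≤ |w x - g x| + |g x| := by simpa using abs_add_le (w x - g x) (g x)
        have h3 : (g x - w x) * ψ x ≤ |w x - g x| := by
          refine (le_abs_self _).trans ?_
          rw [abs_mul, abs_sub_comm]
          exact mul_le_of_le_one_right (abs_nonneg _) (hψ1 x)
        show |w x| ≤ w x * ψ x + 2 * |w x - g x| + (tsupport g).indicator (fun _ => ι) x
        linarith
    _ = (∫ x, w x * ψ x) + 2 * (∫ x, |w x - g x|) + ∫ x, (tsupport g).indicator (fun _ => ι) x := by
        have j : Integrable (fun x => w x * ψ x + 2 * |w x - g x|) := i2.add (hsub.abs.const_mul 2)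
        rw [integral_add j hind, integral_add i2 (hsub.abs.const_mul 2), integral_const_mul]
    _ ≤ C + κ := by linarith [h ψ hψc hψs hψ1]

lemma integral_shift_mul (v ψ : ℝ → ℝ) (δ : ℝ) :
    ∫ x, v (x + δ) * ψ x = ∫ x, v x * ψ (x - δ) := by
  rw [← integral_add_right_eq_self (fun x => v x * ψ (x - δ)) δ]
  simp

/-- The total variation controls the `L¹` distance of translates. -/
theorem integral_abs_shift_sub_le_of_totalVar_le {v : ℝ → ℝ} (hv : Integrable v) {C : ℝ}
    (hC0 : 0 ≤ C) (hC : totalVar v ≤ ENNReal.ofReal C) (δ : ℝ) :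
    ∫ x, |v (x + δ) - v x| ≤ C * |δ| := by
  have hvs : Integrable (fun x => v (x + δ)) := hv.comp_add_right δ
  refine integral_abs_le_of_forall_integral_mul_le (hvs.sub hv) fun ψ hψ hψs hψ1 => ?_
  have hψs' : HasCompactSupport (fun x => ψ (x - δ)) :=
    hψs.comp_homeomorph (Homeomorph.subRight δ)
  have i1 := integrable_mul_of_continuous hvs hψ hψs
  have i2 := integrable_mul_of_continuous hv hψ hψs
  have i3 : Integrable (fun x => v x * ψ (x - δ)) :=
    integrable_mul_of_continuous hv (hψ.comp (continuous_id.sub continuous_const)) hψs'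
  have e : ∫ x, (v (x + δ) - v x) * ψ x = ∫ x, v x * (ψ (x - δ) - ψ x) := by
    simp only [sub_mul, mul_sub]
    rw [integral_sub i1 i2, integral_sub i3 i2, integral_shift_mul]
  refine le_of_eq_of_le e ?_
  rcases eq_or_ne δ 0 with rfl | hδ
  · simp
  have hδ' : 0 < |δ| := abs_pos.2 hδ
  -- Minus a primitive increment of `ψ` over the window of length `|δ|`, divided by that length. It
  -- is continuously differentiable and bounded by `1`, hence admissible in `totalVar`, and its
  -- derivative is precisely the difference quotient tested against `v`.
  set Ψ : ℝ → ℝ := fun x => -(∫ s in (x - δ)..x, ψ s) / |δ| with hΨ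
  have hd : ∀ x, HasDerivAt Ψ ((ψ (x - δ) - ψ x) / |δ|) x := fun x => by
    have h0 : ∀ y, HasDerivAt (fun y => ∫ s in (0 : ℝ)..y, ψ s) (ψ y) y := fun y =>
      intervalIntegral.integral_hasDerivAt_right (hψ.intervalIntegrable _ _)
        (hψ.stronglyMeasurableAtFilter _ _) hψ.continuousAt
    have h1 : HasDerivAt (fun y => ∫ s in (0 : ℝ)..(y - δ), ψ s) (ψ (x - δ)) x :=
      (h0 (x - δ)).comp_sub_const x δ
    have h2 := (h1.sub (h0 x)).div_const |δ|
    refine h2.congr_of_eventuallyEq (.of_forall fun y => ?_)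
    simp only [hΨ, Pi.sub_apply]
    rw [← intervalIntegral.integral_add_adjacent_intervals (hψ.intervalIntegrable (y - δ) 0)
      (hψ.intervalIntegrable 0 y), intervalIntegral.integral_symm]
    ring
  have hder : deriv Ψ = fun x => (ψ (x - δ) - ψ x) / |δ| := funext fun x => (hd x).deriv
  have hsm : ContDiff ℝ 1 Ψ := by
    rw [contDiff_one_iff_deriv]
    exact ⟨fun x => (hd x).differentiableAt, by rw [hder]; fun_prop⟩
  have hcs : HasCompactSupport Ψ := by
    obtain ⟨r, hr⟩ := hψs.isCompact.isBounded.subset_closedBall 0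
    refine HasCompactSupport.intro (isCompact_Icc (a := -(r + |δ|)) (b := r + |δ|)) fun x hx => ?_
    have : ∫ s in (x - δ)..x, ψ s = 0 := by
      refine (intervalIntegral.integral_congr fun s hs => ?_).trans intervalIntegral.integral_zero
      have hs' : |s - x| ≤ |δ| := by
        have := abs_sub_right_of_mem_uIcc hs
        rw [abs_sub_comm]; simpa using this
      refine image_eq_zero_of_notMem_tsupport fun hmem => hx ?_
      have h1 := hr hmem
      rw [mem_closedBall_zero_iff, Real.norm_eq_abs, abs_le] at h1
      rw [abs_le] at hs'
      constructor <;> linarith [hs'.1, hs'.2, h1.1, h1.2]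
    simp [hΨ, this]
  have hle : ∀ x, |Ψ x| ≤ 1 := fun x => by
    have h1 := intervalIntegral.norm_integral_le_of_norm_le_const (a := x - δ) (b := x) (C := 1)
      (f := ψ) fun s _ => hψ1 s
    simp only [hΨ]
    rw [abs_div, abs_neg, abs_abs, div_le_one hδ']
    simpa using h1
  have h3 : ENNReal.ofReal (∫ x, v x * deriv Ψ x) ≤ ENNReal.ofReal C :=
    (le_iSup₂_of_le (f := fun (ψ : ℝ → ℝ) (_ : ContDiff ℝ 1 ψ ∧ HasCompactSupport ψ ∧
      ∀ x, |ψ x| ≤ 1) => ENNReal.ofReal (∫ x, v x * deriv ψ x)) Ψ ⟨hsm, hcs, hle⟩ le_rfl).trans hC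
  have h4 := (ENNReal.ofReal_le_ofReal_iff hC0).1 h3
  rw [hder] at h4
  have e2 : ∫ x, v x * (ψ (x - δ) - ψ x) = (∫ x, v x * ((ψ (x - δ) - ψ x) / |δ|)) * |δ| := by
    rw [← integral_mul_const]
    refine integral_congr_ae (.of_forall fun x => ?_)
    field_simp
  rw [e2]
  gcongr

/-- Bounds on the `L¹` distances of translates bound the sum of the total variations. -/
theorem sum_totalVar_le_of_shift {ι : Type*} [Fintype ι] {v : ι → ℝ → ℝ}
    (hv : ∀ k, Integrable (v k)) {B : ℝ} (hB : ∀ δ, ∑ k, ∫ x, |v k (x + δ) - v k x| ≤ B * |δ|) :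
    ∑ k, totalVar (v k) ≤ ENNReal.ofReal B := by
  have key : ∀ ψ : ι → ℝ → ℝ, (∀ k, ContDiff ℝ 1 (ψ k) ∧ HasCompactSupport (ψ k) ∧
      ∀ x, |ψ k x| ≤ 1) → ∑ k, ENNReal.ofReal (∫ x, v k x * deriv (ψ k) x) ≤ ENNReal.ofReal B := by
    intro ψ hψ
    set d : ℕ → ℝ := fun n => 1 / ((n : ℝ) + 1) with hdd
    have hd0 : ∀ n, 0 < d n := fun n => by positivity
    have hdt : Tendsto d atTop (𝓝[>] 0) :=
      tendsto_nhdsWithin_iff.2 ⟨tendsto_one_div_add_atTop_nhds_zero_nat,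
        Eventually.of_forall fun n => hd0 n⟩
    -- The derivative of the test function is replaced by difference quotients, which can be moved
    -- onto `v`. The maximum with `0` reproduces the truncation in `ENNReal.ofReal`, since single
    -- lanes may contribute negative integrals.
    have hlim : ∀ k, Tendsto (fun n => max (∫ x, v k x * ((ψ k (x + d n) - ψ k x) / d n)) 0) atTop
        (𝓝 (max (∫ x, v k x * deriv (ψ k) x) 0)) := fun k => by
      obtain ⟨h1, h2, h3⟩ := hψ k
      obtain ⟨L, hL⟩ := h1.lipschitzWith_of_hasCompactSupport h2 (by simp)
      refine Tendsto.max (tendsto_integral_of_dominated_convergence (fun x => L * |v k x|)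
        (fun n => (hv k).aestronglyMeasurable.mul (Continuous.aestronglyMeasurable (by
          have := h1.continuous; fun_prop))) ((hv k).abs.const_mul _)
        (fun n => Eventually.of_forall fun x => ?_) (.of_forall fun x => ?_))
        tendsto_const_nhds
      · rw [Real.norm_eq_abs, abs_mul, abs_div, abs_of_pos (hd0 n), mul_comm]
        refine mul_le_mul_of_nonneg_right ?_ (abs_nonneg _)
        rw [div_le_iff₀ (hd0 n)]
        have := hL.dist_le_mul (x + d n) x
        simpa [Real.dist_eq, abs_of_pos (hd0 n)] using this
      · have h4 := ((h1.differentiable (by simp) x).hasDerivAt.tendsto_slope_zero_right).comp hdt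
        refine (h4.congr fun n => ?_).const_mul _
        simp [div_eq_inv_mul]
    have hb : ∀ n, ∑ k, max (∫ x, v k x * ((ψ k (x + d n) - ψ k x) / d n)) 0 ≤ B := fun n => by
      have h5 := hB (-d n)
      rw [abs_neg, abs_of_pos (hd0 n)] at h5
      rw [← mul_le_mul_iff_left₀ (hd0 n)]
      refine le_trans ?_ h5
      rw [Finset.sum_mul]
      refine Finset.sum_le_sum fun k _ => ?_
      obtain ⟨h1, h2, h3⟩ := hψ k
      have hvs : Integrable (fun x => v k (x + -d n)) := (hv k).comp_add_right _
      have i1 := integrable_mul_of_continuous hvs h1.continuous h2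
      have i2 := integrable_mul_of_continuous (hv k) h1.continuous h2
      have i3 : Integrable (fun x => v k x * ψ k (x + d n)) :=
        integrable_mul_of_continuous (hv k) (h1.continuous.comp (continuous_id.add continuous_const))
          (h2.comp_homeomorph (Homeomorph.addRight (d n)))
      have e : (∫ x, v k x * ((ψ k (x + d n) - ψ k x) / d n)) * d n
          = ∫ x, (v k (x + -d n) - v k x) * ψ k x := by
        simp only [sub_mul]
        rw [integral_sub i1 i2, integral_shift_mul, ← integral_mul_const]
        simp only [sub_neg_eq_add]
        rw [← integral_sub i3 i2]
        refine integral_congr_ae (.of_forall fun x => ?_)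
        have := (hd0 n).ne'
        field_simp
      have h6 : ∫ x, (v k (x + -d n) - v k x) * ψ k x ≤ ∫ x, |v k (x + -d n) - v k x| := by
        refine integral_mono ((i1.sub i2).congr (.of_forall fun x => by
          simp [sub_mul])) (hvs.sub (hv k)).abs fun x => (le_abs_self _).trans ?_
        rw [abs_mul]
        exact mul_le_of_le_one_right (abs_nonneg _) (h3 x)
      rw [max_mul_of_nonneg _ _ (hd0 n).le, e, zero_mul]
      exact max_le h6 (integral_nonneg fun x => abs_nonneg _)
    have hsum := le_of_tendsto' (tendsto_finsetSum Finset.univ fun k _ => hlim k) hb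
    calc ∑ k, ENNReal.ofReal (∫ x, v k x * deriv (ψ k) x)
        = ∑ k, ENNReal.ofReal (max (∫ x, v k x * deriv (ψ k) x) 0) :=
          Finset.sum_congr rfl fun k _ => by rw [ENNReal.ofReal_max]; simp
      _ = ENNReal.ofReal (∑ k, max (∫ x, v k x * deriv (ψ k) x) 0) :=
          (ENNReal.ofReal_sum_of_nonneg fun k _ => le_max_right _ _).symm
      _ ≤ _ := ENNReal.ofReal_le_ofReal hsum
  have hz : ContDiff ℝ 1 (fun _ : ℝ => (0 : ℝ)) ∧ HasCompactSupport (fun _ : ℝ => (0 : ℝ)) ∧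
      ∀ x : ℝ, |(fun _ : ℝ => (0 : ℝ)) x| ≤ 1 :=
    ⟨contDiff_const, HasCompactSupport.zero, by simp⟩
  classical
  -- Testing one lane and taking zero in the others shows that each variation is finite, which is
  -- needed before a small amount can be subtracted from it.
  have hfin : ∀ k, totalVar (v k) ≤ ENNReal.ofReal B := fun k => iSup₂_le fun ψ hψ => by
    have h := key (Function.update (fun _ _ => 0) k ψ) fun j => by
      rcases eq_or_ne j k with rfl | hj
      · simpa using hψ
      · simpa [Function.update_of_ne hj] using hz
    refine le_trans ?_ h
    simpa using Finset.single_le_sum (f := fun j => ENNReal.ofReal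
      (∫ x, v j x * deriv (Function.update (fun _ _ => 0) k ψ j) x)) (fun j _ => zero_le)
      (Finset.mem_univ k)
  refine ENNReal.le_of_forall_pos_le_add fun ε hε _ => ?_
  -- The suprema in the different lanes are separate, so a nearly optimal test function is chosen in
  -- each of them. The slack is divided by the number of lanes plus one, so that the divisor is
  -- never zero.
  have hex : ∀ k, ∃ ψ : ℝ → ℝ, (ContDiff ℝ 1 ψ ∧ HasCompactSupport ψ ∧ ∀ x, |ψ x| ≤ 1) ∧
      totalVar (v k) ≤ ENNReal.ofReal (∫ x, v k x * deriv ψ x)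
        + ε / (Fintype.card ι + 1 : ℕ) := fun k => by
    by_contra! hcon
    set e : ℝ≥0∞ := ε / (Fintype.card ι + 1 : ℕ) with he
    have he0 : e ≠ 0 := by
      rw [he]
      exact (ENNReal.div_pos (ENNReal.coe_ne_zero.2 hε.ne') (ENNReal.natCast_ne_top _)).ne'
    have htop := ne_top_of_le_ne_top ENNReal.ofReal_ne_top (hfin k)
    have h1 : totalVar (v k) ≤ totalVar (v k) - e := iSup₂_le fun ψ hψ =>
      ENNReal.le_sub_of_add_le_right (ne_top_of_le_ne_top htop (le_add_self.trans (hcon _ hz).le))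
        (hcon ψ hψ).le
    exact (ENNReal.sub_lt_self htop (pos_of_gt (hcon _ hz)).ne' he0).not_ge h1
  choose ψ hψ hψt using hex
  calc _ ≤ ∑ k, (ENNReal.ofReal (∫ x, v k x * deriv (ψ k) x) + ε / (Fintype.card ι + 1 : ℕ)) :=
        Finset.sum_le_sum fun k _ => hψt k
    _ ≤ ENNReal.ofReal B + ε := by
        rw [Finset.sum_add_distrib]
        refine add_le_add (key ψ hψ) ?_
        rw [Finset.sum_const, Finset.card_univ, nsmul_eq_mul, ← mul_div_assoc]
        refine ENNReal.div_le_of_le_mul ?_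
        rw [mul_comm]
        gcongr
        omega

/-! ### Smooth cutoffs, and integration of weak differential inequalities -/

namespace IsMollifier

variable {ρ : ℝ → ℝ} {δ : ℝ}

/-- The primitive of a mollifier. -/
def _root_.smoothStep (ρ : ℝ → ℝ) (δ x : ℝ) : ℝ := ∫ z in (-(2 * δ))..x, ρ z

lemma hasDerivAt_smoothStep (h : IsMollifier ρ δ) (x : ℝ) :
    HasDerivAt (smoothStep ρ δ) (ρ x) x :=
  intervalIntegral.integral_hasDerivAt_right (h.continuous.intervalIntegrable _ _)
    (h.continuous.stronglyMeasurableAtFilter _ _) h.continuous.continuousAt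

lemma contDiff_smoothStep (h : IsMollifier ρ δ) : ContDiff ℝ (⊤ : ℕ∞) (smoothStep ρ δ) := by
  rw [contDiff_infty_iff_deriv]
  exact ⟨fun x => (h.hasDerivAt_smoothStep x).differentiableAt, by
    rw [show deriv (smoothStep ρ δ) = ρ from funext fun x => (h.hasDerivAt_smoothStep x).deriv]
    exact h.smooth⟩

lemma monotone_smoothStep (h : IsMollifier ρ δ) : Monotone (smoothStep ρ δ) :=
  monotone_of_deriv_nonneg (fun x => (h.hasDerivAt_smoothStep x).differentiableAt) fun x => by
    rw [(h.hasDerivAt_smoothStep x).deriv]; exact h.nonneg x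

lemma smoothStep_eq_one (h : IsMollifier ρ δ) (hδ : 0 < δ) {x : ℝ} (hx : δ ≤ x) :
    smoothStep ρ δ x = 1 := by
  rw [smoothStep, intervalIntegral.integral_eq_integral_of_support_subset, h.integral]
  intro z hz
  have h1 : |z| ≤ δ := by
    by_contra! hcon
    exact hz (h.eq_zero z hcon)
  rw [abs_le] at h1
  exact ⟨by linarith, by linarith⟩

lemma smoothStep_eq_zero (h : IsMollifier ρ δ) (hδ : 0 < δ) {x : ℝ} (hx : x ≤ -δ) :
    smoothStep ρ δ x = 0 := by
  have hne : ∀ᵐ z : ℝ, z ≠ -δ := by simp [ae_iff]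
  refine (intervalIntegral.integral_congr_ae (g := fun _ => (0 : ℝ)) ?_).trans
    intervalIntegral.integral_zero
  filter_upwards [hne] with z hz hzm
  have h1 : z ≤ -δ := (mem_uIoc.1 hzm).elim (fun h => h.2.trans hx) fun h => by linarith [h.2]
  exact h.eq_zero z (lt_abs.2 (Or.inr (by linarith [lt_of_le_of_ne h1 hz])))

lemma smoothStep_mem (h : IsMollifier ρ δ) (hδ : 0 < δ) (x : ℝ) :
    smoothStep ρ δ x ∈ Icc (0 : ℝ) 1 := by
  constructor
  · rw [← h.smoothStep_eq_zero hδ (min_le_right x (-δ))]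
    exact h.monotone_smoothStep (min_le_left _ _)
  · rw [← h.smoothStep_eq_one hδ (le_max_right x δ)]
    exact h.monotone_smoothStep (le_max_left _ _)

end IsMollifier

/-- A weak differential inequality for a Lipschitz continuous function can be integrated. -/
theorem le_add_integral_of_weak {F r : ℝ → ℝ} {T L Q : ℝ} (hF : ∀ s t, |F s - F t| ≤ L * |s - t|)
    (hr : Measurable r) (hQ : ∀ x, |r x| ≤ Q)
    (hw : ∀ θ : ℝ → ℝ, ContDiff ℝ (⊤ : ℕ∞) θ → HasCompactSupport θ → tsupport θ ⊆ Ioo 0 T →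
      (∀ x, 0 ≤ θ x) → 0 ≤ ∫ x in (0 : ℝ)..T, (F x * deriv θ x + θ x * r x))
    {s t : ℝ} (hs : 0 ≤ s) (hst : s ≤ t) (ht : t ≤ T) : F t ≤ F s + ∫ x in s..t, r x := by
  rcases hst.eq_or_lt with rfl | hst
  · simp
  have hL : 0 ≤ L := by simpa using (abs_nonneg _).trans (hF 1 0)
  have hQ0 : 0 ≤ Q := (abs_nonneg _).trans (hQ 0)
  have hFc : Continuous F := (LipschitzWith.of_dist_le_mul (K := L.toNNReal) fun x y => by
    rw [Real.coe_toNNReal _ hL, Real.dist_eq, Real.dist_eq]; exact hF x y).continuous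
  refine le_of_forall_pos_le_add fun κ hκ => ?_
  obtain ⟨τ₀, hτ₀, hτκ⟩ := exists_pos_mul_le (a := 6 * L + 6 * Q) (by positivity) hκ
  obtain ⟨τ, hτ, hτ1, hτ2⟩ : ∃ τ, 0 < τ ∧ τ ≤ τ₀ ∧ 6 * τ ≤ t - s :=
    ⟨min τ₀ ((t - s) / 6), lt_min hτ₀ (by linarith), min_le_left _ _, by
      have := min_le_right τ₀ ((t - s) / 6); linarith⟩
  obtain ⟨ρ, hρ⟩ := exists_isMollifier hτ
  -- The cutoff rises between `s + τ` and `s + 3τ` and falls symmetrically before `t`. Its support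
  -- is thus contained in the open interval `(0, T)` even if `s = 0` and `t = T`.
  set s' := s + 2 * τ
  set t' := t - 2 * τ
  set θ : ℝ → ℝ := fun x => smoothStep ρ τ (x - s') - smoothStep ρ τ (x - t') with hθ
  have hs't' : s' ≤ t' := by simp only [s', t']; linarith
  have hθd : ∀ x, HasDerivAt θ (ρ (x - s') - ρ (x - t')) x := fun x =>
    ((hρ.hasDerivAt_smoothStep _).comp_sub_const x s').sub
      ((hρ.hasDerivAt_smoothStep _).comp_sub_const x t')
  have hθ0 : ∀ x, 0 ≤ θ x := fun x => sub_nonneg.2 (hρ.monotone_smoothStep (by linarith))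
  have hθ1 : ∀ x, θ x ≤ 1 := fun x => by
    have h1 := (hρ.smoothStep_mem hτ (x - s')).2
    have h2 := (hρ.smoothStep_mem hτ (x - t')).1
    simp only [hθ]; linarith
  have hθz : ∀ x, x ∉ Icc (s + τ) (t - τ) → θ x = 0 := fun x hx => by
    rcases lt_or_ge x (s + τ) with h1 | h1
    · simp only [hθ]
      rw [hρ.smoothStep_eq_zero hτ (by simp only [s']; linarith),
        hρ.smoothStep_eq_zero hτ (by linarith)]; ring
    · have h2 : t - τ < x := by
        by_contra! hcon; exact hx ⟨h1, hcon⟩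
      simp only [hθ]
      rw [hρ.smoothStep_eq_one hτ (by linarith),
        hρ.smoothStep_eq_one hτ (by simp only [t']; linarith)]; ring
  have hθo : ∀ x ∈ Icc (s + 3 * τ) (t - 3 * τ), θ x = 1 := fun x hx => by
    simp only [hθ]
    rw [hρ.smoothStep_eq_one hτ (by simp only [s']; linarith [hx.1]),
      hρ.smoothStep_eq_zero hτ (by simp only [t']; linarith [hx.2])]; ring
  have hθs : tsupport θ ⊆ Icc (s + τ) (t - τ) :=
    closure_minimal (fun x hx => by_contra fun hcon => hx (hθz x hcon)) isClosed_Icc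
  have hθc : HasCompactSupport θ := HasCompactSupport.intro isCompact_Icc fun x hx => hθz x hx
  have hθsm : ContDiff ℝ (⊤ : ℕ∞) θ :=
    (hρ.contDiff_smoothStep.comp (contDiff_id.sub contDiff_const)).sub
      (hρ.contDiff_smoothStep.comp (contDiff_id.sub contDiff_const))
  have hwθ := hw θ hθsm hθc (hθs.trans fun x hx => ⟨by linarith [hx.1], by linarith [hx.2]⟩) hθ0
  have hder : deriv θ = fun x => ρ (x - s') - ρ (x - t') := funext fun x => (hθd x).deriv
  have i1 : ∀ y, Integrable (fun x => F x * ρ (x - y)) := fun y =>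
    (hFc.mul (hρ.continuous.comp (continuous_id.sub continuous_const))).integrable_of_hasCompactSupport
      ((hρ.compact.comp_homeomorph (Homeomorph.subRight y)).mul_left)
  have i2 : Integrable (fun x => θ x * r x) := by
    simpa only [mul_comm] using (hθsm.continuous.integrable_of_hasCompactSupport hθc).bdd_mul_of_abs_le hr hQ
  have e1 : ∫ x in (0 : ℝ)..T, (F x * deriv θ x + θ x * r x)
      = ∫ x, (F x * deriv θ x + θ x * r x) := by
    refine intervalIntegral.integral_eq_integral_of_support_subset fun x hx => ?_
    by_contra hcon
    refine hx ?_
    have hx' : x ∉ Icc (s + τ) (t - τ) := fun h => hcon ⟨by linarith [h.1], by linarith [h.2]⟩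
    have h1 : x ∉ tsupport θ := fun h => hx' (hθs h)
    have h2 : deriv θ x = 0 := image_eq_zero_of_notMem_tsupport fun h => h1 (tsupport_deriv_subset h)
    simp [h2, hθz x hx']
  have e2 : ∫ x, (F x * deriv θ x + θ x * r x)
      = (∫ x, F x * ρ (x - s')) - (∫ x, F x * ρ (x - t')) + ∫ x, θ x * r x := by
    rw [← integral_sub (i1 s') (i1 t')]
    have i3 : Integrable (fun x => F x * ρ (x - s') - F x * ρ (x - t')) := (i1 s').sub (i1 t')
    rw [← integral_add i3 i2]
    refine integral_congr_ae (.of_forall fun x => ?_)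
    simp only [hder]; ring
  have hρi : ∀ y, Integrable (fun x => ρ (x - y)) := fun y => hρ.integrable.comp_sub_right y
  have b1 : ∫ x, F x * ρ (x - s') ≤ F s + 3 * L * τ := by
    calc _ ≤ ∫ x, (F s + 3 * L * τ) * ρ (x - s') := by
          refine integral_mono (i1 s') ((hρi s').const_mul _) fun x =>
            hρ.mul_le_mul_of_abs_le fun hx => ?_
          have h1 := (le_abs_self _).trans (hF x s)
          have h2 : |x - s| ≤ 3 * τ := by
            rw [abs_le] at hx ⊢
            simp only [s'] at hx
            constructor <;> linarith [hx.1, hx.2]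
          nlinarith
      _ = _ := by rw [integral_const_mul, hρ.integral_fst, mul_one]
  have b2 : F t - 3 * L * τ ≤ ∫ x, F x * ρ (x - t') := by
    calc _ = ∫ x, (F t - 3 * L * τ) * ρ (x - t') := by
          rw [integral_const_mul, hρ.integral_fst, mul_one]
      _ ≤ _ := by
          refine integral_mono ((hρi t').const_mul _) (i1 t') fun x =>
            hρ.mul_le_mul_of_abs_le fun hx => ?_
          have h1 := (le_abs_self _).trans (hF t x)
          have h2 : |t - x| ≤ 3 * τ := by
            rw [abs_le] at hx ⊢
            simp only [t'] at hx
            constructor <;> linarith [hx.1, hx.2]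
          nlinarith
  have hri : ∀ a b, IntervalIntegrable r volume a b := intervalIntegrable_of_abs_le hr hQ
  have hθi : ∀ a b, IntervalIntegrable θ volume a b := fun a b =>
    hθsm.continuous.intervalIntegrable a b
  -- Within `[s, t]` the cutoff differs from `1` on a set of length at most `6τ`, where `r` is
  -- bounded by `Q`.
  have b3 : ∫ x, θ x * r x ≤ (∫ x in s..t, r x) + 6 * Q * τ := by
    have e3 : ∫ x, θ x * r x = ∫ x in s..t, θ x * r x := by
      refine (intervalIntegral.integral_eq_integral_of_support_subset fun x hx => ?_).symm
      by_contra hcon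
      refine hx ?_
      have hx' : x ∉ Icc (s + τ) (t - τ) := fun h => hcon ⟨by linarith [h.1], by linarith [h.2]⟩
      simp [hθz x hx']
    have e4 : t - s - 6 * τ ≤ ∫ x in s..t, θ x := by
      calc t - s - 6 * τ = ∫ x in (s + 3 * τ)..(t - 3 * τ), θ x := by
            rw [intervalIntegral.integral_congr (g := fun _ => (1 : ℝ)) fun x hx => by
              rw [uIcc_of_le (by linarith)] at hx; exact hθo x hx]
            simp; ring
        _ ≤ _ := intervalIntegral.integral_mono_interval (by linarith) (by linarith) (by linarith)
            (.of_forall hθ0) (hθi s t)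
    have hm : ∫ x in s..t, θ x * r x ≤ ∫ x in s..t, (r x + Q * (1 - θ x)) := by
      refine intervalIntegral.integral_mono_on hst.le i2.intervalIntegrable
        ((hri s t).add ((intervalIntegrable_const.sub (hθi s t)).const_mul Q)) fun x _ => ?_
      have h1 := abs_le.1 (hQ x)
      nlinarith [hθ1 x]
    rw [e3]
    refine hm.trans ?_
    rw [intervalIntegral.integral_add (hri s t)
      ((intervalIntegrable_const.sub (hθi s t)).const_mul Q), intervalIntegral.integral_const_mul,
      intervalIntegral.integral_sub intervalIntegrable_const (hθi s t)]
    simp only [intervalIntegral.integral_const, smul_eq_mul, mul_one]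
    nlinarith
  rw [e1, e2] at hwθ
  have : (6 * L + 6 * Q) * τ ≤ κ := le_trans (by gcongr) hτκ
  linarith

/-! ### Entropy solutions satisfy the inequalities between two times -/

namespace LaneModel

variable {N : ℕ} {P : LaneModel N} {K M T μ B L : ℝ} {u : Fin N → ℝ → ℝ → ℝ}

lemma measurable_rate (hP : P.Regular K) (hm : ∀ k, Measurable (fun p : ℝ × ℝ => u k p.1 p.2))
    (hmd : ∀ k, Measurable (fun p : ℝ × ℝ => deriv (P.speed k (u k p.1)) p.2))
    (hd : ∀ k t, IsDensity (u k t)) (k : Fin N) (α : ℝ) {ψ m : ℝ → ℝ} (hψ : IsTest ψ m) :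
    Measurable (fun t => P.rate k (fun j => u j t) α ψ) := by
  have ms : Measurable (fun p : ℝ × ℝ => Real.sign (u k p.1 p.2 - α)) :=
    measurable_real_sign.comp ((hm k).sub_const α)
  have mk : Measurable (fun p : ℝ × ℝ => kruzkov (P.f k) (u k p.1 p.2) α) :=
    (continuous_kruzkov (continuous_f hP.adm k)).measurable.comp
      ((hm k).prodMk (measurable_const (a := α)))
  have mv := measurable_speed_comp hP k (hm k) (hd k)
  have mr := measurable_source_comp (c := u) hP k hm hd
  have m1 : Measurable (fun p : ℝ × ℝ => ψ p.2) := hψ.continuous.measurable.comp measurable_snd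
  have m2 : Measurable (fun p : ℝ × ℝ => deriv ψ p.2) := (measurable_deriv ψ).comp measurable_snd
  exact (StronglyMeasurable.integral_prod_right (ν := (volume : Measure ℝ))
    (f := fun t x => kruzkov (P.f k) (u k t x) α * P.speed k (u k t) x * deriv ψ x
      + Real.sign (u k t x - α) * (P.source k (fun j => u j t) x
        - P.f k α * deriv (P.speed k (u k t)) x) * ψ x)
    (((mk.mul mv).mul m2).add ((ms.mul (mr.sub ((hmd k).const_mul _))).mul m1)).stronglyMeasurable).measurable

lemma abs_integral_abs_sub_mul_sub_le {a b : ℝ → ℝ} (ha : IsDensity a) (hb : IsDensity b) (α : ℝ)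
    {ψ : ℝ → ℝ} (hψi : Integrable ψ) {C : ℝ} (hC : ∀ x, |ψ x| ≤ C) :
    |(∫ x, |a x - α| * ψ x) - ∫ x, |b x - α| * ψ x| ≤ C * ∫ x, |a x - b x| := by
  have i : ∀ c, IsDensity c → Integrable (fun x => |c x - α| * ψ x) := fun c hc =>
    hψi.bdd_mul_of_abs_le (measurable_norm.comp (hc.measurable.sub_const α)) (C := 1 + |α|)
      fun x => (abs_abs _).trans_le (abs_sub_le_one_add (hc.mem x) α)
  rw [← integral_sub (i a ha) (i b hb), ← integral_const_mul]
  refine abs_integral_le_integral_abs.trans (integral_mono ((i a ha).sub (i b hb)).abs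
    ((integrable_abs_sub ha.integrable hb.integrable).const_mul _) fun x => ?_)
  have h1 : |(|a x - α| - |b x - α|)| ≤ |a x - b x| := by
    simpa using abs_abs_sub_abs_le_abs_sub (a x - α) (b x - α)
  show |(|a x - α| * ψ x - |b x - α| * ψ x)| ≤ C * |a x - b x|
  rw [← sub_mul, abs_mul, mul_comm]
  exact mul_le_mul (hC x) h1 (abs_nonneg _) ((abs_nonneg _).trans (hC x))

lemma exists_abs_rate_le (hP : P.Regular K) (hM : P.SpeedLE M) (k : Fin N) {ψ m : ℝ → ℝ}
    (hψ : IsTest ψ m) (F : ℝ) : ∃ Q, ∀ (a : Fin N → ℝ → ℝ) (α : ℝ), (∀ j, IsDensity (a j)) →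
      |P.f k α| ≤ F → |P.rate k a α ψ| ≤ Q := by
  have hK := hP.nonneg
  have hM0 := hM.nonneg k
  refine ⟨rateBound K M * ((∫ x, m x * N) + F * ∫ x, m x), fun a α ha hF => ?_⟩
  refine (abs_rate_le hP hM k ha α hψ).trans
    (mul_le_mul_of_nonneg_left (add_le_add ?_ (mul_le_mul_of_nonneg_right hF hψ.integral_nonneg))
      (rateBound_nonneg hK hM0))
  refine integral_mono (hψ.integrable_mul (integrable_finsetSum _ fun j _ => (ha j).integrable))
    (hψ.integrable.mul_const _) fun x => mul_le_mul_of_nonneg_left ?_ (hψ.major_nonneg x)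
  calc _ ≤ ∑ _j : Fin N, (1 : ℝ) := Finset.sum_le_sum fun j _ => ((ha j).mem x).2
    _ = N := by simp

/-- Entropy solutions satisfy the entropy inequalities between any two times. -/
theorem IsEntropySolution.exists_isApprox (hP : P.Regular K) (hM : P.SpeedLE M) (hT : 0 < T)
    {u₀ : Fin N → ℝ → ℝ} {v : Fin N → ℝ → ℝ → ℝ} (hv : P.IsEntropySolution T u₀ v) :
    ∃ (μ B L : ℝ) (W : Fin N → ℝ → ℝ → ℝ), 0 ≤ μ ∧ 0 ≤ B ∧ 0 ≤ L ∧ P.IsApprox T μ B L 0 W ∧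
      ∀ k, ∀ t ∈ Icc 0 T, W k t =ᵐ[volume] v k t := by
  obtain ⟨L₁, hL₁⟩ := hv.lip
  set L := max L₁ 0 with hLdef
  have hL0 : 0 ≤ L := le_max_right _ _
  have hLip : ∀ k, ∀ s ∈ Icc 0 T, ∀ t ∈ Icc 0 T, ∫ x, |v k s x - v k t x| ≤ L * |s - t| :=
    fun k s hs t ht => (hL₁ k s hs t ht).trans
      (mul_le_mul_of_nonneg_right (le_max_left _ _) (abs_nonneg _))
  obtain ⟨M₁, hM₁⟩ := hv.bv
  -- The given solution is only almost everywhere measurable on the strip and arbitrary outside `[0,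
  -- T]`. It is replaced by a jointly measurable version, constant in time outside `[0, T]`, with
  -- values in `[0, 1]` everywhere.
  choose W hWm hWd hWv using fun k => exists_measurable_version hT hL0 (hv.integrable k)
    (hv.range k) (hLip k)
  have hclm : ∀ t, max 0 (min t T) ∈ Icc 0 T := fun t =>
    ⟨le_max_left _ _, max_le hT.le (min_le_right _ _)⟩
  have hWv' : ∀ k, ∀ t ∈ Icc 0 T, W k t =ᵐ[volume] v k t := fun k t ht => by
    have := hWv k t
    rwa [min_eq_left ht.2, max_eq_right ht.1] at this
  have hdist : ∀ k s t, ∫ x, |W k s x - W k t x| ≤ L * |max 0 (min s T) - max 0 (min t T)| :=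
    fun k s t => by
      refine le_trans (le_of_eq (integral_congr_ae ?_)) (hLip k _ (hclm s) _ (hclm t))
      filter_upwards [hWv k s, hWv k t] with x h1 h2
      rw [h1, h2]
  have hWL : ∀ k s t, ∫ x, |W k s x - W k t x| ≤ L * |s - t| := fun k s t =>
    (hdist k s t).trans (mul_le_mul_of_nonneg_left (abs_clamp_sub_clamp_le T s t) hL0)
  have hWmd : ∀ k, Measurable (fun p : ℝ × ℝ => deriv (P.speed k (W k p.1)) p.2) := fun k =>
    measurable_deriv_with_param (continuous_speed_of_time hP k (hWd k) (hWL k))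
  -- the two functions agree almost everywhere in the strip
  have hae : ∀ᵐ p : ℝ × ℝ ∂(volume.restrict (Ioo 0 T ×ˢ univ)), ∀ k, v k p.1 p.2 = W k p.1 p.2 := by
    rw [ae_all_iff]
    intro k
    have h1 := (hv.measurable k).ae_eq_mk
    have hg := (hv.measurable k).stronglyMeasurable_mk.measurable
    set g := (hv.measurable k).mk (fun p : ℝ × ℝ => v k p.1 p.2)
    rw [Measure.volume_eq_prod, ← Measure.prod_restrict, Measure.restrict_univ] at h1 ⊢
    have h2 : ∀ᵐ p : ℝ × ℝ ∂((volume.restrict (Ioo 0 T)).prod volume), W k p.1 p.2 = g p := by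
      rw [Measure.ae_prod_iff_ae_ae (measurableSet_eq_fun (hWm k) hg)]
      filter_upwards [Measure.ae_ae_of_ae_prod h1, ae_restrict_mem measurableSet_Ioo] with t ht1 ht2
      filter_upwards [ht1, hWv' k t (Ioo_subset_Icc_self ht2)] with x h3 h4
      rw [h4, h3]
    filter_upwards [h1, h2] with p h3 h4
    rw [h3, h4]
  have hae2 : ∀ᵐ p : ℝ × ℝ ∂(volume.restrict (Ioo 0 T ×ˢ univ)), ∀ k, P.vel v k p.1 = P.vel W k p.1 := by
    filter_upwards [ae_restrict_mem (measurableSet_Ioo.prod MeasurableSet.univ)] with p hp k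
    exact speed_congr_ae k (hWv' k p.1 (Ioo_subset_Icc_self hp.1)).symm
  have hae3 : ∀ᵐ p : ℝ × ℝ ∂(volume.restrict (Ioo 0 T ×ˢ univ)), ∀ k,
      P.src v k p.1 p.2 = P.src W k p.1 p.2 := by
    filter_upwards [hae, ae_restrict_mem (measurableSet_Ioo.prod MeasurableSet.univ)] with p hp1 hp k
    have h1 : ∀ j, P.avg (v j p.1) p.2 = P.avg (W j p.1) p.2 := fun j =>
      avg_congr_ae (hWv' j p.1 (Ioo_subset_Icc_self hp.1)).symm _
    simp only [src, h1, hp1]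
  -- Conservation of mass is not part of the definition of an entropy solution; a bound for the mass
  -- follows from the Lipschitz continuity in time.
  obtain ⟨μ, hμ0, hμ⟩ : ∃ μ, 0 ≤ μ ∧ ∀ t, ∑ j, ∫ x, W j t x ≤ μ := by
    have hnn : ∀ j, 0 ≤ ∫ x, W j 0 x := fun j => integral_nonneg fun x => ((hWd j 0).mem x).1
    refine ⟨∑ j, ((∫ x, W j 0 x) + L * T), Finset.sum_nonneg fun j _ =>
      add_nonneg (hnn j) (by positivity), fun t => Finset.sum_le_sum fun j _ => ?_⟩
    have h1 := hdist j t 0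
    have h2 : |max 0 (min t T) - max 0 (min 0 T)| ≤ T := by
      have h3 := hclm t
      rw [min_eq_left hT.le, max_self, sub_zero, abs_of_nonneg h3.1]
      exact h3.2
    have h4 : (∫ x, W j t x) - ∫ x, W j 0 x ≤ ∫ x, |W j t x - W j 0 x| := by
      rw [← integral_sub (hWd j t).integrable (hWd j 0).integrable]
      exact (le_abs_self _).trans abs_integral_le_integral_abs
    have h5 : L * |max 0 (min t T) - max 0 (min 0 T)| ≤ L * T := by gcongr
    linarith
  set B := ∑ _k : Fin N, max M₁ 0 with hBdef
  have hB0 : 0 ≤ B := Finset.sum_nonneg fun k _ => le_max_right _ _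
  refine ⟨μ, B, L, W, hμ0, hB0, hL0, isApprox_zero hP hWm hWd hμ (fun t δ => ?_) hWL ?_, hWv'⟩
  · rw [hBdef, Finset.sum_mul]
    refine Finset.sum_le_sum fun k _ => ?_
    have h1 := hv.integrable k _ (hclm t)
    have h2 := integral_abs_shift_sub_le_of_totalVar_le h1 (le_max_right M₁ 0)
      ((hM₁ k _ (hclm t)).trans (ENNReal.ofReal_le_ofReal (le_max_left _ _))) δ
    refine le_trans (le_of_eq (integral_congr_ae ?_)) h2
    filter_upwards [hWv k t, (measurePreserving_add_right (volume : Measure ℝ) δ).quasiMeasurePreserving.ae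
      (hWv k t)] with x h3 h4
    rw [h3, h4]
  intro s t hs hst ht k α ψ m hψ hψs hψc
  have hψi := hψ.integrable_fun
  obtain ⟨C, hC⟩ := hψc.exists_bound_of_continuous hψ.continuous
  have hC0 : 0 ≤ C := (norm_nonneg _).trans (hC 0)
  obtain ⟨Q, hQ⟩ := exists_abs_rate_le hP hM k hψ |P.f k α|
  refine le_add_integral_of_weak (F := fun t => ∫ x, |W k t x - α| * ψ x) (L := C * L) (T := T)
    (fun s t => ?_) (measurable_rate hP hWm hWmd hWd k α hψ)
    (fun r => hQ (fun j => W j r) α (fun j => hWd j r) le_rfl) ?_ hs hst ht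
  · refine (abs_integral_abs_sub_mul_sub_le (hWd k s) (hWd k t) α hψi hC).trans ?_
    rw [mul_assoc]
    exact mul_le_mul_of_nonneg_left (hWL k s t) hC0
  · intro θ hθ hθc hθs hθ0
    -- A product test function. The time factor is supported in the open interval, so the initial
    -- term drops out and a weak inequality for the function of time `∫ |W - α| ψ` remains.
    set φ : ℝ → ℝ → ℝ := fun t x => θ t * ψ x with hφdef
    have hφ : ContDiff ℝ (⊤ : ℕ∞) (fun p : ℝ × ℝ => φ p.1 p.2) :=
      (hθ.comp contDiff_fst).mul (hψs.comp contDiff_snd)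
    have hφK : ∀ p ∉ tsupport θ ×ˢ tsupport ψ, φ p.1 p.2 = 0 := fun p hp => by
      simp only [mem_prod, not_and_or] at hp
      rcases hp with hp | hp <;> simp [hφdef, image_eq_zero_of_notMem_tsupport hp]
    have hφc : HasCompactSupport (fun p : ℝ × ℝ => φ p.1 p.2) :=
      HasCompactSupport.intro (hθc.isCompact.prod hψc.isCompact) hφK
    have hφs : tsupport (fun p : ℝ × ℝ => φ p.1 p.2) ⊆ Iio T ×ˢ univ := by
      have hsub : Function.support (fun p : ℝ × ℝ => φ p.1 p.2) ⊆ tsupport θ ×ˢ tsupport ψ :=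
        fun p hp => by_contra fun hcon => hp (hφK p hcon)
      refine (closure_minimal hsub
        ((isClosed_tsupport θ).prod (isClosed_tsupport ψ))).trans fun p hp => ⟨(hθs hp.1).2, mem_univ _⟩
    have hE := hv.entropy k α φ hφ hφc hφs fun t _ x => mul_nonneg (hθ0 t) (hψ.nonneg x)
    have hw := (weak_form_eq hP hM hWm hWmd hWd hφ hφc hT.le k α).2
    have e1 : ∫ p in Ioo 0 T ×ˢ univ, |v k p.1 p.2 - α| * deriv (fun t => φ t p.2) p.1
        = ∫ p in Ioo 0 T ×ˢ univ, |W k p.1 p.2 - α| * deriv (fun t => φ t p.2) p.1 :=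
      integral_congr_ae (hae.mono fun p hp => by simp only [hp])
    have e2 : ∫ p in Ioo 0 T ×ˢ univ,
          P.G k (v k p.1 p.2) α * P.vel v k p.1 p.2 * deriv (fun x => φ p.1 x) p.2
        = ∫ p in Ioo 0 T ×ˢ univ,
          P.G k (W k p.1 p.2) α * P.vel W k p.1 p.2 * deriv (fun x => φ p.1 x) p.2 :=
      integral_congr_ae (by
        filter_upwards [hae, hae2] with p hp hp2
        simp only [hp, hp2])
    have e3 : ∫ p in Ioo 0 T ×ˢ univ, Real.sign (v k p.1 p.2 - α) * P.f k α
          * deriv (fun x => P.vel v k p.1 x) p.2 * φ p.1 p.2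
        = ∫ p in Ioo 0 T ×ˢ univ, Real.sign (W k p.1 p.2 - α) * P.f k α
          * deriv (fun x => P.vel W k p.1 x) p.2 * φ p.1 p.2 :=
      integral_congr_ae (by
        filter_upwards [hae, hae2] with p hp hp2
        simp only [hp, hp2])
    have e4 : ∫ p in Ioo 0 T ×ˢ univ, Real.sign (v k p.1 p.2 - α) * P.src v k p.1 p.2 * φ p.1 p.2
        = ∫ p in Ioo 0 T ×ˢ univ, Real.sign (W k p.1 p.2 - α) * P.src W k p.1 p.2 * φ p.1 p.2 :=
      integral_congr_ae (by
        filter_upwards [hae, hae3] with p hp hp2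
        simp only [hp, hp2])
    have e5 : ∀ x, φ 0 x = 0 := fun x => by
      simp only [hφdef]
      rw [image_eq_zero_of_notMem_tsupport fun h => lt_irrefl _ (hθs h).1, zero_mul]
    simp only [e5, mul_zero, integral_zero] at hE
    rw [e1, e2, e3, e4] at hE
    have e6 : ∀ t, (∫ x, |W k t x - α| * deriv (fun s => φ s x) t)
        + P.rate k (fun j => W j t) α (φ t)
        = (∫ x, |W k t x - α| * ψ x) * deriv θ t + θ t * P.rate k (fun j => W j t) α ψ := fun t => by
      have h1 : ∀ x, deriv (fun s => φ s x) t = deriv θ t * ψ x := fun x => by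
        simp only [hφdef]
        exact deriv_mul_const (hθ.differentiable (by simp) t) _
      have h2 : ∀ x, deriv (φ t) x = θ t * deriv ψ x := fun x => by
        simp only [hφdef]
        exact deriv_const_mul _ (hψ.differentiable x)
      congr 1
      · rw [← integral_mul_const]
        exact integral_congr_ae (.of_forall fun x => by simp only [h1]; ring)
      · rw [rate, rate, ← integral_const_mul]
        exact integral_congr_ae (.of_forall fun x => by
          beta_reduce; rw [h2]; ring)
    simp only [e6] at hw
    linarith

end LaneModel

/-! ### Continuity of the entropy rate in the profile and in the Kruzkov constant -/

namespace LaneModel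

variable {N : ℕ} {P : LaneModel N} {K M : ℝ} {a b : Fin N → ℝ → ℝ} {ψ m : ℝ → ℝ}

/-- The entropy rate of the density `w` transported by the velocity and the source of `b`. -/
def frozenRate (P : LaneModel N) (k : Fin N) (w : ℝ → ℝ) (b : Fin N → ℝ → ℝ) (α : ℝ) (ψ : ℝ → ℝ) : ℝ :=
  ∫ x, (kruzkov (P.f k) (w x) α * P.speed k (b k) x * deriv ψ x
    + Real.sign (w x - α) * (P.source k b x - P.f k α * deriv (P.speed k (b k)) x) * ψ x)

/-- The velocity and the source depend continuously on the densities. -/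
lemma exists_abs_rate_sub_frozenRate_le (hP : P.Regular K) (hM : P.SpeedLE M) (k : Fin N) (α : ℝ)
    (hψ : IsTest ψ m) :
    ∃ Z, ∀ a b : Fin N → ℝ → ℝ, (∀ j, IsDensity (a j)) → (∀ j, IsDensity (b j)) →
      |P.rate k a α ψ - P.frozenRate k (a k) b α ψ| ≤ Z * ∑ j, ∫ x, |a j x - b j x| := by
  have hK := hP.nonneg
  have hi := hψ.integrable_fun
  obtain ⟨C, hψC⟩ := hψ.exists_abs_le
  have hC0 : 0 ≤ C := (abs_nonneg _).trans (hψC 0)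
  set F := |P.f k α| with hF
  set CV := (K + 2 * K ^ 2) * K with hCV
  refine ⟨(K + F) * K ^ 2 * (∫ x, |deriv ψ x|) + (C * (4 * K) + F * (CV * (∫ x, |ψ x|)
    + K * C * (2 * K))), fun a b ha hb => ?_⟩
  set D := ∑ j, ∫ x, |a j x - b j x| with hD
  have hDk : ∫ x, |a k x - b k x| ≤ D :=
    integral_abs_le_sum (fun j x => a j x - b j x) k
  have hD0 : 0 ≤ ∫ x, |a k x - b k x| := integral_nonneg fun x => abs_nonneg _
  have hia := integrable_rate hP hM k (ha k) ha α hψ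
  have hib := integrable_rate hP hM k (ha k) hb α hψ
  have is : Integrable (fun x => |P.source k a x - P.source k b x|) :=
    integrable_abs_sub (integrable_source hP k ha) (integrable_source hP k hb)
  obtain ⟨iA, hiA⟩ := integrable_deriv_avg_sub hP (ha k) (hb k)
  have j1 : Integrable (fun x => (K + F) * (K ^ 2 * D) * |deriv ψ x|) :=
    hψ.integrable_deriv.abs.const_mul _
  have j2 : Integrable (fun x => C * |P.source k a x - P.source k b x|) := is.const_mul _
  have j3 : Integrable (fun x => F * (CV * D) * |ψ x|) := hi.abs.const_mul _
  have j4 : Integrable (fun x => F * (K * C) * |deriv (P.avg (a k)) x - deriv (P.avg (b k)) x|) :=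
    iA.abs.const_mul _
  unfold rate frozenRate
  rw [← integral_sub hia hib]
  have j12 : Integrable (fun x => (K + F) * (K ^ 2 * D) * |deriv ψ x|
    + C * |P.source k a x - P.source k b x|) := j1.add j2
  have j123 : Integrable (fun x => (K + F) * (K ^ 2 * D) * |deriv ψ x|
    + C * |P.source k a x - P.source k b x| + F * (CV * D) * |ψ x|) := j12.add j3
  refine abs_integral_le_integral_abs.trans ((integral_mono_ae (hia.sub hib).abs
    (j123.add j4) ?_).trans ?_)
  · filter_upwards [ae_abs_deriv_speed_sub_le hP k (ha k) (hb k)] with x hx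
    refine (congrArg abs (?_ : _ = kruzkov (P.f k) (a k x) α
      * (P.speed k (a k) x - P.speed k (b k) x) * deriv ψ x
      + (Real.sign (a k x - α) * ((P.source k a x - P.source k b x) * ψ x)
        - Real.sign (a k x - α) * (P.f k α
          * ((deriv (P.speed k (a k)) x - deriv (P.speed k (b k)) x) * ψ x))))).trans_le ?_
    · simp only [Pi.sub_apply]; ring
    have h1 : |kruzkov (P.f k) (a k x) α * (P.speed k (a k) x - P.speed k (b k) x) * deriv ψ x|
        ≤ (K + F) * (K ^ 2 * D) * |deriv ψ x| := by
      rw [abs_mul, abs_mul]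
      refine mul_le_mul_of_nonneg_right (mul_le_mul ?_ ?_ (abs_nonneg _) (by positivity))
        (abs_nonneg _)
      · exact (abs_kruzkov_f_le_add hP.bdd k ((ha k).mem x) α).trans
          (add_le_add (mul_le_of_le_one_right hK ((ha k).mem x).2) le_rfl)
      · exact (abs_speed_sub_speed_le hP k (ha k) (hb k) x).trans
          (mul_le_mul_of_nonneg_left hDk (by positivity))
    have h2 : |Real.sign (a k x - α) * ((P.source k a x - P.source k b x) * ψ x)|
        ≤ C * |P.source k a x - P.source k b x| := by
      refine (abs_sign_mul_le _ _).trans ?_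
      rw [abs_mul, mul_comm]
      exact mul_le_mul_of_nonneg_right (hψC x) (abs_nonneg _)
    have h3 : |Real.sign (a k x - α) * (P.f k α
        * ((deriv (P.speed k (a k)) x - deriv (P.speed k (b k)) x) * ψ x))|
        ≤ F * (CV * D) * |ψ x|
          + F * (K * C) * |deriv (P.avg (a k)) x - deriv (P.avg (b k)) x| := by
      refine (abs_sign_mul_le _ _).trans ?_
      rw [abs_mul, abs_mul]
      calc _ ≤ F * ((CV * D + K * |deriv (P.avg (a k)) x - deriv (P.avg (b k)) x|) * |ψ x|) := by
            refine mul_le_mul_of_nonneg_left (mul_le_mul_of_nonneg_right (hx.trans ?_)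
              (abs_nonneg _)) (abs_nonneg _)
            exact add_le_add (mul_le_mul_of_nonneg_left hDk (by positivity)) le_rfl
        _ = F * (CV * D) * |ψ x|
            + F * (K * |ψ x|) * |deriv (P.avg (a k)) x - deriv (P.avg (b k)) x| := by ring
        _ ≤ _ := by
            have := hψC x
            gcongr
    refine (abs_add_le _ _).trans ((add_le_add h1 ((abs_sub _ _).trans (add_le_add h2 h3))).trans ?_)
    simp only [Pi.add_apply]; linarith
  · simp only [Pi.add_apply]
    rw [integral_add j123 j4, integral_add j12 j3, integral_add j1 j2]
    simp only [integral_const_mul]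
    have h4 := integral_abs_source_sub_le hP k ha hb
    have h5 : C * (∫ x, |P.source k a x - P.source k b x|) ≤ C * (4 * K * D) := by gcongr
    have h6 : F * (K * C) * (∫ x, |deriv (P.avg (a k)) x - deriv (P.avg (b k)) x|)
        ≤ F * (K * C) * (2 * K * D) := by
      have : 0 ≤ F := abs_nonneg _
      exact mul_le_mul_of_nonneg_left (hiA.trans (mul_le_mul_of_nonneg_left hDk (by positivity)))
        (by positivity)
    calc _ ≤ (K + F) * (K ^ 2 * D) * (∫ x, |deriv ψ x|) + C * (4 * K * D)
          + F * (CV * D) * (∫ x, |ψ x|) + F * (K * C) * (2 * K * D) := by gcongr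
      _ = _ := by ring

lemma tendsto_sign_sub {ι : Type*} {l : Filter ι} {c : ι → ℝ} {c₀ α : ℝ} (hc : Tendsto c l (𝓝 c₀))
    (h : c₀ ≠ α) : ∀ᶠ n in l, Real.sign (c n - α) = Real.sign (c₀ - α) := by
  rcases h.lt_or_gt with h | h
  · filter_upwards [hc.eventually (gt_mem_nhds h)] with n hn
    rw [Real.sign_of_neg (by linarith), Real.sign_of_neg (by linarith)]
  · filter_upwards [hc.eventually (lt_mem_nhds h)] with n hn
    rw [Real.sign_of_pos (by linarith), Real.sign_of_pos (by linarith)]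

/-- Continuity of the entropy rate for Kruzkov constants that the limit attains on a null set. -/
theorem tendsto_rate (hP : P.Regular K) (hM : P.SpeedLE M) (k : Fin N) {α : ℝ} (hψ : IsTest ψ m)
    {c : ℕ → Fin N → ℝ → ℝ} (hc : ∀ n j, IsDensity (c n j)) (hb : ∀ j, IsDensity (b j))
    (hae : ∀ᵐ x, Tendsto (fun n => c n k x) atTop (𝓝 (b k x)))
    (hL : Tendsto (fun n => ∑ j, ∫ x, |c n j x - b j x|) atTop (𝓝 0)) (hα : ∀ᵐ x, b k x ≠ α) :
    Tendsto (fun n => P.rate k (c n) α ψ) atTop (𝓝 (P.rate k b α ψ)) := by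
  -- With velocity and source frozen at the limit, only continuous functions of the density and its
  -- sign vary. The sign converges wherever the limit differs from `α`, so dominated convergence
  -- applies. The effect of the freezing is controlled in `L¹`.
  have h1 : Tendsto (fun n => P.frozenRate k (c n k) b α ψ) atTop (𝓝 (P.frozenRate k (b k) b α ψ)) := by
    refine tendsto_integral_of_dominated_convergence _ (fun n =>
      (measurable_rate_integrand hP k (hc n k) hb α hψ).aestronglyMeasurable)
      (integrable_rate_bound hψ _ _) (fun n => Eventually.of_forall
        (abs_rate_integrand_le hP hM k (hc n k) hb le_rfl ψ)) ?_
    filter_upwards [hae, hα] with x h2 h3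
    have h4 : Tendsto (fun n => kruzkov (P.f k) (c n k x) α) atTop (𝓝 (kruzkov (P.f k) (b k x) α)) :=
      ((continuous_kruzkov (continuous_f hP.adm k)).tendsto (b k x, α)).comp
        (h2.prodMk_nhds tendsto_const_nhds)
    have h5 : Tendsto (fun n => Real.sign (c n k x - α)) atTop (𝓝 (Real.sign (b k x - α))) :=
      tendsto_const_nhds.congr' ((tendsto_sign_sub h2 h3).mono fun n hn => hn.symm)
    exact ((h4.mul_const _).mul_const _).add ((h5.mul_const _).mul_const _)
  obtain ⟨Z, hZ⟩ := exists_abs_rate_sub_frozenRate_le hP hM k α hψ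
  have h2 : Tendsto (fun n => P.rate k (c n) α ψ - P.frozenRate k (c n k) b α ψ) atTop (𝓝 0) := by
    refine squeeze_zero_norm (fun n => hZ (c n) b (hc n) hb) ?_
    simpa using hL.const_mul Z
  simpa [frozenRate, rate] using h2.add h1

/-- The sum of the entropy rates for two Kruzkov constants that tend to `α` from both sides. -/
theorem tendsto_rate_add_rate (hP : P.Regular K) (hM : P.SpeedLE M) (k : Fin N) {α : ℝ}
    (hψ : IsTest ψ m) (hb : ∀ j, IsDensity (b j)) {β γ : ℕ → ℝ} (hβ : Tendsto β atTop (𝓝 α))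
    (hγ : Tendsto γ atTop (𝓝 α)) (hβα : ∀ n, β n < α) (hγα : ∀ n, α < γ n) {F : ℝ}
    (hβF : ∀ n, |P.f k (β n)| ≤ F) (hγF : ∀ n, |P.f k (γ n)| ≤ F) :
    Tendsto (fun n => P.rate k b (β n) ψ + P.rate k b (γ n) ψ) atTop
      (𝓝 (P.rate k b α ψ + P.rate k b α ψ)) := by
  have i := fun α => integrable_rate hP hM k (hb k) hb α hψ
  have hf : ∀ {δ : ℕ → ℝ}, Tendsto δ atTop (𝓝 α) →
      Tendsto (fun n => P.f k (δ n)) atTop (𝓝 (P.f k α)) := fun hδ =>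
    ((continuous_f hP.adm k).tendsto α).comp hδ
  have hk : ∀ {δ : ℕ → ℝ} (x : ℝ), Tendsto δ atTop (𝓝 α) → Tendsto (fun n =>
      kruzkov (P.f k) (b k x) (δ n)) atTop (𝓝 (kruzkov (P.f k) (b k x) α)) := fun x hδ =>
    ((continuous_kruzkov (continuous_f hP.adm k)).tendsto (b k x, α)).comp
      (tendsto_const_nhds.prodMk_nhds hδ)
  simp only [rate]
  simp only [← integral_add (i _) (i _)]
  refine tendsto_integral_of_dominated_convergence
    (fun x => ((K + F) * M * |deriv ψ x| + (2 * K * N + F * (K + 2 * K ^ 2)) * |ψ x|)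
      + ((K + F) * M * |deriv ψ x| + (2 * K * N + F * (K + 2 * K ^ 2)) * |ψ x|)) (fun n =>
      ((i _).add (i _)).aestronglyMeasurable)
    ((integrable_rate_bound hψ _ _).add (integrable_rate_bound hψ _ _))
    (fun n => Eventually.of_forall fun x => (abs_add_le _ _).trans (add_le_add
      (abs_rate_integrand_le hP hM k (hb k) hb (hβF n) ψ x)
      (abs_rate_integrand_le hP hM k (hb k) hb (hγF n) ψ x)))
    (.of_forall fun x => ?_)
  have hs : Tendsto (fun n => Real.sign (b k x - β n) * (P.source k b x
        - P.f k (β n) * deriv (P.speed k (b k)) x)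
      + Real.sign (b k x - γ n) * (P.source k b x - P.f k (γ n) * deriv (P.speed k (b k)) x)) atTop
      (𝓝 (Real.sign (b k x - α) * (P.source k b x - P.f k α * deriv (P.speed k (b k)) x)
        + Real.sign (b k x - α) * (P.source k b x - P.f k α * deriv (P.speed k (b k)) x))) := by
    have hr : ∀ {δ : ℕ → ℝ}, Tendsto δ atTop (𝓝 α) → Tendsto (fun n => P.source k b x
        - P.f k (δ n) * deriv (P.speed k (b k)) x) atTop
        (𝓝 (P.source k b x - P.f k α * deriv (P.speed k (b k)) x)) := fun hδ =>
      tendsto_const_nhds.sub ((hf hδ).mul_const _)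
    rcases lt_trichotomy (b k x) α with h | h | h
    · have e1 : ∀ᶠ n in atTop, Real.sign (b k x - β n) = Real.sign (b k x - α) := by
        filter_upwards [hβ.eventually (lt_mem_nhds h)] with n hn
        rw [Real.sign_of_neg (by linarith), Real.sign_of_neg (by linarith)]
      have e2 : ∀ n, Real.sign (b k x - γ n) = Real.sign (b k x - α) := fun n => by
        have := hγα n
        rw [Real.sign_of_neg (by linarith), Real.sign_of_neg (by linarith)]
      simp only [e2]
      exact ((tendsto_const_nhds.congr' (e1.mono fun n hn => hn.symm)).mul (hr hβ)).add
        ((hr hγ).const_mul _)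
    -- Where the profile equals `α` the two signs are `1` and `-1`. The source and velocity terms
    -- cancel in the limit, in agreement with `sgn 0 = 0`.
    · have e1 : ∀ n, Real.sign (b k x - β n) = 1 := fun n => by
        have := hβα n
        rw [Real.sign_of_pos (by linarith)]
      have e2 : ∀ n, Real.sign (b k x - γ n) = -1 := fun n => by
        have := hγα n
        rw [Real.sign_of_neg (by linarith)]
      have e3 : Real.sign (b k x - α) = 0 := by rw [h, sub_self, Real.sign_zero]
      simp only [e1, e2, e3]
      convert ((hr hβ).const_mul 1).add ((hr hγ).const_mul (-1)) using 2
      ring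
    · have e1 : ∀ᶠ n in atTop, Real.sign (b k x - γ n) = Real.sign (b k x - α) := by
        filter_upwards [hγ.eventually (gt_mem_nhds h)] with n hn
        rw [Real.sign_of_pos (by linarith), Real.sign_of_pos (by linarith)]
      have e2 : ∀ n, Real.sign (b k x - β n) = Real.sign (b k x - α) := fun n => by
        have := hβα n
        rw [Real.sign_of_pos (by linarith), Real.sign_of_pos (by linarith)]
      simp only [e2]
      exact ((hr hβ).const_mul _).add
        ((tendsto_const_nhds.congr' (e1.mono fun n hn => hn.symm)).mul (hr hγ))
  have hkk := (((hk x hβ).add (hk x hγ)).mul_const (P.speed k (b k) x * deriv ψ x)).add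
    (hs.mul_const (ψ x))
  convert hkk using 2
  · ring
  · ring

end LaneModel

/-! ### Limits of approximate solutions -/

namespace LaneModel

variable {N : ℕ} {P : LaneModel N} {K M T μ B L : ℝ} {ψ m : ℝ → ℝ}

/-- Bounds on the translates pass to limits in `L¹`. -/
lemma sum_integral_abs_shift_sub_le_of_tendsto {c : ℕ → Fin N → ℝ → ℝ} {b : Fin N → ℝ → ℝ}
    (hc : ∀ n j, Integrable (c n j)) (hb : ∀ j, Integrable (b j))
    (hlim : ∀ j, Tendsto (fun n => ∫ x, |c n j x - b j x|) atTop (𝓝 0)) {δ C : ℝ} {C' : ℕ → ℝ}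
    (hC : ∀ n, ∑ j, ∫ x, |c n j (x + δ) - c n j x| ≤ C' n) (hC' : Tendsto C' atTop (𝓝 C)) :
    ∑ j, ∫ x, |b j (x + δ) - b j x| ≤ C := by
  have h : ∀ n, ∑ j, ∫ x, |b j (x + δ) - b j x| ≤ C' n + ∑ j, 2 * ∫ x, |c n j x - b j x| :=
    fun n => by
      refine le_trans ?_ (add_le_add (hC n) le_rfl)
      rw [← Finset.sum_add_distrib]
      refine Finset.sum_le_sum fun j _ => ?_
      have i1 := integrable_abs_sub ((hc n j).comp_add_right δ) (hc n j)
      have i2 := integrable_abs_sub (hc n j) (hb j)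
      have i3 : Integrable (fun x => |c n j (x + δ) - b j (x + δ)|) := i2.comp_add_right δ
      have i4 : Integrable (fun x => |c n j (x + δ) - b j (x + δ)| + |c n j x - b j x|) := i3.add i2
      calc _ ≤ ∫ x, (|c n j (x + δ) - c n j x|
            + (|c n j (x + δ) - b j (x + δ)| + |c n j x - b j x|)) := by
            refine integral_mono (integrable_abs_sub ((hb j).comp_add_right δ) (hb j))
              (i1.add i4) fun x => ?_
            have e : b j (x + δ) - b j x = (c n j (x + δ) - c n j x)
              + (-(c n j (x + δ) - b j (x + δ)) + (c n j x - b j x)) := by ring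
            show |b j (x + δ) - b j x| ≤ _
            rw [e, ← abs_neg (c n j (x + δ) - b j (x + δ))]
            exact (abs_add_le _ _).trans (add_le_add le_rfl (abs_add_le _ _))
        _ = _ := by
            rw [integral_add i1 i4, integral_add i3 i2,
              integral_comp_add (fun x => |c n j x - b j x|) δ]
            ring
  have h0 := hC'.add (tendsto_finsetSum Finset.univ fun j _ => (hlim j).const_mul 2)
  simp only [mul_zero, Finset.sum_const_zero, add_zero] at h0
  exact ge_of_tendsto' h0 h

lemma tendsto_integral_of_abs_sub {c : ℕ → ℝ → ℝ} {b : ℝ → ℝ} (hc : ∀ n, Integrable (c n))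
    (hb : Integrable b) (hlim : Tendsto (fun n => ∫ x, |c n x - b x|) atTop (𝓝 0)) :
    Tendsto (fun n => ∫ x, c n x) atTop (𝓝 (∫ x, b x)) :=
  tendsto_iff_norm_sub_tendsto_zero.2 (squeeze_zero_norm (fun n => by
    rw [norm_norm, ← integral_sub (hc n) hb]; exact abs_integral_le_integral_abs) hlim)

lemma tendsto_integral_abs_sub_mul {c : ℕ → ℝ → ℝ} {b : ℝ → ℝ} (hc : ∀ n, IsDensity (c n))
    (hb : IsDensity b) (hlim : Tendsto (fun n => ∫ x, |c n x - b x|) atTop (𝓝 0)) (α : ℝ)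
    (hψ : IsTest ψ m) :
    Tendsto (fun n => ∫ x, |c n x - α| * ψ x) atTop (𝓝 (∫ x, |b x - α| * ψ x)) := by
  obtain ⟨C, hC⟩ := hψ.exists_abs_le
  refine tendsto_iff_norm_sub_tendsto_zero.2 (squeeze_zero_norm (fun n => ?_)
    (by simpa using hlim.const_mul C))
  rw [norm_norm]
  exact abs_integral_abs_sub_mul_sub_le (hc n) hb α hψ.integrable_fun hC

/-- Two sequences of Kruzkov constants outside of a countable set that tend to `α`. -/
lemma exists_seq_tendsto_of_countable {S : Set ℝ} (hS : S.Countable) (α : ℝ) :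
    ∃ β γ : ℕ → ℝ, Tendsto β atTop (𝓝 α) ∧ Tendsto γ atTop (𝓝 α) ∧ (∀ n, β n < α) ∧
      (∀ n, α < γ n) ∧ (∀ n, β n ∉ S) ∧ ∀ n, γ n ∉ S := by
  have hd := hS.dense_compl ℝ
  have hpos : ∀ n : ℕ, 0 < 1 / ((n : ℝ) + 1) := fun n => by positivity
  choose β hβS hβ using fun n : ℕ => hd.exists_between (sub_lt_self α (hpos n))
  choose γ hγS hγ using fun n : ℕ => hd.exists_between (lt_add_of_pos_right α (hpos n))
  have h0 := tendsto_one_div_add_atTop_nhds_zero_nat (𝕜 := ℝ)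
  refine ⟨β, γ, ?_, ?_, fun n => (hβ n).2, fun n => (hγ n).1, hβS, hγS⟩
  · exact tendsto_of_tendsto_of_tendsto_of_le_of_le (by simpa using h0.const_sub α)
      tendsto_const_nhds (fun n => (hβ n).1.le) fun n => (hβ n).2.le
  · exact tendsto_of_tendsto_of_tendsto_of_le_of_le tendsto_const_nhds
      (by simpa using h0.const_add α) (fun n => (hγ n).1.le) fun n => (hγ n).2.le

/-- Fast Cauchy sequences of approximate entropy solutions converge to exact ones. -/
theorem exists_limit (hP : P.Regular K) (hM : P.SpeedLE M) (hT : 0 < T) {e : ℕ → ℝ}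
    (he : Tendsto e atTop (𝓝 0)) (hL0 : 0 ≤ L) {U : ℕ → Fin N → ℝ → ℝ → ℝ}
    (hU : ∀ n, P.IsApprox T μ B L (e n) (U n))
    (hcau : ∀ n, ∀ t ∈ Icc 0 T, ∀ k, ∫ x, |U n k t x - U (n + 1) k t x| ≤ (1 / 2) ^ n) :
    ∃ W, P.IsApprox T μ B L 0 W ∧
      ∀ t ∈ Icc 0 T, ∀ k, Tendsto (fun n => ∫ x, |U n k t x - W k t x|) atTop (𝓝 0) := by
  have hclm : ∀ t, max 0 (min t T) ∈ Icc 0 T := fun t =>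
    ⟨le_max_left _ _, max_le hT.le (min_le_right _ _)⟩
  have hclc : Measurable fun p : ℝ × ℝ => (max 0 (min p.1 T), p.2) :=
    (measurable_const.max (measurable_fst.min measurable_const)).prodMk measurable_snd
  -- Times are clamped to `[0, T]`: the Cauchy bound holds only there, whereas the bounds in
  -- `IsApprox` concern all times.
  choose W hWm hW using fun k => exists_measurable_limit
    (w := fun n t => U n k (max 0 (min t T))) (fun n => ((hU n).measurable k).comp hclc)
    (fun n t => (hU n).density k _) fun n t => hcau n _ (hclm t) k
  have hWd : ∀ k t, IsDensity (W k t) := fun k t => (hW k t).1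
  have hpow : Tendsto (fun n : ℕ => 2 * (1 / 2 : ℝ) ^ n) atTop (𝓝 0) := by
    simpa using (tendsto_pow_atTop_nhds_zero_of_lt_one (r := (1 / 2 : ℝ))
      (by norm_num) (by norm_num)).const_mul 2
  have hlim : ∀ k t, Tendsto (fun n => ∫ x, |U n k (max 0 (min t T)) x - W k t x|) atTop (𝓝 0) :=
    fun k t => squeeze_zero (fun n => integral_nonneg fun x => abs_nonneg _)
      (fun n => (hW k t).2.1 n) hpow
  have hWL : ∀ k s t, ∫ x, |W k s x - W k t x| ≤ L * |s - t| := fun k s t => by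
    have h1 : Tendsto (fun n => ((∫ x, |U n k (max 0 (min s T)) x - W k s x|)
        + (∫ x, |U n k (max 0 (min t T)) x - W k t x|)) + (L * |s - t| + e n)) atTop
        (𝓝 (L * |s - t|)) := by
      simpa using ((hlim k s).add (hlim k t)).add (he.const_add (L * |s - t|))
    refine ge_of_tendsto' h1 fun n => ?_
    have h2 := (hU n).time k (max 0 (min s T)) (max 0 (min t T))
    have h3 : L * |max 0 (min s T) - max 0 (min t T)| ≤ L * |s - t| :=
      mul_le_mul_of_nonneg_left (abs_clamp_sub_clamp_le T s t) hL0
    refine le_trans ?_ (add_le_add le_rfl (h2.trans (add_le_add h3 le_rfl)))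
    have i : ∀ t, Integrable (fun x => |U n k (max 0 (min t T)) x - W k t x|) := fun t =>
      integrable_abs_sub ((hU n).density k _).integrable (hWd k t).integrable
    have i3 := integrable_abs_sub ((hU n).density k (max 0 (min s T))).integrable
      ((hU n).density k (max 0 (min t T))).integrable
    have i4 : Integrable (fun x => |U n k (max 0 (min s T)) x - W k s x|
      + |U n k (max 0 (min t T)) x - W k t x|) := (i s).add (i t)
    rw [← integral_add (i s) (i t), ← integral_add i4 i3]
    refine integral_mono (integrable_abs_sub (hWd k s).integrable (hWd k t).integrable)
      (i4.add i3) fun x => ?_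
    have e1 := abs_sub_le (W k s x) (U n k (max 0 (min s T)) x) (W k t x)
    have e2 := abs_sub_le (U n k (max 0 (min s T)) x) (U n k (max 0 (min t T)) x) (W k t x)
    rw [abs_sub_comm (W k s x) (U n k (max 0 (min s T)) x)] at e1
    change |W k s x - W k t x| ≤ |U n k (max 0 (min s T)) x - W k s x|
      + |U n k (max 0 (min t T)) x - W k t x|
      + |U n k (max 0 (min s T)) x - U n k (max 0 (min t T)) x|
    linarith
  have hWmd : ∀ k, Measurable (fun p : ℝ × ℝ => deriv (P.speed k (W k p.1)) p.2) := fun k =>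
    measurable_deriv_with_param (continuous_speed_of_time hP k (hWd k) (hWL k))
  have hlim' : ∀ t ∈ Icc 0 T, ∀ k, Tendsto (fun n => ∫ x, |U n k t x - W k t x|) atTop (𝓝 0) :=
    fun t ht k => by
      have := hlim k t
      rwa [min_eq_left ht.2, max_eq_right ht.1] at this
  refine ⟨W, isApprox_zero hP hWm hWd (fun t => ?_) (fun t δ => ?_) hWL ?_, hlim'⟩
  · exact le_of_tendsto' (tendsto_finsetSum Finset.univ fun k _ => tendsto_integral_of_abs_sub
      (fun n => ((hU n).density k _).integrable) (hWd k t).integrable (hlim k t))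
      fun n => (hU n).mass _
  · exact sum_integral_abs_shift_sub_le_of_tendsto
      (fun n j => ((hU n).density j (max 0 (min t T))).integrable) (fun j => (hWd j t).integrable)
      (fun j => hlim j t) (fun n => (hU n).shift _ δ) tendsto_const_nhds
  intro s t hs hst ht k α ψ m hψ hψs hψc
  have hmem : ∀ r ∈ Icc s t, r ∈ Icc 0 T := fun r hr => ⟨hs.trans hr.1, hr.2.trans ht⟩
  have hrm : ∀ α, Measurable fun r => P.rate k (fun j => W j r) α ψ := fun α =>
    measurable_rate hP hWm hWmd hWd k α hψ
  -- Kruzkov constants that the limit attains on a null set only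
  have generic : ∀ α, ¬ 0 < volume {p : ℝ × ℝ | W k p.1 p.2 = α} →
      ∫ x, |W k t x - α| * ψ x
        ≤ (∫ x, |W k s x - α| * ψ x) + ∫ r in s..t, P.rate k (fun j => W j r) α ψ := by
    intro α hα
    obtain ⟨Q, hQ⟩ := exists_abs_rate_le hP hM k hψ |P.f k α|
    obtain ⟨C, hC⟩ := hψ.bdd
    have hα' : ∀ᵐ r : ℝ, ∀ᵐ x : ℝ, W k r x ≠ α := by
      have h0 : ∀ᵐ p : ℝ × ℝ, W k p.1 p.2 ≠ α := by
        rw [ae_iff]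
        simpa using hα
      rw [Measure.volume_eq_prod] at h0
      exact Measure.ae_ae_of_ae_prod h0
    have hrate : Tendsto (fun n => ∫ r in s..t, P.rate k (fun j => U n j r) α ψ) atTop
        (𝓝 (∫ r in s..t, P.rate k (fun j => W j r) α ψ)) := by
      refine intervalIntegral.tendsto_integral_filter_of_dominated_convergence (fun _ => Q)
        (.of_forall fun n => (measurable_rate hP (hU n).measurable
          (hU n).measurable_deriv (hU n).density k α hψ).aestronglyMeasurable)
        (.of_forall fun n => Eventually.of_forall fun r _ =>
          hQ _ α (fun j => (hU n).density j r) le_rfl) intervalIntegrable_const ?_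
      filter_upwards [hα'] with r hr hrm
      rw [uIoc_of_le hst] at hrm
      have hr' := hmem r (Ioc_subset_Icc_self hrm)
      refine tendsto_rate hP hM k hψ (c := fun n j => U n j r) (b := fun j => W j r)
        (fun n j => (hU n).density j r) (fun j => hWd j r) ?_ ?_ hr
      · have := (hW k r).2.2
        rwa [min_eq_left hr'.2, max_eq_right hr'.1] at this
      · simpa using tendsto_finsetSum Finset.univ fun j _ => hlim' r hr' j
    have hFt := tendsto_integral_abs_sub_mul (fun n => (hU n).density k t) (hWd k t)
      (hlim' t (hmem t ⟨hst, le_rfl⟩) k) α hψ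
    have hFs := tendsto_integral_abs_sub_mul (fun n => (hU n).density k s) (hWd k s)
      (hlim' s (hmem s ⟨le_rfl, hst⟩) k) α hψ
    have herr : Tendsto (fun n => (1 + |P.f k α|) * (C * e n)
        + e n * (|α| + |P.f k α|) * ∫ x, m x) atTop (𝓝 0) := by
      simpa using ((he.const_mul C).const_mul (1 + |P.f k α|)).add
        ((he.mul_const (|α| + |P.f k α|)).mul_const (∫ x, m x))
    have hR : Tendsto (fun n => ((∫ x, |U n k s x - α| * ψ x)
        + ∫ r in s..t, P.rate k (fun j => U n j r) α ψ) + ((1 + |P.f k α|) * (C * e n)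
        + e n * (|α| + |P.f k α|) * ∫ x, m x)) atTop (𝓝 ((∫ x, |W k s x - α| * ψ x)
          + ∫ r in s..t, P.rate k (fun j => W j r) α ψ)) := by
      simpa using (hFs.add hrate).add herr
    refine le_of_tendsto_of_tendsto' hFt hR fun n => ?_
    obtain ⟨E, h1, h2, h3, h4⟩ := (hU n).entropy s t hs hst ht k
    refine (h4 α ψ m hψ hψs hψc).trans (add_le_add le_rfl (add_le_add
      (mul_le_mul_of_nonneg_left ?_ (by positivity)) le_rfl))
    have hC0 : 0 ≤ C := (hψ.major_nonneg 0).trans (hC 0)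
    calc ∫ x, m x * E x ≤ ∫ x, C * E x := integral_mono (hψ.integrable_mul h1) (h1.const_mul C)
          fun x => mul_le_mul_of_nonneg_right (hC x) (h2 x)
      _ ≤ C * e n := by rw [integral_const_mul]; gcongr
  -- approximation of arbitrary constants from both sides
  obtain ⟨β, γ, hβ, hγ, hβα, hγα, hβS, hγS⟩ := exists_seq_tendsto_of_countable
    (Measure.countable_meas_level_set_pos (μ := (volume : Measure (ℝ × ℝ))) (hWm k)) α
  have hf : ∀ {δ : ℕ → ℝ}, Tendsto δ atTop (𝓝 α) → ∃ F, ∀ n, |P.f k (δ n)| ≤ F := fun hδ => by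
    obtain ⟨F, hF⟩ := (((continuous_f hP.adm k).tendsto α).comp hδ).norm.bddAbove_range
    exact ⟨F, fun n => hF ⟨n, rfl⟩⟩
  obtain ⟨F₁, hF₁⟩ := hf hβ
  obtain ⟨F₂, hF₂⟩ := hf hγ
  have hβF : ∀ n, |P.f k (β n)| ≤ max F₁ F₂ := fun n => (hF₁ n).trans (le_max_left _ _)
  have hγF : ∀ n, |P.f k (γ n)| ≤ max F₁ F₂ := fun n => (hF₂ n).trans (le_max_right _ _)
  obtain ⟨Q, hQ⟩ := exists_abs_rate_le hP hM k hψ (max F₁ F₂)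
  have hαF : |P.f k α| ≤ max F₁ F₂ :=
    le_of_tendsto' (((continuous_f hP.adm k).tendsto α).comp hβ).abs hβF
  have hri : ∀ α, |P.f k α| ≤ max F₁ F₂ →
      IntervalIntegrable (fun r => P.rate k (fun j => W j r) α ψ) volume s t := fun α hα =>
    intervalIntegrable_of_abs_le (hrm α) (fun r => hQ _ α (fun j => hWd j r) hα) s t
  have hrate : Tendsto (fun n => ∫ r in s..t, (P.rate k (fun j => W j r) (β n) ψ
      + P.rate k (fun j => W j r) (γ n) ψ)) atTop (𝓝 (∫ r in s..t,
        (P.rate k (fun j => W j r) α ψ + P.rate k (fun j => W j r) α ψ))) :=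
    intervalIntegral.tendsto_integral_filter_of_dominated_convergence (fun _ => Q + Q)
      (.of_forall fun n => ((hrm _).add (hrm _)).aestronglyMeasurable)
      (.of_forall fun n => Eventually.of_forall fun r _ => (abs_add_le _ _).trans
        (add_le_add (hQ _ _ (fun j => hWd j r) (hβF n)) (hQ _ _ (fun j => hWd j r) (hγF n))))
      intervalIntegrable_const (.of_forall fun r _ =>
        tendsto_rate_add_rate hP hM k hψ (fun j => hWd j r) hβ hγ hβα hγα hβF hγF)
  have hF : ∀ r {δ : ℕ → ℝ}, Tendsto δ atTop (𝓝 α) → Tendsto (fun n => ∫ x, |W k r x - δ n| * ψ x)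
      atTop (𝓝 (∫ x, |W k r x - α| * ψ x)) := fun r δ hδ => by
    have hi := hψ.integrable_fun
    obtain ⟨D, hD⟩ := hδ.norm.bddAbove_range
    refine tendsto_integral_of_dominated_convergence (fun x => (1 + D) * ψ x) (fun n =>
      (measurable_norm.comp ((hWd k r).measurable.sub_const _)).aestronglyMeasurable.mul
        hi.aestronglyMeasurable) (hi.const_mul _) (fun n => Eventually.of_forall fun x => ?_)
      (.of_forall fun x => ((tendsto_const_nhds.sub hδ).abs.mul_const _))
    rw [Real.norm_eq_abs, abs_mul, abs_abs, abs_of_nonneg (hψ.nonneg x)]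
    exact mul_le_mul_of_nonneg_right ((abs_sub_le_one_add ((hWd k r).mem x) _).trans
      (add_le_add le_rfl (hD ⟨n, rfl⟩))) (hψ.nonneg x)
  -- The inequalities for the two approximating constants are added before passing to the limit. The
  -- sum converges to twice the inequality for `α`, although the single rates need not converge to
  -- the rate at `α`.
  have hfinal := le_of_tendsto_of_tendsto' ((hF t hβ).add (hF t hγ))
    (((hF s hβ).add (hF s hγ)).add hrate) fun n => by
      rw [intervalIntegral.integral_add (hri _ (hβF n)) (hri _ (hγF n))]
      linarith [generic _ (hβS n), generic _ (hγS n)]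
  rw [intervalIntegral.integral_add (hri _ hαF) (hri _ hαF)] at hfinal
  linarith

end LaneModel

/-! ### From inequalities between two times back to the weak formulation -/

/-- A quadratic remainder in a differential inequality disappears. -/
lemma sub_le_integral_of_quadratic {Φ H : ℝ → ℝ} {T C : ℝ} (hT : 0 < T)
    (hH : ∀ a b, IntervalIntegrable H volume a b)
    (h : ∀ s t, 0 ≤ s → s < t → t ≤ T → Φ t - Φ s ≤ (∫ r in s..t, H r) + C * (t - s) ^ 2) :
    Φ T - Φ 0 ≤ ∫ r in (0 : ℝ)..T, H r := by
  have key : ∀ n : ℕ, Φ T - Φ 0 ≤ (∫ r in (0 : ℝ)..T, H r) + C * T ^ 2 * (1 / ((n : ℝ) + 1)) := by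
    intro n
    set τ := T / ((n : ℝ) + 1) with hτ
    have hτ0 : 0 < τ := by positivity
    have hnτ : ((n : ℝ) + 1) * τ = T := by rw [hτ]; field_simp
    have hind : ∀ j : ℕ, j ≤ n + 1 → Φ (j * τ) - Φ 0 ≤ (∫ r in (0 : ℝ)..(j * τ), H r)
        + C * (j * τ ^ 2) := by
      intro j
      induction j with
      | zero => simp
      | succ j ih =>
        intro hj
        have hj' : ((j + 1 : ℕ) : ℝ) ≤ n + 1 := by exact_mod_cast hj
        have h1 := ih (by omega)
        have h2 := h (j * τ) ((j + 1 : ℕ) * τ) (by positivity) (by push_cast; nlinarith)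
          (by rw [← hnτ]; gcongr)
        rw [← intervalIntegral.integral_add_adjacent_intervals (hH 0 (j * τ)) (hH _ _)]
        have e : C * ((((j + 1 : ℕ) : ℝ) * τ) - j * τ) ^ 2 = C * τ ^ 2 := by push_cast; ring
        rw [e] at h2
        push_cast at h2 ⊢
        linarith
    have h3 := hind (n + 1) le_rfl
    push_cast at h3
    rw [hnτ] at h3
    have e : C * (((n : ℝ) + 1) * τ ^ 2) = C * T ^ 2 * (1 / ((n : ℝ) + 1)) := by
      rw [hτ]; field_simp
    rwa [e] at h3
  have hlim := ((tendsto_one_div_add_atTop_nhds_zero_nat (𝕜 := ℝ)).const_mul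
    (C * T ^ 2)).const_add (∫ r in (0 : ℝ)..T, H r)
  simp only [mul_zero, add_zero] at hlim
  exact ge_of_tendsto' hlim key

lemma exists_slice_bound {g : ℝ × ℝ → ℝ} (hg : ContDiff ℝ (⊤ : ℕ∞) g) (hs : HasCompactSupport g) :
    ∃ χ : ℝ → ℝ, Integrable χ ∧ (∀ x, 0 ≤ χ x) ∧
      ∀ s r x, |g (s, x) - g (r, x)| ≤ χ x * |s - r| := by
  obtain ⟨L, hL⟩ := hg.lipschitzWith_of_hasCompactSupport hs (by simp)
  have hK := hs.isCompact.image continuous_snd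
  refine ⟨(Prod.snd '' tsupport g).indicator fun _ => (L : ℝ),
    (integrable_indicator_iff hK.measurableSet).2 (integrableOn_const hK.measure_lt_top.ne),
    fun x => indicator_nonneg (fun _ _ => L.2) x, fun s r x => ?_⟩
  by_cases hx : x ∈ Prod.snd '' tsupport g
  · rw [indicator_of_mem hx]
    have := hL.dist_le_mul (s, x) (r, x)
    simpa [Prod.dist_eq, Real.dist_eq] using this
  · have h0 : ∀ s, g (s, x) = 0 := fun s =>
      image_eq_zero_of_notMem_tsupport fun h => hx ⟨(s, x), h, rfl⟩
    simp [h0, indicator_of_notMem hx]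

lemma hasCompactSupport_slice {g : ℝ × ℝ → ℝ} (hs : HasCompactSupport g) (t : ℝ) :
    HasCompactSupport fun x => g (t, x) :=
  HasCompactSupport.intro (hs.isCompact.image continuous_snd) fun x hx =>
    image_eq_zero_of_notMem_tsupport fun h => hx ⟨(t, x), h, rfl⟩

namespace LaneModel

variable {N : ℕ} {P : LaneModel N} {K M T μ B L : ℝ} {W : Fin N → ℝ → ℝ → ℝ} {ψ ψ' m m' : ℝ → ℝ}

/-- The integrand is linear in the test function and its derivative, so its pointwise bound applies
to the difference of the two test functions. That difference need not be non-negative, which is why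
the integrand bound does not require it. -/
lemma rate_le_rate_add (hP : P.Regular K) (hM : P.SpeedLE M) (k : Fin N) {a : Fin N → ℝ → ℝ}
    (ha : ∀ j, IsDensity (a j)) (α : ℝ) (hψ : IsTest ψ m) (hψ' : IsTest ψ' m') {χ χ' : ℝ → ℝ}
    {h : ℝ} (hχ : Integrable χ) (hχ' : Integrable χ') (h1 : ∀ x, |ψ x - ψ' x| ≤ χ x * h)
    (h2 : ∀ x, |deriv ψ x - deriv ψ' x| ≤ χ' x * h) :
    P.rate k a α ψ ≤ P.rate k a α ψ' + ((K + |P.f k α|) * M * (∫ x, χ' x)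
      + (2 * K * N + |P.f k α| * (K + 2 * K ^ 2)) * ∫ x, χ x) * h := by
  have hK := hP.nonneg
  have hM0 := hM.nonneg k
  set c₁ := (K + |P.f k α|) * M with hc₁
  set c₂ := 2 * K * N + |P.f k α| * (K + 2 * K ^ 2) with hc₂
  have j1 := (hχ'.const_mul (c₁ * h))
  have j2 := (hχ.const_mul (c₂ * h))
  have j3 : Integrable (fun x => c₁ * h * χ' x + c₂ * h * χ x) := j1.add j2
  have hd : ∀ x, deriv (fun x => ψ x - ψ' x) x = deriv ψ x - deriv ψ' x := fun x =>
    deriv_fun_sub (hψ.differentiable x) (hψ'.differentiable x)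
  have i := fun {ψ m} (hψ : IsTest ψ m) => integrable_rate hP hM k (ha k) ha α hψ
  calc P.rate k a α ψ ≤ ∫ x, ((kruzkov (P.f k) (a k x) α * P.speed k (a k) x * deriv ψ' x
        + Real.sign (a k x - α) * (P.source k a x - P.f k α * deriv (P.speed k (a k)) x) * ψ' x)
        + (c₁ * h * χ' x + c₂ * h * χ x)) := by
        refine integral_mono (i hψ) ((i hψ').add j3) fun x => ?_
        have h3 := (le_abs_self _).trans (abs_rate_integrand_le hP hM k (ha k) ha
          (le_refl |P.f k α|)
          (fun x => ψ x - ψ' x) x)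
        rw [hd] at h3
        have h4 : c₁ * |deriv ψ x - deriv ψ' x| ≤ c₁ * (χ' x * h) := by gcongr; exact h2 x
        have h5 : c₂ * |ψ x - ψ' x| ≤ c₂ * (χ x * h) := by gcongr; exact h1 x
        beta_reduce
        linarith
    _ = _ := by
        rw [integral_add (i hψ') j3, integral_add j1 j2, integral_const_mul,
          integral_const_mul, rate]
        ring

/-- Exact entropy inequalities between any two times imply the weak entropy inequality. -/
theorem IsApprox.weak_entropy (hP : P.Regular K) (hM : P.SpeedLE M) (hT : 0 < T) (hL : 0 ≤ L)
    (hW : P.IsApprox T μ B L 0 W) (k : Fin N) (α : ℝ) {φ : ℝ → ℝ → ℝ}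
    (hφ : ContDiff ℝ (⊤ : ℕ∞) (fun p : ℝ × ℝ => φ p.1 p.2))
    (hc : HasCompactSupport (fun p : ℝ × ℝ => φ p.1 p.2))
    (hs : tsupport (fun p : ℝ × ℝ => φ p.1 p.2) ⊆ Iio T ×ˢ univ)
    (h0 : ∀ t ∈ Ico 0 T, ∀ x, 0 ≤ φ t x) :
    0 ≤ (∫ t in (0 : ℝ)..T, ((∫ x, |W k t x - α| * deriv (fun s => φ s x) t)
      + P.rate k (fun j => W j t) α (φ t))) + ∫ x, |W k 0 x - α| * φ 0 x := by
  have hK := hP.nonneg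
  have hM0 := hM.nonneg k
  have hd := hW.density
  have hsm : ∀ t, ContDiff ℝ (⊤ : ℕ∞) (φ t) := fun t =>
    hφ.comp (contDiff_const.prodMk contDiff_id)
  have hsm2 : ∀ t, ContDiff ℝ 2 (φ t) := fun t => contDiff_infty.1 (hsm t) 2
  have hcs : ∀ t, HasCompactSupport (φ t) := fun t => hasCompactSupport_slice hc t
  obtain ⟨χ₀, hχ₀, hχ₀0, hb₀⟩ := exists_slice_bound hφ hc
  obtain ⟨χ₁, hχ₁, hχ₁0, hb₁⟩ := exists_slice_bound (contDiff_deriv_snd hφ)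
    (hasCompactSupport_deriv_snd hφ hc)
  obtain ⟨χ₂, hχ₂, hχ₂0, hb₂⟩ := exists_slice_bound (contDiff_deriv_fst hφ)
    (hasCompactSupport_deriv_fst hφ hc)
  obtain ⟨C, hC⟩ := (hasCompactSupport_deriv_fst hφ hc).exists_bound_of_continuous
    (contDiff_deriv_fst hφ).continuous
  have hC0 : 0 ≤ C := (norm_nonneg _).trans (hC 0)
  have hint := (weak_form_eq hP hM hW.measurable hW.measurable_deriv hd hφ hc hT.le k α).1
  -- The support lies strictly before `T`. This removes the end term at `T`, and it supplies the
  -- sign of the test function at `T`, where the hypothesis is silent.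
  have hz : ∀ x, φ T x = 0 := fun x =>
    image_eq_zero_of_notMem_tsupport (f := fun p : ℝ × ℝ => φ p.1 p.2) (x := (T, x))
      fun h => lt_irrefl T (hs h).1
  have htest : ∀ r ∈ Icc 0 T, ∃ m, IsTest (φ r) m := fun r hr =>
    exists_isTest (hsm2 r) (hcs r) fun x => by
      rcases hr.2.eq_or_lt with rfl | hrT
      · rw [hz]
      · exact h0 r ⟨hr.1, hrT⟩ x
  set H : ℝ → ℝ := fun t => (∫ x, |W k t x - α| * deriv (fun s => φ s x) t)
    + P.rate k (fun j => W j t) α (φ t) with hH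
  set C₁ := (K + |P.f k α|) * M * (∫ x, χ₁ x)
    + (2 * K * N + |P.f k α| * (K + 2 * K ^ 2)) * ∫ x, χ₀ x with hC₁
  have hC₁0 : 0 ≤ C₁ := by
    have : 0 ≤ ∫ x, χ₀ x := integral_nonneg hχ₀0
    have : 0 ≤ ∫ x, χ₁ x := integral_nonneg hχ₁0
    positivity
  set C₂ := (1 + |α|) * (∫ x, χ₂ x) + C * L with hC₂
  -- On a short interval the entropy inequality is applied with the test function frozen at the left
  -- end. Un-freezing the rate costs `C₁` and the increment of the test function in time costs `C₂`,
  -- each times the square of the length, so both disappear under refinement.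
  have hmain := sub_le_integral_of_quadratic (Φ := fun t => ∫ x, |W k t x - α| * φ t x) (H := H)
    (C := C₁ + C₂) hT (fun a b => hint.intervalIntegrable) fun s t hs0 hst htT => ?_
  · simp only [hz, mul_zero, integral_zero] at hmain
    linarith
  have hst0 : 0 < t - s := by linarith
  have hφd : ∀ τ, Integrable (fun x => deriv (fun s => φ s x) τ) := fun τ =>
    Continuous.integrable_of_hasCompactSupport ((contDiff_deriv_fst hφ).continuous.comp
      (continuous_const.prodMk continuous_id))
      (hasCompactSupport_slice (hasCompactSupport_deriv_fst hφ hc) τ)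
  have hia : ∀ τ {g : ℝ → ℝ}, Integrable g → Integrable (fun x => |W k τ x - α| * g x) :=
    fun τ g hg => hg.bdd_mul_of_abs_le (measurable_norm.comp ((hd k τ).measurable.sub_const α))
      (C := 1 + |α|) fun x => (abs_abs _).trans_le (abs_sub_le_one_add ((hd k τ).mem x) α)
  have hφi : ∀ τ, Integrable (φ τ) := fun τ =>
    (hsm τ).continuous.integrable_of_hasCompactSupport (hcs τ)
  set X := (∫ x, |W k t x - α| * φ t x) - ∫ x, |W k t x - α| * φ s x with hX
  obtain ⟨m, hm⟩ := htest s ⟨hs0, hst.le.trans htT⟩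
  have hent : ∫ x, |W k t x - α| * φ s x ≤ (∫ x, |W k s x - α| * φ s x)
      + ∫ r in s..t, P.rate k (fun j => W j r) α (φ s) := by
    obtain ⟨E, e1, e2, e3, e4⟩ := hW.entropy s t hs0 hst.le htT k
    have e5 := e4 α (φ s) m hm (hsm s) (hcs s)
    have e6 : ∫ x, m x * E x = 0 := by
      have e7 : E =ᵐ[volume] 0 := (integral_eq_zero_iff_of_nonneg e2 e1).1
        (le_antisymm e3 (integral_nonneg e2))
      rw [← integral_zero ℝ ℝ (μ := volume)]
      exact integral_congr_ae (e7.mono fun x hx => by simp [hx])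
    rw [e6] at e5
    linarith
  -- The bound holds for every `r` of the interval and not just at one end, so it can be averaged
  -- over `r` and compared with the time integral of `H`.
  have hX' : ∀ r ∈ Icc s t, X ≤ (t - s) * (∫ x, |W k r x - α| * deriv (fun s => φ s x) r)
      + C₂ * (t - s) ^ 2 := by
    intro r hr
    have h1 : X ≤ ∫ x, ((t - s) * (|W k t x - α| * deriv (fun s => φ s x) r)
        + (1 + |α|) * (t - s) ^ 2 * χ₂ x) := by
      rw [hX, ← integral_sub (hia t (hφi t)) (hia t (hφi s))]
      refine integral_mono ((hia t (hφi t)).sub (hia t (hφi s)))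
        (((hia t (hφd r)).const_mul _).add (hχ₂.const_mul _)) fun x => ?_
      obtain ⟨ξ, hξ, hξe⟩ := exists_deriv_eq_slope (fun s => φ s x) hst
        (fun τ _ => (hasDerivAt_fst_of_contDiff hφ τ x).continuousAt.continuousWithinAt)
        (fun τ _ => (hasDerivAt_fst_of_contDiff hφ τ x).differentiableAt.differentiableWithinAt)
      have h2 : φ t x - φ s x = deriv (fun s => φ s x) ξ * (t - s) := by
        rw [hξe]; field_simp
      have h3 := (le_abs_self _).trans (hb₂ ξ r x)
      have h4 : χ₂ x * |ξ - r| ≤ χ₂ x * (t - s) :=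
        mul_le_mul_of_nonneg_left (abs_le.2 ⟨by linarith [hξ.1, hr.2], by linarith [hξ.2, hr.1]⟩)
          (hχ₂0 x)
      have h5 := abs_sub_le_one_add ((hd k t).mem x) α
      have h6 : 0 ≤ χ₂ x * (t - s) * (t - s) := by have := hχ₂0 x; positivity
      show |W k t x - α| * φ t x - |W k t x - α| * φ s x
        ≤ (t - s) * (|W k t x - α| * deriv (fun s => φ s x) r) + (1 + |α|) * (t - s) ^ 2 * χ₂ x
      have h7 : φ t x - φ s x ≤ (t - s) * deriv (fun s => φ s x) r + χ₂ x * (t - s) * (t - s) := by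
        rw [h2]
        have : deriv (fun s => φ s x) ξ ≤ deriv (fun s => φ s x) r + χ₂ x * (t - s) := by
          simp only at h3; linarith
        nlinarith
      have h8 := mul_le_mul_of_nonneg_left h7 (abs_nonneg (W k t x - α))
      have h9 := mul_le_mul_of_nonneg_right h5 h6
      nlinarith
    rw [integral_add ((hia t (hφd r)).const_mul _) (hχ₂.const_mul _), integral_const_mul,
      integral_const_mul] at h1
    have h2 := (le_abs_self _).trans (abs_integral_abs_sub_mul_sub_le (hd k t) (hd k r) α (hφd r)
      fun x => hC (r, x))
    have h3 : C * (∫ x, |W k t x - W k r x|) ≤ C * (L * (t - s)) := by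
      refine mul_le_mul_of_nonneg_left ((hW.time k t r).trans ?_) hC0
      rw [add_zero, abs_of_nonneg (by linarith [hr.2])]
      exact mul_le_mul_of_nonneg_left (by linarith [hr.1]) hL
    have h4 := mul_le_mul_of_nonneg_left (h2.trans h3) hst0.le
    simp only [hC₂]
    nlinarith
  have hrate : ∀ r ∈ Icc s t, P.rate k (fun j => W j r) α (φ s)
      ≤ P.rate k (fun j => W j r) α (φ r) + C₁ * (t - s) := fun r hr => by
    have hsr : |s - r| ≤ t - s := abs_le.2 ⟨by linarith [hr.2], by linarith [hr.1]⟩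
    obtain ⟨m', hm'⟩ := htest r ⟨hs0.trans hr.1, hr.2.trans htT⟩
    exact rate_le_rate_add hP hM k (fun j => hd j r) α hm hm'
      hχ₀ hχ₁ (fun x => (hb₀ s r x).trans (mul_le_mul_of_nonneg_left hsr (hχ₀0 x)))
      (fun x => (hb₁ s r x).trans (mul_le_mul_of_nonneg_left hsr (hχ₁0 x)))
  obtain ⟨Q, hQ⟩ := exists_abs_rate_le hP hM k hm |P.f k α|
  have hri : IntervalIntegrable (fun r => P.rate k (fun j => W j r) α (φ s)) volume s t :=
    intervalIntegrable_of_abs_le (measurable_rate hP hW.measurable hW.measurable_deriv hd k α hm)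
      (fun r => hQ _ α (fun j => hd j r) le_rfl) s t
  have hsum : ∫ r in s..t, (X / (t - s) + P.rate k (fun j => W j r) α (φ s))
      ≤ ∫ r in s..t, (H r + (C₁ + C₂) * (t - s)) := by
    refine intervalIntegral.integral_mono_on hst.le (intervalIntegrable_const.add hri)
      (hint.intervalIntegrable.add intervalIntegrable_const) fun r hr => ?_
    have h1 : X / (t - s) ≤ (∫ x, |W k r x - α| * deriv (fun s => φ s x) r) + C₂ * (t - s) := by
      rw [div_le_iff₀ hst0]
      refine (hX' r hr).trans_eq (by ring)
    have h2 := hrate r hr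
    simp only [hH]
    linarith
  rw [intervalIntegral.integral_add intervalIntegrable_const hri,
    intervalIntegral.integral_add hint.intervalIntegrable intervalIntegrable_const] at hsum
  simp only [intervalIntegral.integral_const, smul_eq_mul] at hsum
  have e : (t - s) * (X / (t - s)) = X := by field_simp
  rw [e] at hsum
  change (∫ x, |W k t x - α| * φ t x) - (∫ x, |W k s x - α| * φ s x) ≤ _
  nlinarith

end LaneModel

/-! ### Existence and uniqueness of exact solutions -/

lemma totalVar_congr_ae {v w : ℝ → ℝ} (h : v =ᵐ[volume] w) : totalVar v = totalVar w := by
  unfold totalVar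
  refine iSup_congr fun ψ => iSup_congr fun _ => ?_
  exact congrArg _ (integral_congr_ae (h.mono fun x hx => by simp only [hx]))

namespace LaneModel

variable {N : ℕ} {P : LaneModel N} {K M T μ B L : ℝ} {u : Fin N → ℝ → ℝ → ℝ}

lemma speedBound_nonneg {lam : ℝ} (hK : 0 ≤ K) (hM : 0 ≤ M) (hB : 0 ≤ B) (hl : 0 ≤ lam) :
    0 ≤ speedBound K M B lam := by unfold speedBound; positivity

/-- Exact entropy inequalities between any two times characterize entropy solutions. -/
theorem IsApprox.isEntropySolution (hP : P.Regular K) (hM : P.SpeedLE M) (hT : 0 < T) (hL : 0 ≤ L)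
    (hu : P.IsApprox T μ B L 0 u) {u₀ : Fin N → ℝ → ℝ} (h0 : ∀ k, u k 0 =ᵐ[volume] u₀ k) :
    P.IsEntropySolution T u₀ u where
  measurable k := (hu.measurable k).aestronglyMeasurable
  integrable k t _ := (hu.density k t).integrable
  range k t _ := Eventually.of_forall (hu.density k t).mem
  lip := ⟨L, fun k s _ t _ => by simpa using hu.time k s t⟩
  bv := ⟨B, fun k t _ => (Finset.single_le_sum (f := fun k => totalVar (u k t))
    (fun _ _ => zero_le) (Finset.mem_univ k)).trans
    (sum_totalVar_le_of_shift (fun j => (hu.density j t).integrable) (hu.shift t))⟩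
  initial := h0
  entropy k α φ hφ hc hs hn := by
    have h1 := (weak_form_eq hP hM hu.measurable hu.measurable_deriv hu.density hφ hc hT.le k α).2
    have h2 := hu.weak_entropy hP hM hT hL k α hφ hc hs hn
    linarith

/-- Existence of a limit of the scheme. -/
theorem exists_isApprox_zero (hP : P.Regular K) (hM : P.SpeedLE M) (hM0 : 0 ≤ M) (hT : 0 < T)
    {a : Fin N → ℝ → ℝ} (ha : ∀ j, IsDensity (a j)) (hm : ∑ j, ∫ x, a j x ≤ K) {V : ℝ} (hB0 : 0 ≤ B)
    (hV : B ≤ V) (hTV : ∀ δ, ∑ j, ∫ x, |a j (x + δ) - a j x| ≤ B * |δ|) :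
    ∃ u : Fin N → ℝ → ℝ → ℝ,
      P.IsApprox T K (Real.exp (tvRate N K * T) * (V + 1))
        (speedBound K M (Real.exp (tvRate N K * T) * (V + 1)) (1 / (2 * K * M + 1))) 0 u ∧
      (∀ k, u k 0 =ᵐ[volume] a k) ∧
      (∀ t ∈ Icc 0 T, ∑ j, ∫ x, u j t x = ∑ j, ∫ x, a j x) ∧
      ∀ t ∈ Icc 0 T, ∀ δ, ∑ j, ∫ x, |u j t (x + δ) - u j t x|
        ≤ (Real.exp (tvRate N K * t) * (B + 1) - 1) * |δ| := by
  have hK := hP.nonneg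
  have hV0 : 0 ≤ V := hB0.trans hV
  set B' := Real.exp (tvRate N K * T) * (V + 1) with hP.bdd'
  have hP.bdd'0 : 0 ≤ B' := by positivity
  set L := speedBound K M B' (1 / (2 * K * M + 1)) with hLdef
  have hL0 : 0 ≤ L := speedBound_nonneg hK hM0 hP.bdd'0 (by positivity)
  choose κ hκ0 hκ using fun n : ℕ => exists_stability hP hM hM0 hT hK hP.bdd'0 hL0
    (show (0 : ℝ) < (1 / 2) ^ n by positivity)
  -- Stability at level `n` is applied to `U n` and `U (n + 1)`, so both errors must be below `κ n`.
  -- For the second one this is provided by the entry `κ (n - 1)`, taken at `n + 1`; at `n = 0` the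
  -- truncated subtraction is harmless.
  set e : ℕ → ℝ := fun n => min (min (κ n) (κ (n - 1))) ((1 / 2) ^ n) with he
  have he0 : ∀ n, 0 < e n := fun n => lt_min (lt_min (hκ0 _) (hκ0 _)) (by positivity)
  have hel : Tendsto e atTop (𝓝 0) := squeeze_zero (fun n => (he0 n).le)
    (fun n => min_le_right _ _) (tendsto_pow_atTop_nhds_zero_of_lt_one (r := (1 / 2 : ℝ))
      (by norm_num) (by norm_num))
  choose U hU hU0 hUm hUs using fun n => exists_isApprox hP hM hM0 hT ha hm hB0 hV hTV (he0 n)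
  have h1 : ∀ n, e n ≤ κ n := fun n => (min_le_left _ _).trans (min_le_left _ _)
  have h2 : ∀ n, e (n + 1) ≤ κ n := fun n => (min_le_left _ _).trans (min_le_right _ _)
  obtain ⟨W, hW, hlim⟩ := exists_limit hP hM hT hel hL0 hU fun n t ht k => by
    have h3 := hκ n (κ n) (U n) (U (n + 1)) (hκ0 n).le le_rfl
      ((hU n).mono le_rfl le_rfl le_rfl (h1 n)) ((hU (n + 1)).mono le_rfl le_rfl le_rfl (h2 n))
      (by simpa [hU0] using (hκ0 n).le) t ht
    exact (integral_abs_le_sum (fun k x => U n k t x - U (n + 1) k t x) k).trans h3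
  refine ⟨W, hW, fun k => ?_, fun t ht => ?_, fun t ht δ => ?_⟩
  · have h3 := hlim 0 ⟨le_rfl, hT.le⟩ k
    simp only [hU0] at h3
    exact (ae_eq_of_integral_abs_sub_nonpos (ha k).integrable (hW.density k 0).integrable
      (tendsto_nhds_unique tendsto_const_nhds h3).le).symm
  · have h3 := tendsto_finsetSum Finset.univ fun k _ => tendsto_integral_of_abs_sub
      (fun n => ((hU n).density k t).integrable) (hW.density k t).integrable (hlim t ht k)
    simp only [hUm] at h3
    exact (tendsto_nhds_unique tendsto_const_nhds h3).symm
  · refine sum_integral_abs_shift_sub_le_of_tendsto (fun n j => ((hU n).density j t).integrable)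
      (fun j => (hW.density j t).integrable) (fun j => hlim t ht j)
      (fun n => hUs n t ht.1 δ) ?_
    -- The interpolation rounds times up to the grid, so the approximate bound is attained at `t +
    -- ε`; continuity of the exponential restores the sharp form as the error tends to zero.
    have hc : Continuous fun ε => (Real.exp (tvRate N K * (t + ε)) * (B + 1) - 1) * |δ| := by
      fun_prop
    simpa [Function.comp_def] using (hc.tendsto 0).comp hel

/-- Uniqueness of exact solutions. -/
theorem IsApprox.ae_eq (hP : P.Regular K) (hM : P.SpeedLE M) (hM0 : 0 ≤ M) (hT : 0 < T) (hμ : 0 ≤ μ)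
    (hB0 : 0 ≤ B) (hL : 0 ≤ L) {v : Fin N → ℝ → ℝ → ℝ} (hu : P.IsApprox T μ B L 0 u)
    (hv : P.IsApprox T μ B L 0 v) (h0 : ∀ k, u k 0 =ᵐ[volume] v k 0) (k : Fin N) {t : ℝ}
    (ht : t ∈ Icc 0 T) : u k t =ᵐ[volume] v k t := by
  have hz : ∑ k, ∫ x, |u k 0 x - v k 0 x| = 0 := Finset.sum_eq_zero fun k _ => by
    rw [← integral_zero ℝ ℝ (μ := volume)]
    exact integral_congr_ae ((h0 k).mono fun x hx => by simp [hx])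
  refine ae_eq_of_integral_abs_sub_nonpos (hu.density k t).integrable (hv.density k t).integrable
    (le_of_forall_pos_le_add fun κ hκ => ?_)
  obtain ⟨ε, hε, h⟩ := exists_stability hP hM hM0 hT hμ hB0 hL hκ
  rw [zero_add]
  exact (integral_abs_le_sum (fun k x => u k t x - v k t x) k).trans
    (h 0 u v le_rfl hε.le hu hv (hz.trans_le hε.le) t ht)

end LaneModel

end

end

/-! ### Assembly of the theorem -/

theorem corollary4p4 (N : ℕ) (K : ℝ) :
    -- the constant `C_TV` depends only on `N` and the bound `K`
    ∃ C_TV : ℝ, 0 ≤ C_TV ∧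
      -- the constant `C_L` depends in addition on the bounds `M` on the velocities and `V` on the
      -- total variation of the initial data, and on the final time `T`
      ∀ (M V T : ℝ), 0 < T → ∃ C_L : ℝ, 0 ≤ C_L ∧
        ∀ (P : LaneModel N) (u₀ : Fin N → ℝ → ℝ),
          P.Admissible → P.BoundedBy K → LaneModel.IsInitialDatum u₀ →
          (∑ k, ∫ x, |u₀ k x|) ≤ K →
          (∀ k x, ∀ w ∈ Set.Icc (0 : ℝ) 1, |P.ν k x w| ≤ M) →
          (∑ k, totalVar (u₀ k)) ≤ ENNReal.ofReal V →
          ∃ u : Fin N → ℝ → ℝ → ℝ,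
            P.IsEntropySolution T u₀ u ∧
            (∀ v : Fin N → ℝ → ℝ → ℝ, P.IsEntropySolution T u₀ v →
              ∀ k, ∀ t ∈ Set.Icc 0 T, v k t =ᵐ[MeasureTheory.volume] u k t) ∧
            (∀ k, ∀ t ∈ Set.Icc 0 T, ∀ᵐ x, u k t x ∈ Set.Icc (0 : ℝ) 1) ∧
            (∀ t ∈ Set.Icc 0 T, (∑ k, ∫ x, |u k t x|) = ∑ k, ∫ x, |u₀ k x|) ∧
            (∀ t ∈ Set.Icc 0 T,
              (∑ k, totalVar (u k t)) ≤
                ENNReal.ofReal (Real.exp (C_TV * t)) * (∑ k, totalVar (u₀ k))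
                  + ENNReal.ofReal (Real.exp (C_TV * t) - 1)) ∧
            (∀ t₁ ∈ Set.Icc 0 T, ∀ t₂ ∈ Set.Icc 0 T,
              (∑ k, ∫ x, |u k t₂ x - u k t₁ x|) ≤ N * C_L * |t₂ - t₁|) := by
  -- The constants are named before any model is given, when the signs of `K`, `M` and `V` are
  -- unknown; hence the absolute values and the maximum with `0`. Once a model is given, `K ≥ 0`
  -- follows from the bound for the kernel.
  refine ⟨LaneModel.tvRate N |K|, LaneModel.tvRate_nonneg (abs_nonneg K), fun M V T hT => ?_⟩
  set B' := Real.exp (LaneModel.tvRate N |K| * T) * (max V 0 + 1) with hB'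
  have hB'0 : 0 ≤ B' := mul_nonneg (Real.exp_pos _).le (by linarith [le_max_right V 0])
  set C_L := LaneModel.speedBound |K| |M| B' (1 / (2 * |K| * |M| + 1)) with hC_L
  have hC_L0 : 0 ≤ C_L := LaneModel.speedBound_nonneg (abs_nonneg K) (abs_nonneg M) hB'0
    (by positivity)
  refine ⟨C_L, hC_L0, fun P u₀ hA hB hu₀ hmass hM hV => ?_⟩
  have hP : P.Regular K := ⟨hA, hB⟩
  have hK := hP.nonneg
  have hM' : P.SpeedLE |M| := fun k x w hw =>
    (hM k x w hw).trans (le_abs_self M)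
  choose a ha hau using fun k => exists_isDensity_ae_eq (hu₀.integrable k) (hu₀.range k)
  have hai : ∀ k, ∫ x, a k x = ∫ x, |u₀ k x| := fun k =>
    MeasureTheory.integral_congr_ae ((hau k).mono fun x hx => by
      beta_reduce; rw [← hx, abs_of_nonneg ((ha k).mem x).1])
  have htv : ∀ k, totalVar (a k) = ENNReal.ofReal (totalVar (u₀ k)).toReal := fun k => by
    rw [totalVar_congr_ae (hau k), ENNReal.ofReal_toReal (hu₀.bv k).ne]
  set B := ∑ k, (totalVar (u₀ k)).toReal with hBdef
  have hB0 : 0 ≤ B := Finset.sum_nonneg fun k _ => ENNReal.toReal_nonneg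
  have hBeq : ∑ k, totalVar (u₀ k) = ENNReal.ofReal B := by
    rw [hBdef, ENNReal.ofReal_sum_of_nonneg fun k _ => ENNReal.toReal_nonneg]
    exact Finset.sum_congr rfl fun k _ => (ENNReal.ofReal_toReal (hu₀.bv k).ne).symm
  have hBV : B ≤ max V 0 := by
    rw [hBeq] at hV
    rcases le_or_gt B 0 with h | h
    · exact h.trans (le_max_right _ _)
    · exact ((ENNReal.ofReal_le_ofReal_iff'.1 hV).resolve_right h.not_ge).trans (le_max_left _ _)
  have hshift : ∀ δ, ∑ j, ∫ x, |a j (x + δ) - a j x| ≤ B * |δ| := fun δ => by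
    rw [hBdef, Finset.sum_mul]
    exact Finset.sum_le_sum fun k _ => integral_abs_shift_sub_le_of_totalVar_le
      (ha k).integrable ENNReal.toReal_nonneg (htv k).le δ
  obtain ⟨u, hu, hua, hum, hus⟩ := LaneModel.exists_isApprox_zero hP hM' (abs_nonneg M) hT ha
    (by simpa only [hai] using hmass) hB0 hBV hshift
  simp only [abs_of_nonneg hK] at hB' hC_L ⊢
  rw [← hB', ← hC_L] at hu
  refine ⟨u, hu.isEntropySolution hP hM' hT hC_L0 fun k => (hua k).trans (hau k), ?_,
    fun k t _ => Filter.Eventually.of_forall (hu.density k t).mem, fun t ht => ?_, fun t ht => ?_,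
    fun t₁ _ t₂ _ => ?_⟩
  · intro v hv k t ht
    obtain ⟨μ, B₁, L₁, w, hμ, hB₁, hL₁, hw, hwv⟩ := hv.exists_isApprox hP hM' hT
    refine (hwv k t ht).symm.trans ?_
    -- The competing solution brings its own bounds on mass, variation and speed. Both solutions are
    -- regarded with the larger constants, and uniqueness holds whatever these are.
    refine LaneModel.IsApprox.ae_eq (μ := max μ K) (B := max B₁ B') (L := max L₁ C_L) hP hM'
      (abs_nonneg M) hT (hμ.trans (le_max_left _ _)) (hB₁.trans (le_max_left _ _))
      (hL₁.trans (le_max_left _ _))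
      (hw.mono (le_max_left _ _) (le_max_left _ _) (le_max_left _ _) le_rfl)
      (hu.mono (le_max_right _ _) (le_max_right _ _) (le_max_right _ _) le_rfl)
      (fun j => ((hwv j 0 ⟨le_rfl, hT.le⟩).trans (hv.initial j)).trans
        ((hua j).trans (hau j)).symm) k ht
  · have h : ∀ k, ∫ x, |u k t x| = ∫ x, u k t x := fun k =>
      congrArg _ (funext fun x => abs_of_nonneg ((hu.density k t).mem x).1)
    simp only [h, hum t ht, hai]
  · refine (sum_totalVar_le_of_shift (fun k => (hu.density k t).integrable) (hus t ht)).trans ?_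
    have h1 : 1 ≤ Real.exp (LaneModel.tvRate N K * t) :=
      Real.one_le_exp (mul_nonneg (LaneModel.tvRate_nonneg hK) ht.1)
    rw [hBeq, ← ENNReal.ofReal_mul (Real.exp_pos _).le,
      ← ENNReal.ofReal_add (mul_nonneg (Real.exp_pos _).le hB0) (by linarith)]
    exact (congrArg _ (by ring)).le
  · calc _ ≤ ∑ _k : Fin N, C_L * |t₂ - t₁| := Finset.sum_le_sum fun k _ => by
          simpa using hu.time k t₂ t₁
      _ = _ := by simp [mul_assoc]
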